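/- Let $(M,\omega)$ be a closed symplectic manifold of dimension $2n$ and let $\mathrm{Ham}(M)$ be its group of Hamiltonian diffeomorphisms, i.e. the time-one maps of the flows of the time-dependent vector fields $X_{H_t}$ given by $\omega(X_{H_t},\cdot)=-dH_t$, for $H:[0,1]\times M\to\mathbb R$ smooth. For an integer $g\ge 0$ let $C_g\subset \mathrm{Ham}(M)$ be the set of products of at most $g$ commutators $[a,b]=a\circ b\circ a^{-1}\circ b^{-1}$ with $a,b\in\mathrm{Ham}(M)$. Let $S$ be a compact connected oriented surface with one boundary circle and a base-point on the boundary. A Hamiltonian fibration over $S$ with fibre $(M,\omega)$ is a smooth fibre bundle $\pi:P\to S$ with fibre $M$, with a symplectic form $\Omega$ on $P$ that is nondegenerate on each fibre and positive on the positively oriented horizontal planes (the horizontal space is the $\Omega$-orthogonal complement of the vertical tangent space), and with a symplectomorphism from $(M,\omega)$ to the fibre over the base-point, such that the monodromy of the horizontal connection around each loop at the base-point belongs to the structure group $\mathrm{Ham}(M)$. Its area is $$A(P,\Omega)=\frac{\mathrm{vol}(P,\Omega)}{\mathrm{vol}(M,\omega)},\qquad \mathrm{vol}(P,\Omega)=\int_P\Omega^{n+1},\quad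 \mathrm{vol}(M,\omega)=\int_M\omega^n .$$ For $\phi\in\mathrm{Ham}(M)$ let $\mathcal P(S,\phi)$ be the class of the Hamiltonian fibrations over $S$ with fibre $(M,\omega)$ whose monodromy around the positively oriented boundary is $\phi$. Let $\Sigma_g$ be the compact oriented surface of genus $g$ with one boundary circle and $D$ the closed unit disc, and put $$|\phi|_g=\inf_{(P,\Omega)\in\mathcal P(\Sigma_g,\phi)}A(P,\Omega),\qquad \|\phi\|_H^+=\inf_{(P,\Omega)\in\mathcal P(D,\phi)}A(P,\Omega),$$ $$d_0(\phi,\psi)=\|\phi\circ\psi^{-1}\|_H^+,\qquad d_0(\phi,C_g)=\inf_{\psi\in C_g}d_0(\phi,\psi).$$ Then for all $g\ge 0$ and all $\phi\in\mathrm{Ham}(M)$, $$|\phi|_g\ \ge\ d_0(\phi,C_g).$$ -/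

import Mathlib

open Set Topology MeasureTheory
open scoped Manifold ContDiff ENNReal

noncomputable section

namespace HamGeometry

universe u

/-! ## Symplectic forms and symplectic volume -/

section Forms

variable {E : Type*} [NormedAddCommGroup E] [NormedSpace ℝ E]
  {H : Type*} [TopologicalSpace H]
  {N : Type*} [TopologicalSpace N] [ChartedSpace H N]

/-- A (not necessarily continuous) differential 2-form on the manifold `N`. -/
abbrev TwoForm (I : ModelWithCorners ℝ E H) (N : Type*) [TopologicalSpace N]
    [ChartedSpace H N] : Type _ :=
  ∀ p : N, TangentSpace I p [⋀^Fin 2]→L[ℝ] ℝ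

variable {I : ModelWithCorners ℝ E H}

/-- The form `σ` read in the chart around `p`: its pullback under the inverse of that chart. -/
def TwoForm.inChart (σ : TwoForm I N) (p : N) (y : E) : E [⋀^Fin 2]→L[ℝ] ℝ :=
  (σ ((extChartAt I p).symm y)).compContinuousLinearMap
    (mfderivWithin 𝓘(ℝ, E) I (extChartAt I p).symm (range I) y)

/-- `σ` is a symplectic form: smooth (up to the boundary, if there is one), closed and
nondegenerate. -/
structure TwoForm.IsSymplectic (σ : TwoForm I N) : Prop where
  smooth : ∀ p : N, ContDiffOn ℝ ∞ (σ.inChart p) (extChartAt I p).target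
  closed : ∀ p : N, ∀ y ∈ (extChartAt I p).target,
    extDerivWithin (σ.inChart p) (extChartAt I p).target y = 0
  nondegenerate : ∀ (p : N) (v : TangentSpace I p),
    (∀ w : TangentSpace I p, σ p ![v, w] = 0) → v = 0

variable [FiniteDimensional ℝ E]

/-- The density of the top exterior power `σ ^ m`, `2 m = dim N`, in the chart around `p`, with
respect to Lebesgue measure normalised by a basis of the model space. The coefficient of `σ ^ m` is
`m!` times the Pfaffian of the coefficient matrix, and the square of the Pfaffian is the
determinant. -/
def TwoForm.volumeDensity (σ : TwoForm I N) (p : N) (y : E) : ℝ :=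
  ((Module.finrank ℝ E / 2).factorial : ℝ) *
    √|(Matrix.of fun i j => σ.inChart p y ![Module.finBasis ℝ E i, Module.finBasis ℝ E j]).det|

/-- The symplectic volume `∫_N σ ^ m`, `2 m = dim N`, for the orientation given by `σ ^ m`.
It is the supremum of the sums of chart integrals over finitely many disjoint Borel sets, each
contained in the domain of a chart; on a compact manifold finitely many of them exhaust `N`. -/
def TwoForm.volume [MeasurableSpace E] [BorelSpace E] (σ : TwoForm I N) : ℝ≥0∞ :=
  ⨆ (s : Finset N) (A : N → Set N)
    (_ : (∀ p ∈ s, MeasurableSet[borel N] (A p) ∧ A p ⊆ (chartAt H p).source) ∧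
      (s : Set N).PairwiseDisjoint A),
    ∑ p ∈ s, ∫⁻ y in extChartAt I p '' A p,
      ENNReal.ofReal (σ.volumeDensity p y) ∂(Module.finBasis ℝ E).addHaar

end Forms

/-! ## Hamiltonian diffeomorphisms -/

section Ham

variable {n : ℕ} {M : Type u} [TopologicalSpace M]
  [ChartedSpace (EuclideanSpace ℝ (Fin (2 * n))) M]

/-- The set `Ham(M, σ)` of Hamiltonian diffeomorphisms: the time-one maps `φ = Φ 1` of the flows
`Φ` of the vector fields `X` with `σ (X, ·) = - d (H t)`, for the smooth time-dependent functions
`H` on `[0, 1] × M`. -/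
def Ham (σ : TwoForm (𝓡 (2 * n)) M) : Set (Equiv.Perm M) :=
  {φ | ∃ H : ℝ → M → ℝ,
    ContMDiffOn (𝓘(ℝ, ℝ).prod (𝓡 (2 * n))) 𝓘(ℝ, ℝ) ∞ (fun q : ℝ × M => H q.1 q.2)
      (Icc 0 1 ×ˢ univ) ∧
    ∃ Φ : ℝ → M → M, (∀ x, Φ 0 x = x) ∧ (∀ x, Φ 1 x = φ x) ∧
      ∀ t ∈ Icc (0 : ℝ) 1, ∀ x, ∃ X : TangentSpace (𝓡 (2 * n)) (Φ t x),
        HasMFDerivWithinAt 𝓘(ℝ, ℝ) (𝓡 (2 * n)) (fun s => Φ s x) (Icc 0 1) t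
          ((1 : ℝ →L[ℝ] ℝ).smulRight X) ∧
        ∀ v : TangentSpace (𝓡 (2 * n)) (Φ t x),
          σ (Φ t x) ![X, v] = - mfderiv (𝓡 (2 * n)) 𝓘(ℝ, ℝ) (H t) (Φ t x) v}

/-- The set `C_k(M)` of products of at most `k` commutators of Hamiltonian diffeomorphisms. -/
def commutatorProducts (σ : TwoForm (𝓡 (2 * n)) M) (k : ℕ) : Set (Equiv.Perm M) :=
  {ψ | ∃ l : List (Equiv.Perm M), l.length ≤ k ∧
    (∀ c ∈ l, ∃ a ∈ Ham σ, ∃ b ∈ Ham σ, c = a * b * a⁻¹ * b⁻¹) ∧ l.prod = ψ}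

end Ham

/-! ## The base surfaces -/

/-- A model of a compact Riemann surface with one boundary circle: a subset `carrier` of `ℂ²` that
is a smooth complex curve with boundary, and a parametrisation `loop` of its boundary circle with
period `1`, in the direction of the boundary orientation. Each surface below is such a model
up to diffeomorphism. -/
structure ModelSurface where
  carrier : Set (ℂ × ℂ)
  loop : ℝ → ℂ × ℂ

/-- The closed unit disc, with boundary run through counterclockwise. -/
def disc : ModelSurface where
  carrier := {q | ‖q.1‖ ≤ 1 ∧ q.2 = 0}
  loop t := (Complex.exp (2 * Real.pi * Complex.I * t), 0)

/-- The compact surface `Σ_g` of genus `g` with one boundary circle, realised as the part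
`|x| ≤ 2 g + 2` of the hyperelliptic curve `y² = (x - 1) (x - 2) ⋯ (x - (2 g + 1))`. All
branch points lie in `|x| < 2 g + 2`, and, their number being odd, the boundary is a connected double
cover of the circle `|x| = 2 g + 2`; along `loop` the coordinate `x` runs twice counterclockwise
around that circle. -/
def genusSurface (g : ℕ) : ModelSurface where
  carrier := {q | q.2 ^ 2 = ∏ k ∈ Finset.Icc 1 (2 * g + 1), (q.1 - (k : ℂ)) ∧
    ‖q.1‖ ≤ 2 * (g : ℝ) + 2}
  loop t :=
    ((2 * (g : ℂ) + 2) * Complex.exp (4 * Real.pi * Complex.I * t),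
      (√((2 * (g : ℝ) + 2) ^ (2 * g + 1)) : ℂ) *
        Complex.exp (2 * Real.pi * Complex.I * ((2 * g + 1 : ℕ) : ℂ) * t) *
        ∏ k ∈ Finset.Icc 1 (2 * g + 1),
          (1 - (k : ℂ) / ((2 * (g : ℂ) + 2) * Complex.exp (4 * Real.pi * Complex.I * t))) ^
            (1 / 2 : ℂ))

/-! ## Hamiltonian fibrations -/

section Fibrations

variable {n : ℕ} {M : Type u} [TopologicalSpace M]
  [ChartedSpace (EuclideanSpace ℝ (Fin (2 * n))) M]

/-- The model of the total space of a fibration over a surface with boundary, with fibre a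
`2 n`-dimensional manifold without boundary. -/
abbrev totalModel (n : ℕ) :=
  (𝓡∂ 2).prod (𝓡 (2 * n))

/-- A fibre bundle `π : P → B` of smooth manifolds with fibre `M`, where `B` is a compact surface
with boundary diffeomorphic to the model `S` by `emb`, and a differential 2-form `Ω` on `P`. -/
structure FibrationData (M : Type u) [TopologicalSpace M]
    [ChartedSpace (EuclideanSpace ℝ (Fin (2 * n))) M] (S : ModelSurface) where
  /-- the base -/
  B : Type
  [topB : TopologicalSpace B]
  [chartB : ChartedSpace (EuclideanHalfSpace 2) B]
  [manifoldB : IsManifold (𝓡∂ 2) ∞ B]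
  [t2B : T2Space B]
  [compactB : CompactSpace B]
  /-- a smooth embedding of the base with image the model surface -/
  emb : B → ℂ × ℂ
  emb_smooth : ContMDiff (𝓡∂ 2) 𝓘(ℝ, ℂ × ℂ) ∞ emb
  emb_injective : Function.Injective emb
  emb_immersion : ∀ b, Function.Injective (mfderiv (𝓡∂ 2) 𝓘(ℝ, ℂ × ℂ) emb b)
  emb_range : range emb = S.carrier
  /-- the total space -/
  P : Type u
  [topP : TopologicalSpace P]
  [chartP : ChartedSpace (ModelProd (EuclideanHalfSpace 2) (EuclideanSpace ℝ (Fin (2 * n)))) P]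
  [manifoldP : IsManifold (totalModel n) ∞ P]
  [t2P : T2Space P]
  /-- the projection -/
  π : P → B
  π_smooth : ContMDiff (totalModel n) (𝓡∂ 2) ∞ π
  locally_trivial : ∀ b : B, ∃ U : Set B, b ∈ U ∧ ∃ e : OpenPartialHomeomorph P (B × M),
    e.source = π ⁻¹' U ∧ e.target = U ×ˢ univ ∧ (∀ p ∈ e.source, (e p).1 = π p) ∧
    ContMDiffOn (totalModel n) (totalModel n) ∞ e e.source ∧
    ContMDiffOn (totalModel n) (totalModel n) ∞ e.symm e.target
  /-- the 2-form on the total space -/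
  Ω : TwoForm (totalModel n) P
  /-- the boundary loop of the base -/
  bdry : ℝ → B
  emb_bdry : ∀ t, emb (bdry t) = S.loop t
  /-- the identification of the fibre `M` with the fibre over the base-point `bdry 0` -/
  ι : M → P

attribute [instance] FibrationData.topB FibrationData.chartB FibrationData.manifoldB
  FibrationData.t2B FibrationData.compactB FibrationData.topP FibrationData.chartP
  FibrationData.manifoldP FibrationData.t2P

namespace FibrationData

variable {S : ModelSurface} (F : FibrationData (n := n) M S)

/-- The vertical tangent vectors: those tangent to the fibres of `π`. -/
def IsVertical {p : F.P} (v : TangentSpace (totalModel n) p) : Prop :=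
  mfderiv (totalModel n) (𝓡∂ 2) F.π p v = 0

/-- The horizontal tangent vectors of the connection of `Ω`: those that are `Ω`-orthogonal to all
vertical vectors. -/
def IsHorizontal {p : F.P} (u : TangentSpace (totalModel n) p) : Prop :=
  ∀ v : TangentSpace (totalModel n) p, F.IsVertical v → F.Ω p ![u, v] = 0

/-- The image in `ℂ²` of a tangent vector of `P` under the differential of
`P → B → ℂ²`. -/
def baseVector {p : F.P} (u : TangentSpace (totalModel n) p) : ℂ × ℂ :=
  mfderiv (𝓡∂ 2) 𝓘(ℝ, ℂ × ℂ) F.emb (F.π p) (mfderiv (totalModel n) (𝓡∂ 2) F.π p u)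

/-- The path `c : [0, 1] → P` is a horizontal lift of the path `γ : [0, 1] → B`. -/
def IsHorizontalLift (γ : ℝ → F.B) (c : ℝ → F.P) : Prop :=
  ∀ t ∈ Icc (0 : ℝ) 1, F.π (c t) = γ t ∧ ∃ u : TangentSpace (totalModel n) (c t),
    HasMFDerivWithinAt 𝓘(ℝ, ℝ) (totalModel n) c (Icc 0 1) t ((1 : ℝ →L[ℝ] ℝ).smulRight u) ∧
    F.IsHorizontal u

/-- The monodromy around the loop `γ`, `γ 0 = γ 1 = bdry 0`, is `φ`: parallel transport
along `γ` takes `ι x` to `ι (φ x)`. -/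
def HasMonodromy (γ : ℝ → F.B) (φ : Equiv.Perm M) : Prop :=
  ∀ x : M, ∃ c : ℝ → F.P, F.IsHorizontalLift γ c ∧ c 0 = F.ι x ∧ c 1 = F.ι (φ x)

/-- `(P, Ω)` is a Hamiltonian fibration over the oriented surface `B`, with fibre `(M, σ)`. -/
structure IsHamiltonian (σ : TwoForm (𝓡 (2 * n)) M) : Prop where
  symplectic : F.Ω.IsSymplectic
  /-- the restriction of `Ω` to each fibre is nondegenerate -/
  fibre_nondegenerate : ∀ (p : F.P) (v : TangentSpace (totalModel n) p), F.IsVertical v →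
    (∀ w : TangentSpace (totalModel n) p, F.IsVertical w → F.Ω p ![v, w] = 0) → v = 0
  /-- `Ω` is positive on positively oriented horizontal planes, the orientation of the base being
  the complex orientation of the model surface -/
  positive : ∀ (p : F.P) (u w : TangentSpace (totalModel n) p), u ≠ 0 →
    F.IsHorizontal u → F.IsHorizontal w →
    F.baseVector w = Complex.I • F.baseVector u →
    0 < F.Ω p ![u, w]
  /-- `ι` is a symplectomorphism of `(M, σ)` onto the fibre over the base-point -/
  ι_smooth : ContMDiff (𝓡 (2 * n)) (totalModel n) ∞ F.ι
  ι_injective : Function.Injective F.ι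
  ι_range : range F.ι = F.π ⁻¹' {F.bdry 0}
  ι_symplectic : ∀ (x : M) (v w : TangentSpace (𝓡 (2 * n)) x),
    F.Ω (F.ι x) ![mfderiv (𝓡 (2 * n)) (totalModel n) F.ι x v,
      mfderiv (𝓡 (2 * n)) (totalModel n) F.ι x w] = σ x ![v, w]
  /-- the monodromies around the loops at the base-point belong to the structure group `Ham(M, σ)`
  of a Hamiltonian fibration -/
  monodromy_mem_Ham : ∀ γ : ℝ → F.B, ContMDiffOn 𝓘(ℝ, ℝ) (𝓡∂ 2) ∞ γ (Icc 0 1) →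
    γ 0 = F.bdry 0 → γ 1 = F.bdry 0 → ∃ a ∈ Ham σ, F.HasMonodromy γ a

/-- The area `A(P, Ω) = vol(P, Ω) / vol(M, σ)`. -/
def area (σ : TwoForm (𝓡 (2 * n)) M) : ℝ≥0∞ :=
  F.Ω.volume / σ.volume

end FibrationData

/-- The infimum of the areas of the Hamiltonian fibrations with fibre `(M, σ)` over the surface `S`
whose monodromy around the boundary is `φ`. -/
def surfaceArea (σ : TwoForm (𝓡 (2 * n)) M) (S : ModelSurface) (φ : Equiv.Perm M) : ℝ≥0∞ :=
  ⨅ (F : FibrationData (n := n) M S) (_ : F.IsHamiltonian σ) (_ : F.HasMonodromy F.bdry φ),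
    F.area σ

/-- The positive Hofer norm `‖φ‖_H^+`. -/
def positiveHoferNorm (σ : TwoForm (𝓡 (2 * n)) M) (φ : Equiv.Perm M) : ℝ≥0∞ :=
  surfaceArea σ disc φ

/-- The `g`-area `|φ|_g`. -/
def gArea (σ : TwoForm (𝓡 (2 * n)) M) (g : ℕ) (φ : Equiv.Perm M) : ℝ≥0∞ :=
  surfaceArea σ (genusSurface g) φ

/-- The positive Hofer pseudo-distance `d_0(φ, ψ) = ‖φ ∘ ψ⁻¹‖_H^+`. -/
def d₀ (σ : TwoForm (𝓡 (2 * n)) M) (φ ψ : Equiv.Perm M) : ℝ≥0∞ :=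
  positiveHoferNorm σ (φ * ψ⁻¹)

end Fibrations

end HamGeometry

end

/-!
The surface of genus `g` is cut open along a graph, the fibration is pulled back to the disc that
results, and its boundary monodromy is read off.

*The cut.* The model surface is the part of the curve `y² = (x - 1) ⋯ (x - 2g - 1)` over the disc
`|x| ≤ 2 g + 2`. With `x = 1 + w²` the curve becomes the image of a map `hyper g` that is
holomorphic on the upper half plane, and the surface consists of two copies of a half disc in the
variable `w`, interchanged by `y ↦ -y` and glued along the real segment. The lift of this segment to
the curve is the cut system. The map `cutMap g` from the unit disc to `ℂ²` sends the upper half of the boundary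
circle onto the cut system (`cutMap_top`) and the lower half onto the boundary of the surface
(`cutMap_bottom`). It is not an immersion, since the boundary of the disc
has to be folded at the vertices of the cut system. Instead it is smooth (`contDiff_cutMap`), does not reverse
the orientation (`sensePreserving_cutMap`) and is injective on the points where it is an immersion
(`cutMap_injective`). Smoothness is the delicate point: `hyper g` has square root singularities at
the branch points, which are removed by reparametrisations that are flat there
(`contDiff_sqrt`, `IsStripParam.contDiff_hyper`).

*The disc fibration.* The base of a fibration over the surface is identified with the model surface
by an injective immersion, and `cutMap g` lifts to a smooth map `f` from the disc to the base
(`exists_lift_to_base`). The pullback of the bundle by `f` (`FibrationData.Pullback`) carries the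
pullback of the form `Ω`. This closed form is nondegenerate on the fibres but only nonnegative on
the positively oriented horizontal planes (`isSemipositive_form`). Adding `ε` times the area form of
the disc makes it symplectic, and does not change horizontality
(`isHamiltonian_discFibration`). The volume of the pulled back form is at most that of `Ω`, because
the bundle map is injective on its immersion points (`TwoForm.volume_pullback_le`), and the
correction is `O(ε)`, because the root of the Gram determinant is affine in `ε`
(`sqrt_gramDet_add_le`, `volume_discForm_le`).

*The monodromy.* Along the boundary of the disc, parallel transport is first the inverse of the
transport `ψ` along the cut path and then the monodromy `φ` of the boundary of the surface, so it is
`φ ψ⁻¹` (`exists_monodromy_discLoop`). The cut path runs once in each direction through every edge of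
a graph whose `2 g` independent loops have monodromies in the structure group. Written in these,
`ψ` is a word in which each letter occurs once together with its inverse
(`IsCutPath.exists_monodromy`), and the order of the letters makes it a product of `g` commutators
(`word_mem_commutatorProducts`). The transports along parts of paths can be compared because
horizontal lifts are unique (`IsLiftOn.eqOn`).

So the disc fibration shows that `d₀ φ ψ` is at most the area of the given fibration plus `O(ε)`,
with `ψ` independent of `ε`.
-/

namespace HamGeometry

open Filter Asymptotics

/-! ### Square roots of flat functions -/

section FlatSqrt

variable {E : Type*} [NormedAddCommGroup E] [NormedSpace ℝ E]
  {G : Type*} [NormedAddCommGroup G] [NormedSpace ℝ G]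

/-- `f` is smooth and, at the zeros of `W`, all its derivatives are `O(‖W‖ ^ a)` for every
exponent `a < j` (for `j = 0` only `a = 0` is asked for, which is no condition). -/
def FlatOrder (W : E → ℂ) (j : ℕ) (f : E → G) : Prop :=
  ContDiff ℝ ∞ f ∧ ∀ (m : ℕ) (z₀ : E), W z₀ = 0 → ∀ a : ℝ, 0 ≤ a → (a < j ∨ a = 0) →
    (fun z => iteratedFDeriv ℝ m f z) =O[𝓝 z₀] fun z => ‖W z‖ ^ a

theorem FlatOrder.of_contDiff {W : E → ℂ} {f : E → G} (hf : ContDiff ℝ ∞ f) :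
    FlatOrder W 0 f := by
  refine ⟨hf, fun m z₀ _ a ha h => ?_⟩
  have : a = 0 := by
    rcases h with h | h
    · simp at h; linarith
    · exact h
  subst this
  simp only [Real.rpow_zero]
  exact (hf.continuous_iteratedFDeriv (m := m) (by exact_mod_cast le_top)).continuousAt.isBigO_one ℝ

/-- An exponent below `i + j` splits into exponents below `i` and `j`, and the Leibniz rule applies.
-/
theorem FlatOrder.mul {W : E → ℂ} {i j : ℕ} {f g : E → ℂ} (hf : FlatOrder W i f)
    (hg : FlatOrder W j g) : FlatOrder W (i + j) (fun z => f z * g z) := by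
  refine ⟨hf.1.mul hg.1, fun m z₀ hz a ha h => ?_⟩
  obtain ⟨b, c, hb, hc, hbi, hcj, rfl⟩ : ∃ b c : ℝ, 0 ≤ b ∧ 0 ≤ c ∧ (b < i ∨ b = 0) ∧
      (c < j ∨ c = 0) ∧ a = b + c := by
    rcases Nat.eq_zero_or_pos i with rfl | hi
    · exact ⟨0, a, le_rfl, ha, Or.inr rfl, by simpa using h, by simp⟩
    rcases Nat.eq_zero_or_pos j with rfl | hj
    · exact ⟨a, 0, ha, le_rfl, by simpa using h, Or.inr rfl, by simp⟩
    have hi' : (0 : ℝ) < i := by exact_mod_cast hi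
    have hj' : (0 : ℝ) < j := by exact_mod_cast hj
    have h' : a < i + j := by
      rcases h with h | h
      · exact_mod_cast h
      · rw [h]; positivity
    refine ⟨a * (i / (i + j)), a * (j / (i + j)), by positivity, by positivity, Or.inl ?_,
      Or.inl ?_, by field_simp⟩
    · rw [← mul_div_assoc, div_lt_iff₀ (by positivity)]; nlinarith
    · rw [← mul_div_assoc, div_lt_iff₀ (by positivity)]; nlinarith
  have key : ∀ k ∈ Finset.range (m + 1),
      (fun z => (m.choose k : ℝ) * ‖iteratedFDeriv ℝ k f z‖ * ‖iteratedFDeriv ℝ (m - k) g z‖)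
        =O[𝓝 z₀] fun z => ‖W z‖ ^ (b + c) := by
    intro k _
    have h1 := (hf.2 k z₀ hz b hb hbi).norm_left
    have h2 := (hg.2 (m - k) z₀ hz c hc hcj).norm_left
    refine ((h1.const_mul_left (m.choose k : ℝ)).mul h2).congr_right fun z => ?_
    rw [Real.rpow_add_of_nonneg (norm_nonneg _) hb hc]
  refine (IsBigO.of_bound 1 (Eventually.of_forall fun z => ?_)).trans (IsBigO.sum key)
  rw [one_mul, Finset.sum_apply, Real.norm_of_nonneg (Finset.sum_nonneg fun k _ => by positivity)]
  exact norm_iteratedFDeriv_mul_le (n := m) (N := ∞) hf.1 hg.1 z (by exact_mod_cast le_top)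

theorem FlatOrder.add {W : E → ℂ} {j : ℕ} {f g : E → G} (hf : FlatOrder W j f)
    (hg : FlatOrder W j g) : FlatOrder W j (fun z => f z + g z) := by
  refine ⟨hf.1.add hg.1, fun m z₀ hz a ha h => ?_⟩
  refine ((hf.2 m z₀ hz a ha h).add (hg.2 m z₀ hz a ha h)).congr_left fun z => ?_
  have h1 : ContDiffAt ℝ m f z := hf.1.contDiffAt.of_le (by exact_mod_cast le_top)
  have h2 : ContDiffAt ℝ m g z := hg.1.contDiffAt.of_le (by exact_mod_cast le_top)
  exact (iteratedFDeriv_add_apply h1 h2).symm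

theorem FlatOrder.fderiv_apply {W : E → ℂ} {j : ℕ} {f : E → G} (hf : FlatOrder W j f) (v : E) :
    FlatOrder W j (fun z => fderiv ℝ f z v) := by
  have hd : ContDiff ℝ ∞ (fderiv ℝ f) := hf.1.fderiv_right (by simp)
  refine ⟨hd.clm_apply contDiff_const, fun m z₀ hz a ha h => ?_⟩
  refine (IsBigO.of_bound ‖ContinuousLinearMap.apply ℝ G v‖ (Eventually.of_forall fun z => ?_)).trans
    (hf.2 (m + 1) z₀ hz a ha h)
  have := (ContinuousLinearMap.apply ℝ G v).norm_iteratedFDeriv_comp_left (f := fderiv ℝ f)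
    (x := z) (n := m) (N := ∞) hd.contDiffAt (by exact_mod_cast le_top)
  rw [norm_iteratedFDeriv_fderiv] at this
  exact this

/-- A continuous square root `S` of a function `W` is smooth through the zeros of `W`, if the
derivatives of `W` are bounded there by almost the first power of `W`: the products `f S W⁻ʲ`
with `f` of order `j` are closed under differentiation. -/
theorem contDiff_mul_sqrt [FiniteDimensional ℝ E] {W S : E → ℂ} (hW : ContDiff ℝ ∞ W)
    (hdW : ∀ v, FlatOrder W 1 (fun z => fderiv ℝ W z v))
    (hW8 : ∀ z₀, W z₀ = 0 → W =O[𝓝 z₀] fun z => ‖z - z₀‖ ^ 8)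
    (hS : ∀ z, S z ^ 2 = W z) (hSd : ∀ z, W z ≠ 0 → DifferentiableAt ℝ S z) (n : ℕ) :
    ∀ (j : ℕ) (f : E → ℂ), FlatOrder W j f →
      ContDiff ℝ n (fun z => f z * (S z * (W z)⁻¹ ^ j)) := by
  have hder : ∀ (j : ℕ) (f : E → ℂ), FlatOrder W j f → ∀ z,
      DifferentiableAt ℝ (fun z => f z * (S z * (W z)⁻¹ ^ j)) z ∧
      ∀ v, fderiv ℝ (fun z => f z * (S z * (W z)⁻¹ ^ j)) z v =
        fderiv ℝ f z v * (S z * (W z)⁻¹ ^ j) +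
        ((1 / 2 - j : ℂ) * (f z * fderiv ℝ W z v)) * (S z * (W z)⁻¹ ^ (j + 1)) := by
    intro j f hf z
    by_cases hz : W z = 0
    · have hSz : S z = 0 := by have := hS z; rw [hz] at this; exact pow_eq_zero_iff (two_ne_zero) |>.1 this
      -- At a zero of `W` the product is `O(|W| ^ (1/4))`, hence `O(|y - z| ^ 2)`, and its
      -- derivative vanishes; the junk value `0⁻¹ = 0` gives the product the right value there.
      have : HasFDerivAt (fun z => f z * (S z * (W z)⁻¹ ^ j)) (0 : E →L[ℝ] ℂ) z := by
        have hO : (fun y => f y * (S y * (W y)⁻¹ ^ j)) =O[𝓝 z] fun y => ‖W y‖ ^ (1 / 4 : ℝ) := by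
          obtain ⟨a, ha0, ha, ha'⟩ : ∃ a : ℝ, 0 ≤ a ∧ (a < j ∨ a = 0) ∧ (j : ℝ) - 1 / 4 ≤ a := by
            rcases Nat.eq_zero_or_pos j with rfl | hj
            · exact ⟨0, le_rfl, Or.inr rfl, by norm_num⟩
            · have : (1 : ℝ) ≤ j := by exact_mod_cast hj
              exact ⟨j - 1 / 4, by linarith, Or.inl (by linarith), le_rfl⟩
          have h0 := hf.2 0 z hz a ha0 ha
          have h0' : f =O[𝓝 z] fun y => ‖W y‖ ^ a :=
            (IsBigO.of_bound 1 (Eventually.of_forall fun y => by simp)).trans h0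
          have hWs : ∀ᶠ y in 𝓝 z, ‖W y‖ < 1 :=
            (hW.continuous.norm.tendsto z).eventually_lt_const (by simp [hz])
          refine (h0'.mul (isBigO_refl (fun y => S y * (W y)⁻¹ ^ j) _).norm_right).trans ?_
          refine IsBigO.of_bound 1 ?_
          filter_upwards [hWs] with y hy
          by_cases hWy : W y = 0
          · have hSy : S y = 0 := by
              have := hS y; rw [hWy] at this; exact pow_eq_zero_iff (two_ne_zero) |>.1 this
            simp [hSy, hWy]
          · have hp : 0 < ‖W y‖ := norm_pos_iff.2 hWy
            have hSn : ‖S y‖ = ‖W y‖ ^ (1 / 2 : ℝ) := by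
              rw [← hS y, norm_pow, ← Real.rpow_natCast, ← Real.rpow_mul (norm_nonneg _)]; simp
            rw [norm_mul, norm_norm, norm_mul, norm_pow, norm_inv, hSn, one_mul,
              Real.norm_of_nonneg (by positivity), Real.norm_of_nonneg (by positivity),
              ← Real.rpow_natCast, Real.inv_rpow (norm_nonneg _), ← Real.rpow_neg (norm_nonneg _),
              ← Real.rpow_add hp, ← Real.rpow_add hp]
            exact Real.rpow_le_rpow_of_exponent_ge hp hy.le (by linarith)
        have h2 : (fun y => ‖W y‖ ^ (1 / 4 : ℝ)) =O[𝓝 z] fun y => ‖y - z‖ ^ 2 := by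
          have := (hW8 z hz).norm_left.rpow (r := 1 / 4) (by norm_num)
            (Eventually.of_forall fun y => by positivity)
          refine this.congr_right fun y => ?_
          rw [← Real.rpow_natCast, ← Real.rpow_mul (norm_nonneg _), ← Real.rpow_natCast]; norm_num
        rw [hasFDerivAt_iff_isLittleO_nhds_zero] 
        have h3 := (hO.trans h2)
        have h4 : (fun y => ‖y - z‖ ^ 2) =o[𝓝 z] fun y => y - z := by
          refine ((isLittleO_pow_id one_lt_two).comp_tendsto
            (k := fun y => ‖y - z‖) (l' := 𝓝 z) ?_).norm_right.congr' ?_ ?_ |>.of_norm_right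
          · have : Tendsto (fun y => ‖y - z‖) (𝓝 z) (𝓝 ‖z - z‖) := by
              exact (continuous_id.sub continuous_const).norm.tendsto z
            simpa using this
          · exact Eventually.of_forall fun y => by simp
          · exact Eventually.of_forall fun y => by simp
        have h5 := (h3.trans_isLittleO h4).comp_tendsto
          (k := fun h => z + h) (l' := 𝓝 (0 : E)) (by
            have : Tendsto (fun h : E => z + h) (𝓝 0) (𝓝 (z + 0)) := (continuous_const.add continuous_id).tendsto 0
            simpa using this)
        refine h5.congr' (Eventually.of_forall fun h => ?_) (Eventually.of_forall fun h => ?_)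
        · simp [hSz]
        · simp
      refine ⟨this.differentiableAt, fun v => ?_⟩
      rw [this.fderiv]; simp [hSz]
    · have hfd : HasFDerivAt f (fderiv ℝ f z) z :=
        (hf.1.differentiable (by simp)).differentiableAt.hasFDerivAt
      have hWd : HasFDerivAt W (fderiv ℝ W z) z :=
        (hW.differentiable (by simp)).differentiableAt.hasFDerivAt
      have hSd' := (hSd z hz).hasFDerivAt
      have hS0 : S z ≠ 0 := fun h => hz (by rw [← hS z, h]; simp)
      have hinv : HasFDerivAt (fun y => (W y)⁻¹ ^ j)
          ((-(j : ℂ) * (W z)⁻¹ ^ (j + 1)) • fderiv ℝ W z) z := by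
        have h1 : HasDerivAt (fun w : ℂ => w⁻¹ ^ j) (-(j : ℂ) * (W z)⁻¹ ^ (j + 1)) (W z) := by
          have := (hasDerivAt_inv hz).pow j
          convert! this using 1
          rcases j with _ | j
          · simp
          · simp only [Nat.add_sub_cancel]; push_cast; rw [pow_succ, pow_succ, inv_pow, ← inv_pow]; ring
        exact h1.comp_hasFDerivAt z hWd
      -- Away from the zeros of `W` the formula is the product rule with `2 S dS = dW`.
      have hS2 : ∀ v, 2 * S z * fderiv ℝ S z v = fderiv ℝ W z v := by
        intro v
        have : HasFDerivAt W ((2 * S z) • fderiv ℝ S z) z := by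
          have h := hSd'.pow 2
          have hfun : (fun y => S y ^ 2) = W := funext hS
          have h' : HasFDerivAt (fun y => S y ^ 2) ((2 * S z) • fderiv ℝ S z) z := by
            convert! h using 1
            simp
          rwa [hfun] at h'
        rw [this.fderiv]; simp
      have hmul := hfd.mul (hSd'.mul hinv)
      refine ⟨hmul.differentiableAt, fun v => ?_⟩
      have heq : fderiv ℝ (fun z => f z * (S z * (W z)⁻¹ ^ j)) z v =
          f z * (S z * ((-(j : ℂ) * (W z)⁻¹ ^ (j + 1)) * fderiv ℝ W z v) +
            (W z)⁻¹ ^ j * fderiv ℝ S z v) + (S z * (W z)⁻¹ ^ j) * fderiv ℝ f z v := by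
        have := hmul.fderiv
        rw [show (fun z => f z * (S z * (W z)⁻¹ ^ j)) = f * (S * fun y => (W y)⁻¹ ^ j) from rfl, this]
        simp
        ring
      have hSv : fderiv ℝ S z v = fderiv ℝ W z v * S z * (W z)⁻¹ / 2 := by
        rw [← hS2 v, ← hS z]; field_simp
      rw [heq, hSv]
      ring
  -- Each derivative is a sum of two products of the same kind.
  induction n with
  | zero =>
    intro j f hf
    exact contDiff_zero.2 (continuous_iff_continuousAt.2 fun z => (hder j f hf z).1.continuousAt)
  | succ n ih =>
    intro j f hf
    rw [show ((n + 1 : ℕ) : WithTop ℕ∞) = n + 1 from rfl, contDiff_succ_iff_fderiv_apply]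
    refine ⟨fun z => (hder j f hf z).1, by simp, fun v => ?_⟩
    simp_rw [(hder j f hf _).2 v]
    refine (ih j _ (hf.fderiv_apply v)).add (ih (j + 1) _ ?_)
    have := (FlatOrder.of_contDiff (W := W) (contDiff_const (c := (1 / 2 - j : ℂ)))).mul
      (hf.mul (hdW v))
    simpa using this

/-- The bound of order 8 at the zeros only serves to make `|W| ^ (1/4)` quadratically small. -/
theorem contDiff_sqrt [FiniteDimensional ℝ E] {W S : E → ℂ} (hW : ContDiff ℝ ∞ W)
    (hdW : ∀ v, FlatOrder W 1 (fun z => fderiv ℝ W z v))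
    (hW8 : ∀ z₀, W z₀ = 0 → W =O[𝓝 z₀] fun z => ‖z - z₀‖ ^ 8)
    (hS : ∀ z, S z ^ 2 = W z) (hSd : ∀ z, W z ≠ 0 → DifferentiableAt ℝ S z) :
    ContDiff ℝ ∞ S := by
  refine contDiff_infty.2 fun n => ?_
  simpa using contDiff_mul_sqrt hW hdW hW8 hS hSd n 0 (fun _ => 1)
    (FlatOrder.of_contDiff contDiff_const)

end FlatSqrt
end HamGeometry

namespace HamGeometry

open Filter Asymptotics

/-! ### Flat steps -/

section FlatStep

theorem natCast_le_infty (k : ℕ) : (k : WithTop ℕ∞) ≤ (∞ : WithTop ℕ∞) := mod_cast le_top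

/-- The derivatives of `Θ` near `s₀` are bounded by almost the first power of `|Θ - Θ s₀|`, and this
difference vanishes to order at least 8. -/
def FlatAt (Θ : ℝ → ℝ) (s₀ : ℝ) : Prop :=
  (∀ (m : ℕ) (a : ℝ), 0 ≤ a → a < 1 →
    iteratedDeriv (m + 1) Θ =O[𝓝 s₀] fun s => |Θ s - Θ s₀| ^ a) ∧
  (fun s => Θ s - Θ s₀) =O[𝓝 s₀] fun s => |s - s₀| ^ 8

/-- If `Θ - Θ (L z₀)` is dominated by `W` at the zeros `z₀` of `W`, flatness of `Θ` gives `deriv Θ`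
the order 1 with respect to `W`. -/
theorem FlatAt.flatOrder {E : Type*} [NormedAddCommGroup E] [NormedSpace ℝ E] {W : E → ℂ}
    {Θ : ℝ → ℝ} (L : E →L[ℝ] ℝ) (hΘ : ContDiff ℝ ∞ Θ)
    (h : ∀ z₀, W z₀ = 0 → FlatAt Θ (L z₀) ∧ (fun z => Θ (L z) - Θ (L z₀)) =O[𝓝 z₀] W) :
    FlatOrder W 1 (fun z => ((deriv Θ (L z) : ℝ) : ℂ)) := by
  have hd : ContDiff ℝ ∞ (deriv Θ) := (contDiff_infty_iff_deriv.1 hΘ).2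
  have hdL : ContDiff ℝ ∞ (fun z => deriv Θ (L z)) := hd.comp L.contDiff
  refine ⟨Complex.ofRealCLM.contDiff.comp hdL, fun m z₀ hz a ha ha1 => ?_⟩
  obtain ⟨h1, h2⟩ := h z₀ hz
  have ha1' : a < 1 := by rcases ha1 with h | h <;> [simpa using h; linarith]
  have hb : ∀ z, ‖iteratedFDeriv ℝ m (fun z => ((deriv Θ (L z) : ℝ) : ℂ)) z‖ ≤
      (‖Complex.ofRealCLM‖ * ∏ _i : Fin m, ‖L‖) * ‖iteratedDeriv (m + 1) Θ (L z)‖ := by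
    intro z
    have e1 := Complex.ofRealCLM.norm_iteratedFDeriv_comp_left (f := fun z => deriv Θ (L z))
      (x := z) (n := m) (N := ∞) hdL.contDiffAt (by exact_mod_cast le_top)
    have e2 : iteratedFDeriv ℝ m (fun z => deriv Θ (L z)) z =
        (iteratedFDeriv ℝ m (deriv Θ) (L z)).compContinuousLinearMap fun _ => L :=
      L.iteratedFDeriv_comp_right hd z (i := m) (by exact_mod_cast le_top)
    have e3 : ‖iteratedFDeriv ℝ m (deriv Θ) (L z)‖ = ‖iteratedDeriv (m + 1) Θ (L z)‖ := by
      rw [norm_iteratedFDeriv_eq_norm_iteratedDeriv, iteratedDeriv_succ']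
    calc _ ≤ ‖Complex.ofRealCLM‖ * ‖iteratedFDeriv ℝ m (fun z => deriv Θ (L z)) z‖ := e1
      _ ≤ ‖Complex.ofRealCLM‖ * (‖iteratedFDeriv ℝ m (deriv Θ) (L z)‖ * ∏ _i : Fin m, ‖L‖) := by
        rw [e2]; gcongr; exact ContinuousMultilinearMap.norm_compContinuousLinearMap_le _ _
      _ = _ := by rw [e3]; ring
  refine (IsBigO.of_bound _ (Eventually.of_forall hb)).trans ?_
  have e := (h1.1 m a ha ha1').comp_tendsto (L.continuous.tendsto z₀)
  refine e.trans ?_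
  have := h2.norm_norm.rpow (r := a) ha (Eventually.of_forall fun y => norm_nonneg _)
  exact this

theorem FlatAt.congr {Θ Θ' : ℝ → ℝ} {s₀ : ℝ} (h : FlatAt Θ s₀) (he : Θ' =ᶠ[𝓝 s₀] Θ) :
    FlatAt Θ' s₀ := by
  refine ⟨fun m a ha ha1 => ?_, ?_⟩
  · refine (h.1 m a ha ha1).congr' (he.iteratedDeriv (m + 1)).symm ?_
    filter_upwards [he] with s hs
    rw [hs, he.eq_of_nhds]
  · refine h.2.congr' ?_ EventuallyEq.rfl
    filter_upwards [he] with s hs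
    rw [hs, he.eq_of_nhds]

theorem FlatAt.const (c s₀ : ℝ) : FlatAt (fun _ => c) s₀ := by
  refine ⟨fun m a _ _ => ?_, ?_⟩
  · have : iteratedDeriv (m + 1) (fun _ : ℝ => c) = fun _ => 0 := by
      funext s; simp [iteratedDeriv_const]
    rw [this]; exact isBigO_zero _ _
  · simp only [sub_self]; exact isBigO_zero _ _

theorem FlatAt.comp_affine {Θ : ℝ → ℝ} (hΘ : ContDiff ℝ ∞ Θ) {k l b c s₀ : ℝ}
    (h : FlatAt Θ (k * s₀ + l)) : FlatAt (fun s => c + b * Θ (k * s + l)) s₀ := by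
  have ht : Tendsto (fun s => k * s + l) (𝓝 s₀) (𝓝 (k * s₀ + l)) := by
    apply Continuous.tendsto; fun_prop
  rcases eq_or_ne b 0 with rfl | hb
  · simpa using FlatAt.const c s₀
  have hit : ∀ m s, iteratedDeriv (m + 1) (fun s => c + b * Θ (k * s + l)) s =
      (b * k ^ (m + 1)) * iteratedDeriv (m + 1) Θ (k * s + l) := by
    intro m s
    have h1 : iteratedDeriv (m + 1) (fun s => c + b * Θ (k * s + l)) s =
        iteratedDeriv (m + 1) (fun s => b * Θ (k * s + l)) s := by
      rw [iteratedDeriv_succ', iteratedDeriv_succ']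
      congr 1
      funext s
      exact deriv_const_add c
    have hΘl : ContDiff ℝ ∞ (fun s => Θ (s + l)) := hΘ.comp (contDiff_id.add contDiff_const)
    rw [h1, iteratedDeriv_const_mul_field]
    have h2 := iteratedDeriv_comp_const_mul (n := m + 1) (f := fun s => Θ (s + l))
      (hΘl.of_le (by exact_mod_cast le_top)) k
    have h3 := congrFun h2 s
    rw [h3, iteratedDeriv_comp_add_const]
    ring
  refine ⟨fun m a ha ha1 => ?_, ?_⟩
  · have e := ((h.1 m a ha ha1).comp_tendsto ht).const_mul_left (b * k ^ (m + 1))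
    refine (e.congr_left fun s => (hit m s).symm).trans ?_
    refine IsBigO.of_bound ((|b| ^ a)⁻¹) (Eventually.of_forall fun s => ?_)
    have hb' : 0 < |b| ^ a := Real.rpow_pos_of_pos (abs_pos.2 hb) a
    have : |c + b * Θ (k * s + l) - (c + b * Θ (k * s₀ + l))| ^ a =
        |b| ^ a * |Θ (k * s + l) - Θ (k * s₀ + l)| ^ a := by
      rw [← Real.mul_rpow (abs_nonneg _) (abs_nonneg _), ← abs_mul]; congr 2; ring
    simp only [Function.comp, Real.norm_eq_abs, this, abs_mul]
    rw [← mul_assoc, abs_of_pos hb', inv_mul_cancel₀ hb'.ne', one_mul]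
  · have e := (h.2.comp_tendsto ht).const_mul_left b
    refine (e.congr_left fun s => ?_).trans (g := fun s => |k * s + l - (k * s₀ + l)| ^ 8) ?_
    · simp only [Function.comp]; ring
    · refine IsBigO.of_bound (|k| ^ 8) (Eventually.of_forall fun s => ?_)
      rw [show k * s + l - (k * s₀ + l) = k * (s - s₀) by ring, abs_mul, mul_pow, norm_mul]
      simp

open Polynomial in
/-- Write `exp (-1/x)` as `exp (-(1-a)/x) * exp (-a/x)`; the first factor absorbs the polynomial in
`1/x`. -/
theorem isBigO_polynomial_mul_expNegInvGlue (p : ℝ[X]) {a : ℝ} (ha : a < 1) :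
    (fun x => p.eval x⁻¹ * expNegInvGlue x) =O[𝓝 0] fun x => expNegInvGlue x ^ a := by
  set c : ℝ := 1 - a with hc
  have hc0 : 0 < c := by linarith
  have ht : Tendsto (fun x : ℝ => x / c) (𝓝 0) (𝓝 0) := by
    have : Tendsto (fun x : ℝ => x / c) (𝓝 0) (𝓝 (0 / c)) := Continuous.tendsto (by fun_prop) 0
    simpa using this
  have h1 := ((expNegInvGlue.tendsto_polynomial_inv_mul_zero (p.comp (C c⁻¹ * X))).comp ht).isBigO_one ℝ
  have h2 : ∀ x, p.eval x⁻¹ * expNegInvGlue x =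
      ((p.comp (C c⁻¹ * X)).eval (x / c)⁻¹ * expNegInvGlue (x / c)) * expNegInvGlue x ^ a := by
    intro x
    have e1 : (p.comp (C c⁻¹ * X)).eval (x / c)⁻¹ = p.eval x⁻¹ := by
      simp only [eval_comp, eval_mul, eval_C, eval_X]
      congr 1; rw [inv_div]; field_simp
    rw [e1, mul_assoc]
    congr 1
    rcases le_or_gt x 0 with hx | hx
    · rw [expNegInvGlue.zero_of_nonpos hx, expNegInvGlue.zero_of_nonpos
        (div_nonpos_of_nonpos_of_nonneg hx hc0.le)]; simp
    · have hxc : 0 < x / c := by positivity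
      simp only [expNegInvGlue, hx.not_ge, hxc.not_ge, if_false]
      rw [← Real.exp_mul, ← Real.exp_add]
      congr 1; field_simp; rw [hc]; ring
  have := h1.mul (isBigO_refl (fun x => expNegInvGlue x ^ a) (𝓝 (0:ℝ)))
  simp only [one_mul] at this
  exact this.congr_left fun x => (h2 x).symm

open Polynomial in
theorem exists_iteratedDeriv_expNegInvGlue (m : ℕ) :
    ∃ p : ℝ[X], iteratedDeriv m expNegInvGlue = fun x => p.eval x⁻¹ * expNegInvGlue x := by
  induction m with
  | zero => exact ⟨1, by simp⟩
  | succ m ih =>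
    obtain ⟨p, hp⟩ := ih
    refine ⟨X ^ 2 * (p - derivative p), ?_⟩
    rw [iteratedDeriv_succ, hp]
    funext x
    exact (expNegInvGlue.hasDerivAt_polynomial_eval_inv_mul p x).deriv

theorem flatAt_smoothTransition_zero : FlatAt Real.smoothTransition 0 := by
  have hG : ContDiff ℝ ∞ (fun x : ℝ => (expNegInvGlue x + expNegInvGlue (1 - x))⁻¹) := by
    refine ContDiff.inv ?_ fun x => (Real.smoothTransition.pos_denom x).ne'
    exact expNegInvGlue.contDiff.add (expNegInvGlue.contDiff.comp (contDiff_const.sub contDiff_id))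
  have hE : ContDiff ℝ ∞ expNegInvGlue := expNegInvGlue.contDiff
  have hfun : Real.smoothTransition =
      fun x => expNegInvGlue x * (expNegInvGlue x + expNegInvGlue (1 - x))⁻¹ := by
    funext x; rw [Real.smoothTransition, div_eq_mul_inv]
  have hle : ∀ x, expNegInvGlue x ≤ 2 * Real.smoothTransition x := by
    intro x
    have hE1 : ∀ y, expNegInvGlue y ≤ 1 := by
      intro y; unfold expNegInvGlue; split_ifs with h
      · norm_num
      · exact Real.exp_le_one_iff.2 (by push Not at h; simp [h.le])
    have hp := Real.smoothTransition.pos_denom x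
    rw [Real.smoothTransition, mul_div_assoc', le_div_iff₀ hp]
    nlinarith [hE1 x, hE1 (1 - x), expNegInvGlue.nonneg x]
  have hST : ∀ a : ℝ, 0 ≤ a → (fun x => expNegInvGlue x ^ a) =O[𝓝 0]
      fun x => |Real.smoothTransition x - Real.smoothTransition 0| ^ a := by
    intro a ha
    have : (fun x => expNegInvGlue x) =O[𝓝 0]
        fun x => |Real.smoothTransition x - Real.smoothTransition 0| := by
      refine IsBigO.of_bound 2 (Eventually.of_forall fun x => ?_)
      rw [Real.smoothTransition.zero, sub_zero, Real.norm_of_nonneg (expNegInvGlue.nonneg x),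
        Real.norm_eq_abs, abs_abs, abs_of_nonneg (Real.smoothTransition.nonneg x)]
      exact hle x
    exact this.rpow ha (Eventually.of_forall fun x => abs_nonneg _)
  refine ⟨fun m a ha ha1 => ?_, ?_⟩
  · refine IsBigO.trans ?_ (hST a ha)
    have hb : ∀ x, ‖iteratedDeriv (m + 1) Real.smoothTransition x‖ ≤
        ‖∑ k ∈ Finset.range (m + 1 + 1), ((m + 1).choose k : ℝ) * ‖iteratedDeriv k expNegInvGlue x‖ *
          ‖iteratedFDeriv ℝ (m + 1 - k) (fun x : ℝ =>
            (expNegInvGlue x + expNegInvGlue (1 - x))⁻¹) x‖‖ := by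
      intro x
      rw [Real.norm_of_nonneg (r := ∑ k ∈ _, _) (Finset.sum_nonneg fun k _ => by positivity)]
      have := norm_iteratedFDeriv_mul_le (n := m + 1) (N := ∞) hE hG x (by exact_mod_cast le_top)
      rw [← hfun] at this
      simpa only [norm_iteratedFDeriv_eq_norm_iteratedDeriv] using this
    refine (IsBigO.of_bound 1 (Eventually.of_forall fun x => by simpa using hb x)).trans
      (g := fun x => ∑ k ∈ Finset.range (m + 1 + 1), ((m + 1).choose k : ℝ) *
        ‖iteratedDeriv k expNegInvGlue x‖ * ‖iteratedFDeriv ℝ (m + 1 - k) (fun x : ℝ =>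
            (expNegInvGlue x + expNegInvGlue (1 - x))⁻¹) x‖) ?_
    refine IsBigO.fun_sum fun k _ => ?_
    obtain ⟨p, hp⟩ := exists_iteratedDeriv_expNegInvGlue k
    have h1 := (isBigO_polynomial_mul_expNegInvGlue p ha1).norm_left.const_mul_left
      ((m + 1).choose k : ℝ)
    have h2 : (fun x => ‖iteratedFDeriv ℝ (m + 1 - k) (fun x : ℝ =>
        (expNegInvGlue x + expNegInvGlue (1 - x))⁻¹) x‖) =O[𝓝 0] fun _ => (1 : ℝ) :=
      ((hG.continuous_iteratedFDeriv (m := m + 1 - k) (natCast_le_infty _)).norm.continuousAt).isBigO_one ℝ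
    rw [hp]
    simpa using h1.mul h2
  · have h := ((expNegInvGlue.tendsto_polynomial_inv_mul_zero (Polynomial.X ^ 8)).isBigO_one ℝ)
    have h2 := (h.mul (isBigO_refl (fun x : ℝ => |x - 0| ^ 8) (𝓝 (0:ℝ)))).mul
      ((hG.continuous.continuousAt (x := 0)).isBigO_one ℝ)
    simp only [one_mul, mul_one] at h2
    refine h2.congr_left fun x => ?_
    rw [Real.smoothTransition.zero, sub_zero, sub_zero, hfun]
    simp only [Polynomial.eval_pow, Polynomial.eval_X]
    rcases eq_or_ne x 0 with rfl | hx
    · simp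
    · rw [(show Even 8 by decide).pow_abs]; field_simp

theorem smoothTransition_one_sub (x : ℝ) :
    Real.smoothTransition (1 - x) = 1 - Real.smoothTransition x := by
  have := Real.smoothTransition.pos_denom x
  unfold Real.smoothTransition
  rw [sub_sub_cancel, add_comm (expNegInvGlue (1 - x))]
  field_simp; ring

/-- The smooth step is flat at every point where it is not strictly increasing. -/
theorem flatAt_smoothTransition_of_notMem {x : ℝ} (hx : x ∉ Ioo (0 : ℝ) 1) :
    FlatAt Real.smoothTransition x := by
  have hsm : ContDiff ℝ ∞ Real.smoothTransition := Real.smoothTransition.contDiff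
  rcases lt_trichotomy x 0 with h | rfl | h
  · refine (FlatAt.const 0 x).congr ?_
    filter_upwards [gt_mem_nhds h] with y hy
    exact Real.smoothTransition.zero_of_nonpos hy.le
  · exact flatAt_smoothTransition_zero
  · have h1 : 1 ≤ x := by by_contra h'; exact hx ⟨h, not_le.1 h'⟩
    rcases h1.eq_or_lt with rfl | h1
    · have := FlatAt.comp_affine (c := 1) (b := -1) (k := -1) (l := 1) (s₀ := 1) hsm
        (by simpa using flatAt_smoothTransition_zero)
      refine this.congr (Eventually.of_forall fun s => ?_)
      have := smoothTransition_one_sub s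
      simp only [show -1 * s + 1 = 1 - s by ring, this]; ring
    · refine (FlatAt.const 1 x).congr ?_
      filter_upwards [lt_mem_nhds h1] with y hy
      exact Real.smoothTransition.one_of_one_le hy.le

end FlatStep
end HamGeometry

namespace HamGeometry

open Filter Asymptotics Complex

/-! ### The curve over the boundary of the half disc -/

section Root

/-- The principal square root. -/
noncomputable def csqrt (w : ℂ) : ℂ := w ^ (1 / 2 : ℂ)

theorem csqrt_sq (w : ℂ) : csqrt w ^ 2 = w := by
  have := Complex.cpow_nat_inv_pow w (n := 2) two_ne_zero
  simpa only [csqrt, one_div, Nat.cast_ofNat] using this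

theorem csqrt_zero : csqrt 0 = 0 := by simp [csqrt]

theorem csqrt_ne_zero {w : ℂ} (hw : w ≠ 0) : csqrt w ≠ 0 := fun h => hw (by
  rw [← csqrt_sq w, h]; simp)

theorem contDiffAt_csqrt {w : ℂ} (hw : w ∈ slitPlane) : ContDiffAt ℝ ∞ csqrt w := by
  have h : ContDiffAt ℂ ∞ (fun z => Complex.exp (Complex.log z * (1 / 2))) w :=
    ((Complex.contDiffAt_log hw).mul contDiffAt_const).cexp
  refine (h.restrict_scalars ℝ).congr_of_eventuallyEq ?_
  filter_upwards [isOpen_slitPlane.mem_nhds hw] with z hz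
  rw [csqrt, Complex.cpow_def_of_ne_zero (slitPlane_ne_zero hz)]

theorem continuousAt_csqrt {w : ℂ} (hw : 0 ≤ w.re) : ContinuousAt csqrt w := by
  by_cases h0 : w = 0
  · subst h0
    have : ContinuousAt (fun w : ℂ => w ^ (1 / 2 : ℂ)) 0 := by
      have := Complex.continuousAt_cpow_zero_of_re_pos (z := (1 / 2 : ℂ)) (by norm_num)
      exact this.comp (f := fun w : ℂ => (w, (1 / 2 : ℂ))) (by fun_prop)
    exact this
  · refine (contDiffAt_csqrt ?_).continuousAt
    rw [mem_slitPlane_iff]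
    rcases hw.lt_or_eq with h | h
    · exact Or.inl h
    · refine Or.inr fun h' => h0 (Complex.ext h.symm h')

theorem csqrt_ofReal {x : ℝ} (hx : 0 ≤ x) : csqrt x = (√x : ℝ) := by
  rw [csqrt, Real.sqrt_eq_rpow, Complex.ofReal_cpow hx]; simp

theorem csqrt_conj {w : ℂ} (hw : w ∈ slitPlane) :
    csqrt ((starRingEnd ℂ) w) = (starRingEnd ℂ) (csqrt w) := by
  have h := Complex.conj_cpow w (1 / 2) (slitPlane_arg_ne_pi hw)
  rw [csqrt, csqrt, h, map_div₀, map_one, Complex.conj_ofNat]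

variable (R : ℝ)

/-- The square root of `R exp (i θ) - 1` that depends continuously on `θ` and is
positive for `θ = 0`. -/
noncomputable def rootTop (θ : ℝ) : ℂ :=
  (√R : ℂ) * Complex.exp (θ / 2 * I) * csqrt (1 - Complex.exp (-θ * I) / R)

variable {R} 

theorem re_one_sub_exp_div_pos {k : ℝ} (hk0 : 0 ≤ k) (hk : k < R) (θ : ℝ) :
    0 < (1 - k * Complex.exp (-θ * I) / R : ℂ).re := by
  have hR : 0 < R := hk0.trans_lt hk
  have h1 : ‖(k * Complex.exp (-θ * I) / R : ℂ)‖ < 1 := by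
    rw [norm_div, norm_mul, ← Complex.ofReal_neg, Complex.norm_exp_ofReal_mul_I]
    simp only [norm_real, Real.norm_eq_abs, abs_of_nonneg hk0, abs_of_pos hR, mul_one]
    exact (div_lt_one hR).2 hk
  have h2 := Complex.re_le_norm (k * Complex.exp (-θ * I) / R : ℂ)
  simp only [Complex.sub_re, Complex.one_re]; linarith

/-- The argument of the principal root in `rootTop` stays off the branch cut. -/
theorem rootTop_mem_slitPlane (hR : 2 ≤ R) (θ : ℝ) :
    (1 - Complex.exp (-θ * I) / R : ℂ) ∈ slitPlane := by
  have := re_one_sub_exp_div_pos (R := R) zero_le_one (by linarith) θ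
  exact Or.inl (by simpa using this)

theorem rootTop_sq (hR : 2 ≤ R) (θ : ℝ) :
    rootTop R θ ^ 2 = R * Complex.exp (θ * I) - 1 := by
  have hR0 : (R : ℂ) ≠ 0 := by exact_mod_cast (by linarith : R ≠ 0)
  rw [rootTop, mul_pow, mul_pow, csqrt_sq, ← Complex.ofReal_pow, Real.sq_sqrt (by linarith),
    ← Complex.exp_nat_mul, mul_sub, mul_one, mul_div_assoc', mul_assoc, ← Complex.exp_add]
  rw [show ((2 : ℕ) : ℂ) * (θ / 2 * I) + -θ * I = 0 by push_cast; ring,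
    show ((2 : ℕ) : ℂ) * (θ / 2 * I) = θ * I by push_cast; ring, Complex.exp_zero]
  field_simp

theorem contDiff_rootTop (hR : 2 ≤ R) : ContDiff ℝ ∞ (rootTop R) := by
  have h1 : ContDiff ℝ ∞ (fun θ : ℝ => (θ : ℂ)) := ofRealCLM.contDiff
  have h2 : ContDiff ℝ ∞ (fun θ : ℝ => Complex.exp (θ / 2 * I)) :=
    (((h1.div_const 2).mul contDiff_const)).cexp
  have h3 : ContDiff ℝ ∞ (fun θ : ℝ => (1 - Complex.exp (-θ * I) / R : ℂ)) :=
    contDiff_const.sub (((h1.neg.mul contDiff_const).cexp).div_const _)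
  refine (contDiff_const.mul h2).mul (contDiff_iff_contDiffAt.2 fun θ => ?_)
  exact (contDiffAt_csqrt (rootTop_mem_slitPlane hR θ)).comp θ h3.contDiffAt

theorem rootTop_ne_zero (hR : 2 ≤ R) (θ : ℝ) : rootTop R θ ≠ 0 := by
  have h1 := slitPlane_ne_zero (rootTop_mem_slitPlane hR θ)
  have h2 : (√R : ℂ) ≠ 0 := by
    have : 0 < √R := Real.sqrt_pos.2 (by linarith)
    exact_mod_cast this.ne'
  exact mul_ne_zero (mul_ne_zero h2 (Complex.exp_ne_zero _)) (csqrt_ne_zero h1)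

/-- The right side is `|R exp (i θ) - 1| ^ 2`. -/
theorem normSq_rootTop (hR : 2 ≤ R) (θ : ℝ) :
    normSq (rootTop R θ) ^ 2 = (R - 1) ^ 2 + 2 * R * (1 - Real.cos θ) := by
  have h : normSq (rootTop R θ) ^ 2 = normSq (rootTop R θ ^ 2) := by rw [map_pow]
  rw [h, rootTop_sq hR, normSq_apply]
  simp [Complex.exp_ofReal_mul_I_re, Complex.exp_ofReal_mul_I_im]
  nlinarith [Real.sin_sq_add_cos_sq θ]

theorem one_le_normSq_rootTop (hR : 2 ≤ R) (θ : ℝ) : 1 ≤ normSq (rootTop R θ) := by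
  have h := normSq_rootTop hR θ
  have := Real.cos_le_one θ
  have h0 := normSq_nonneg (rootTop R θ)
  nlinarith

theorem cos_lt_one {θ : ℝ} (hθ : θ ∈ Ioo 0 (2 * Real.pi)) : Real.cos θ < 1 := by
  refine lt_of_le_of_ne (Real.cos_le_one θ) fun h => ?_
  rw [Real.cos_eq_one_iff_of_lt_of_lt (by linarith [hθ.1, Real.pi_pos]) hθ.2] at h
  exact hθ.1.ne' h

theorem one_lt_normSq_rootTop (hR : 2 ≤ R) {θ : ℝ} (hθ : θ ∈ Ioo 0 (2 * Real.pi)) :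
    1 < normSq (rootTop R θ) := by
  have h := normSq_rootTop hR θ
  have := cos_lt_one hθ
  have h0 := normSq_nonneg (rootTop R θ)
  nlinarith

/-- Differentiating `w ^ 2 = R exp (i θ) - 1` gives `2 w w' = i (w ^ 2 + 1)`. -/
theorem hasDerivAt_rootTop (hR : 2 ≤ R) (θ : ℝ) :
    HasDerivAt (rootTop R) (I / 2 * (rootTop R θ + (rootTop R θ)⁻¹)) θ := by
  have hd : HasDerivAt (rootTop R) (deriv (rootTop R) θ) θ :=
    ((contDiff_rootTop hR).differentiable (by simp)).differentiableAt.hasDerivAt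
  have h1 := hd.pow 2
  have h2 : HasDerivAt (fun θ : ℝ => (R * Complex.exp (θ * I) - 1 : ℂ))
      (R * (Complex.exp (θ * I) * (1 * I))) θ := by
    exact ((((hasDerivAt_id θ).ofReal_comp).mul_const I).cexp.const_mul (R : ℂ)).sub_const 1
  have h3 : (rootTop R ^ 2) = fun θ : ℝ => (R * Complex.exp (θ * I) - 1 : ℂ) := by
    funext θ; exact rootTop_sq hR θ
  rw [h3] at h1
  have h4 := h1.unique h2
  have h0 := rootTop_ne_zero hR θ
  have h5 : (R : ℂ) * Complex.exp (θ * I) = rootTop R θ ^ 2 + 1 := by rw [rootTop_sq hR]; ring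
  have h6 : deriv (rootTop R) θ = I / 2 * (rootTop R θ + (rootTop R θ)⁻¹) := by
    have : 2 * rootTop R θ * deriv (rootTop R) θ = (rootTop R θ ^ 2 + 1) * I := by
      rw [← h5]
      simpa [mul_assoc] using h4
    field_simp
    linear_combination this
  rw [← h6]; exact hd

theorem rootTop_neg (hR : 2 ≤ R) (θ : ℝ) :
    rootTop R (-θ) = (starRingEnd ℂ) (rootTop R θ) := by
  rw [rootTop, rootTop, map_mul, map_mul, ← csqrt_conj (rootTop_mem_slitPlane hR θ),
    ← Complex.exp_conj]
  simp [← Complex.exp_conj, neg_div, Complex.conj_ofNat]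

theorem rootTop_add_two_pi (θ : ℝ) : rootTop R (θ + 2 * Real.pi) = -rootTop R θ := by
  have h1 : Complex.exp (((θ + 2 * Real.pi : ℝ) : ℂ) / 2 * I) = -Complex.exp (θ / 2 * I) := by
    rw [show (((θ + 2 * Real.pi : ℝ) : ℂ) / 2 * I) = θ / 2 * I + Real.pi * I by push_cast; ring,
      Complex.exp_add, Complex.exp_pi_mul_I]; ring
  have h2 : Complex.exp (-((θ + 2 * Real.pi : ℝ) : ℂ) * I) = Complex.exp (-θ * I) := by
    rw [show (-((θ + 2 * Real.pi : ℝ) : ℂ) * I) = -θ * I - 2 * Real.pi * I by push_cast; ring,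
      Complex.exp_sub, Complex.exp_two_pi_mul_I, div_one]
  rw [rootTop, rootTop, h1, h2]; ring

theorem rootTop_two_pi_sub (hR : 2 ≤ R) (θ : ℝ) :
    rootTop R (2 * Real.pi - θ) = -(starRingEnd ℂ) (rootTop R θ) := by
  rw [show 2 * Real.pi - θ = -θ + 2 * Real.pi by ring, rootTop_add_two_pi, rootTop_neg hR]

theorem rootTop_zero (hR : 2 ≤ R) : rootTop R 0 = (√(R - 1) : ℝ) := by
  have hR0 : R ≠ 0 := by linarith
  have h1 : (1 - 1 / R : ℂ) = ((1 - 1 / R : ℝ) : ℂ) := by push_cast; ring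
  simp only [rootTop, ofReal_zero, zero_div, zero_mul, Complex.exp_zero, mul_one, neg_zero]
  have h2 : 0 ≤ 1 - 1 / R := by
    rw [sub_nonneg, div_le_one (by linarith)]; linarith
  rw [h1, csqrt_ofReal h2, ← ofReal_mul, ← Real.sqrt_mul (by linarith)]
  congr 2; field_simp

/-- The imaginary part has no zero on `(0, 2π)`, as a real square root of `R exp (i θ) - 1` would
force `exp (i θ) = 1`, and it is positive for `θ = π`. -/
theorem rootTop_im_pos (hR : 2 ≤ R) {θ : ℝ} (hθ : θ ∈ Ioo 0 (2 * Real.pi)) :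
    0 < (rootTop R θ).im := by
  have hcont : ContinuousOn (fun θ => (rootTop R θ).im) (Ioo 0 (2 * Real.pi)) :=
    (Complex.continuous_im.comp (contDiff_rootTop hR).continuous).continuousOn
  have hne : ∀ θ ∈ Ioo 0 (2 * Real.pi), (rootTop R θ).im ≠ 0 := by
    intro θ hθ h
    have hsq := rootTop_sq hR θ
    have hre := congrArg Complex.re hsq
    have him := congrArg Complex.im hsq
    simp [pow_two, h, Complex.exp_ofReal_mul_I_re, Complex.exp_ofReal_mul_I_im] at hre him
    have hs : Real.sin θ = 0 := by
      rcases him with h | h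
      · linarith
      · exact h
    have hc := cos_lt_one hθ
    have h2 := Real.sin_sq_add_cos_sq θ
    rw [hs] at h2
    have : Real.cos θ = -1 := by nlinarith
    rw [this] at hre
    nlinarith [mul_self_nonneg (rootTop R θ).re]
  have hpi : 0 < (rootTop R Real.pi).im := by
    have h1 := one_lt_normSq_rootTop hR ⟨Real.pi_pos, by linarith [Real.pi_pos]⟩
    have h2 : Complex.exp (-(Real.pi : ℂ) * I) = -1 := by
      rw [neg_mul, Complex.exp_neg, Complex.exp_pi_mul_I]; norm_num
    have h3 : Complex.exp ((Real.pi : ℂ) / 2 * I) = I := Complex.exp_pi_div_two_mul_I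
    rw [rootTop, h2, h3, show (1 - -1 / R : ℂ) = ((1 + 1 / R : ℝ) : ℂ) by push_cast; ring,
      csqrt_ofReal (by positivity)]
    have : 0 < √R * √(1 + 1 / R) := by positivity
    simpa using this
  by_contra hn
  have hlt : (rootTop R θ).im < 0 := lt_of_le_of_ne (not_lt.1 hn) (hne θ hθ)
  have := isPreconnected_Ioo.intermediate_value hθ ⟨Real.pi_pos, by linarith [Real.pi_pos]⟩ hcont
  obtain ⟨θ', h1, h2⟩ := this ⟨hlt.le, hpi.le⟩
  exact hne θ' h1 h2

theorem hasDerivAt_rootTop_re (hR : 2 ≤ R) (θ : ℝ) :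
    HasDerivAt (fun θ => (rootTop R θ).re)
      (-((rootTop R θ).im / 2 * (1 - (normSq (rootTop R θ))⁻¹))) θ := by
  have h := (reCLM.hasFDerivAt (x := rootTop R θ)).comp_hasDerivAt θ (hasDerivAt_rootTop hR θ)
  convert! h using 1
  simp [Complex.mul_re, Complex.inv_re, Complex.inv_im]
  ring

theorem hasDerivAt_rootTop_im (hR : 2 ≤ R) (θ : ℝ) :
    HasDerivAt (fun θ => (rootTop R θ).im)
      ((I / 2 * (rootTop R θ + (rootTop R θ)⁻¹)).im) θ :=
  (imCLM.hasFDerivAt (x := rootTop R θ)).comp_hasDerivAt θ (hasDerivAt_rootTop hR θ)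

theorem deriv_rootTop_re_neg (hR : 2 ≤ R) {θ : ℝ} (hθ : θ ∈ Ioo 0 (2 * Real.pi)) :
    -((rootTop R θ).im / 2 * (1 - (normSq (rootTop R θ))⁻¹)) < 0 := by
  have h1 := rootTop_im_pos hR hθ
  have h2 := one_lt_normSq_rootTop hR hθ
  have h3 : (normSq (rootTop R θ))⁻¹ < 1 := inv_lt_one_of_one_lt₀ h2
  have : 0 < (rootTop R θ).im / 2 * (1 - (normSq (rootTop R θ))⁻¹) :=
    mul_pos (by linarith) (by linarith)
  linarith

theorem strictAntiOn_rootTop_re (hR : 2 ≤ R) :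
    StrictAntiOn (fun θ => (rootTop R θ).re) (Icc 0 (2 * Real.pi)) := by
  refine strictAntiOn_of_deriv_neg (convex_Icc _ _)
    (Complex.continuous_re.comp (contDiff_rootTop hR).continuous).continuousOn fun θ hθ => ?_
  rw [interior_Icc] at hθ
  rw [(hasDerivAt_rootTop_re hR θ).deriv]
  exact deriv_rootTop_re_neg hR hθ

theorem rootTop_two_pi (hR : 2 ≤ R) : rootTop R (2 * Real.pi) = -(√(R - 1) : ℝ) := by
  have := rootTop_two_pi_sub hR 0
  rw [sub_zero] at this
  rw [this, rootTop_zero hR, conj_ofReal]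

theorem rootTop_im_nonneg (hR : 2 ≤ R) {θ : ℝ} (hθ : θ ∈ Icc 0 (2 * Real.pi)) :
    0 ≤ (rootTop R θ).im := by
  rcases hθ.1.eq_or_lt with h | h
  · rw [← h, rootTop_zero hR]; simp
  rcases hθ.2.eq_or_lt with h' | h'
  · rw [h', rootTop_two_pi hR]; simp
  exact (rootTop_im_pos hR ⟨h, h'⟩).le

theorem rootTop_re_sq_le (hR : 2 ≤ R) {θ : ℝ} (hθ : θ ∈ Icc 0 (2 * Real.pi)) :
    (rootTop R θ).re ^ 2 ≤ R - 1 := by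
  have hanti := (strictAntiOn_rootTop_re hR).antitoneOn
  have hp : 0 ≤ 2 * Real.pi := by positivity
  have h1 := hanti ⟨le_rfl, hp⟩ hθ hθ.1
  have h2 := hanti hθ ⟨hp, le_rfl⟩ hθ.2
  simp only [rootTop_zero hR, rootTop_two_pi hR, neg_re, ofReal_re] at h1 h2
  exact Real.sq_le (by linarith) |>.2 ⟨h2, h1⟩

end Root
end HamGeometry

namespace HamGeometry

open Filter Asymptotics Complex

/-! ### The hyperelliptic curve over a half plane -/

section Hyper

theorem csqrt_ofReal_mul {a : ℝ} (ha : 0 ≤ a) (w : ℂ) : csqrt (a * w) = (√a : ℝ) * csqrt w := by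
  rcases ha.eq_or_lt with rfl | ha
  · simp [csqrt_zero]
  rcases eq_or_ne w 0 with rfl | hw
  · simp [csqrt_zero]
  have ha' : (a : ℂ) ≠ 0 := by exact_mod_cast ha.ne'
  rw [← csqrt_ofReal ha.le, csqrt, csqrt, csqrt, Complex.cpow_def_of_ne_zero (mul_ne_zero ha' hw),
    Complex.cpow_def_of_ne_zero ha', Complex.cpow_def_of_ne_zero hw, ← Complex.exp_add,
    Complex.log_ofReal_mul ha hw, Complex.ofReal_log ha.le]
  congr 1; ring

/-- The branch of the square root of `w - r` on the closed upper half plane, up to a constant. -/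
noncomputable def halfRoot (r : ℝ) (w : ℂ) : ℂ := csqrt (-I * (w - r))

theorem halfRoot_sq (r : ℝ) (w : ℂ) : halfRoot r w ^ 2 = -I * (w - r) := csqrt_sq _

theorem continuousAt_halfRoot (r : ℝ) {w : ℂ} (hw : 0 ≤ w.im) : ContinuousAt (halfRoot r) w := by
  have h : ContinuousAt csqrt (-I * (w - r)) := continuousAt_csqrt (by simpa using hw)
  exact ContinuousAt.comp (g := csqrt) (f := fun w : ℂ => -I * (w - r)) h (by fun_prop)

/-- The square root of `w ^ 2 - j` on the closed upper half plane that is positive for large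
positive `w`. -/
noncomputable def rootFactor (j : ℕ) (w : ℂ) : ℂ := I * halfRoot (√j) w * halfRoot (-√j) w

theorem rootFactor_sq (j : ℕ) (w : ℂ) : rootFactor j w ^ 2 = w ^ 2 - j := by
  rw [rootFactor, mul_pow, mul_pow, halfRoot_sq, halfRoot_sq]
  have h : ((√(j : ℝ) : ℝ) : ℂ) ^ 2 = j := by
    rw [← ofReal_pow, Real.sq_sqrt (by positivity)]; simp
  push_cast
  have hI : I ^ 2 = -1 := I_sq
  linear_combination ((w ^ 2 - (√(j : ℝ) : ℝ) ^ 2) * (I ^ 2 - 1)) * hI - h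

/-- The points of the hyperelliptic curve `y² = (x - 1) ⋯ (x - (2 g + 1))` over the points
`x = 1 + w²`, for `w` in the closed upper half plane. The open upper half plane covers the plane of
`x` slit along the ray from `1` to `+∞` once, and `y` is a continuous root there; the images of `hyper`
and of `flip ∘ hyper` cover the curve. -/
noncomputable def hyper (g : ℕ) (w : ℂ) : ℂ × ℂ :=
  (1 + w ^ 2, w * ∏ j ∈ Finset.Icc 1 (2 * g), rootFactor j w)

theorem hyper_mem (g : ℕ) (w : ℂ) :
    (hyper g w).2 ^ 2 = ∏ k ∈ Finset.Icc 1 (2 * g + 1), ((hyper g w).1 - (k : ℂ)) := by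
  have h : ∀ m : ℕ, ∏ k ∈ Finset.Icc 1 (m + 1), (1 + w ^ 2 - (k : ℂ)) =
      w ^ 2 * ∏ j ∈ Finset.Icc 1 m, (w ^ 2 - (j : ℂ)) := by
    intro m
    induction m with
    | zero => simp
    | succ m ih =>
      rw [Finset.prod_Icc_succ_top (by omega), ih, Finset.prod_Icc_succ_top (by omega)]
      push_cast; ring
  simp only [hyper]
  rw [h, mul_pow, ← Finset.prod_pow]
  simp only [rootFactor_sq]

/-- The hyperelliptic involution `(x, y) ↦ (x, -y)`. -/
def flip (q : ℂ × ℂ) : ℂ × ℂ := (q.1, -q.2)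

theorem rootFactor_ne_zero {j : ℕ} {w : ℂ} (hw : 0 < w.im) : rootFactor j w ≠ 0 := by
  intro h
  have h2 := rootFactor_sq j w
  rw [h] at h2
  have hre := congrArg Complex.re h2
  have him := congrArg Complex.im h2
  simp [pow_two] at hre him
  have : w.re = 0 := by nlinarith
  rw [this] at hre
  have hj : (0 : ℝ) ≤ j := Nat.cast_nonneg j
  nlinarith

theorem hyper_snd_ne_zero {g : ℕ} {w : ℂ} (hw : 0 < w.im) : (hyper g w).2 ≠ 0 := by
  refine mul_ne_zero (fun h => ?_) (Finset.prod_ne_zero_iff.2 fun j _ => rootFactor_ne_zero hw)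
  rw [h] at hw; simp at hw

theorem eq_of_hyper_fst_eq {g : ℕ} {w w' : ℂ} (hw : 0 < w.im) (hw' : 0 < w'.im)
    (h : (hyper g w).1 = (hyper g w').1) : w = w' := by
  simp only [hyper, add_right_inj] at h
  rcases sq_eq_sq_iff_eq_or_eq_neg.1 h with h | h
  · exact h
  · rw [h] at hw; simp at hw; linarith

/-- To the right of the branch point the root is a positive multiple of a constant. -/
theorem halfRoot_ofReal_of_le {r x : ℝ} (h : r ≤ x) :
    halfRoot r x = (√(x - r) : ℝ) * csqrt (-I) := by
  rw [halfRoot, ← csqrt_ofReal_mul (by linarith)]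
  congr 1; push_cast; ring

theorem rootFactor_ofReal_of_le {j : ℕ} {x : ℝ} (h : √j ≤ x) :
    rootFactor j x = (√(x ^ 2 - j) : ℝ) := by
  have h0 : 0 ≤ √(j : ℝ) := Real.sqrt_nonneg _
  rw [rootFactor, halfRoot_ofReal_of_le h, halfRoot_ofReal_of_le (by linarith)]
  have h1 : (√(x ^ 2 - j) : ℝ) = √(x - √j) * √(x - -√j) := by
    rw [← Real.sqrt_mul (by linarith)]
    congr 1
    have := Real.sq_sqrt (Nat.cast_nonneg (α := ℝ) j)
    linarith
  have h2 := csqrt_sq (-I)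
  rw [h1]; push_cast
  linear_combination ((√(x - √j) : ℝ) * (√(x - -√j) : ℝ) * I : ℂ) * h2 - ((√(x - √j) : ℝ) * (√(x - -√j) : ℝ) : ℂ) * I_sq

theorem rootFactor_neg_ofReal (j : ℕ) (x : ℝ) :
    rootFactor j (-x : ℂ) = -(starRingEnd ℂ) (rootFactor j x) := by
  have h : ∀ r : ℝ, halfRoot r (-x : ℂ) = (starRingEnd ℂ) (halfRoot (-r) x) := by
    intro r
    rcases eq_or_ne (x + r) 0 with h0 | h0
    · have e1 : (-x - r : ℂ) = 0 := by
        have : ((x + r : ℝ) : ℂ) = 0 := by exact_mod_cast h0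
        push_cast at this; linear_combination -this
      have e2 : (x - ((-r : ℝ) : ℂ) : ℂ) = 0 := by push_cast; linear_combination -e1
      rw [halfRoot, halfRoot, e1, e2, mul_zero, csqrt_zero, map_zero]
    · have hs : (-I * ((x : ℂ) - ((-r : ℝ) : ℂ))) ∈ slitPlane := by
        refine Or.inr ?_
        simpa using fun h => h0 (by linarith : x + r = 0)
      rw [halfRoot, halfRoot, ← csqrt_conj hs]
      congr 1
      simp; ring
  rw [rootFactor, rootFactor, h, h, map_mul, map_mul, conj_I, neg_neg]
  ring

theorem hyper_neg_ofReal (g : ℕ) (x : ℝ) : hyper g (-x : ℂ) =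
    ((hyper g x).1, -(starRingEnd ℂ) (hyper g x).2) := by
  simp only [hyper, rootFactor_neg_ofReal, map_mul, map_prod, conj_ofReal]
  rw [Finset.prod_neg]
  simp

/-- For `u` between `j` and `j + 1`, the factors with `i > j` are the nonpositive ones. -/
theorem prod_sub_sign {j m : ℕ} {u : ℝ} (hjm : j ≤ m) (h1 : (j : ℝ) ≤ u) (h2 : u ≤ j + 1) :
    0 ≤ (-1) ^ (m + j) * ∏ i ∈ Finset.Icc 1 m, (u - i) := by
  induction m, hjm using Nat.le_induction with
  | base =>
    rw [Even.neg_one_pow ⟨j, rfl⟩, one_mul]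
    refine Finset.prod_nonneg fun i hi => ?_
    have : (i : ℝ) ≤ j := by exact_mod_cast (Finset.mem_Icc.1 hi).2
    linarith
  | succ m hm ih =>
    rw [Finset.prod_Icc_succ_top (by omega)]
    have : (j : ℝ) ≤ m := by exact_mod_cast hm
    have h3 : 0 ≤ ((m + 1 : ℕ) : ℝ) - u := by push_cast; linarith
    have := mul_nonneg ih h3
    have e : (-1 : ℝ) ^ (m + 1 + j) = -(-1) ^ (m + j) := by ring
    rw [e]; linarith

theorem conj_eq_of_sq_eq {y : ℂ} {c : ℝ} (h : y ^ 2 = c) {ε : ℝ} (hε : ε = 1 ∨ ε = -1)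
    (hc : 0 ≤ ε * c) : (starRingEnd ℂ) y = ε * y := by
  have hre := congrArg Complex.re h
  have him := congrArg Complex.im h
  simp [pow_two] at hre him
  have him' : y.re * y.im = 0 := by linarith
  rcases hε with rfl | rfl <;> rcases mul_eq_zero.1 him' with h0 | h0
  · have : y.im = 0 := by rw [h0] at hre; nlinarith
    apply Complex.ext <;> simp [h0, this]
  · apply Complex.ext <;> simp [h0]
  · apply Complex.ext <;> simp [h0]
  · have : y.re = 0 := by rw [h0] at hre; nlinarith
    apply Complex.ext <;> simp [h0, this]

/-- Over the real segment between the branch points `1 + j` and `2 + j`, the function `y` is real or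
purely imaginary, according to the parity of `j`. -/
theorem conj_hyper_snd {g j : ℕ} (hj : j ≤ 2 * g) {x : ℝ} (h1 : (j : ℝ) ≤ x ^ 2)
    (h2 : x ^ 2 ≤ j + 1) : (starRingEnd ℂ) (hyper g x).2 = (-1) ^ j * (hyper g x).2 := by
  have hc : (hyper g (x : ℂ)).2 ^ 2 = ((x ^ 2 * ∏ i ∈ Finset.Icc 1 (2 * g), (x ^ 2 - i) : ℝ) : ℂ) := by
    simp only [hyper]
    rw [mul_pow, ← Finset.prod_pow]
    simp only [rootFactor_sq]
    push_cast; rfl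
  have := conj_eq_of_sq_eq hc (ε := (-1) ^ j) (neg_one_pow_eq_or ℝ j) (by
    have := prod_sub_sign hj h1 h2
    rw [pow_add, pow_mul, neg_one_sq, one_pow, one_mul] at this
    nlinarith [sq_nonneg x])
  simpa using this

/-- The two edges `w` and `-w` of the half plane lie over the same segment; the curve is glued from
them directly or through the involution. -/
theorem hyper_neg_ofReal_eq {g j : ℕ} (hj : j ≤ 2 * g) {x : ℝ} (h1 : (j : ℝ) ≤ x ^ 2)
    (h2 : x ^ 2 ≤ j + 1) :
    hyper g (-x : ℂ) = if Even j then flip (hyper g x) else hyper g x := by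
  rw [hyper_neg_ofReal, conj_hyper_snd hj h1 h2]
  split_ifs with h
  · rw [h.neg_one_pow, one_mul]; rfl
  · rw [(Nat.not_even_iff_odd.1 h).neg_one_pow]; simp

/-- Both sides are continuous square roots of the same nonvanishing function of `θ` and agree at `θ
= 0`. -/
theorem rootFactor_rootTop {R : ℝ} {j : ℕ} (hR : (j : ℝ) + 2 ≤ R) {θ : ℝ}
    (hθ : θ ∈ Icc 0 (2 * Real.pi)) : rootFactor j (rootTop R θ) =
      (√R : ℝ) * Complex.exp (θ / 2 * I) * csqrt (1 - (j + 1 : ℝ) * Complex.exp (-θ * I) / R) := by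
  have hj : (0 : ℝ) ≤ j := Nat.cast_nonneg j
  have hR2 : 2 ≤ R := by linarith
  have hR0 : (R : ℂ) ≠ 0 := by exact_mod_cast (by linarith : R ≠ 0)
  have hsl : ∀ θ : ℝ, (1 - (j + 1 : ℝ) * Complex.exp (-θ * I) / R : ℂ) ∈ slitPlane := fun θ =>
    Or.inl (re_one_sub_exp_div_pos (k := j + 1) (by positivity) (by linarith) θ)
  have hcs : ContinuousOn (fun θ : ℝ => ((√R : ℝ) : ℂ) * Complex.exp (θ / 2 * I) *
      csqrt (1 - (j + 1 : ℝ) * Complex.exp (-θ * I) / R)) (Icc 0 (2 * Real.pi)) := by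
    refine Continuous.continuousOn ?_
    refine Continuous.mul (by fun_prop) (continuous_iff_continuousAt.2 fun θ => ?_)
    exact ContinuousAt.comp (g := csqrt)
      (f := fun θ : ℝ => (1 - (j + 1 : ℝ) * Complex.exp (-θ * I) / R : ℂ))
      (contDiffAt_csqrt (hsl θ)).continuousAt (by fun_prop)
  have hcf : ContinuousOn (fun θ : ℝ => rootFactor j (rootTop R θ)) (Icc 0 (2 * Real.pi)) := by
    intro θ hθ
    refine ContinuousAt.continuousWithinAt ?_
    have hr := (contDiff_rootTop hR2).continuous.continuousAt (x := θ)
    have hi := rootTop_im_nonneg hR2 hθ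
    exact (continuousAt_const.mul ((continuousAt_halfRoot _ hi).comp hr)).mul
      ((continuousAt_halfRoot _ hi).comp hr)
  refine isPreconnected_Icc.eq_of_sq_eq hcf hcs ?_ ?_ (y := 0) ⟨le_rfl, by positivity⟩ ?_ hθ
  · intro θ hθ
    simp only [Pi.pow_apply]
    rw [rootFactor_sq, rootTop_sq hR2, mul_pow, mul_pow, csqrt_sq, ← ofReal_pow,
      Real.sq_sqrt (by linarith), ← Complex.exp_nat_mul,
      show ((2 : ℕ) : ℂ) * (θ / 2 * I) = θ * I by push_cast; ring]
    have : Complex.exp (θ * I) * Complex.exp (-θ * I) = 1 := by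
      rw [← Complex.exp_add]; simp
    field_simp
    push_cast
    simp only [neg_mul] at this ⊢
    linear_combination (j + 1 : ℂ) * this
  · intro θ _
    have h2 : ((√R : ℝ) : ℂ) ≠ 0 := by
      have : 0 < √R := Real.sqrt_pos.2 (by linarith)
      exact_mod_cast this.ne'
    exact mul_ne_zero (mul_ne_zero h2 (Complex.exp_ne_zero _))
      (csqrt_ne_zero (slitPlane_ne_zero (hsl θ)))
  · simp only [rootTop_zero hR2]
    rw [rootFactor_ofReal_of_le (Real.sqrt_le_sqrt (by linarith)), Real.sq_sqrt (by linarith)]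
    simp only [ofReal_zero, zero_div, zero_mul, Complex.exp_zero, mul_one, neg_zero]
    rw [show (1 - ((j + 1 : ℝ) : ℂ) / R : ℂ) = ((1 - (j + 1) / R : ℝ) : ℂ) by push_cast; ring,
      csqrt_ofReal, ← ofReal_mul, ← Real.sqrt_mul (by linarith)]
    · congr 2
      have : R ≠ 0 := by linarith
      field_simp; ring
    · rw [sub_nonneg, div_le_one (by linarith)]; linarith

theorem hyper_rootTop (g : ℕ) {θ : ℝ} (hθ : θ ∈ Icc 0 (2 * Real.pi)) :
    hyper g (rootTop (2 * g + 2) θ) = (genusSurface g).loop (θ / (4 * Real.pi)) := by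
  have hg : (0 : ℝ) ≤ g := Nat.cast_nonneg g
  have hR : (2 : ℝ) ≤ 2 * g + 2 := by linarith
  have hpi : (Real.pi : ℂ) ≠ 0 := by exact_mod_cast Real.pi_ne_zero
  have e1 : (4 * Real.pi * I * ((θ / (4 * Real.pi) : ℝ) : ℂ) : ℂ) = θ * I := by
    push_cast; field_simp
  have e2 : (2 * Real.pi * I * ((2 * g + 1 : ℕ) : ℂ) * ((θ / (4 * Real.pi) : ℝ) : ℂ) : ℂ) =
      ((2 * g + 1 : ℕ) : ℂ) * (θ / 2 * I) := by
    push_cast; field_simp; ring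
  simp only [genusSurface, hyper]
  rw [rootTop_sq hR]
  rw [e1, e2]
  refine Prod.ext ?_ ?_
  · push_cast; ring
  · simp only
    have h1 : rootTop (2 * g + 2) θ * ∏ j ∈ Finset.Icc 1 (2 * g), rootFactor j (rootTop (2 * g + 2) θ) =
        ∏ k ∈ Finset.Icc 1 (2 * g + 1), (((√(2 * g + 2) : ℝ) : ℂ) * Complex.exp (θ / 2 * I) *
          csqrt (1 - (k : ℂ) / ((2 * (g : ℂ) + 2) * Complex.exp (θ * I)))) := by
      have hR0 : (2 * (g : ℂ) + 2) ≠ 0 := by exact_mod_cast (by positivity : (2 * (g : ℝ) + 2) ≠ 0)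
      have hk : ∀ k : ℂ, (1 - k / ((2 * (g : ℂ) + 2) * Complex.exp (θ * I))) =
          1 - k * Complex.exp (-θ * I) / (((2 * g + 2 : ℝ)) : ℂ) := by
        intro k
        rw [neg_mul, Complex.exp_neg]; push_cast
        field_simp
      -- The factor `w` plays the role of the root factor with `j = 0`.
      have h : ∀ m : ℕ, m ≤ 2 * g → rootTop (2 * g + 2) θ *
          ∏ j ∈ Finset.Icc 1 m, rootFactor j (rootTop (2 * g + 2) θ) =
          ∏ k ∈ Finset.Icc 1 (m + 1), (((√(2 * g + 2) : ℝ) : ℂ) * Complex.exp (θ / 2 * I) *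
          csqrt (1 - (k : ℂ) / ((2 * (g : ℂ) + 2) * Complex.exp (θ * I)))) := by
        intro m hm
        induction m with
        | zero => simp [rootTop, hk]
        | succ m ih =>
          rw [Finset.prod_Icc_succ_top (by omega), ← mul_assoc, ih (by omega),
            Finset.prod_Icc_succ_top (b := m + 1) (by omega), rootFactor_rootTop _ hθ, hk]
          · push_cast; rfl
          · have : ((m + 1 : ℕ) : ℝ) ≤ ((2 * g : ℕ) : ℝ) := by exact_mod_cast hm
            push_cast at this ⊢; linarith
      exact h _ le_rfl
    rw [h1, Finset.prod_mul_distrib, Finset.prod_mul_distrib, Finset.prod_const, Finset.prod_const,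
      ← Complex.exp_nat_mul]
    simp only [Nat.card_Icc, Nat.add_sub_cancel]
    congr 2
    rw [← ofReal_pow]
    congr 1
    rw [Real.sqrt_eq_rpow, Real.sqrt_eq_rpow, ← Real.rpow_natCast, ← Real.rpow_natCast,
      ← Real.rpow_mul (by positivity), ← Real.rpow_mul (by positivity),
      mul_comm ((2 * g + 1 : ℕ) : ℝ)]

/-- Half of the boundary loop runs once around the circle `|x| = 2 g + 2`, and an odd number of
branch points inside it exchanges the sheets. -/
theorem genusSurface_loop_add_half (g : ℕ) (t : ℝ) :
    (genusSurface g).loop (t + 1 / 2) = flip ((genusSurface g).loop t) := by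
  have e1 : Complex.exp (4 * Real.pi * I * ((t + 1 / 2 : ℝ) : ℂ)) =
      Complex.exp (4 * Real.pi * I * t) := by
    rw [show (4 * Real.pi * I * ((t + 1 / 2 : ℝ) : ℂ) : ℂ) = 4 * Real.pi * I * t + 2 * Real.pi * I by
      push_cast; ring, Complex.exp_add, Complex.exp_two_pi_mul_I, mul_one]
  have e2 : Complex.exp (2 * Real.pi * I * ((2 * g + 1 : ℕ) : ℂ) * ((t + 1 / 2 : ℝ) : ℂ)) =
      -Complex.exp (2 * Real.pi * I * ((2 * g + 1 : ℕ) : ℂ) * t) := by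
    rw [show (2 * Real.pi * I * ((2 * g + 1 : ℕ) : ℂ) * ((t + 1 / 2 : ℝ) : ℂ) : ℂ) =
      2 * Real.pi * I * ((2 * g + 1 : ℕ) : ℂ) * t + (Real.pi * I + (g : ℕ) * (2 * Real.pi * I)) by
      push_cast; ring, Complex.exp_add, Complex.exp_add, Complex.exp_pi_mul_I,
      Complex.exp_nat_mul_two_pi_mul_I]
    ring
  simp only [genusSurface, flip, e1, e2]
  refine Prod.ext rfl ?_
  simp only; ring

/-- The square of the left side is convex in `v ^ 2`, hence attains its maximum at `v = 0` or `v =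
1`. -/
theorem norm_one_add_sq_le {R : ℝ} (hR : 2 ≤ R) {θ : ℝ} (hθ : θ ∈ Icc 0 (2 * Real.pi)) {v : ℝ}
    (hv0 : 0 ≤ v) (hv : v ≤ 1) :
    ‖(1 + ((rootTop R θ).re + v * (rootTop R θ).im * I) ^ 2 : ℂ)‖ ≤ R := by
  set a := (rootTop R θ).re with ha
  set b := (rootTop R θ).im with hb
  have h1 := rootTop_re_sq_le hR hθ
  have htop : (1 + 2 * (a ^ 2 - b ^ 2) + (a ^ 2 + b ^ 2) ^ 2) = R ^ 2 := by
    have hsq := rootTop_sq hR θ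
    have hre := congrArg Complex.re hsq
    have him := congrArg Complex.im hsq
    simp [pow_two, Complex.exp_ofReal_mul_I_re, Complex.exp_ofReal_mul_I_im, ← ha, ← hb] at hre him
    have e := Real.sin_sq_add_cos_sq θ
    have e2 : (a * a - b * b + 1) ^ 2 + (a * b + b * a) ^ 2 =
        R ^ 2 * (Real.sin θ ^ 2 + Real.cos θ ^ 2) := by rw [hre, him]; ring
    rw [e] at e2
    nlinarith
  have hn : ‖(1 + (a + v * b * I) ^ 2 : ℂ)‖ ^ 2 =
      1 + 2 * (a ^ 2 - v ^ 2 * b ^ 2) + (a ^ 2 + v ^ 2 * b ^ 2) ^ 2 := by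
    rw [← Complex.normSq_eq_norm_sq, Complex.normSq_apply]
    simp [pow_two]; ring
  refine abs_le_of_sq_le_sq' ?_ (by linarith) |>.2
  rw [hn, ← htop]
  have h0 : (1 + a ^ 2) ^ 2 ≤ R ^ 2 := by
    apply pow_le_pow_left₀ (by positivity); linarith [ha ▸ h1]
  have hv2 : v ^ 2 ≤ 1 := by nlinarith
  have hv2' : 0 ≤ v ^ 2 := sq_nonneg v
  nlinarith [mul_nonneg hv2' (sub_nonneg.2 hv2), mul_nonneg (mul_nonneg hv2' (sub_nonneg.2 hv2)) (sq_nonneg (b ^ 2)),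
    mul_nonneg (sub_nonneg.2 hv2) (sub_nonneg.2 h0)]

end Hyper
end HamGeometry

namespace HamGeometry

open Filter Asymptotics Complex

/-! ### Reparametrising the half plane -/

section Strip

/-- The point of the closed upper half plane at relative height `V (im z)` above the real axis,
on the vertical segment below the point `rootTop R (Θ (re z))`. -/
noncomputable def stripPoint (R : ℝ) (Θ V : ℝ → ℝ) (z : ℂ) : ℂ :=
  (rootTop R (Θ z.re)).re + V z.im * (rootTop R (Θ z.re)).im * I

/-- The conditions on a pair of reparametrisations `Θ`, `V` that make `hyper g ∘ stripPoint` smooth,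
sense preserving and injective where it is an immersion. The flatness conditions concern the points
that are mapped to the branch points. -/
structure IsStripParam (g : ℕ) (Θ V : ℝ → ℝ) : Prop where
  contDiff_fst : ContDiff ℝ ∞ Θ
  contDiff_snd : ContDiff ℝ ∞ V
  mem_fst : ∀ s, Θ s ∈ Icc 0 (2 * Real.pi)
  mem_snd : ∀ t, V t ∈ Icc (0 : ℝ) 1
  monotone : Monotone Θ
  antitone : Antitone V
  flat_fst : ∀ s, ∀ j ∈ Finset.Icc 1 (2 * g), (rootTop (2 * g + 2) (Θ s)).re ^ 2 = j → FlatAt Θ s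
  flat_snd : ∀ t, V t = 0 → FlatAt V t

variable {g : ℕ} {Θ V : ℝ → ℝ}

theorem two_le_two_mul_add_two (g : ℕ) : (2 : ℝ) ≤ 2 * g + 2 := by
  have : (0 : ℝ) ≤ g := Nat.cast_nonneg g
  linarith

theorem hasFDerivAt_ofReal_comp_re {f : ℝ → ℝ} {f' : ℝ} {z : ℂ} (hf : HasDerivAt f f' z.re) :
    HasFDerivAt (fun z : ℂ => ((f z.re : ℝ) : ℂ)) (reCLM.smulRight (f' : ℂ)) z := by
  have h1 : HasFDerivAt (fun s : ℝ => ((f s : ℝ) : ℂ)) _ (reCLM z) := hf.ofReal_comp.hasFDerivAt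
  exact h1.comp z reCLM.hasFDerivAt

theorem hasFDerivAt_ofReal_comp_im {f : ℝ → ℝ} {f' : ℝ} {z : ℂ} (hf : HasDerivAt f f' z.im) :
    HasFDerivAt (fun z : ℂ => ((f z.im : ℝ) : ℂ)) (imCLM.smulRight (f' : ℂ)) z := by
  have h1 : HasFDerivAt (fun s : ℝ => ((f s : ℝ) : ℂ)) _ (imCLM z) := hf.ofReal_comp.hasFDerivAt
  exact h1.comp z imCLM.hasFDerivAt

theorem hasFDerivAt_stripPoint {R : ℝ} (hR : 2 ≤ R) (hΘ : ContDiff ℝ ∞ Θ) (hV : ContDiff ℝ ∞ V)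
    (z : ℂ) : ∃ a b : ℂ, a.re = deriv (fun θ => (rootTop R θ).re) (Θ z.re) ∧
      b = (rootTop R (Θ z.re)).im * I ∧
      HasFDerivAt (stripPoint R Θ V)
        ((reCLM.smulRight (a * deriv Θ z.re)) + imCLM.smulRight (b * deriv V z.im)) z := by
  have hd1 : HasDerivAt Θ (deriv Θ z.re) z.re :=
    (hΘ.differentiable (by simp)).differentiableAt.hasDerivAt
  have hd2 : HasDerivAt V (deriv V z.im) z.im :=
    (hV.differentiable (by simp)).differentiableAt.hasDerivAt
  have hα := hasFDerivAt_ofReal_comp_re ((hasDerivAt_rootTop_re hR (Θ z.re)).comp z.re hd1)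
  have hβ := hasFDerivAt_ofReal_comp_re ((hasDerivAt_rootTop_im hR (Θ z.re)).comp z.re hd1)
  have hVd := hasFDerivAt_ofReal_comp_im hd2
  have h := hα.add ((hVd.mul hβ).mul_const I)
  refine ⟨deriv (fun θ => (rootTop R θ).re) (Θ z.re) +
    V z.im * ((I / 2 * (rootTop R (Θ z.re) + (rootTop R (Θ z.re))⁻¹)).im : ℝ) * I,
    (rootTop R (Θ z.re)).im * I, by simp, rfl, ?_⟩
  convert! h using 1
  ext <;> simp [(hasDerivAt_rootTop_re hR (Θ z.re)).deriv, Complex.ext_iff]; ring_nf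

theorem contDiff_stripPoint {R : ℝ} (hR : 2 ≤ R) (hΘ : ContDiff ℝ ∞ Θ) (hV : ContDiff ℝ ∞ V) :
    ContDiff ℝ ∞ (stripPoint R Θ V) := by
  have h1 : ContDiff ℝ ∞ (fun z : ℂ => rootTop R (Θ z.re)) :=
    (contDiff_rootTop hR).comp (hΘ.comp reCLM.contDiff)
  have h2 : ContDiff ℝ ∞ (fun z : ℂ => ((V z.im : ℝ) : ℂ)) :=
    ofRealCLM.contDiff.comp (hV.comp imCLM.contDiff)
  have h3 : ContDiff ℝ ∞ (fun z : ℂ => (((rootTop R (Θ z.re)).re : ℝ) : ℂ)) :=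
    ofRealCLM.contDiff.comp (reCLM.contDiff.comp h1)
  have h4 : ContDiff ℝ ∞ (fun z : ℂ => (((rootTop R (Θ z.re)).im : ℝ) : ℂ)) :=
    ofRealCLM.contDiff.comp (imCLM.contDiff.comp h1)
  exact h3.add ((h2.mul h4).mul contDiff_const)

theorem stripPoint_re (R : ℝ) (z : ℂ) : (stripPoint R Θ V z).re = (rootTop R (Θ z.re)).re := by
  simp [stripPoint]

theorem stripPoint_im (R : ℝ) (z : ℂ) :
    (stripPoint R Θ V z).im = V z.im * (rootTop R (Θ z.re)).im := by
  simp [stripPoint]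

theorem IsStripParam.stripPoint_im_nonneg (h : IsStripParam g Θ V) (z : ℂ) :
    0 ≤ (stripPoint (2 * g + 2) Θ V z).im := by
  rw [stripPoint_im]
  exact mul_nonneg (h.mem_snd _).1 (rootTop_im_nonneg (two_le_two_mul_add_two g) (h.mem_fst _))

/-- At a point that is mapped to a branch point, both parameters are flat. -/
theorem IsStripParam.of_stripPoint_eq (h : IsStripParam g Θ V) {j : ℕ}
    (hj : j ∈ Finset.Icc 1 (2 * g)) {r : ℝ} (hr : r ^ 2 = j) {z₀ : ℂ}
    (hz : stripPoint (2 * g + 2) Θ V z₀ = r) :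
    Θ z₀.re ∈ Ioo 0 (2 * Real.pi) ∧ V z₀.im = 0 ∧ FlatAt Θ z₀.re ∧ FlatAt V z₀.im := by
  have hR := two_le_two_mul_add_two g
  have hre : (rootTop (2 * g + 2) (Θ z₀.re)).re = r := by
    rw [← stripPoint_re (V := V), hz, ofReal_re]
  have him : V z₀.im * (rootTop (2 * g + 2) (Θ z₀.re)).im = 0 := by
    rw [← stripPoint_im, hz, ofReal_im]
  have hjg : (j : ℝ) < 2 * g + 1 := by
    have : (j : ℝ) ≤ ((2 * g : ℕ) : ℝ) := by exact_mod_cast (Finset.mem_Icc.1 hj).2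
    push_cast at this; linarith
  have hg1 : 0 ≤ (2 * g + 2 - 1 : ℝ) := by linarith
  have hmem : Θ z₀.re ∈ Ioo 0 (2 * Real.pi) := by
    have hm := h.mem_fst z₀.re
    refine ⟨lt_of_le_of_ne hm.1 fun h0 => ?_, lt_of_le_of_ne hm.2 fun h0 => ?_⟩
    · rw [← h0, rootTop_zero hR, ofReal_re] at hre
      rw [← hre, Real.sq_sqrt hg1] at hr; linarith
    · rw [h0, rootTop_two_pi hR, neg_re, ofReal_re] at hre
      rw [← hre, neg_sq, Real.sq_sqrt hg1] at hr; linarith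
  have hβ := rootTop_im_pos hR hmem
  have hV0 : V z₀.im = 0 := (mul_eq_zero.1 him).resolve_right hβ.ne'
  exact ⟨hmem, hV0, h.flat_fst _ j hj (by rw [hre, hr]), h.flat_snd _ hV0⟩

/-- Near a point that is mapped to a branch point `r`, the increments of `Θ ∘ re` and `V ∘ im` and
the distance to `r` bound each other. -/
theorem IsStripParam.isBigO_of_stripPoint_eq (h : IsStripParam g Θ V) {j : ℕ}
    (hj : j ∈ Finset.Icc 1 (2 * g)) {r : ℝ} (hr : r ^ 2 = j) {z₀ : ℂ}
    (hz : stripPoint (2 * g + 2) Θ V z₀ = r) :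
    (fun z : ℂ => Θ z.re - Θ z₀.re) =O[𝓝 z₀] (fun z => stripPoint (2 * g + 2) Θ V z - r) ∧
    (fun z : ℂ => V z.im - V z₀.im) =O[𝓝 z₀] (fun z => stripPoint (2 * g + 2) Θ V z - r) ∧
    (fun z => stripPoint (2 * g + 2) Θ V z - r) =O[𝓝 z₀] fun z => ‖z - z₀‖ ^ 8 := by
  have hR := two_le_two_mul_add_two g
  obtain ⟨hmem, hV0, hf1, hf2⟩ := h.of_stripPoint_eq hj hr hz
  have hre : (rootTop (2 * g + 2) (Θ z₀.re)).re = r := by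
    rw [← stripPoint_re (V := V), hz, ofReal_re]
  have htre : Tendsto (fun z : ℂ => z.re) (𝓝 z₀) (𝓝 z₀.re) := continuous_re.tendsto z₀
  have htim : Tendsto (fun z : ℂ => z.im) (𝓝 z₀) (𝓝 z₀.im) := continuous_im.tendsto z₀
  have htΘ : Tendsto (fun z : ℂ => Θ z.re) (𝓝 z₀) (𝓝 (Θ z₀.re)) :=
    (h.contDiff_fst.continuous.tendsto _).comp htre
  have hβ := rootTop_im_pos hR hmem
  have hβc : Continuous fun z : ℂ => (rootTop (2 * g + 2) (Θ z.re)).im :=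
    continuous_im.comp ((contDiff_rootTop hR).continuous.comp
      (h.contDiff_fst.continuous.comp continuous_re))
  have hcomp : ∀ z, |(rootTop (2 * g + 2) (Θ z.re)).re - r| ≤
      ‖stripPoint (2 * g + 2) Θ V z - r‖ := by
    intro z
    have := abs_re_le_norm (stripPoint (2 * g + 2) Θ V z - r)
    rwa [sub_re, stripPoint_re, ofReal_re] at this
  have hcomp2 : ∀ z, |V z.im * (rootTop (2 * g + 2) (Θ z.re)).im| ≤
      ‖stripPoint (2 * g + 2) Θ V z - r‖ := by
    intro z
    have := abs_im_le_norm (stripPoint (2 * g + 2) Θ V z - r)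
    rwa [sub_im, stripPoint_im, ofReal_im, sub_zero] at this
  have hΘα : (fun z : ℂ => Θ z.re - Θ z₀.re) =Θ[𝓝 z₀]
      fun z : ℂ => (rootTop (2 * g + 2) (Θ z.re)).re - r := by
    have hd := hasDerivAt_rootTop_re hR (Θ z₀.re)
    have hne := (deriv_rootTop_re_neg hR hmem).ne
    have hinj : Topology.IsInducing (ContinuousLinearMap.toSpanSingleton ℝ
        (-((rootTop (2 * g + 2) (Θ z₀.re)).im / 2 *
          (1 - (normSq (rootTop (2 * g + 2) (Θ z₀.re)))⁻¹)))) := by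
      refine (LinearMap.isClosedEmbedding_of_injective (𝕜 := ℝ) (f := (ContinuousLinearMap.toSpanSingleton ℝ _ : ℝ →L[ℝ] ℝ).toLinearMap) ?_).isInducing
      rw [LinearMap.ker_eq_bot]
      intro x y hxy
      have hxy' : x * _ = y * _ := hxy
      exact mul_right_cancel₀ hne hxy'
    have := (hd.hasFDerivAt.isTheta_sub hinj).symm
    have h2 : (_ ∘ fun z : ℂ => Θ z.re) =Θ[𝓝 z₀] (_ ∘ fun z : ℂ => Θ z.re) :=
      ⟨this.1.comp_tendsto htΘ, this.2.comp_tendsto htΘ⟩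
    simpa only [Function.comp_def, hre] using h2
  refine ⟨hΘα.1.trans (IsBigO.of_bound 1 (Eventually.of_forall fun z => ?_)),
    IsBigO.of_bound (2 / (rootTop (2 * g + 2) (Θ z₀.re)).im) ?_, ?_⟩
  · rw [one_mul]; exact hcomp z
  · have hev : ∀ᶠ z in 𝓝 z₀, (rootTop (2 * g + 2) (Θ z₀.re)).im / 2 <
        (rootTop (2 * g + 2) (Θ z.re)).im :=
      (hβc.tendsto z₀).eventually_const_lt (by linarith)
    filter_upwards [hev] with z hz'
    have h2 := hcomp2 z
    rw [abs_mul] at h2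
    have h3 : (rootTop (2 * g + 2) (Θ z₀.re)).im / 2 < |(rootTop (2 * g + 2) (Θ z.re)).im| :=
      hz'.trans_le (le_abs_self _)
    rw [hV0, sub_zero, Real.norm_eq_abs, div_mul_eq_mul_div, le_div_iff₀ hβ]
    nlinarith [abs_nonneg (V z.im)]
  · have e1 : (fun z : ℂ => (((rootTop (2 * g + 2) (Θ z.re)).re - r : ℝ) : ℂ)) =O[𝓝 z₀]
        fun z => ‖z - z₀‖ ^ 8 := by
      have h8 : (fun z : ℂ => Θ z.re - Θ z₀.re) =O[𝓝 z₀] fun z => ‖z - z₀‖ ^ 8 := by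
        refine (hf1.2.comp_tendsto htre).trans (IsBigO.of_bound 1
          (Eventually.of_forall fun z => ?_))
        have := abs_re_le_norm (z - z₀)
        rw [sub_re] at this
        simp only [Function.comp, one_mul, norm_pow, Real.norm_eq_abs, abs_abs, abs_norm]
        exact pow_le_pow_left₀ (abs_nonneg _) this 8
      have := hΘα.2.trans h8
      exact (IsBigO.of_bound 1 (Eventually.of_forall fun z => by
        rw [one_mul, norm_real])).trans this
    have e2 : (fun z : ℂ => ((V z.im : ℝ) : ℂ)) =O[𝓝 z₀] fun z => ‖z - z₀‖ ^ 8 := by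
      have h8 : (fun z : ℂ => V z.im - V z₀.im) =O[𝓝 z₀] fun z => ‖z - z₀‖ ^ 8 := by
        refine (hf2.2.comp_tendsto htim).trans (IsBigO.of_bound 1
          (Eventually.of_forall fun z => ?_))
        have := abs_im_le_norm (z - z₀)
        rw [sub_im] at this
        simp only [Function.comp, one_mul, norm_pow, Real.norm_eq_abs, abs_abs, abs_norm]
        exact pow_le_pow_left₀ (abs_nonneg _) this 8
      refine (IsBigO.of_bound 1 (Eventually.of_forall fun z => ?_)).trans h8
      simp [hV0]
    have e3 : (fun z : ℂ => (((rootTop (2 * g + 2) (Θ z.re)).im : ℝ) : ℂ) * I) =O[𝓝 z₀]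
        fun _ => (1 : ℝ) :=
      ((continuous_ofReal.comp hβc).mul continuous_const).continuousAt.isBigO_one ℝ
    refine (e1.add ((e2.mul e3).congr_right fun z => mul_one _)).congr_left fun z => ?_
    simp only [stripPoint]; push_cast; ring

/-- Although `halfRoot r` is not smooth at the branch point `r`, its composition with `stripPoint`
is: both parameters are flat where `r` is hit, which is the hypothesis of `contDiff_sqrt`. -/
theorem IsStripParam.contDiff_halfRoot (h : IsStripParam g Θ V) {j : ℕ}
    (hj : j ∈ Finset.Icc 1 (2 * g)) {r : ℝ} (hr : r ^ 2 = j) :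
    ContDiff ℝ ∞ (fun z => halfRoot r (stripPoint (2 * g + 2) Θ V z)) := by
  have hR := two_le_two_mul_add_two g
  have hw := contDiff_stripPoint hR h.contDiff_fst h.contDiff_snd
  set W : ℂ → ℂ := fun z => -I * (stripPoint (2 * g + 2) Θ V z - r) with hWdef
  have hW : ContDiff ℝ ∞ W := contDiff_const.mul (hw.sub contDiff_const)
  have hW0 : ∀ z, W z = 0 → stripPoint (2 * g + 2) Θ V z = r := by
    intro z hz
    have := (mul_eq_zero.1 hz).resolve_left (by simp)
    exact sub_eq_zero.1 this
  have hWn : ∀ z, ‖stripPoint (2 * g + 2) Θ V z - r‖ = ‖W z‖ := fun z => by simp [hWdef]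
  -- The derivatives of the parameters are flat functions of the distance `‖W‖` to the branch point.
  have hF1 : FlatOrder W 1 (fun z : ℂ => ((deriv Θ (reCLM z) : ℝ) : ℂ)) := by
    refine FlatAt.flatOrder reCLM h.contDiff_fst fun z₀ hz => ⟨?_, ?_⟩
    · exact (h.of_stripPoint_eq hj hr (hW0 z₀ hz)).2.2.1
    · exact (h.isBigO_of_stripPoint_eq hj hr (hW0 z₀ hz)).1.trans
        (IsBigO.of_bound 1 (Eventually.of_forall fun z => by rw [hWn, one_mul]))
  have hF2 : FlatOrder W 1 (fun z : ℂ => ((deriv V (imCLM z) : ℝ) : ℂ)) := by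
    refine FlatAt.flatOrder imCLM h.contDiff_snd fun z₀ hz => ⟨?_, ?_⟩
    · exact (h.of_stripPoint_eq hj hr (hW0 z₀ hz)).2.2.2
    · exact (h.isBigO_of_stripPoint_eq hj hr (hW0 z₀ hz)).2.1.trans
        (IsBigO.of_bound 1 (Eventually.of_forall fun z => by rw [hWn, one_mul]))
  refine contDiff_sqrt hW (fun v => ?_) (fun z₀ hz => ?_) (fun z => halfRoot_sq _ _) fun z hz => ?_
  · -- `dW` is a combination of `Θ'` and `V'` with smooth coefficients
    have hr1 : ContDiff ℝ ∞ (fun z : ℂ => rootTop (2 * g + 2) (Θ z.re)) :=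
      (contDiff_rootTop hR).comp (h.contDiff_fst.comp reCLM.contDiff)
    have hinv : ContDiff ℝ ∞ (fun z : ℂ => (rootTop (2 * g + 2) (Θ z.re) +
        (rootTop (2 * g + 2) (Θ z.re))⁻¹)) :=
      hr1.add (hr1.inv fun z => rootTop_ne_zero hR _)
    have hI2 : ContDiff ℝ ∞ (fun z : ℂ => I / 2 * (rootTop (2 * g + 2) (Θ z.re) +
        (rootTop (2 * g + 2) (Θ z.re))⁻¹)) := contDiff_const.mul hinv
    have hVs : ContDiff ℝ ∞ (fun z : ℂ => ((V z.im : ℝ) : ℂ)) :=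
      ofRealCLM.contDiff.comp (h.contDiff_snd.comp imCLM.contDiff)
    have hc1 : ContDiff ℝ ∞ (fun z : ℂ => -I * (((((I / 2 * (rootTop (2 * g + 2) (Θ z.re) +
        (rootTop (2 * g + 2) (Θ z.re))⁻¹)).re : ℝ) : ℂ) + V z.im *
          (((I / 2 * (rootTop (2 * g + 2) (Θ z.re) +
        (rootTop (2 * g + 2) (Θ z.re))⁻¹)).im : ℝ) : ℂ) * I) * v.re)) :=
      contDiff_const.mul (((ofRealCLM.contDiff.comp (reCLM.contDiff.comp hI2)).add
        ((hVs.mul (ofRealCLM.contDiff.comp (imCLM.contDiff.comp hI2))).mul contDiff_const)).mul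
          contDiff_const)
    have hc2 : ContDiff ℝ ∞ (fun z : ℂ => -I * ((((rootTop (2 * g + 2) (Θ z.re)).im : ℝ) : ℂ) * I *
        v.im)) :=
      contDiff_const.mul (((ofRealCLM.contDiff.comp (imCLM.contDiff.comp hr1)).mul
        contDiff_const).mul contDiff_const)
    have hsum := ((FlatOrder.of_contDiff (W := W) hc1).mul hF1).add
      ((FlatOrder.of_contDiff (W := W) hc2).mul hF2)
    rw [zero_add] at hsum
    convert! hsum using 1
    funext z
    have hd1 : HasDerivAt Θ (deriv Θ z.re) z.re :=
      (h.contDiff_fst.differentiable (by simp)).differentiableAt.hasDerivAt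
    have hd2 : HasDerivAt V (deriv V z.im) z.im :=
      (h.contDiff_snd.differentiable (by simp)).differentiableAt.hasDerivAt
    have hα := hasFDerivAt_ofReal_comp_re
      (((reCLM.hasFDerivAt (x := rootTop (2 * g + 2) (Θ z.re))).comp_hasDerivAt _
      (hasDerivAt_rootTop hR (Θ z.re))).comp z.re hd1)
    have hβ := hasFDerivAt_ofReal_comp_re ((hasDerivAt_rootTop_im hR (Θ z.re)).comp z.re hd1)
    have hVd := hasFDerivAt_ofReal_comp_im hd2
    have hh := ((hα.add ((hVd.mul hβ).mul_const I)).sub_const (r : ℂ)).const_mul (-I)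
    have hWf : HasFDerivAt W _ z := hh
    rw [hWf.fderiv]
    simp
    ring
  · have := (h.isBigO_of_stripPoint_eq hj hr (hW0 z₀ hz)).2.2
    exact (IsBigO.of_bound 1 (Eventually.of_forall fun z => by rw [hWn, one_mul])).trans this
  · have hsl : W z ∈ slitPlane := by
      rw [mem_slitPlane_iff]
      have hre : 0 ≤ (W z).re := by
        have := h.stripPoint_im_nonneg z
        simpa [hWdef] using this
      rcases hre.lt_or_eq with h1 | h1
      · exact Or.inl h1
      · exact Or.inr fun h2 => hz (Complex.ext h1.symm h2)
    have : DifferentiableAt ℝ (csqrt ∘ W) z :=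
      ((contDiffAt_csqrt hsl).differentiableAt (by simp)).comp z
        (hW.differentiable (by simp)).differentiableAt
    exact this

theorem IsStripParam.contDiff_rootFactor (h : IsStripParam g Θ V) {j : ℕ}
    (hj : j ∈ Finset.Icc 1 (2 * g)) :
    ContDiff ℝ ∞ (fun z => rootFactor j (stripPoint (2 * g + 2) Θ V z)) := by
  have hs : √(j : ℝ) ^ 2 = j := Real.sq_sqrt (Nat.cast_nonneg j)
  exact (contDiff_const.mul (h.contDiff_halfRoot hj hs)).mul
    (h.contDiff_halfRoot hj (by rw [neg_sq, hs]))

theorem IsStripParam.contDiff_hyper (h : IsStripParam g Θ V) :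
    ContDiff ℝ ∞ (fun z => hyper g (stripPoint (2 * g + 2) Θ V z)) := by
  have hw := contDiff_stripPoint (two_le_two_mul_add_two g) h.contDiff_fst h.contDiff_snd
  exact (contDiff_const.add (hw.pow 2)).prodMk
    (hw.mul (contDiff_prod fun j hj => h.contDiff_rootFactor hj))

end Strip
end HamGeometry

namespace HamGeometry

open Filter Asymptotics Complex

/-! ### The differential of the reparametrised curve -/

section StripDeriv

variable {g : ℕ} {Θ V : ℝ → ℝ}

/-- The functions whose differential is a complex multiple of a fixed real linear map `D` are closed
under products. In this sense the composition with `stripPoint` remains holomorphic. -/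
theorem exists_hasFDerivAt_smul_mul {f₁ f₂ : ℂ → ℂ} {D : ℂ →L[ℝ] ℂ} {z : ℂ}
    (h₁ : ∃ c : ℂ, HasFDerivAt f₁ (c • D) z) (h₂ : ∃ c : ℂ, HasFDerivAt f₂ (c • D) z) :
    ∃ c : ℂ, HasFDerivAt (fun z => f₁ z * f₂ z) (c • D) z := by
  obtain ⟨c₁, h₁⟩ := h₁
  obtain ⟨c₂, h₂⟩ := h₂
  refine ⟨f₁ z * c₂ + f₂ z * c₁, ?_⟩
  convert! h₁.mul h₂ using 1
  ext1 e
  simp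
  ring

theorem exists_hasFDerivAt_smul_prod {ι : Type*} [DecidableEq ι] {s : Finset ι} {f : ι → ℂ → ℂ}
    {D : ℂ →L[ℝ] ℂ} {z : ℂ} (h : ∀ i ∈ s, ∃ c : ℂ, HasFDerivAt (f i) (c • D) z) :
    ∃ c : ℂ, HasFDerivAt (fun z => ∏ i ∈ s, f i z) (c • D) z := by
  induction s using Finset.induction_on with
  | empty => exact ⟨0, by
      rw [show (0 : ℂ) • D = 0 by ext1 e; simp]
      simpa using hasFDerivAt_const (𝕜 := ℝ) (1 : ℂ) z⟩
  | insert i s hi ih =>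
    simp_rw [Finset.prod_insert hi]
    exact exists_hasFDerivAt_smul_mul (h i (Finset.mem_insert_self _ _))
      (ih fun j hj => h j (Finset.mem_insert_of_mem hj))

/-- Away from the branch points this is the chain rule. At a branch point the factor is the square
root of a function that vanishes to a high order, and its differential is zero. -/
theorem IsStripParam.exists_hasFDerivAt_rootFactor (h : IsStripParam g Θ V) {j : ℕ}
    (hj : j ∈ Finset.Icc 1 (2 * g)) (z : ℂ) :
    ∃ c : ℂ, HasFDerivAt (fun z => rootFactor j (stripPoint (2 * g + 2) Θ V z))
      (c • fderiv ℝ (stripPoint (2 * g + 2) Θ V) z) z := by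
  have hR := two_le_two_mul_add_two g
  set w := stripPoint (2 * g + 2) Θ V with hw
  have hwd : HasFDerivAt w (fderiv ℝ w z) z :=
    ((contDiff_stripPoint hR h.contDiff_fst h.contDiff_snd).differentiable
      (by simp)).differentiableAt.hasFDerivAt
  by_cases h0 : rootFactor j (w z) = 0
  · -- here `w z` is a branch point, to which `w` is flat
    have hs : √(j : ℝ) ^ 2 = j := Real.sq_sqrt (Nat.cast_nonneg j)
    have hsC : ((√(j : ℝ) : ℝ) : ℂ) ^ 2 = j := by exact_mod_cast congrArg ((↑) : ℝ → ℂ) hs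
    have hz2 : w z ^ 2 = ((√(j : ℝ) : ℝ) : ℂ) ^ 2 := by
      have := rootFactor_sq j (w z)
      rw [h0] at this
      rw [hsC]; linear_combination -this
    obtain ⟨r, hr, hzr⟩ : ∃ r : ℝ, r ^ 2 = j ∧ w z = r := by
      rcases sq_eq_sq_iff_eq_or_eq_neg.1 hz2 with h1 | h1
      · exact ⟨√j, hs, h1⟩
      · exact ⟨-√j, by rw [neg_sq, hs], by rw [h1]; push_cast; rfl⟩
    have hO := (h.isBigO_of_stripPoint_eq hj hr hzr).2.2
    have hO2 : (fun y => w y + r) =O[𝓝 z] fun _ => (1 : ℝ) :=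
      (hwd.continuousAt.add continuousAt_const).isBigO_one ℝ
    refine ⟨0, ?_⟩
    rw [zero_smul]
    refine IsBigO.hasFDerivAt (n := 4) ?_ (by norm_num)
    have h3 := ((hO.mul hO2).norm_left.rpow (r := 1 / 2) (by norm_num)
      (Eventually.of_forall fun y => by positivity))
    refine (IsBigO.of_bound 1 (Eventually.of_forall fun y => ?_)).trans (h3.congr_right fun y => ?_)
    · have e : (w y - r) * (w y + r) = rootFactor j (w y) ^ 2 := by
        rw [rootFactor_sq]
        have : (r : ℂ) ^ 2 = j := by exact_mod_cast congrArg ((↑) : ℝ → ℂ) hr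
        linear_combination -this
      rw [e, one_mul, norm_pow, ← Real.sqrt_eq_rpow, Real.sqrt_sq (norm_nonneg _), norm_norm]
    · rw [mul_one, ← Real.sqrt_eq_rpow, show ‖y - z‖ ^ 8 = (‖y - z‖ ^ 4) ^ 2 by ring,
        Real.sqrt_sq (by positivity)]
  · have hd : HasFDerivAt (fun z => rootFactor j (w z)) (fderiv ℝ (fun z => rootFactor j (w z)) z) z :=
      ((h.contDiff_rootFactor hj).differentiable (by simp)).differentiableAt.hasFDerivAt
    refine ⟨w z / rootFactor j (w z), ?_⟩
    convert! hd using 1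
    have h1 := hd.pow 2
    have h2 := (hwd.pow 2).sub_const (j : ℂ)
    have h3 := h1.congr_of_eventuallyEq (f₁ := fun z => w z ^ 2 - (j : ℂ))
      (Eventually.of_forall fun y => (rootFactor_sq j (w y)).symm)
    have h4 := h3.unique h2
    ext1 e
    have h5 := congrArg (fun L : ℂ →L[ℝ] ℂ => L e) h4
    simp at h5
    simp
    field_simp
    linear_combination -h5 / 2

/-- The differential of the curve over the strip is the differential of `stripPoint` times a vector
of `ℂ²`, also at the branch points, where `hyper g` is not differentiable. -/
theorem IsStripParam.exists_fderiv_hyper (h : IsStripParam g Θ V) (z : ℂ) : ∃ κ : ℂ × ℂ, ∀ e,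
    fderiv ℝ (fun z => hyper g (stripPoint (2 * g + 2) Θ V z)) z e =
      fderiv ℝ (stripPoint (2 * g + 2) Θ V) z e • κ := by
  have hR := two_le_two_mul_add_two g
  have hwd : HasFDerivAt (stripPoint (2 * g + 2) Θ V)
      (fderiv ℝ (stripPoint (2 * g + 2) Θ V) z) z :=
    ((contDiff_stripPoint hR h.contDiff_fst h.contDiff_snd).differentiable
      (by simp)).differentiableAt.hasFDerivAt
  obtain ⟨c, hc⟩ := exists_hasFDerivAt_smul_mul ⟨1, by rw [one_smul]; exact hwd⟩
    (exists_hasFDerivAt_smul_prod (s := Finset.Icc 1 (2 * g)) fun j hj =>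
      h.exists_hasFDerivAt_rootFactor hj z)
  have h1 := ((hwd.pow 2).const_add 1).prodMk hc
  refine ⟨(2 * stripPoint (2 * g + 2) Θ V z, c), fun e => ?_⟩
  have h2 : HasFDerivAt (fun z => hyper g (stripPoint (2 * g + 2) Θ V z)) _ z := h1
  rw [h2.fderiv]
  refine Prod.ext ?_ ?_ <;> simp [mul_comm]

/-- A map `h : ℂ → ℂ²` that maps tangent planes to complex lines, or degenerately, without
reversing the orientation. -/
def SensePreserving (h : ℂ → ℂ × ℂ) : Prop :=
  ∀ z e, fderiv ℝ h z e = 0 ∨ ∃ c₁ c₂ : ℝ, 0 ≤ c₂ ∧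
    fderiv ℝ h z (I * e) = c₁ • fderiv ℝ h z e + c₂ • (I • fderiv ℝ h z e)

/-- `Θ` increases and `V` decreases, so `stripPoint` does not reverse the orientation, and the curve
is complex. -/
theorem IsStripParam.sensePreserving (h : IsStripParam g Θ V) :
    SensePreserving fun z => hyper g (stripPoint (2 * g + 2) Θ V z) := by
  have hR := two_le_two_mul_add_two g
  intro z e
  obtain ⟨κ, hκ⟩ := h.exists_fderiv_hyper z
  obtain ⟨a, b, ha, hb, hd⟩ := hasFDerivAt_stripPoint hR h.contDiff_fst h.contDiff_snd z
  simp only [hκ]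
  rw [hd.fderiv]
  set u : ℂ := ((reCLM.smulRight (a * deriv Θ z.re)) + imCLM.smulRight (b * deriv V z.im)) e with hu
  set u' : ℂ := ((reCLM.smulRight (a * deriv Θ z.re)) + imCLM.smulRight (b * deriv V z.im)) (I * e)
    with hu'
  by_cases hu0 : u = 0
  · left; rw [hu0, zero_smul]
  right
  -- The Jacobian of `stripPoint` is a nonnegative multiple of `-Θ' V'`.
  have hJ : 0 ≤ ((starRingEnd ℂ) u * u').im := by
    have h1 : ((starRingEnd ℂ) u * u').im = (a.re * (rootTop (2 * g + 2) (Θ z.re)).im) *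
        deriv Θ z.re * deriv V z.im * (e.re ^ 2 + e.im ^ 2) := by
      rw [hu, hu', hb]
      simp
      ring
    rw [h1]
    have h2 : a.re * (rootTop (2 * g + 2) (Θ z.re)).im ≤ 0 := by
      rw [ha, (hasDerivAt_rootTop_re hR _).deriv]
      have h3 := rootTop_im_nonneg hR (h.mem_fst z.re)
      have h4 : (normSq (rootTop (2 * g + 2) (Θ z.re)))⁻¹ ≤ 1 :=
        inv_le_one_of_one_le₀ (one_le_normSq_rootTop hR _)
      nlinarith [mul_nonneg (mul_nonneg h3 h3) (sub_nonneg.2 h4)]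
    have h5 : 0 ≤ deriv Θ z.re := h.monotone.deriv_nonneg
    have h6 : deriv V z.im ≤ 0 := h.antitone.deriv_nonpos
    have h7 := mul_nonneg_of_nonpos_of_nonpos (mul_nonpos_of_nonpos_of_nonneg h2 h5) h6
    exact mul_nonneg h7 (by positivity)
  have hn : 0 < normSq u := normSq_pos.2 hu0
  refine ⟨((starRingEnd ℂ) u * u').re / normSq u, ((starRingEnd ℂ) u * u').im / normSq u,
    div_nonneg hJ hn.le, ?_⟩
  have hq : u' = (((starRingEnd ℂ) u * u').re / normSq u : ℝ) * u +
      (((starRingEnd ℂ) u * u').im / normSq u : ℝ) * (I * u) := by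
    have h1 : ((((starRingEnd ℂ) u * u').re : ℝ) : ℂ) + (((starRingEnd ℂ) u * u').im : ℝ) * I =
        (starRingEnd ℂ) u * u' := re_add_im _
    have h2 : (starRingEnd ℂ) u * u = normSq u := by rw [normSq_eq_conj_mul_self]
    have hn' : (normSq u : ℂ) ≠ 0 := by exact_mod_cast hn.ne'
    generalize ((starRingEnd ℂ) u * u').re = p at h1 ⊢
    generalize ((starRingEnd ℂ) u * u').im = q at h1 ⊢
    push_cast
    field_simp
    linear_combination -u * h1 - u' * h2
  rw [hq]
  simp only [add_smul, ← smul_smul, Complex.coe_smul]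
  simp only [smul_smul, hq.symm]

/-- At an immersion point both parameters have nonzero derivatives. They cannot take extremal values
there, so that the point is mapped into the open half plane. -/
theorem IsStripParam.of_injective (h : IsStripParam g Θ V) {z : ℂ}
    (hz : ∀ e, fderiv ℝ (fun z => hyper g (stripPoint (2 * g + 2) Θ V z)) z e = 0 → e = 0) :
    deriv Θ z.re ≠ 0 ∧ deriv V z.im ≠ 0 ∧ 0 < V z.im ∧ Θ z.re ∈ Ioo 0 (2 * Real.pi) := by
  have hR := two_le_two_mul_add_two g
  obtain ⟨κ, hκ⟩ := h.exists_fderiv_hyper z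
  obtain ⟨a, b, ha, hb, hd⟩ := hasFDerivAt_stripPoint hR h.contDiff_fst h.contDiff_snd z
  have hz' : ∀ e : ℂ, e.re * (a * deriv Θ z.re) + e.im * (b * deriv V z.im) = 0 → e = 0 := by
    intro e he
    refine hz e ?_
    rw [hκ, hd.fderiv]
    have : ((reCLM.smulRight (a * deriv Θ z.re)) + imCLM.smulRight (b * deriv V z.im)) e =
      e.re * (a * deriv Θ z.re) + e.im * (b * deriv V z.im) := by simp
    rw [this, he, zero_smul]
  have h1 : deriv Θ z.re ≠ 0 := fun h0 => one_ne_zero (hz' 1 (by simp [h0]))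
  have h2 : deriv V z.im ≠ 0 := fun h0 => I_ne_zero (hz' I (by simp [h0]))
  have h3 : b ≠ 0 := fun h0 => I_ne_zero (hz' I (by simp [h0]))
  refine ⟨h1, h2, lt_of_le_of_ne (h.mem_snd _).1 fun h0 => h2 ?_,
    lt_of_le_of_ne (h.mem_fst _).1 fun h0 => h1 ?_, lt_of_le_of_ne (h.mem_fst _).2 fun h0 => h1 ?_⟩
  · refine IsLocalMin.deriv_eq_zero (Eventually.of_forall fun t => ?_)
    rw [← h0]; exact (h.mem_snd t).1
  · refine IsLocalMin.deriv_eq_zero (Eventually.of_forall fun t => ?_)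
    rw [← h0]; exact (h.mem_fst t).1
  · refine IsLocalMax.deriv_eq_zero (Eventually.of_forall fun t => ?_)
    rw [h0]; exact (h.mem_fst t).2

theorem deriv_eq_zero_of_monotone {f : ℝ → ℝ} (hf : Monotone f) {a b : ℝ} (hab : a < b)
    (h : f a = f b) (ha : DifferentiableAt ℝ f a) : deriv f a = 0 := by
  have h1 : HasDerivWithinAt f (deriv f a) (Icc a b) a := ha.hasDerivAt.hasDerivWithinAt
  have h2 : HasDerivWithinAt f 0 (Icc a b) a := by
    refine (hasDerivWithinAt_const a (Icc a b) (f a)).congr (fun x hx => ?_) rfl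
    exact le_antisymm (h ▸ hf hx.2) (hf hx.1)
  exact (uniqueDiffOn_Icc hab a ⟨le_rfl, hab.le⟩).eq_deriv _ h1 h2

theorem eq_of_monotone_of_deriv_ne_zero {f : ℝ → ℝ} (hf : Monotone f) {a b : ℝ} (h : f a = f b)
    (ha : DifferentiableAt ℝ f a) (hb : DifferentiableAt ℝ f b) (ha' : deriv f a ≠ 0)
    (hb' : deriv f b ≠ 0) : a = b := by
  rcases lt_trichotomy a b with hlt | heq | hgt
  · exact absurd (deriv_eq_zero_of_monotone hf hlt h ha) ha'
  · exact heq
  · exact absurd (deriv_eq_zero_of_monotone hf hgt h.symm hb) hb'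

/-- A monotone function takes the same value at two points only if its derivative vanishes there, so
`stripPoint` is injective on its immersion points. -/
theorem IsStripParam.eq_of_stripPoint_eq (h : IsStripParam g Θ V)
    {z z' : ℂ} (hV : deriv V z.im ≠ 0) (hV' : deriv V z'.im ≠ 0)
    (hz : deriv Θ z.re ≠ 0) (hz' : deriv Θ z'.re ≠ 0) (hmem : Θ z.re ∈ Ioo 0 (2 * Real.pi))
    (he : stripPoint (2 * g + 2) Θ V z = stripPoint (2 * g + 2) Θ V z') : z = z' := by
  have hR := two_le_two_mul_add_two g
  have hre := congrArg Complex.re he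
  rw [stripPoint_re, stripPoint_re] at hre
  have hΘ : Θ z.re = Θ z'.re :=
    (strictAntiOn_rootTop_re hR).injOn (h.mem_fst _) (h.mem_fst _) hre
  have him := congrArg Complex.im he
  rw [stripPoint_im, stripPoint_im, ← hΘ] at him
  have hVe := mul_right_cancel₀ (rootTop_im_pos hR hmem).ne' him
  have hdΘ : ∀ s, DifferentiableAt ℝ Θ s := fun s =>
    (h.contDiff_fst.differentiable (by simp)).differentiableAt
  have hdV : ∀ s, DifferentiableAt ℝ V s := fun s =>
    (h.contDiff_snd.differentiable (by simp)).differentiableAt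
  refine Complex.ext ?_ ?_
  · exact eq_of_monotone_of_deriv_ne_zero h.monotone hΘ (hdΘ _) (hdΘ _) hz hz'
  · exact eq_of_monotone_of_deriv_ne_zero (f := fun t => -V t) h.antitone.neg (by rw [hVe])
      (hdV _).neg (hdV _).neg (by rw [deriv.fun_neg]; exact neg_ne_zero.2 hV)
      (by rw [deriv.fun_neg]; exact neg_ne_zero.2 hV')

end StripDeriv
end HamGeometry

namespace HamGeometry

open Filter Asymptotics Complex

/-! ### Smooth step functions -/

section Steps

/-- A smooth step from `0` to `1`, constant off the middle third of the unit interval. -/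
noncomputable def unitStep (x : ℝ) : ℝ := Real.smoothTransition (3 * x - 1)

theorem contDiff_unitStep : ContDiff ℝ ∞ unitStep :=
  Real.smoothTransition.contDiff.comp (by fun_prop)

theorem unitStep_of_le {x : ℝ} (h : x ≤ 1 / 3) : unitStep x = 0 :=
  Real.smoothTransition.zero_of_nonpos (by linarith)

theorem unitStep_of_ge {x : ℝ} (h : 2 / 3 ≤ x) : unitStep x = 1 :=
  Real.smoothTransition.one_of_one_le (by linarith)

theorem unitStep_one_sub (x : ℝ) : unitStep (1 - x) = 1 - unitStep x := by
  unfold unitStep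
  rw [← smoothTransition_one_sub]; ring_nf

theorem monotone_smoothTransition : Monotone Real.smoothTransition := by
  have h0 : Monotone expNegInvGlue := expNegInvGlue.monotone
  intro x y hxy
  have h1 := h0 hxy
  have h2 : expNegInvGlue (1 - y) ≤ expNegInvGlue (1 - x) := h0 (by linarith)
  unfold Real.smoothTransition
  rw [div_le_div_iff₀ (Real.smoothTransition.pos_denom x) (Real.smoothTransition.pos_denom y)]
  nlinarith [expNegInvGlue.nonneg x, expNegInvGlue.nonneg (1 - y)]

theorem monotone_unitStep : Monotone unitStep := fun x y h =>
  monotone_smoothTransition (by linarith)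

theorem unitStep_mem (x : ℝ) : unitStep x ∈ Icc (0 : ℝ) 1 :=
  ⟨Real.smoothTransition.nonneg _, Real.smoothTransition.le_one _⟩

/-- The smooth function that rises from `τ k` to `τ (k + 1)` on `[k, k + 1]`, for `k < m`, and is
constant near the integers, left of `0` and right of `m`. -/
noncomputable def steps (τ : ℕ → ℝ) (m : ℕ) (s : ℝ) : ℝ :=
  τ 0 + ∑ k ∈ Finset.range m, (τ (k + 1) - τ k) * unitStep (s - k)

variable {τ : ℕ → ℝ} {m : ℕ}

theorem contDiff_steps : ContDiff ℝ ∞ (steps τ m) :=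
  contDiff_const.add (ContDiff.sum fun k _ =>
    contDiff_const.mul (contDiff_unitStep.comp (by fun_prop)))

theorem monotone_steps (hτ : Monotone τ) : Monotone (steps τ m) := by
  intro x y h
  unfold steps
  gcongr with k hk
  · exact sub_nonneg.2 (hτ (Nat.le_succ k))
  · exact monotone_unitStep (by linarith)

theorem steps_of_le {s : ℝ} (hs : s ≤ 1 / 3) : steps τ m s = τ 0 := by
  unfold steps
  rw [Finset.sum_eq_zero, add_zero]
  intro k _
  rw [unitStep_of_le (by have : (0 : ℝ) ≤ k := Nat.cast_nonneg k
                         linarith), mul_zero]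

theorem steps_eq {k : ℕ} (hk : k < m) {s : ℝ} (h1 : k - 1 / 3 ≤ s) (h2 : s ≤ k + 4 / 3) :
    steps τ m s = τ k + (τ (k + 1) - τ k) * unitStep (s - k) := by
  obtain ⟨l, rfl⟩ : ∃ l, m = k + 1 + l := ⟨m - (k + 1), by omega⟩
  unfold steps
  rw [Finset.sum_range_add, Finset.sum_range_succ, Finset.sum_eq_zero (s := Finset.range l)]
  · rw [Finset.sum_congr rfl (g := fun i => τ (i + 1) - τ i), Finset.sum_range_sub]
    · ring
    · intro i hi
      have : (i : ℝ) + 1 ≤ k := by exact_mod_cast Finset.mem_range.1 hi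
      rw [unitStep_of_ge (by linarith), mul_one]
  · intro i _
    rw [unitStep_of_le (by push_cast; have : (0 : ℝ) ≤ i := Nat.cast_nonneg i
                           linarith), mul_zero]

theorem steps_of_ge {s : ℝ} (hs : m - 1 / 3 ≤ s) : steps τ m s = τ m := by
  unfold steps
  rw [Finset.sum_congr rfl (g := fun i => τ (i + 1) - τ i), Finset.sum_range_sub]
  · ring
  · intro i hi
    have : (i : ℝ) + 1 ≤ m := by exact_mod_cast Finset.mem_range.1 hi
    rw [unitStep_of_ge (by linarith), mul_one]

/-- The symmetry of the values `τ k` under reversal is inherited by the step function. -/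
theorem steps_sub {c : ℝ} (h : ∀ k ≤ m, τ (m - k) = c - τ k) (s : ℝ) :
    steps τ m (m - s) = c - steps τ m s := by
  have h0 : τ m = c - τ 0 := by simpa using h 0 (Nat.zero_le _)
  have h1 : ∑ k ∈ Finset.range m, (τ (k + 1) - τ k) * unitStep (m - s - k) =
      ∑ k ∈ Finset.range m, (τ (k + 1) - τ k) * (1 - unitStep (s - k)) := by
    rw [← Finset.sum_range_reflect]
    refine Finset.sum_congr rfl fun k hk => ?_
    have hk := Finset.mem_range.1 hk
    have e1 := h k hk.le
    have e2 := h (k + 1) hk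
    rw [show m - 1 - k + 1 = m - k by omega, show m - 1 - k = m - (k + 1) by omega, e1, e2,
      ← unitStep_one_sub, Nat.cast_sub hk]
    push_cast
    ring_nf
  unfold steps
  rw [h1]
  simp only [mul_sub, mul_one]
  rw [Finset.sum_sub_distrib, Finset.sum_range_sub]
  linarith

theorem steps_mem_Icc (hτ : Monotone τ) {k : ℕ} (hk : k < m) {s : ℝ} (h1 : k ≤ s) (h2 : s ≤ k + 1) :
    steps τ m s ∈ Icc (τ k) (τ (k + 1)) := by
  rw [steps_eq hk (by linarith) (by linarith)]
  have h := unitStep_mem (s - k)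
  have h3 := sub_nonneg.2 (hτ (Nat.le_succ k))
  constructor <;> nlinarith [h.1, h.2]

theorem steps_mem_Icc' (hτ : Monotone τ) (s : ℝ) : steps τ m s ∈ Icc (τ 0) (τ m) := by
  constructor
  · rw [← steps_of_le (τ := τ) (m := m) (s := min s 0) ((min_le_right _ _).trans (by norm_num))]
    exact monotone_steps hτ (min_le_left _ _)
  · rw [← steps_of_ge (τ := τ) (m := m) (s := max s m) (le_trans (by linarith) (le_max_right _ _))]
    exact monotone_steps hτ (le_max_left _ _)

/-- The step function is flat to each of its values at the integers. -/
theorem flatAt_steps (hτ : StrictMonoOn τ (Iic m)) (hτ' : Monotone τ) {s : ℝ}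
    (h : ∃ i, steps τ m s = τ i ∧ i ≤ m) : FlatAt (steps τ m) s := by
  obtain ⟨i, hi, him⟩ := h
  rcases lt_or_ge s (1 / 3) with h0 | h0
  · refine (FlatAt.const (τ 0) s).congr ?_
    filter_upwards [gt_mem_nhds h0] with y hy using steps_of_le hy.le
  rcases lt_or_ge (m - 1 / 3 : ℝ) s with h1 | h1
  · refine (FlatAt.const (τ m) s).congr ?_
    filter_upwards [lt_mem_nhds h1] with y hy using steps_of_ge hy.le
  set k := ⌊s⌋₊
  have hk1 : (k : ℝ) ≤ s := Nat.floor_le (by linarith)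
  have hk2 : s < k + 1 := Nat.lt_floor_add_one s
  have hkm : k < m := by
    have : (k : ℝ) < m := by linarith
    exact_mod_cast this
  have hs : steps τ m s = τ k + (τ (k + 1) - τ k) * unitStep (s - k) :=
    steps_eq hkm (by linarith) (by linarith)
  have hlt : 0 < τ (k + 1) - τ k := sub_pos.2 (hτ (mem_Iic.2 hkm.le) (mem_Iic.2 hkm) (Nat.lt_succ_self k))
  have hf : FlatAt Real.smoothTransition (3 * s + (-3 * k - 1)) := by
    refine flatAt_smoothTransition_of_notMem fun hmem => ?_
    have hu : unitStep (s - k) ∈ Ioo (0 : ℝ) 1 := by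
      unfold unitStep
      rw [show 3 * (s - k) - 1 = 3 * s + (-3 * k - 1) by ring]
      refine ⟨Real.smoothTransition.pos_of_pos hmem.1, ?_⟩
      have := Real.smoothTransition.pos_of_pos (x := 1 - (3 * s + (-3 * k - 1))) (by linarith [hmem.2])
      rw [smoothTransition_one_sub] at this
      linarith
    rcases le_or_gt i k with hik | hik
    · have := hτ' hik
      nlinarith [mul_pos hlt hu.1]
    · have := hτ' (Nat.succ_le_of_lt hik)
      simp only [Nat.succ_eq_add_one] at this
      nlinarith [mul_pos hlt (sub_pos.2 hu.2)]
  refine (FlatAt.comp_affine (c := τ k) (b := τ (k + 1) - τ k)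
    Real.smoothTransition.contDiff hf).congr ?_
  filter_upwards [lt_mem_nhds (show (k - 1 / 3 : ℝ) < s by linarith),
    gt_mem_nhds (show s < (k : ℝ) + 4 / 3 by linarith)] with y hy1 hy2
  rw [steps_eq hkm hy1.le hy2.le]
  unfold unitStep
  ring_nf

end Steps

/-! ### The boundary angle and the branch points -/

section Nodes

variable (g : ℕ)

/-- The numbers `√N, …, 1, 0, -1, …, -√N`, for `N = 2 g + 1`. -/
noncomputable def nodeValue (k : ℕ) : ℝ := √(2 * g + 1 - k) - √(k - (2 * g + 1))

theorem nodeValue_sub {k : ℕ} (hk : k ≤ 2 * (2 * g + 1)) :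
    nodeValue g (2 * (2 * g + 1) - k) = -nodeValue g k := by
  unfold nodeValue
  rw [Nat.cast_sub hk]
  push_cast
  rw [show (2 * g + 1 - (2 * (2 * g + 1) - k) : ℝ) = k - (2 * g + 1) by ring,
    show (2 * (2 * g + 1) - k - (2 * g + 1) : ℝ) = 2 * g + 1 - k by ring]
  ring

theorem nodeValue_of_le {k : ℕ} (hk : k ≤ 2 * g + 1) : nodeValue g k = √(2 * g + 1 - k) := by
  have : (k : ℝ) ≤ 2 * g + 1 := by exact_mod_cast hk
  unfold nodeValue
  rw [Real.sqrt_eq_zero_of_nonpos (x := k - (2 * g + 1)) (by linarith), sub_zero]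

theorem antitone_nodeValue : Antitone (nodeValue g) := by
  intro k l h
  have : (k : ℝ) ≤ l := by exact_mod_cast h
  unfold nodeValue
  gcongr

theorem strictAnti_nodeValue : StrictAnti (nodeValue g) := by
  refine strictAnti_nat_of_succ_lt fun k => ?_
  unfold nodeValue
  push_cast
  rcases lt_or_ge k (2 * g + 1) with h | h
  · have : (k : ℝ) + 1 ≤ 2 * g + 1 := by exact_mod_cast h
    have h1 : √(2 * g + 1 - (k + 1)) < √(2 * g + 1 - k : ℝ) :=
      Real.sqrt_lt_sqrt (by linarith) (by linarith)
    have h2 : √(k - (2 * g + 1)) ≤ √(k + 1 - (2 * g + 1) : ℝ) := Real.sqrt_le_sqrt (by linarith)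
    linarith
  · have : (2 * g + 1 : ℝ) ≤ k := by exact_mod_cast h
    have h1 : √(2 * g + 1 - (k + 1)) ≤ √(2 * g + 1 - k : ℝ) := Real.sqrt_le_sqrt (by linarith)
    have h2 : √(k - (2 * g + 1)) < √(k + 1 - (2 * g + 1) : ℝ) :=
      Real.sqrt_lt_sqrt (by linarith) (by linarith)
    linarith

theorem sqrt_two_mul_add_two_sub_one : √((2 * g + 2 : ℝ) - 1) = nodeValue g 0 := by
  rw [nodeValue_of_le g (Nat.zero_le _)]
  norm_num
  congr 1; ring

/-- The angle over a point of the real segment swept by the upper square root. -/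
noncomputable def nodeAngle (x : ℝ) : ℝ :=
  Function.invFunOn (fun θ => (rootTop (2 * g + 2) θ).re) (Icc 0 (2 * Real.pi))
    (max (-nodeValue g 0) (min (nodeValue g 0) x))

theorem nodeValue_zero_nonneg : 0 ≤ nodeValue g 0 := by
  rw [nodeValue_of_le g (Nat.zero_le _)]; positivity

theorem nodeAngle_spec (x : ℝ) : nodeAngle g x ∈ Icc 0 (2 * Real.pi) ∧
    (rootTop (2 * g + 2) (nodeAngle g x)).re = max (-nodeValue g 0) (min (nodeValue g 0) x) := by
  have hR := two_le_two_mul_add_two g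
  have h0 := nodeValue_zero_nonneg g
  have hp : 0 ≤ 2 * Real.pi := by positivity
  have hc : ContinuousOn (fun θ => (rootTop (2 * g + 2) θ).re) (Icc 0 (2 * Real.pi)) :=
    (Complex.continuous_re.comp (contDiff_rootTop hR).continuous).continuousOn
  have hex : ∃ θ ∈ Icc 0 (2 * Real.pi), (fun θ => (rootTop (2 * g + 2) θ).re) θ =
      max (-nodeValue g 0) (min (nodeValue g 0) x) := by
    refine intermediate_value_Icc' hp hc ⟨?_, ?_⟩
    · simp only [rootTop_two_pi hR, neg_re, ofReal_re, sqrt_two_mul_add_two_sub_one]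
      exact le_max_left _ _
    · simp only [rootTop_zero hR, ofReal_re, sqrt_two_mul_add_two_sub_one]
      exact max_le (by linarith) (min_le_left _ _)
  exact ⟨Function.invFunOn_mem hex, Function.invFunOn_eq hex⟩

theorem rootTop_nodeAngle {x : ℝ} (h1 : -nodeValue g 0 ≤ x) (h2 : x ≤ nodeValue g 0) :
    (rootTop (2 * g + 2) (nodeAngle g x)).re = x := by
  rw [(nodeAngle_spec g x).2, min_eq_right h2, max_eq_right h1]

theorem antitone_nodeAngle : Antitone (nodeAngle g) := by
  intro x y h
  refine (strictAntiOn_rootTop_re (two_le_two_mul_add_two g)).le_iff_ge (nodeAngle_spec g x).1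
    (nodeAngle_spec g y).1 |>.1 ?_
  simp only [(nodeAngle_spec g _).2]
  gcongr

/-- The angles at which the subdivision of the strip is made. -/
noncomputable def node (k : ℕ) : ℝ := nodeAngle g (nodeValue g k)

theorem nodeValue_mem {k : ℕ} (hk : k ≤ 2 * (2 * g + 1)) :
    -nodeValue g 0 ≤ nodeValue g k ∧ nodeValue g k ≤ nodeValue g 0 := by
  refine ⟨?_, antitone_nodeValue g (Nat.zero_le k)⟩
  rw [← nodeValue_sub g (Nat.zero_le _)]
  exact antitone_nodeValue g (by omega)

theorem rootTop_node {k : ℕ} (hk : k ≤ 2 * (2 * g + 1)) :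
    (rootTop (2 * g + 2) (node g k)).re = nodeValue g k :=
  rootTop_nodeAngle g (nodeValue_mem g hk).1 (nodeValue_mem g hk).2

theorem node_mem (k : ℕ) : node g k ∈ Icc 0 (2 * Real.pi) := (nodeAngle_spec g _).1

theorem monotone_node : Monotone (node g) := (antitone_nodeAngle g).comp (antitone_nodeValue g)

theorem eq_node {θ : ℝ} (hθ : θ ∈ Icc 0 (2 * Real.pi)) {k : ℕ} (hk : k ≤ 2 * (2 * g + 1))
    (h : (rootTop (2 * g + 2) θ).re = nodeValue g k) : θ = node g k :=
  (strictAntiOn_rootTop_re (two_le_two_mul_add_two g)).injOn hθ (node_mem g k)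
    (h.trans (rootTop_node g hk).symm)

theorem strictMonoOn_node : StrictMonoOn (node g) (Iic (2 * (2 * g + 1))) := by
  intro k hk l hl h
  refine (monotone_node g h.le).lt_of_ne fun he => ?_
  have := (rootTop_node g hk).symm.trans ((congrArg _ (congrArg _ he)).trans (rootTop_node g hl))
  exact (strictAnti_nodeValue g h).ne' this

theorem node_zero : node g 0 = 0 :=
  (eq_node g ⟨le_rfl, by positivity⟩ (Nat.zero_le _) (by
    rw [rootTop_zero (two_le_two_mul_add_two g), ofReal_re, sqrt_two_mul_add_two_sub_one])).symm

theorem node_sub {k : ℕ} (hk : k ≤ 2 * (2 * g + 1)) :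
    node g (2 * (2 * g + 1) - k) = 2 * Real.pi - node g k := by
  have h := node_mem g k
  refine (eq_node g ⟨by linarith [h.2], by linarith [h.1]⟩ (by omega) ?_).symm
  rw [rootTop_two_pi_sub (two_le_two_mul_add_two g), nodeValue_sub g hk, ← rootTop_node g hk]
  simp

theorem node_last : node g (2 * (2 * g + 1)) = 2 * Real.pi := by
  simpa [node_zero] using node_sub g (Nat.zero_le _)

/-- The reparametrised angle: it runs from `0` to `2 π`, resting at the nodes. -/
noncomputable def stepAngle (s : ℝ) : ℝ := steps (node g) (2 * (2 * g + 1)) s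

theorem contDiff_stepAngle : ContDiff ℝ ∞ (stepAngle g) := contDiff_steps

theorem monotone_stepAngle : Monotone (stepAngle g) := monotone_steps (monotone_node g)

theorem stepAngle_mem (s : ℝ) : stepAngle g s ∈ Icc 0 (2 * Real.pi) := by
  have := steps_mem_Icc' (m := 2 * (2 * g + 1)) (monotone_node g) s
  rwa [node_zero, node_last] at this

theorem stepAngle_of_le {s : ℝ} (hs : s ≤ 1 / 3) : stepAngle g s = 0 := by
  rw [stepAngle, steps_of_le hs, node_zero]

theorem stepAngle_of_ge {s : ℝ} (hs : 2 * (2 * g + 1) - 1 / 3 ≤ s) :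
    stepAngle g s = 2 * Real.pi := by
  rw [stepAngle, steps_of_ge (by push_cast; exact hs), node_last]

theorem stepAngle_sub (s : ℝ) : stepAngle g (2 * (2 * g + 1) - s) = 2 * Real.pi - stepAngle g s := by
  have := steps_sub (m := 2 * (2 * g + 1)) (c := 2 * Real.pi) (fun k hk => node_sub g hk) s
  push_cast at this
  exact this

/-- The angle moves slowly whenever it passes over a branch point, as all branch points are nodes.
-/
theorem flatAt_stepAngle {s : ℝ} {j : ℕ} (hj : j ≤ 2 * g + 1)
    (h : (rootTop (2 * g + 2) (stepAngle g s)).re ^ 2 = j) : FlatAt (stepAngle g) s := by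
  refine flatAt_steps (strictMonoOn_node g) (monotone_node g) ?_
  have e : nodeValue g (2 * g + 1 - j) = √j := by
    rw [nodeValue_of_le g (Nat.sub_le _ _), Nat.cast_sub hj]
    push_cast
    congr 1; ring
  have hs : (rootTop (2 * g + 2) (stepAngle g s)).re ^ 2 = √(j : ℝ) ^ 2 := by
    rw [h, Real.sq_sqrt (Nat.cast_nonneg j)]
  rcases sq_eq_sq_iff_eq_or_eq_neg.1 hs with h1 | h1
  · exact ⟨2 * g + 1 - j, eq_node g (stepAngle_mem g s) (by omega) (h1.trans e.symm), by omega⟩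
  · refine ⟨2 * (2 * g + 1) - (2 * g + 1 - j), eq_node g (stepAngle_mem g s) (by omega) ?_, by omega⟩
    rw [nodeValue_sub g (by omega), e, h1]

end Nodes
end HamGeometry

namespace HamGeometry

open Filter Asymptotics Complex

/-! ### The cut path -/

section Cut

variable (g : ℕ)

/-- The abscissa of the path along the real axis. -/
noncomputable def realPoint (s : ℝ) : ℝ := (rootTop (2 * g + 2) (stepAngle g s)).re

theorem realPoint_sub (s : ℝ) : realPoint g (2 * (2 * g + 1) - s) = -realPoint g s := by
  unfold realPoint
  rw [stepAngle_sub, rootTop_two_pi_sub (two_le_two_mul_add_two g)]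
  simp

theorem realPoint_of_ge {s : ℝ} (hs : 2 * (2 * g + 1) - 1 / 3 ≤ s) :
    realPoint g s = -nodeValue g 0 := by
  unfold realPoint
  rw [stepAngle_of_ge g hs, rootTop_two_pi (two_le_two_mul_add_two g),
    sqrt_two_mul_add_two_sub_one]
  simp

theorem realPoint_of_le {s : ℝ} (hs : s ≤ 1 / 3) : realPoint g s = nodeValue g 0 := by
  unfold realPoint
  rw [stepAngle_of_le g hs, rootTop_zero (two_le_two_mul_add_two g),
    sqrt_two_mul_add_two_sub_one, ofReal_re]

theorem flip_flip (q : ℂ × ℂ) : flip (flip q) = q := by simp [flip]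

theorem hyper_neg_nodeValue_zero : hyper g (-nodeValue g 0 : ℂ) = flip (hyper g (nodeValue g 0)) := by
  have h : nodeValue g 0 ^ 2 = 2 * g + 1 := by
    rw [nodeValue_of_le g (Nat.zero_le _), Real.sq_sqrt (by
      have : (0 : ℝ) ≤ g := Nat.cast_nonneg g
      push_cast; linarith)]
    push_cast; ring
  rw [hyper_neg_ofReal_eq (j := 2 * g) le_rfl (by rw [h]; push_cast; linarith)
    (by rw [h]; push_cast; linarith), if_pos (by simp)]

/-- The cut system: the path that runs along the lift of a real segment from one boundary point to
its image under the involution, and then along the image of that path under the involution. -/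
noncomputable def cutPath (u : ℝ) : ℂ × ℂ :=
  if u ≤ 2 * (2 * g + 1) then hyper g (realPoint g u)
  else flip (hyper g (realPoint g (u - 2 * (2 * g + 1))))

theorem cutPath_of_le {u : ℝ} (hu : u ≤ 2 * (2 * g + 1)) : cutPath g u = hyper g (realPoint g u) :=
  if_pos hu

theorem cutPath_of_ge {u : ℝ} (hu : 2 * (2 * g + 1) ≤ u) :
    cutPath g u = flip (hyper g (realPoint g (u - 2 * (2 * g + 1)))) := by
  rcases hu.eq_or_lt with rfl | h
  · rw [cutPath_of_le g le_rfl, sub_self, realPoint_of_ge g (by linarith),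
      realPoint_of_le g (by norm_num)]
    rw [ofReal_neg, hyper_neg_nodeValue_zero]
  · exact if_neg (not_le.2 h)

theorem cutPath_add {u : ℝ} (hu : 0 ≤ u) (hu' : u ≤ 2 * (2 * g + 1)) :
    cutPath g (2 * (2 * g + 1) + u) = flip (cutPath g u) := by
  rw [cutPath_of_ge g (by linarith), cutPath_of_le g hu', add_sub_cancel_left]

/-- Between the `k`-th and the `(k + 1)`-st vertex no branch point lies in the interior of the edge.
-/
theorem realPoint_sq_mem {k : ℕ} (hk : k ≤ 2 * g) {s : ℝ} (h1 : k ≤ s) (h2 : s ≤ k + 1) :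
    ((2 * g - k : ℕ) : ℝ) ≤ realPoint g s ^ 2 ∧ realPoint g s ^ 2 ≤ ((2 * g - k : ℕ) : ℝ) + 1 := by
  have h := steps_mem_Icc (m := 2 * (2 * g + 1)) (monotone_node g) (by omega) h1 h2
  have hanti := (strictAntiOn_rootTop_re (two_le_two_mul_add_two g)).antitoneOn
  have e1 := hanti (node_mem g _) (stepAngle_mem g s) h.1
  have e2 := hanti (stepAngle_mem g s) (node_mem g _) h.2
  simp only [rootTop_node g (show k ≤ 2 * (2 * g + 1) by omega),
    rootTop_node g (show k + 1 ≤ 2 * (2 * g + 1) by omega)] at e1 e2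
  rw [nodeValue_of_le g (by omega)] at e1
  rw [nodeValue_of_le g (by omega)] at e2
  have hk' : (k : ℝ) ≤ 2 * g := by exact_mod_cast hk
  rw [Nat.cast_sub hk]
  push_cast at e2 ⊢
  change √(2 * g + 1 - (k + 1) : ℝ) ≤ realPoint g s at e2
  change realPoint g s ≤ _ at e1
  have h0 : 0 ≤ realPoint g s := (Real.sqrt_nonneg _).trans e2
  constructor
  · have := (Real.sqrt_le_left h0).1 e2
    linarith
  · have := (Real.le_sqrt h0 (by linarith)).1 e1
    linarith

/-- The second quarter of the path runs back over the edges of the first and the third quarter, by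
turns: for real `r` with `2 g - k ≤ r² ≤ 2 g - k + 1`, the second coordinates of `hyper g (-r)` and
`hyper g r` differ by the sign `(-1)^(k+1)`. -/
theorem cutPath_two_mul_sub {k : ℕ} (hk : k ≤ 2 * g) {s : ℝ} (h1 : k ≤ s) (h2 : s ≤ k + 1) :
    cutPath g (2 * (2 * g + 1) - s) =
      if Even k then flip (cutPath g s) else cutPath g s := by
  have hk' : (k : ℝ) ≤ 2 * g := by exact_mod_cast hk
  have hk0 : (0 : ℝ) ≤ k := Nat.cast_nonneg k
  have h := realPoint_sq_mem g hk h1 h2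
  rw [cutPath_of_le g (by linarith), cutPath_of_le g (by linarith), realPoint_sub, ofReal_neg,
    hyper_neg_ofReal_eq (Nat.sub_le _ _) h.1 h.2]
  simp [Nat.even_sub hk]

/-- The fourth quarter of the path runs back over the edges of the first and the third quarter that
the second one leaves out. -/
theorem cutPath_four_mul_sub {k : ℕ} (hk : k ≤ 2 * g) {s : ℝ} (h1 : k ≤ s) (h2 : s ≤ k + 1) :
    cutPath g (4 * (2 * g + 1) - s) =
      if Even k then cutPath g s else flip (cutPath g s) := by
  have hk' : (k : ℝ) ≤ 2 * g := by exact_mod_cast hk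
  have hk0 : (0 : ℝ) ≤ k := Nat.cast_nonneg k
  rw [show (4 * (2 * g + 1) - s : ℝ) = 2 * (2 * g + 1) + (2 * (2 * g + 1) - s) by ring,
    cutPath_add g (by linarith) (by linarith), cutPath_two_mul_sub g hk h1 h2]
  split_ifs <;> simp [flip_flip]

theorem cutPath_zero : cutPath g 0 = (genusSurface g).loop 0 := by
  have := hyper_rootTop g (θ := 0) ⟨le_rfl, by positivity⟩
  rw [zero_div] at this
  rw [← this, cutPath_of_le g (by positivity), realPoint_of_le g (by norm_num),
    rootTop_zero (two_le_two_mul_add_two g), sqrt_two_mul_add_two_sub_one]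

theorem cutPath_of_nonpos {u : ℝ} (hu : u ≤ 1 / 3) : cutPath g u = (genusSurface g).loop 0 := by
  have h0 : (0 : ℝ) ≤ g := Nat.cast_nonneg g
  rw [← cutPath_zero, cutPath_of_le g (by linarith), cutPath_of_le g (by linarith),
    realPoint_of_le g hu, realPoint_of_le g (by norm_num)]

theorem cutPath_of_ge_four {u : ℝ} (hu : 4 * (2 * g + 1) - 1 / 3 ≤ u) :
    cutPath g u = (genusSurface g).loop 0 := by
  have h0 : (0 : ℝ) ≤ g := Nat.cast_nonneg g
  rw [← cutPath_zero, cutPath_of_ge g (by linarith), cutPath_of_le g (by linarith),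
    realPoint_of_ge g (s := u - 2 * (2 * g + 1)) (by linarith), realPoint_of_le g (by norm_num),
    ofReal_neg, hyper_neg_nodeValue_zero, flip_flip]

/-- The vertices of the cut system on the real segment are branch points, but for the end points. -/
theorem flip_cutPath_node {k : ℕ} (h1 : 1 ≤ k) (hk : k ≤ 2 * g + 1) :
    flip (cutPath g k) = cutPath g k := by
  have hk' : (k : ℝ) ≤ 2 * g + 1 := by exact_mod_cast hk
  have h0 : (0 : ℝ) ≤ g := Nat.cast_nonneg g
  have hr : realPoint g k ^ 2 = ((2 * g + 1 - k : ℕ) : ℝ) := by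
    have e := steps_eq (τ := node g) (m := 2 * (2 * g + 1)) (k := k) (by omega) (s := k)
      (by linarith) (by linarith)
    rw [sub_self, unitStep_of_le (by norm_num), mul_zero, add_zero] at e
    unfold realPoint stepAngle
    rw [e, rootTop_node g (by omega), nodeValue_of_le g hk, Nat.cast_sub hk,
      Real.sq_sqrt (by linarith)]
    push_cast; ring
  rw [cutPath_of_le g (by linarith)]
  have hy := hyper_mem g (realPoint g k)
  have : ∏ i ∈ Finset.Icc 1 (2 * g + 1), ((hyper g (realPoint g k : ℂ)).1 - (i : ℂ)) = 0 := by
    refine Finset.prod_eq_zero (i := 2 * g + 2 - k) (Finset.mem_Icc.2 ⟨by omega, by omega⟩) ?_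
    have hrc : (realPoint g k : ℂ) ^ 2 = ((2 * g + 1 - k : ℕ) : ℂ) := by exact_mod_cast hr
    simp only [hyper, hrc]
    rw [show 2 * g + 2 - k = 1 + (2 * g + 1 - k) by omega]
    push_cast
    ring
  rw [this] at hy
  have hy0 := pow_eq_zero_iff (two_ne_zero) |>.1 hy
  refine Prod.ext rfl ?_
  simp [flip, hy0]

end Cut

/-! ### The map from the disc to the surface -/

section CutMap

variable (g : ℕ)

/-- The height function, from `1` at the bottom to `0` at the top of the disc. -/
noncomputable def stripHeight (t : ℝ) : ℝ := 1 + -1 * Real.smoothTransition (1 * t + 1 / 2)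

theorem stripHeight_of_le {t : ℝ} (ht : t ≤ -1 / 2) : stripHeight t = 1 := by
  unfold stripHeight
  rw [Real.smoothTransition.zero_of_nonpos (by linarith)]; ring

theorem stripHeight_of_ge {t : ℝ} (ht : 1 / 2 ≤ t) : stripHeight t = 0 := by
  unfold stripHeight
  rw [Real.smoothTransition.one_of_one_le (by linarith)]; ring

theorem isStripParam {l : ℝ} :
    IsStripParam g (fun s => stepAngle g (4 * (2 * g + 1) * s + l)) stripHeight where
  contDiff_fst := (contDiff_stepAngle g).comp (by fun_prop)
  contDiff_snd := contDiff_const.add (contDiff_const.mul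
    (Real.smoothTransition.contDiff.comp (by fun_prop)))
  mem_fst s := stepAngle_mem g _
  mem_snd t := by
    have h1 := Real.smoothTransition.nonneg (1 * t + 1 / 2)
    have h2 := Real.smoothTransition.le_one (1 * t + 1 / 2)
    unfold stripHeight
    constructor <;> linarith
  monotone := by
    intro x y h
    refine monotone_stepAngle g ?_
    gcongr
  antitone := by
    intro x y h
    have := monotone_smoothTransition (show 1 * x + 1 / 2 ≤ 1 * y + 1 / 2 by linarith)
    unfold stripHeight
    linarith
  flat_fst s j hj h := by
    have := flatAt_stepAngle g (j := j) (by have := (Finset.mem_Icc.1 hj).2; omega) h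
    simpa using this.comp_affine (c := 0) (b := 1) (contDiff_stepAngle g)
  flat_snd t ht := by
    refine FlatAt.comp_affine Real.smoothTransition.contDiff
      (flatAt_smoothTransition_of_notMem fun hmem => ?_)
    have := Real.smoothTransition.pos_of_pos (x := 1 - (1 * t + 1 / 2)) (by linarith [hmem.2])
    rw [smoothTransition_one_sub] at this
    unfold stripHeight at ht
    linarith

/-- One half of the map from the disc to the surface: a map to the upper sheet of the surface cut
along the real segment. -/
noncomputable def halfMap (l : ℝ) (z : ℂ) : ℂ × ℂ :=
  hyper g (stripPoint (2 * g + 2) (fun s => stepAngle g (4 * (2 * g + 1) * s + l)) stripHeight z)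

/-- The map from the disc to the surface. It collapses the upper half of the boundary to the cut
system and is injective on the open set on which it is an immersion. -/
noncomputable def cutMap (z : ℂ) : ℂ × ℂ :=
  if z.re ≤ 0 then halfMap g (2 * (2 * g + 1)) z else flip (halfMap g 0 z)

theorem halfMap_of_eq_zero {l : ℝ} {z : ℂ} (h : stepAngle g (4 * (2 * g + 1) * z.re + l) = 0) :
    halfMap g l z = hyper g (nodeValue g 0) := by
  unfold halfMap stripPoint
  simp only [h]
  rw [rootTop_zero (two_le_two_mul_add_two g), sqrt_two_mul_add_two_sub_one]
  simp

theorem halfMap_of_eq_two_pi {l : ℝ} {z : ℂ}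
    (h : stepAngle g (4 * (2 * g + 1) * z.re + l) = 2 * Real.pi) :
    halfMap g l z = flip (hyper g (nodeValue g 0)) := by
  rw [← hyper_neg_nodeValue_zero]
  unfold halfMap stripPoint
  simp only [h]
  rw [rootTop_two_pi (two_le_two_mul_add_two g), sqrt_two_mul_add_two_sub_one]
  simp

/-- Near the vertical diameter of the disc both halves of the map are constant and they agree, so
that they fit together smoothly. -/
theorem halfMap_eq_flip_halfMap {z : ℂ} (h1 : -(1 / (12 * (2 * g + 1))) ≤ z.re)
    (h2 : z.re ≤ 1 / (12 * (2 * g + 1))) :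
    halfMap g (2 * (2 * g + 1)) z = flip (halfMap g 0 z) := by
  have h0 : (0 : ℝ) ≤ g := Nat.cast_nonneg g
  have hc : (0 : ℝ) < 12 * (2 * g + 1) := by positivity
  rw [le_div_iff₀ hc] at h2
  rw [neg_le, le_div_iff₀ hc] at h1
  rw [halfMap_of_eq_two_pi g (stepAngle_of_ge g (by linarith)),
    halfMap_of_eq_zero g (stepAngle_of_le g (by linarith))]

theorem contDiff_halfMap (l : ℝ) : ContDiff ℝ ∞ (halfMap g l) := (isStripParam g).contDiff_hyper

/-- The involution as a linear map. -/
noncomputable def flipL : (ℂ × ℂ) →L[ℝ] (ℂ × ℂ) :=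
  (ContinuousLinearMap.fst ℝ ℂ ℂ).prod (-ContinuousLinearMap.snd ℝ ℂ ℂ)

theorem flipL_apply (q : ℂ × ℂ) : flipL q = flip q := by simp [flipL, flip]

theorem cutMap_eventuallyEq_left {z : ℂ} (hz : z.re < 1 / (12 * (2 * g + 1))) :
    cutMap g =ᶠ[𝓝 z] halfMap g (2 * (2 * g + 1)) := by
  filter_upwards [(continuous_re.continuousAt (x := z)).eventually_lt continuousAt_const hz] with y hy
  unfold cutMap
  split_ifs with h
  · rfl
  · refine (halfMap_eq_flip_halfMap g ?_ hy.le).symm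
    have : 0 ≤ (1 : ℝ) / (12 * (2 * g + 1)) := by positivity
    linarith

theorem cutMap_eventuallyEq_right {z : ℂ} (hz : -(1 / (12 * (2 * g + 1))) < z.re) :
    cutMap g =ᶠ[𝓝 z] fun z => flipL (halfMap g 0 z) := by
  filter_upwards [continuousAt_const.eventually_lt (continuous_re.continuousAt (x := z)) hz] with y hy
  rw [flipL_apply]
  unfold cutMap
  split_ifs with h
  · refine halfMap_eq_flip_halfMap g hy.le ?_
    have : 0 ≤ (1 : ℝ) / (12 * (2 * g + 1)) := by positivity
    linarith
  · rfl

theorem cutMap_cases (z : ℂ) : z.re < 1 / (12 * (2 * g + 1)) ∨ -(1 / (12 * (2 * g + 1))) < z.re := by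
  have : 0 < (1 : ℝ) / (12 * (2 * g + 1)) := by positivity
  rcases le_or_gt z.re 0 with h | h
  · left; linarith
  · right; linarith

theorem contDiff_cutMap : ContDiff ℝ ∞ (cutMap g) := by
  refine contDiff_iff_contDiffAt.2 fun z => ?_
  rcases cutMap_cases g z with h | h
  · exact (contDiff_halfMap g _).contDiffAt.congr_of_eventuallyEq (cutMap_eventuallyEq_left g h)
  · exact (flipL.contDiff.comp (contDiff_halfMap g _)).contDiffAt.congr_of_eventuallyEq
      (cutMap_eventuallyEq_right g h)

theorem fderiv_flipL_comp {f : ℂ → ℂ × ℂ} {z : ℂ} (hf : DifferentiableAt ℝ f z) (e : ℂ) :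
    fderiv ℝ (fun z => flipL (f z)) z e = flip (fderiv ℝ f z e) := by
  rw [← flipL_apply]
  exact congrArg (fun L : ℂ →L[ℝ] ℂ × ℂ => L e) (flipL.hasFDerivAt.comp z hf.hasFDerivAt).fderiv

/-- The involution `flip` is complex linear, so both halves preserve the orientation. -/
theorem sensePreserving_cutMap : SensePreserving (cutMap g) := by
  intro z e
  rcases cutMap_cases g z with h | h
  · rw [(cutMap_eventuallyEq_left g h).fderiv_eq]
    exact (isStripParam g).sensePreserving z e
  · rw [(cutMap_eventuallyEq_right g h).fderiv_eq]
    have hd := ((contDiff_halfMap g 0).differentiable (by simp)).differentiableAt (x := z)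
    simp only [fderiv_flipL_comp hd]
    rcases (isStripParam g).sensePreserving z e with h1 | ⟨c₁, c₂, hc, h1⟩
    · left
      change fderiv ℝ (halfMap g 0) z e = 0 at h1
      rw [h1]; simp [flip]
    · right
      refine ⟨c₁, c₂, hc, ?_⟩
      change fderiv ℝ (halfMap g 0) z (I * e) = _ at h1
      rw [h1]
      simp only [← flipL_apply, map_add, map_smul]
      congr 2
      change flipL (I • (fderiv ℝ (halfMap g 0) z e)) = _
      simp [flipL]

theorem halfMap_mem (l : ℝ) (z : ℂ) : halfMap g l z ∈ (genusSurface g).carrier := by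
  refine ⟨hyper_mem g _, ?_⟩
  have h := isStripParam g (l := l)
  exact norm_one_add_sq_le (two_le_two_mul_add_two g) (h.mem_fst z.re) (h.mem_snd z.im).1
    (h.mem_snd z.im).2

theorem flip_mem {q : ℂ × ℂ} (h : q ∈ (genusSurface g).carrier) :
    flip q ∈ (genusSurface g).carrier :=
  ⟨by simpa [flip] using h.1, h.2⟩

theorem cutMap_mem (z : ℂ) : cutMap g z ∈ (genusSurface g).carrier := by
  unfold cutMap
  split_ifs
  · exact halfMap_mem g _ z
  · exact flip_mem g (halfMap_mem g _ z)

/-- At immersion points, the image lies over the open half plane, where the curve is injective and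
`y ≠ 0`. -/
theorem halfMap_injective {l l' : ℝ} {z z' : ℂ} (he : (halfMap g l z).1 = (halfMap g l' z').1)
    (hz : ∀ e, fderiv ℝ (halfMap g l) z e = 0 → e = 0)
    (hz' : ∀ e, fderiv ℝ (halfMap g l') z' e = 0 → e = 0) :
    (halfMap g l z).2 ≠ 0 ∧ halfMap g l z = halfMap g l' z' ∧ (l = l' → z = z') := by
  have h := isStripParam g (l := l)
  have h' := isStripParam g (l := l')
  have hR := two_le_two_mul_add_two g
  obtain ⟨a1, a2, a3, a4⟩ := h.of_injective hz
  obtain ⟨b1, b2, b3, b4⟩ := h'.of_injective hz'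
  have p1 : 0 < (stripPoint (2 * g + 2) (fun s => stepAngle g (4 * (2 * g + 1) * s + l))
      stripHeight z).im := by
    rw [stripPoint_im]; exact mul_pos a3 (rootTop_im_pos hR a4)
  have p2 : 0 < (stripPoint (2 * g + 2) (fun s => stepAngle g (4 * (2 * g + 1) * s + l'))
      stripHeight z').im := by
    rw [stripPoint_im]; exact mul_pos b3 (rootTop_im_pos hR b4)
  have hw := eq_of_hyper_fst_eq p1 p2 he
  refine ⟨hyper_snd_ne_zero p1, congrArg (hyper g) hw, ?_⟩
  rintro rfl
  exact h.eq_of_stripPoint_eq a2 b2 a1 b1 a4 hw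

/-- The two halves map their immersion points to the two sheets over the same domain, which `flip`
interchanges; the sheets are disjoint since `y ≠ 0` there. -/
theorem cutMap_injective {z z' : ℂ} (he : cutMap g z = cutMap g z')
    (hz : ∀ e, fderiv ℝ (cutMap g) z e = 0 → e = 0)
    (hz' : ∀ e, fderiv ℝ (cutMap g) z' e = 0 → e = 0) : z = z' := by
  -- At every point the map agrees locally with one of its two halves.
  have key : ∀ z, (∀ e, fderiv ℝ (cutMap g) z e = 0 → e = 0) →
      (∃ b : Bool, cutMap g z = (if b then halfMap g (2 * (2 * g + 1)) z else flip (halfMap g 0 z)) ∧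
        ∀ e, fderiv ℝ (halfMap g (if b then 2 * (2 * g + 1) else 0)) z e = 0 → e = 0) := by
    intro z hz
    rcases cutMap_cases g z with h | h
    · refine ⟨true, (cutMap_eventuallyEq_left g h).eq_of_nhds, fun e h1 => hz e ?_⟩
      rw [(cutMap_eventuallyEq_left g h).fderiv_eq]; exact h1
    · refine ⟨false, (cutMap_eventuallyEq_right g h).eq_of_nhds.trans (flipL_apply _),
        fun e h1 => hz e ?_⟩
      rw [(cutMap_eventuallyEq_right g h).fderiv_eq, fderiv_flipL_comp
        (((contDiff_halfMap g 0).differentiable (by simp)).differentiableAt)]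
      change fderiv ℝ (halfMap g 0) z e = 0 at h1
      rw [h1]; simp [flip]
  obtain ⟨b, h1, h2⟩ := key z hz
  obtain ⟨b', h1', h2'⟩ := key z' hz'
  rw [h1, h1'] at he
  have hfst : (halfMap g (if b then 2 * (2 * g + 1) else 0) z).1 =
      (halfMap g (if b' then 2 * (2 * g + 1) else 0) z').1 := by
    have := congrArg Prod.fst he
    cases b <;> cases b' <;> simpa [flip] using this
  obtain ⟨q1, q2, q3⟩ := halfMap_injective g hfst h2 h2'
  cases b <;> cases b' <;> simp only [if_true, if_false, Bool.false_eq_true] at *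
  · exact q3 trivial
  · have := congrArg Prod.snd (q2.trans he.symm)
    simp only [flip] at this
    exact absurd (self_eq_neg.1 this) q1
  · have := congrArg Prod.snd (he.trans (congrArg flip q2.symm))
    simp only [flip] at this
    exact absurd (self_eq_neg.1 this) q1
  · exact q3 trivial

/-- On the upper half of the unit circle `cutMap` runs along the cut system. -/
theorem cutMap_top {z : ℂ} (hz : z.re ^ 2 + z.im ^ 2 = 1) (h0 : 0 ≤ z.im) :
    cutMap g z = cutPath g (4 * (2 * g + 1) * z.re + 2 * (2 * g + 1)) := by
  have hg : (0 : ℝ) ≤ g := Nat.cast_nonneg g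
  have hl : ∀ l : ℝ, (l = 2 * (2 * g + 1) ∧ z.re ≤ 0 ∨ l = 0 ∧ 0 ≤ z.re) →
      halfMap g l z = hyper g (realPoint g (4 * (2 * g + 1) * z.re + l)) := by
    intro l hl
    rcases lt_or_ge (z.im) (1 / 2) with h | h
    · have hre : 3 / 4 ≤ z.re ^ 2 := by nlinarith
      rcases hl with ⟨rfl, hs⟩ | ⟨rfl, hs⟩
      · have h2 : z.re ≤ -1 / 2 := by nlinarith
        have h3 : 4 * (2 * g + 1) * z.re + 2 * (2 * g + 1) ≤ 1 / 3 := by nlinarith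
        rw [halfMap_of_eq_zero g (stepAngle_of_le g h3), realPoint_of_le g h3]
      · have h2 : 1 / 2 ≤ z.re := by nlinarith
        have h3 : 2 * (2 * g + 1) - 1 / 3 ≤ 4 * (2 * g + 1) * z.re + 0 := by nlinarith
        rw [halfMap_of_eq_two_pi g (stepAngle_of_ge g h3), realPoint_of_ge g h3, ofReal_neg,
          hyper_neg_nodeValue_zero]
    · unfold halfMap stripPoint realPoint
      rw [stripHeight_of_ge h]
      simp
  have hc : (0 : ℝ) < 4 * (2 * g + 1) := by positivity
  unfold cutMap
  split_ifs with h
  · rw [cutPath_of_le g (by nlinarith), hl _ (Or.inl ⟨rfl, h⟩)]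
  · rw [cutPath_of_ge g (by nlinarith), hl _ (Or.inr ⟨rfl, by linarith⟩)]
    ring_nf

/-- The reparametrisation of the boundary of the surface by the lower half of the unit circle. -/
noncomputable def bottomParam (s : ℝ) : ℝ :=
  (stepAngle g (4 * (2 * g + 1) * s + 2 * (2 * g + 1)) + stepAngle g (4 * (2 * g + 1) * s)) /
    (4 * Real.pi)

theorem contDiff_bottomParam : ContDiff ℝ ∞ (bottomParam g) :=
  (((contDiff_stepAngle g).comp (by fun_prop)).add
    ((contDiff_stepAngle g).comp (by fun_prop))).div_const _

theorem bottomParam_neg_one : bottomParam g (-1) = 0 := by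
  have hg : (0 : ℝ) ≤ g := Nat.cast_nonneg g
  unfold bottomParam
  rw [stepAngle_of_le g (by linarith), stepAngle_of_le g (by linarith)]; simp

theorem bottomParam_one : bottomParam g 1 = 1 := by
  have hg : (0 : ℝ) ≤ g := Nat.cast_nonneg g
  unfold bottomParam
  rw [stepAngle_of_ge g (by linarith), stepAngle_of_ge g (by linarith)]
  have := Real.pi_pos
  field_simp
  norm_num

theorem bottomParam_mem (s : ℝ) : bottomParam g s ∈ Icc (0 : ℝ) 1 := by
  have h1 := stepAngle_mem g (4 * (2 * g + 1) * s + 2 * (2 * g + 1))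
  have h2 := stepAngle_mem g (4 * (2 * g + 1) * s)
  have := Real.pi_pos
  unfold bottomParam
  refine ⟨div_nonneg (add_nonneg h1.1 h2.1) (by positivity), ?_⟩
  rw [div_le_one (by positivity)]
  linarith [h1.2, h2.2]

/-- On the lower half of the unit circle `cutMap` runs along the boundary of the surface. -/
theorem cutMap_bottom {z : ℂ} (hz : z.re ^ 2 + z.im ^ 2 = 1) (h0 : z.im ≤ 0) :
    cutMap g z = (genusSurface g).loop (bottomParam g z.re) := by
  have hg : (0 : ℝ) ≤ g := Nat.cast_nonneg g
  have hR := two_le_two_mul_add_two g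
  have hl : ∀ l : ℝ, (l = 2 * (2 * g + 1) ∧ z.re ≤ 0 ∨ l = 0 ∧ 0 ≤ z.re) →
      halfMap g l z = (genusSurface g).loop (stepAngle g (4 * (2 * g + 1) * z.re + l) /
        (4 * Real.pi)) := by
    intro l hl
    rw [← hyper_rootTop g (stepAngle_mem g _)]
    rcases lt_or_ge (-1 / 2) (z.im) with h | h
    · have hre : 3 / 4 ≤ z.re ^ 2 := by nlinarith
      rcases hl with ⟨rfl, hs⟩ | ⟨rfl, hs⟩
      · have h2 : z.re ≤ -1 / 2 := by nlinarith
        have h3 : 4 * (2 * g + 1) * z.re + 2 * (2 * g + 1) ≤ 1 / 3 := by nlinarith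
        rw [halfMap_of_eq_zero g (stepAngle_of_le g h3), stepAngle_of_le g h3, rootTop_zero hR,
          sqrt_two_mul_add_two_sub_one]
      · have h2 : 1 / 2 ≤ z.re := by nlinarith
        have h3 : 2 * (2 * g + 1) - 1 / 3 ≤ 4 * (2 * g + 1) * z.re + 0 := by nlinarith
        rw [halfMap_of_eq_two_pi g (stepAngle_of_ge g h3), stepAngle_of_ge g h3, rootTop_two_pi hR,
          sqrt_two_mul_add_two_sub_one, hyper_neg_nodeValue_zero]
    · unfold halfMap
      congr 1
      refine Complex.ext ?_ ?_
      · rw [stripPoint_re]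
      · rw [stripPoint_im, stripHeight_of_le h, one_mul]
  have hp := Real.pi_pos
  unfold cutMap bottomParam
  split_ifs with h
  · rw [hl _ (Or.inl ⟨rfl, h⟩), stepAngle_of_le g (s := 4 * (2 * g + 1) * z.re) (by nlinarith),
      add_zero]
  · push Not at h
    rw [hl _ (Or.inr ⟨rfl, h.le⟩), ← genusSurface_loop_add_half, add_zero,
      stepAngle_of_ge g (s := 4 * (2 * g + 1) * z.re + 2 * (2 * g + 1)) (by nlinarith)]
    congr 1
    field_simp
    ring

end CutMap
end HamGeometry

namespace HamGeometry

open Filter Asymptotics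

/-! ### Smoothness of maps through immersions -/

section Lifting

variable {E : Type*} [NormedAddCommGroup E] [NormedSpace ℝ E]
  {E' : Type*} [NormedAddCommGroup E'] [NormedSpace ℝ E']

/-- If `G` is close to the identity on a convex set and `G ∘ y` is smooth, then so is `y`. In place
of the inverse function theorem, which is not available at boundary points, the proof bootstraps
the identity `y' = (G' ∘ y)⁻¹ (G ∘ y)'`. -/
theorem contDiffOn_of_comp_nearIdentity [CompleteSpace E] {K : Set E} (hK : Convex ℝ K)
    (hKu : UniqueDiffOn ℝ K) {G : E → E} (hG : ContDiffOn ℝ ∞ G K)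
    (hb : ∀ x ∈ K, ‖fderivWithin ℝ G K x - ContinuousLinearMap.id ℝ E‖ ≤ 1 / 2)
    {s : Set E'} (hs : UniqueDiffOn ℝ s) {y : E' → E} (hy : MapsTo y s K)
    (hr : ContDiffOn ℝ ∞ (fun t => G (y t)) s) : ContDiffOn ℝ ∞ y s := by
  have hGd : ∀ x ∈ K, HasFDerivWithinAt G (fderivWithin ℝ G K x) K x := fun x hx =>
    (hG.differentiableOn (by simp) x hx).hasFDerivWithinAt
  have hlip : ∀ x ∈ K, ∀ x' ∈ K, ‖x' - x‖ ≤ 2 * ‖G x' - G x‖ := by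
    intro x hx x' hx'
    have h1 := hK.norm_image_sub_le_of_norm_hasFDerivWithin_le' hGd hb hx hx'
    have h2 := norm_sub_norm_le (x' - x) (x' - x - (G x' - G x))
    rw [sub_sub_cancel] at h2
    rw [ContinuousLinearMap.id_apply, norm_sub_rev] at h1
    linarith
  have hu : ∀ x ∈ K, IsUnit (fderivWithin ℝ G K x) := by
    intro x hx
    have h1 : ‖(1 : E →L[ℝ] E) - fderivWithin ℝ G K x‖ < 1 := by
      rw [norm_sub_rev]; exact (hb x hx).trans_lt (by norm_num)
    have h2 := (Units.oneSub _ h1).isUnit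
    rwa [Units.val_oneSub, sub_sub_cancel] at h2
  have hrd : ∀ t ∈ s, HasFDerivWithinAt (fun t => G (y t)) (fderivWithin ℝ (fun t => G (y t)) s t) s t :=
    fun t ht => (hr.differentiableOn (by simp) t ht).hasFDerivWithinAt
  have hcont : ContinuousOn y s := by
    intro t ht
    rw [ContinuousWithinAt, tendsto_iff_norm_sub_tendsto_zero]
    have h1 := tendsto_iff_norm_sub_tendsto_zero.1 (hr.continuousOn t ht)
    have h2 := h1.const_mul 2
    rw [mul_zero] at h2
    refine squeeze_zero' (Eventually.of_forall fun _ => norm_nonneg _) ?_ h2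
    filter_upwards [self_mem_nhdsWithin] with t' ht'
    exact hlip _ (hy ht) _ (hy ht')
  have hyd : ∀ t ∈ s, HasFDerivWithinAt y
      ((Ring.inverse (fderivWithin ℝ G K (y t))).comp (fderivWithin ℝ (fun t => G (y t)) s t)) s t := by
    intro t ht
    set A := fderivWithin ℝ G K (y t)
    set r' := fderivWithin ℝ (fun t => G (y t)) s t
    have hA : ∀ v, Ring.inverse A (A v) = v := fun v =>
      congrArg (fun L : E →L[ℝ] E => L v) (Ring.inverse_mul_cancel A (hu _ (hy ht)))
    have htend : Tendsto y (𝓝[s] t) (𝓝[K] (y t)) :=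
      tendsto_nhdsWithin_iff.2 ⟨hcont t ht, by filter_upwards [self_mem_nhdsWithin] with t' h using hy h⟩
    have h1 := (hGd _ (hy ht)).isLittleO.comp_tendsto htend
    have h2 : (fun t' => y t' - y t) =O[𝓝[s] t] fun t' => G (y t') - G (y t) := by
      refine IsBigO.of_bound 2 ?_
      filter_upwards [self_mem_nhdsWithin] with t' ht'
      exact hlip _ (hy ht) _ (hy ht')
    have h3 : (fun t' => G (y t') - G (y t)) =O[𝓝[s] t] fun t' => t' - t := (hrd t ht).isBigO_sub
    have h4 := h1.trans_isBigO (h2.trans h3)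
    have h5 := (hrd t ht).isLittleO
    have h6 := (Ring.inverse A).isBigO_comp (fun t' => (G (y t') - G (y t) - r' (t' - t)) -
      (G (y t') - G (y t) - A (y t' - y t))) (𝓝[s] t)
    refine HasFDerivWithinAt.of_isLittleO ((h6.trans_isLittleO (h5.sub h4)).congr_left fun t' => ?_)
    simp only [map_sub, hA, ContinuousLinearMap.comp_apply]
    abel
  -- The formula `hyd` for the derivative of `y` improves its smoothness by one order at a time.
  rw [contDiffOn_infty]
  intro m
  induction m with
  | zero => exact contDiffOn_zero.2 hcont
  | succ m ih =>
    push_cast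
    refine (contDiffOn_succ_iff_hasFDerivWithinAt_of_uniqueDiffOn hs).2 ⟨by simp, _, ?_, hyd⟩
    have h1 : ContDiffOn ℝ m (fun t => fderivWithin ℝ G K (y t)) s :=
      (hG.fderivWithin (m := m) hKu (by exact_mod_cast le_top)).comp ih hy
    have h2 : ContDiffOn ℝ m (fderivWithin ℝ (fun t => G (y t)) s) s :=
      hr.fderivWithin hs (by exact_mod_cast le_top)
    have h3 : ContDiffOn ℝ m (fun t => Ring.inverse (fderivWithin ℝ G K (y t))) s := by
      intro t ht
      obtain ⟨u, hu'⟩ := hu _ (hy ht)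
      have h4 := contDiffAt_ringInverse ℝ (n := m) u
      rw [hu'] at h4
      exact h4.comp_contDiffWithinAt t (h1 t ht)
    exact h3.clm_comp h2

variable [FiniteDimensional ℝ E]
  {H : Type*} [TopologicalSpace H] {I : ModelWithCorners ℝ E H}
  {H' : Type*} [TopologicalSpace H'] {I' : ModelWithCorners ℝ E' H'}
  {B : Type*} [TopologicalSpace B] [ChartedSpace H B] [IsManifold I ∞ B]
  {X : Type*} [TopologicalSpace X] [ChartedSpace H' X] [IsManifold I' ∞ X]
  {V : Type*} [NormedAddCommGroup V] [NormedSpace ℝ V] [FiniteDimensional ℝ V]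

omit [IsManifold I' ∞ X] in
theorem uniqueDiffOn_extChartAt_target_inter_preimage (x : X) {s : Set X} (hs : IsOpen s) :
    UniqueDiffOn ℝ ((extChartAt I' x).target ∩ (extChartAt I' x).symm ⁻¹' s) := by
  obtain ⟨u, hu, he⟩ := (continuousOn_iff'.1 (continuousOn_extChartAt_symm (I := I') x)) s hs
  rw [inter_comm, he, inter_comm]
  exact (uniqueDiffOn_extChartAt_target x).inter hu

omit [IsManifold I' ∞ X] in
theorem extChartAt_target_inter_preimage_mem_nhdsWithin (x : X) {s : Set X} (hs : s ∈ 𝓝 x) :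
    (extChartAt I' x).target ∩ (extChartAt I' x).symm ⁻¹' s ∈ 𝓝[range I'] (extChartAt I' x x) :=
  inter_mem (extChartAt_target_mem_nhdsWithin x)
    (mem_nhdsWithin_of_mem_nhds ((continuousAt_extChartAt_symm x).preimage_mem_nhds
      (by rwa [extChartAt_to_inv])))

/-- A map into a compact manifold that becomes smooth after an injective immersion is smooth. -/
theorem contMDiff_of_comp_immersion [CompactSpace B] [T2Space B] {emb : B → V}
    (hsm : ContMDiff I 𝓘(ℝ, V) ∞ emb) (hinj : Function.Injective emb)
    (himm : ∀ b, Function.Injective (mfderiv I 𝓘(ℝ, V) emb b)) {k : X → B}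
    (hk : ContMDiff I' 𝓘(ℝ, V) ∞ (fun x => emb (k x))) : ContMDiff I' I ∞ k := by
  have hcont : Continuous k :=
    (hsm.continuous.isClosedEmbedding hinj).isInducing.continuous_iff.2 hk.continuous
  intro x₀
  have := FiniteDimensional.complete ℝ E
  set b₀ := k x₀ with hb₀
  set φ := extChartAt I b₀ with hφ
  set y₀ := φ b₀ with hy₀
  set g : E → V := fun y => emb (φ.symm y) with hg
  have hgs : ContDiffOn ℝ ∞ g φ.target :=
    (hsm.comp_contMDiffOn (contMDiffOn_extChartAt_symm b₀)).contDiffOn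
  have hginj : Function.Injective (fderivWithin ℝ g (range I) y₀) := by
    have h1 := himm b₀
    rw [(hsm.mdifferentiableAt (by simp)).mfderiv] at h1
    have h2 : writtenInExtChartAt I 𝓘(ℝ, V) b₀ emb = g := by
      funext y; rfl
    rw [h2] at h1
    exact h1
  -- Composed with a left inverse of its differential, the immersion is close to the identity.
  obtain ⟨L₀, hL₀⟩ := LinearMap.exists_leftInverse_of_injective
    (fderivWithin ℝ g (range I) y₀ : E →ₗ[ℝ] V) (LinearMap.ker_eq_bot.2 hginj)
  set L : V →L[ℝ] E := L₀.toContinuousLinearMap with hL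
  have hLd : L.comp (fderivWithin ℝ g (range I) y₀) = ContinuousLinearMap.id ℝ E := by
    ext1 v
    exact congrArg (fun f : E →ₗ[ℝ] E => f v) hL₀
  set G : E → E := fun y => L (g y) with hGdef
  have hGs : ContDiffOn ℝ ∞ G φ.target := L.contDiff.comp_contDiffOn hgs
  have hmem : y₀ ∈ φ.target := mem_extChartAt_target b₀
  have hut : UniqueDiffOn ℝ φ.target := uniqueDiffOn_extChartAt_target b₀
  obtain ⟨δ₀, hδ₀, hball⟩ := Metric.mem_nhdsWithin_iff.1 (extChartAt_target_mem_nhdsWithin (I := I) b₀)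
  have hev : ∀ᶠ y in 𝓝[φ.target] y₀,
      ‖fderivWithin ℝ G φ.target y - ContinuousLinearMap.id ℝ E‖ < 1 / 2 := by
    have hc : ContinuousWithinAt (fderivWithin ℝ G φ.target) φ.target y₀ :=
      (hGs.continuousOn_fderivWithin hut (by simp)) y₀ hmem
    have h0 : fderivWithin ℝ G φ.target y₀ = ContinuousLinearMap.id ℝ E := by
      rw [← hLd]
      have h1 : fderivWithin ℝ g (range I) y₀ = fderivWithin ℝ g φ.target y₀ :=
        fderivWithin_of_mem_nhdsWithin (extChartAt_target_mem_nhdsWithin (I := I) b₀)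
          (I.uniqueDiffOn _ (extChartAt_target_subset_range b₀ hmem))
          (hgs.differentiableOn (by simp) _ hmem)
      rw [h1]
      exact (L.hasFDerivAt.comp_hasFDerivWithinAt y₀
        (hgs.differentiableOn (by simp) y₀ hmem).hasFDerivWithinAt).fderivWithin (hut _ hmem)
    have h1 := (hc.sub (continuousWithinAt_const (b := ContinuousLinearMap.id ℝ E))).norm
    refine h1.eventually_lt continuousWithinAt_const ?_
    simp [h0]
  obtain ⟨δ₁, hδ₁, hball'⟩ := Metric.mem_nhdsWithin_iff.1 hev
  set δ := min δ₀ δ₁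
  set K := range I ∩ Metric.ball y₀ δ with hKdef
  have hKt : K ⊆ φ.target := fun y hy =>
    hball ⟨Metric.ball_subset_ball (min_le_left _ _) hy.2, hy.1⟩
  have hKeq : K = φ.target ∩ Metric.ball y₀ δ :=
    Subset.antisymm (fun y hy => ⟨hKt hy, hy.2⟩)
      fun y hy => ⟨extChartAt_target_subset_range b₀ hy.1, hy.2⟩
  have hKu : UniqueDiffOn ℝ K := I.uniqueDiffOn.inter Metric.isOpen_ball
  have hKb : ∀ y ∈ K, ‖fderivWithin ℝ G K y - ContinuousLinearMap.id ℝ E‖ ≤ 1 / 2 := by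
    intro y hy
    rw [hKeq, fderivWithin_inter (Metric.isOpen_ball.mem_nhds hy.2)]
    exact (hball' ⟨Metric.ball_subset_ball (min_le_right _ _) hy.2, hKt hy⟩).le
  -- the part of `X` that is mapped to the neighbourhood corresponding to `K`
  set s : Set X := k ⁻¹' (φ.source ∩ φ ⁻¹' Metric.ball y₀ δ) with hs
  have hso : IsOpen s :=
    ((continuousOn_extChartAt b₀).isOpen_inter_preimage (isOpen_extChartAt_source b₀)
      Metric.isOpen_ball).preimage hcont
  have hxs : x₀ ∈ s := ⟨mem_extChartAt_source b₀, Metric.mem_ball_self (lt_min hδ₀ hδ₁)⟩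
  set ψ := extChartAt I' x₀ with hψ
  have hS := uniqueDiffOn_extChartAt_target_inter_preimage (I' := I') x₀ hso
  have hyS : ContDiffOn ℝ ∞ (fun t => φ (k (ψ.symm t))) (ψ.target ∩ ψ.symm ⁻¹' s) := by
    refine contDiffOn_of_comp_nearIdentity (I.convex_range.inter (convex_ball y₀ δ)) hKu
      (hGs.mono hKt) hKb hS (fun t ht => ?_) ?_
    · have h1 : k (ψ.symm t) ∈ φ.source ∩ φ ⁻¹' Metric.ball y₀ δ := ht.2
      exact ⟨extChartAt_target_subset_range b₀ (φ.map_source h1.1), h1.2⟩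
    · have h1 : ContDiffOn ℝ ∞ (fun t => L (emb (k (ψ.symm t)))) ψ.target :=
        L.contDiff.comp_contDiffOn
          (hk.comp_contMDiffOn (contMDiffOn_extChartAt_symm x₀)).contDiffOn
      refine (h1.mono inter_subset_left).congr fun t ht => ?_
      have h2 : k (ψ.symm t) ∈ φ.source ∩ φ ⁻¹' Metric.ball y₀ δ := ht.2
      simp only [hGdef, hg, φ.left_inv h2.1]
  refine contMDiffAt_iff.2 ⟨hcont.continuousAt, ?_⟩
  have hSm := extChartAt_target_inter_preimage_mem_nhdsWithin (I' := I') x₀ (hso.mem_nhds hxs)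
  exact (hyS _ (mem_of_mem_nhdsWithin (extChartAt_target_subset_range x₀
    (mem_extChartAt_target x₀)) hSm)).mono_of_mem_nhdsWithin hSm

end Lifting
end HamGeometry

namespace HamGeometry

/-! ### Manifolds locally modelled on manifolds -/

section Atlas

variable {E : Type*} [NormedAddCommGroup E] [NormedSpace ℝ E]
  {H : Type*} [TopologicalSpace H] {I : ModelWithCorners ℝ E H}

theorem isManifold_of_contMDiffOn {X : Type*} [TopologicalSpace X] [ChartedSpace H X]
    (h : ∀ e ∈ atlas H X, ∀ e' ∈ atlas H X,
      ContMDiffOn I I ∞ (fun y => e' (e.symm y)) (e.target ∩ e.symm ⁻¹' e'.source)) :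
    IsManifold I ∞ X := by
  refine isManifold_of_contDiffOn I ∞ X fun e e' he he' => ?_
  have h1 : ContMDiffOn 𝓘(ℝ, E) 𝓘(ℝ, E) ∞ (fun y => I (e' (e.symm (I.symm y))))
      (I.symm ⁻¹' (e.symm ≫ₕ e').source ∩ range I) := by
    refine I.contMDiff.comp_contMDiffOn ((h e he e' he').comp
      (I.contMDiffOn_symm.mono inter_subset_right) fun y hy => ?_)
    simpa using hy.1
  exact h1.contDiffOn

theorem contMDiffWithinAt_of_comp_model {E' H' X : Type*} [NormedAddCommGroup E'] [NormedSpace ℝ E']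
    [TopologicalSpace H'] {I' : ModelWithCorners ℝ E' H'} [TopologicalSpace X] [ChartedSpace H' X]
    {f : X → E} {s : Set X} {x : X} (h : ContMDiffWithinAt I' 𝓘(ℝ, E) ∞ f s x) (hx : x ∈ s)
    (hf : ∀ x ∈ s, f x ∈ range I) : ContMDiffWithinAt I' I ∞ (fun x => I.symm (f x)) s x :=
  (I.contMDiffOn_symm _ (hf x hx)).comp x h fun y hy => hf y hy

/-- A space that is locally modelled on a manifold `Y` is a manifold. -/
theorem isManifold_comp (I : ModelWithCorners ℝ E H) {X Y : Type*} [TopologicalSpace X]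
    [TopologicalSpace Y] [ChartedSpace H Y] [IsManifold I ∞ Y] [ChartedSpace Y X]
    (h : ∀ e ∈ atlas Y X, ∀ e' ∈ atlas Y X,
      ContMDiffOn I I ∞ (fun y => e' (e.symm y)) (e.target ∩ e.symm ⁻¹' e'.source)) :
    letI := ChartedSpace.comp H Y X
    IsManifold I ∞ X ∧ ∀ e ∈ atlas Y X, ContMDiffOn I I ∞ e e.source ∧
      ContMDiffOn I I ∞ e.symm e.target := by
  let inst := ChartedSpace.comp H Y X
  have key : ∀ e ∈ atlas Y X, ∀ e' ∈ atlas Y X, ∀ c ∈ atlas H Y,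
      ContMDiffOn I I ∞ (fun y => e' (e.symm (c.symm y)))
        ((e ≫ₕ c).target ∩ (e ≫ₕ c).symm ⁻¹' e'.source) := by
    intro e he e' he' c hc
    refine (h e he e' he').comp ((contMDiffOn_symm_of_mem_maximalAtlas
      (IsManifold.subset_maximalAtlas hc)).mono fun y hy => ?_) fun y hy => ?_
    · simp at hy; exact hy.1.1
    · simp at hy; exact ⟨hy.1.2, hy.2⟩
  have hman : IsManifold I ∞ X := by
    refine isManifold_of_contMDiffOn ?_
    rintro _ ⟨e, he, c, hc, rfl⟩ _ ⟨e', he', c', hc', rfl⟩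
    refine (contMDiffOn_of_mem_maximalAtlas (IsManifold.subset_maximalAtlas hc')).comp
      ((key e he e' he' c hc).mono fun y hy => ?_) fun y hy => ?_
    · simp at hy ⊢; exact ⟨hy.1, hy.2.1⟩
    · simp at hy ⊢; exact hy.2.2
  refine ⟨hman, fun e he => ⟨?_, ?_⟩⟩
  · -- in the chart `e ≫ c`, the map `e` is the inverse of `c`
    intro x hx
    set e₀ := chartAt Y x with he₀
    set c := chartAt H (e₀ x) with hc
    have hmem : e₀ ≫ₕ c ∈ atlas H X := ⟨e₀, chart_mem_atlas Y x, c, chart_mem_atlas H _, rfl⟩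
    have h1 := contMDiffOn_of_mem_maximalAtlas (I := I) (n := ∞) (IsManifold.subset_maximalAtlas hmem)
    have hxs : x ∈ (e₀ ≫ₕ c).source := by
      rw [OpenPartialHomeomorph.trans_source]
      exact ⟨mem_chart_source Y x, mem_chart_source H _⟩
    have h2 : ContMDiffOn I I ∞ (fun z => e (e₀.symm (c.symm ((e₀ ≫ₕ c) z))))
        ((e₀ ≫ₕ c).source ∩ e.source) := by
      refine (key e₀ (chart_mem_atlas Y x) e he c (chart_mem_atlas H _)).comp
        (h1.mono inter_subset_left) fun z hz => ?_
      refine ⟨(e₀ ≫ₕ c).map_source hz.1, ?_⟩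
      rw [mem_preimage, (e₀ ≫ₕ c).left_inv hz.1]; exact hz.2
    have h3 : ContMDiffOn I I ∞ e ((e₀ ≫ₕ c).source ∩ e.source) :=
      h2.congr fun z hz => (congrArg e ((e₀ ≫ₕ c).left_inv hz.1)).symm
    exact (h3.contMDiffAt (((e₀ ≫ₕ c).open_source.inter e.open_source).mem_nhds
      ⟨hxs, hx⟩)).contMDiffWithinAt
  · intro y hy
    set c := chartAt H y with hc
    have hmem : e ≫ₕ c ∈ atlas H X := ⟨e, he, c, chart_mem_atlas H _, rfl⟩
    have h1 := contMDiffOn_symm_of_mem_maximalAtlas (I := I) (n := ∞)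
      (IsManifold.subset_maximalAtlas hmem)
    have h2 : ContMDiffOn I I ∞ (fun z => (e ≫ₕ c).symm (c z)) (e.target ∩ c.source) := by
      refine h1.comp ((contMDiffOn_of_mem_maximalAtlas (IsManifold.subset_maximalAtlas
        (chart_mem_atlas H y))).mono inter_subset_right) fun z hz => ?_
      simp only [OpenPartialHomeomorph.trans_target, mem_preimage, mem_inter_iff]
      refine ⟨c.map_source hz.2, ?_⟩
      rw [c.left_inv hz.2]; exact hz.1
    have h3 : ContMDiffOn I I ∞ e.symm (e.target ∩ c.source) :=
      h2.congr fun z hz => by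
        simp only [OpenPartialHomeomorph.coe_trans_symm, Function.comp_apply]
        rw [c.left_inv hz.2]
    exact (h3.contMDiffAt ((e.open_target.inter c.open_source).mem_nhds
      ⟨hy, mem_chart_source H y⟩)).contMDiffWithinAt

end Atlas

/-! ### The closed disc -/

section Disc

open Complex

/-- The closed unit disc. -/
def UnitDisc : Type := Metric.closedBall (0 : ℂ) 1

namespace UnitDisc

instance : TopologicalSpace UnitDisc := inferInstanceAs (TopologicalSpace (Metric.closedBall (0 : ℂ) 1))
instance : T2Space UnitDisc := inferInstanceAs (T2Space (Metric.closedBall (0 : ℂ) 1))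
instance : CompactSpace UnitDisc :=
  isCompact_iff_compactSpace.1 (isCompact_closedBall (0 : ℂ) 1)

/-- The inclusion of the disc in the plane. -/
def val (z : UnitDisc) : ℂ := Subtype.val z

theorem continuous_val : Continuous val := continuous_subtype_val

theorem val_injective : Function.Injective val := Subtype.val_injective

theorem norm_val_le (z : UnitDisc) : ‖z.val‖ ≤ 1 := mem_closedBall_zero_iff.1 (Subtype.property z)

/-- The plane of the model half space of the disc as the complex plane. -/
noncomputable def planeEquiv : ℂ ≃L[ℝ] EuclideanSpace ℝ (Fin 2) :=
  Complex.orthonormalBasisOneI.repr.toContinuousLinearEquiv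

theorem planeEquiv_apply_zero (w : ℂ) : planeEquiv w 0 = w.re := by
  simp [planeEquiv]

theorem mem_range_model {y : EuclideanSpace ℝ (Fin 2)} : y ∈ range (𝓡∂ 2) ↔ 0 ≤ y 0 := by
  rw [range_modelWithCornersEuclideanHalfSpace]; rfl

/-- The point of the right half plane with the given coordinates. -/
noncomputable def halfPoint (x : EuclideanHalfSpace 2) : ℂ := planeEquiv.symm ((𝓡∂ 2) x)

theorem halfPoint_re_nonneg (x : EuclideanHalfSpace 2) : 0 ≤ (halfPoint x).re := by
  rw [← planeEquiv_apply_zero, halfPoint, ContinuousLinearEquiv.apply_symm_apply]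
  exact mem_range_model.1 (mem_range_self x)

theorem halfPoint_add_one_ne_zero (x : EuclideanHalfSpace 2) : halfPoint x + 1 ≠ 0 := fun h => by
  have h1 := congrArg Complex.re h
  have h2 := halfPoint_re_nonneg x
  simp at h1; linarith

/-- The Cayley transform that maps the disc without `p`, `p = ±1`, to the right half plane. -/
noncomputable def cayley (p z : ℂ) : ℂ := (p + z) / (p - z)

/-- The inverse Cayley transform. -/
noncomputable def cayleyInv (p w : ℂ) : ℂ := p * (w - 1) / (w + 1)

variable {p : ℂ}

theorem cayley_re_nonneg (hp : ‖p‖ = 1) {z : ℂ} (hz : ‖z‖ ≤ 1) : 0 ≤ (cayley p z).re := by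
  have h : (cayley p z).re = (normSq p - normSq z) / normSq (p - z) := by
    rw [cayley, div_re, normSq_apply p, normSq_apply z, ← add_div]
    congr 1
    simp; ring
  rw [h]
  refine div_nonneg (sub_nonneg.2 ?_) (normSq_nonneg _)
  rw [normSq_eq_norm_sq, normSq_eq_norm_sq, hp]
  gcongr

theorem norm_cayleyInv_le (hp : ‖p‖ = 1) {w : ℂ} (hw : 0 ≤ w.re) : ‖cayleyInv p w‖ ≤ 1 := by
  rw [cayleyInv, norm_div, norm_mul, hp, one_mul]
  refine div_le_one_of_le₀ ?_ (norm_nonneg _)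
  refine abs_le_of_sq_le_sq' ?_ (norm_nonneg _) |>.2
  rw [← normSq_eq_norm_sq, ← normSq_eq_norm_sq, normSq_apply, normSq_apply]
  simp; nlinarith

theorem cayleyInv_cayley (hp : p ≠ 0) {z : ℂ} (hz : z ≠ p) : cayleyInv p (cayley p z) = z := by
  have h1 : p - z ≠ 0 := sub_ne_zero.2 hz.symm
  have h2 : cayley p z + 1 ≠ 0 := by
    rw [cayley, div_add_one h1]
    refine div_ne_zero ?_ h1
    rw [show p + z + (p - z) = 2 * p by ring]
    exact mul_ne_zero two_ne_zero hp
  rw [cayleyInv, div_eq_iff h2, cayley]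
  field_simp
  ring

theorem cayley_cayleyInv (hp : p ≠ 0) {w : ℂ} (hw : w + 1 ≠ 0) :
    cayleyInv p w ≠ p ∧ cayley p (cayleyInv p w) = w := by
  have h1 : cayleyInv p w ≠ p := by
    rw [cayleyInv, Ne, div_eq_iff hw, mul_right_inj' hp, sub_eq_iff_eq_add, add_assoc, left_eq_add]
    norm_num
  refine ⟨h1, ?_⟩
  rw [cayley, div_eq_iff (sub_ne_zero.2 h1.symm), cayleyInv]
  field_simp
  ring

/-- The chart of the disc given by a Cayley transform. -/
noncomputable def chart (p : ℂ) (hp : ‖p‖ = 1) :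
    OpenPartialHomeomorph UnitDisc (EuclideanHalfSpace 2) where
  toFun z := (𝓡∂ 2).symm (planeEquiv (cayley p z.val))
  invFun x := ⟨cayleyInv p (halfPoint x),
    mem_closedBall_zero_iff.2 (norm_cayleyInv_le hp (halfPoint_re_nonneg x))⟩
  source := {z | z.val ≠ p}
  target := univ
  map_source' _ _ := mem_univ _
  map_target' x _ := (cayley_cayleyInv (norm_ne_zero_iff.1 (hp ▸ one_ne_zero))
    (halfPoint_add_one_ne_zero x)).1
  left_inv' z hz := by
    refine Subtype.ext ?_
    have h : planeEquiv (cayley p z.val) ∈ range (𝓡∂ 2) :=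
      mem_range_model.2 (by rw [planeEquiv_apply_zero]; exact cayley_re_nonneg hp z.norm_val_le)
    simp only [halfPoint]
    rw [(𝓡∂ 2).right_inv h, ContinuousLinearEquiv.symm_apply_apply]
    exact cayleyInv_cayley (norm_ne_zero_iff.1 (hp ▸ one_ne_zero)) hz
  right_inv' x _ := by
    simp only [val]
    rw [(cayley_cayleyInv (norm_ne_zero_iff.1 (hp ▸ one_ne_zero)) (halfPoint_add_one_ne_zero x)).2,
      halfPoint, ContinuousLinearEquiv.apply_symm_apply, (𝓡∂ 2).left_inv]
  open_source := isOpen_ne_fun continuous_val continuous_const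
  open_target := isOpen_univ
  continuousOn_toFun := by
    refine (𝓡∂ 2).continuous_symm.comp_continuousOn (planeEquiv.continuous.comp_continuousOn ?_)
    exact (continuous_const.add continuous_val).continuousOn.div
      (continuous_const.sub continuous_val).continuousOn fun z hz => sub_ne_zero.2 (Ne.symm hz)
  continuousOn_invFun := by
    have h : Continuous halfPoint := planeEquiv.symm.continuous.comp (𝓡∂ 2).continuous
    refine (Continuous.subtype_mk ?_ _).continuousOn
    exact (continuous_const.mul (h.sub continuous_const)).div (h.add continuous_const)
      halfPoint_add_one_ne_zero

theorem norm_neg_one : ‖(-1 : ℂ)‖ = 1 := by simp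

open Classical in
noncomputable instance : ChartedSpace (EuclideanHalfSpace 2) UnitDisc where
  atlas := {chart 1 norm_one, chart (-1) norm_neg_one}
  chartAt z := if z.val = 1 then chart (-1) norm_neg_one else chart 1 norm_one
  mem_chart_source z := by
    split_ifs with h
    · simp only [chart, mem_ofPred_eq, h]; norm_num
    · exact h
  chart_mem_atlas z := by
    split_ifs <;> simp

theorem mem_atlas {e : OpenPartialHomeomorph UnitDisc (EuclideanHalfSpace 2)}
    (he : e ∈ atlas (EuclideanHalfSpace 2) UnitDisc) :
    ∃ (p : ℂ) (hp : ‖p‖ = 1), e = chart p hp := by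
  rcases he with rfl | rfl
  · exact ⟨1, norm_one, rfl⟩
  · exact ⟨-1, norm_neg_one, rfl⟩

theorem contMDiff_halfPoint : ContMDiff (𝓡∂ 2) 𝓘(ℝ, ℂ) ∞ halfPoint :=
  planeEquiv.symm.contDiff.contMDiff.comp (𝓡∂ 2).contMDiff

theorem contDiffAt_cayley {z : ℂ} (hz : z ≠ p) : ContDiffAt ℝ ∞ (cayley p) z :=
  ContDiffAt.restrict_scalars ℝ ((contDiffAt_const.add contDiffAt_id).div
    (contDiffAt_const.sub contDiffAt_id) (sub_ne_zero.2 hz.symm))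

theorem contDiffAt_cayleyInv {w : ℂ} (hw : w + 1 ≠ 0) : ContDiffAt ℝ ∞ (cayleyInv p) w :=
  ContDiffAt.restrict_scalars ℝ ((contDiffAt_const.mul (contDiffAt_id.sub contDiffAt_const)).div
    (contDiffAt_id.add contDiffAt_const) hw)

theorem contMDiff_cayleyInv_halfPoint :
    ContMDiff (𝓡∂ 2) 𝓘(ℝ, ℂ) ∞ fun x => cayleyInv p (halfPoint x) := fun x =>
  (contDiffAt_cayleyInv (halfPoint_add_one_ne_zero x)).contMDiffAt.comp x (contMDiff_halfPoint x)

instance : IsManifold (𝓡∂ 2) ∞ UnitDisc := by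
  refine isManifold_of_contMDiffOn fun e he e' he' => ?_
  obtain ⟨p, hp, rfl⟩ := mem_atlas he
  obtain ⟨q, hq, rfl⟩ := mem_atlas he'
  intro x hx
  have hq' : ∀ x ∈ (chart p hp).target ∩ (chart p hp).symm ⁻¹' (chart q hq).source,
      cayleyInv p (halfPoint x) ≠ q := fun x hx => hx.2
  refine contMDiffWithinAt_of_comp_model ?_ hx fun x hx =>
    mem_range_model.2 (by
      rw [planeEquiv_apply_zero]; exact cayley_re_nonneg hq (norm_val_le _))
  have h1 : ContMDiffAt (𝓡∂ 2) 𝓘(ℝ, ℂ) ∞ (fun x => cayley q (cayleyInv p (halfPoint x))) x :=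
    (contDiffAt_cayley (hq' x hx)).contMDiffAt.comp x (contMDiff_cayleyInv_halfPoint x)
  exact (planeEquiv.contDiff.contMDiff.contMDiffAt.comp x h1).contMDiffWithinAt

theorem contMDiff_val : ContMDiff (𝓡∂ 2) 𝓘(ℝ, ℂ) ∞ val := by
  intro z
  obtain ⟨p, hp, he⟩ := mem_atlas (chart_mem_atlas (EuclideanHalfSpace 2) z)
  have h1 := (contMDiffOn_chart (I := 𝓡∂ 2) (n := ∞) (x := z)).contMDiffAt
    (chart_source_mem_nhds (EuclideanHalfSpace 2) z)
  have h2 := (contMDiff_cayleyInv_halfPoint (p := p) (chartAt _ z z)).comp z h1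
  refine h2.congr_of_eventuallyEq ?_
  filter_upwards [chart_source_mem_nhds (EuclideanHalfSpace 2) z] with z' hz'
  have h3 := (chartAt (EuclideanHalfSpace 2) z).left_inv hz'
  rw [← h3]
  simp only [Function.comp_apply]
  rw [h3]
  conv_lhs => rw [← h3]
  rw [he]
  rfl

theorem mfderiv_val_injective (z : UnitDisc) :
    Function.Injective (mfderiv (𝓡∂ 2) 𝓘(ℝ, ℂ) val z) := by
  obtain ⟨p, hp, he⟩ := mem_atlas (chart_mem_atlas (EuclideanHalfSpace 2) z)
  have hzp : z.val ≠ p := by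
    have := mem_chart_source (EuclideanHalfSpace 2) z
    rw [he] at this; exact this
  have hinv := (isInvertible_mfderiv_extChartAt (I := 𝓡∂ 2) (mem_extChartAt_source (I := 𝓡∂ 2) z)).injective
  have hR : ContDiffAt ℝ ∞ (fun w => planeEquiv (cayley p w)) z.val :=
    planeEquiv.contDiff.contDiffAt.comp _ (contDiffAt_cayley hzp)
  have hR' := (hR.contMDiffAt).mdifferentiableAt (by simp)
  have hv := (contMDiff_val z).mdifferentiableAt (by simp)
  have hcomp : mfderiv (𝓡∂ 2) 𝓘(ℝ, EuclideanSpace ℝ (Fin 2)) (extChartAt (𝓡∂ 2) z) z =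
      (mfderiv 𝓘(ℝ, ℂ) 𝓘(ℝ, EuclideanSpace ℝ (Fin 2)) (fun w => planeEquiv (cayley p w)) z.val).comp
        (mfderiv (𝓡∂ 2) 𝓘(ℝ, ℂ) val z) := by
    rw [← mfderiv_comp z hR' hv]
    refine Filter.EventuallyEq.mfderiv_eq ?_
    filter_upwards [] with z'
    have h : planeEquiv (cayley p z'.val) ∈ range (𝓡∂ 2) :=
      mem_range_model.2 (by rw [planeEquiv_apply_zero]; exact cayley_re_nonneg hp z'.norm_val_le)
    simp only [extChartAt, he]
    exact (𝓡∂ 2).right_inv h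
  rw [hcomp] at hinv
  exact Function.Injective.of_comp hinv

end UnitDisc
end Disc
end HamGeometry

namespace HamGeometry

universe u

namespace FibrationData

/-! ### The pullback of a fibre bundle -/

section Pullback

variable {n : ℕ} {M : Type u} [TopologicalSpace M]
  [ChartedSpace (EuclideanSpace ℝ (Fin (2 * n))) M]
  {S : ModelSurface} (F : FibrationData (n := n) M S)

/-- The open set of a chosen trivialisation around `b`. -/
noncomputable def trivSet (b : F.B) : Set F.B := (F.locally_trivial b).choose

/-- A chosen trivialisation around `b`. -/
noncomputable def triv (b : F.B) : OpenPartialHomeomorph F.P (F.B × M) :=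
  (F.locally_trivial b).choose_spec.2.choose

theorem mem_trivSet (b : F.B) : b ∈ F.trivSet b := (F.locally_trivial b).choose_spec.1

variable {F}

theorem mem_triv_source {b : F.B} {p : F.P} : p ∈ (F.triv b).source ↔ F.π p ∈ F.trivSet b := by
  rw [triv, (F.locally_trivial b).choose_spec.2.choose_spec.1]; rfl

theorem mem_triv_target {b : F.B} {y : F.B × M} :
    y ∈ (F.triv b).target ↔ y.1 ∈ F.trivSet b := by
  rw [triv, (F.locally_trivial b).choose_spec.2.choose_spec.2.1]; simp [trivSet]

theorem triv_fst {b : F.B} {p : F.P} (hp : p ∈ (F.triv b).source) : (F.triv b p).1 = F.π p :=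
  (F.locally_trivial b).choose_spec.2.choose_spec.2.2.1 p hp

theorem contMDiffOn_triv (b : F.B) :
    ContMDiffOn (totalModel n) (totalModel n) ∞ (F.triv b) (F.triv b).source :=
  (F.locally_trivial b).choose_spec.2.choose_spec.2.2.2.1

theorem contMDiffOn_triv_symm (b : F.B) :
    ContMDiffOn (totalModel n) (totalModel n) ∞ (F.triv b).symm (F.triv b).target :=
  (F.locally_trivial b).choose_spec.2.choose_spec.2.2.2.2

theorem π_triv_symm {b : F.B} {y : F.B × M} (hy : y ∈ (F.triv b).target) :
    F.π ((F.triv b).symm y) = y.1 := by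
  rw [← triv_fst ((F.triv b).map_target hy), (F.triv b).right_inv hy]

variable {D : Type} [TopologicalSpace D] [ChartedSpace (EuclideanHalfSpace 2) D] {f : D → F.B}

/-- The total space of the pullback of the fibre bundle `F` under the map `f`. -/
@[nolint unusedArguments]
def Pullback (_hf : ContMDiff (𝓡∂ 2) (𝓡∂ 2) ∞ f) : Type u := {q : D × F.P // f q.1 = F.π q.2}

namespace Pullback

variable {hf : ContMDiff (𝓡∂ 2) (𝓡∂ 2) ∞ f}

/-- The projection to the new base. -/
def fst (q : Pullback hf) : D := (Subtype.val q).1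

/-- The bundle map that covers `f`. -/
def snd (q : Pullback hf) : F.P := (Subtype.val q).2

theorem π_snd (q : Pullback hf) : F.π q.snd = f q.fst := (Subtype.property q).symm

/-- The point of the pullback with the given components. -/
def mk (d : D) (p : F.P) (h : F.π p = f d) : Pullback hf := ⟨(d, p), h.symm⟩

theorem ext {q q' : Pullback hf} (h1 : q.fst = q'.fst) (h2 : q.snd = q'.snd) : q = q' :=
  Subtype.ext (Prod.ext h1 h2)

instance : TopologicalSpace (Pullback hf) :=
  inferInstanceAs (TopologicalSpace {q : D × F.P // f q.1 = F.π q.2})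

instance [T2Space D] : T2Space (Pullback hf) :=
  inferInstanceAs (T2Space {q : D × F.P // f q.1 = F.π q.2})

theorem continuous_fst : Continuous (fst (hf := hf)) := _root_.continuous_fst.comp continuous_subtype_val

theorem continuous_snd : Continuous (snd (hf := hf)) := _root_.continuous_snd.comp continuous_subtype_val

open Classical in
/-- The trivialisation of the pullback that a trivialisation of the bundle induces. -/
noncomputable def triv (q₀ : Pullback hf) :
    OpenPartialHomeomorph (Pullback hf) (D × M) where
  toFun q := (q.fst, (F.triv (f q₀.fst) q.snd).2)
  invFun y := if h : (f y.1, y.2) ∈ (F.triv (f q₀.fst)).target then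
    mk y.1 ((F.triv (f q₀.fst)).symm (f y.1, y.2)) (π_triv_symm h) else q₀
  source := {q | q.snd ∈ (F.triv (f q₀.fst)).source}
  target := {y | (f y.1, y.2) ∈ (F.triv (f q₀.fst)).target}
  map_source' q hq := by
    rw [mem_ofPred_eq, mem_triv_target]
    have h := mem_triv_source.1 hq
    rwa [π_snd] at h
  map_target' y hy := by
    rw [mem_ofPred_eq] at hy
    simp only [dif_pos hy, mem_ofPred_eq]
    exact (F.triv (f q₀.fst)).map_target hy
  left_inv' q hq := by
    have h1 : (f q.fst, (F.triv (f q₀.fst) q.snd).2) = F.triv (f q₀.fst) q.snd :=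
      Prod.ext (by rw [triv_fst hq, π_snd]) rfl
    have h2 : (f q.fst, (F.triv (f q₀.fst) q.snd).2) ∈ (F.triv (f q₀.fst)).target := by
      rw [h1]; exact (F.triv (f q₀.fst)).map_source hq
    rw [dif_pos h2]
    refine ext rfl ?_
    change (F.triv (f q₀.fst)).symm _ = q.snd
    rw [h1, (F.triv (f q₀.fst)).left_inv hq]
  right_inv' y hy := by
    rw [mem_ofPred_eq] at hy
    simp only [dif_pos hy]
    refine Prod.ext rfl ?_
    change (F.triv (f q₀.fst) ((F.triv (f q₀.fst)).symm _)).2 = y.2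
    rw [(F.triv (f q₀.fst)).right_inv hy]
  open_source := (F.triv (f q₀.fst)).open_source.preimage continuous_snd
  open_target := (F.triv (f q₀.fst)).open_target.preimage
    ((hf.continuous.comp _root_.continuous_fst).prodMk _root_.continuous_snd)
  continuousOn_toFun := continuous_fst.continuousOn.prodMk
    (_root_.continuous_snd.comp_continuousOn ((F.triv (f q₀.fst)).continuousOn.comp
      continuous_snd.continuousOn fun _ h => h))
  continuousOn_invFun := by
    refine IsInducing.subtypeVal.continuousOn_iff.2 ?_
    have h : ContinuousOn (fun y : D × M => (y.1, (F.triv (f q₀.fst)).symm (f y.1, y.2)))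
        {y | (f y.1, y.2) ∈ (F.triv (f q₀.fst)).target} :=
      _root_.continuous_fst.continuousOn.prodMk ((F.triv (f q₀.fst)).continuousOn_symm.comp
        ((hf.continuous.comp _root_.continuous_fst).prodMk _root_.continuous_snd).continuousOn fun _ h => h)
    refine h.congr fun y hy => ?_
    rw [mem_ofPred_eq] at hy
    change Subtype.val (dite _ _ _ : Pullback hf) = _
    rw [dif_pos hy]; rfl

open Classical in
theorem fst_triv_symm (q₀ : Pullback hf) {y : D × M}
    (hy : y ∈ (triv q₀).target) : ((triv q₀).symm y).fst = y.1 := by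
  change (f y.1, y.2) ∈ (F.triv (f q₀.fst)).target at hy
  change (dite _ _ _ : Pullback hf).fst = _
  rw [dif_pos hy]; rfl

open Classical in
theorem snd_triv_symm (q₀ : Pullback hf) {y : D × M}
    (hy : y ∈ (triv q₀).target) :
    ((triv q₀).symm y).snd = (F.triv (f q₀.fst)).symm (f y.1, y.2) := by
  change (f y.1, y.2) ∈ (F.triv (f q₀.fst)).target at hy
  change (dite _ _ _ : Pullback hf).snd = _
  rw [dif_pos hy]; rfl

theorem mem_triv_source_self (q₀ : Pullback hf) : q₀ ∈ (triv q₀).source := by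
  change q₀.snd ∈ (F.triv (f q₀.fst)).source
  rw [mem_triv_source, π_snd]
  exact F.mem_trivSet _

/-- The trivialisations as an atlas of charts with values in the product. -/
@[reducible] noncomputable def trivCharted : ChartedSpace (D × M) (Pullback hf) where
  atlas := range triv
  chartAt := triv
  mem_chart_source := mem_triv_source_self
  chart_mem_atlas q := mem_range_self q

theorem contMDiff_prodMap (hf : ContMDiff (𝓡∂ 2) (𝓡∂ 2) ∞ f) :
    ContMDiff (totalModel n) (totalModel n) ∞ fun y : D × M => (f y.1, y.2) :=
  (hf.comp contMDiff_fst).prodMk contMDiff_snd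

theorem contMDiffOn_snd_triv_symm (q₀ : Pullback hf) :
    ContMDiffOn (totalModel n) (totalModel n) ∞
      (fun y => ((triv q₀).symm y).snd) (triv q₀).target :=
  ((contMDiffOn_triv_symm (f q₀.fst)).comp (contMDiff_prodMap hf).contMDiffOn fun _ h => h).congr
    fun _ hy => snd_triv_symm q₀ hy

theorem contMDiffOn_trivCharted
    {e e' : OpenPartialHomeomorph (Pullback hf) (D × M)}
    (he : e ∈ (trivCharted (hf := hf)).atlas) (he' : e' ∈ (trivCharted (hf := hf)).atlas) :
    ContMDiffOn (totalModel n) (totalModel n) ∞ (fun y => e' (e.symm y))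
      (e.target ∩ e.symm ⁻¹' e'.source) := by
  obtain ⟨q, rfl⟩ := he
  obtain ⟨q', rfl⟩ := he'
  refine ContMDiffOn.prodMk (contMDiff_fst.contMDiffOn.congr fun y hy =>
    fst_triv_symm q hy.1) ?_
  exact contMDiff_snd.comp_contMDiffOn ((contMDiffOn_triv (f q'.fst)).comp
    ((contMDiffOn_snd_triv_symm q).mono inter_subset_left) fun y hy => hy.2)

variable [IsManifold (𝓡∂ 2) ∞ D] [IsManifold (𝓡 (2 * n)) ∞ M]

noncomputable instance : ChartedSpace
    (ModelProd (EuclideanHalfSpace 2) (EuclideanSpace ℝ (Fin (2 * n)))) (Pullback hf) :=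
  letI := trivCharted (hf := hf)
  ChartedSpace.comp _ (D × M) _

instance : IsManifold (totalModel n) ∞ (Pullback hf) :=
  letI := trivCharted (hf := hf)
  (isManifold_comp (totalModel n) fun _ he _ he' => contMDiffOn_trivCharted he he').1

theorem contMDiffOn_triv (q : Pullback hf) :
    ContMDiffOn (totalModel n) (totalModel n) ∞ (triv q) (triv q).source :=
  letI := trivCharted (hf := hf)
  ((isManifold_comp (totalModel n) fun _ he _ he' => contMDiffOn_trivCharted he he').2 _
    (mem_range_self q)).1

theorem contMDiffOn_triv_symm (q : Pullback hf) :
    ContMDiffOn (totalModel n) (totalModel n) ∞ (triv q).symm (triv q).target :=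
  letI := trivCharted (hf := hf)
  ((isManifold_comp (totalModel n) fun _ he _ he' => contMDiffOn_trivCharted he he').2 _
    (mem_range_self q)).2

theorem contMDiff_fst : ContMDiff (totalModel n) (𝓡∂ 2) ∞ (fst (hf := hf)) := by
  intro q
  have h := (contMDiffOn_triv q).contMDiffAt ((triv q).open_source.mem_nhds (mem_triv_source_self q))
  exact (_root_.contMDiff_fst (I := 𝓡∂ 2) (J := 𝓡 (2 * n)) (M := D) (N := M)).contMDiffAt.comp q h

theorem contMDiff_snd : ContMDiff (totalModel n) (totalModel n) ∞ (snd (hf := hf)) := by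
  intro q
  have h1 := (contMDiffOn_triv q).contMDiffAt ((triv q).open_source.mem_nhds (mem_triv_source_self q))
  have h2 := (contMDiffOn_snd_triv_symm q).contMDiffAt
    ((triv q).open_target.mem_nhds ((triv q).map_source (mem_triv_source_self q)))
  refine (h2.comp q h1).congr_of_eventuallyEq ?_
  filter_upwards [(triv q).open_source.mem_nhds (mem_triv_source_self q)] with q' hq'
  simp only [Function.comp_apply, (triv q).left_inv hq']

section Maps

variable {E' H' X : Type*} [NormedAddCommGroup E'] [NormedSpace ℝ E'] [TopologicalSpace H']
  {I' : ModelWithCorners ℝ E' H'} [TopologicalSpace X] [ChartedSpace H' X] {s : Set X} {x : X}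
  {k : X → Pullback hf}

omit [IsManifold (𝓡∂ 2) ∞ D] [IsManifold (𝓡 (2 * n)) ∞ M] in
theorem eventuallyEq_triv_symm (h1 : ContinuousWithinAt (fun x => (k x).fst) s x)
    (h2 : ContinuousWithinAt (fun x => (k x).snd) s x) :
    k =ᶠ[𝓝[s] x] fun y => (triv (k x)).symm
      ((k y).fst, (F.triv (f (k x).fst) (k y).snd).2) := by
  have h3 : ContinuousWithinAt k s x :=
    IsInducing.subtypeVal.continuousWithinAt_iff.2 (h1.prodMk h2)
  filter_upwards [h3 ((triv (k x)).open_source.mem_nhds (mem_triv_source_self (k x)))] with y hy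
  exact ((triv (k x)).left_inv hy).symm

theorem contMDiffWithinAt (h1 : ContMDiffWithinAt I' (𝓡∂ 2) ∞ (fun x => (k x).fst) s x)
    (h2 : ContMDiffWithinAt I' (totalModel n) ∞ (fun x => (k x).snd) s x) (hx : x ∈ s) :
    ContMDiffWithinAt I' (totalModel n) ∞ k s x := by
  have hs := mem_triv_source_self (k x)
  have h3 := (contMDiffOn_triv_symm (k x)).contMDiffAt
    ((triv (k x)).open_target.mem_nhds ((triv (k x)).map_source hs))
  have h4 := (FibrationData.contMDiffOn_triv (f (k x).fst)).contMDiffAt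
    ((F.triv (f (k x).fst)).open_source.mem_nhds hs)
  have h5 := h3.comp_contMDiffWithinAt x (h1.prodMk ((_root_.contMDiff_snd.contMDiffAt.comp _
    h4).comp_contMDiffWithinAt x h2))
  exact h5.congr_of_eventuallyEq_of_mem
    (eventuallyEq_triv_symm h1.continuousWithinAt h2.continuousWithinAt) hx

theorem mdifferentiableWithinAt
    (h1 : MDifferentiableWithinAt I' (𝓡∂ 2) (fun x => (k x).fst) s x)
    (h2 : MDifferentiableWithinAt I' (totalModel n) (fun x => (k x).snd) s x) (hx : x ∈ s) :
    MDifferentiableWithinAt I' (totalModel n) k s x := by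
  have hs := mem_triv_source_self (k x)
  have h3 := ((contMDiffOn_triv_symm (k x)).contMDiffAt
    ((triv (k x)).open_target.mem_nhds ((triv (k x)).map_source hs))).mdifferentiableAt (by simp)
  have h4 := ((FibrationData.contMDiffOn_triv (f (k x).fst)).contMDiffAt
    ((F.triv (f (k x).fst)).open_source.mem_nhds hs)).mdifferentiableAt (by simp)
  have h5 := (h3.comp_mdifferentiableWithinAt x (h1.prodMk ((mdifferentiableAt_snd.comp _
    h4).comp_mdifferentiableWithinAt x h2)))
  exact h5.congr_of_eventuallyEq
    (eventuallyEq_triv_symm h1.continuousWithinAt h2.continuousWithinAt)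
    ((eventuallyEq_triv_symm h1.continuousWithinAt h2.continuousWithinAt).eq_of_nhdsWithin hx)

end Maps

end Pullback
end Pullback
end FibrationData
end HamGeometry

namespace HamGeometry

universe u

namespace FibrationData

/-! ### Tangent vectors of the pullback -/

section TangentPullback

variable {n : ℕ} {M : Type u} [TopologicalSpace M]
  [ChartedSpace (EuclideanSpace ℝ (Fin (2 * n))) M]
  {S : ModelSurface} {F : FibrationData (n := n) M S}

theorem mdifferentiable_triv (b : F.B) :
    (F.triv b).MDifferentiable (totalModel n) (totalModel n) :=
  ⟨(F.contMDiffOn_triv b).mdifferentiableOn (by simp),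
    (F.contMDiffOn_triv_symm b).mdifferentiableOn (by simp)⟩

theorem mfderiv_triv_fst {b : F.B} {p : F.P} (hp : p ∈ (F.triv b).source)
    (v : TangentSpace (totalModel n) p) :
    (mfderiv (totalModel n) (totalModel n) (F.triv b) p v : EuclideanSpace ℝ (Fin 2) ×
      EuclideanSpace ℝ (Fin (2 * n))).1 = mfderiv (totalModel n) (𝓡∂ 2) F.π p v := by
  have h1 := (mdifferentiable_triv b).mdifferentiableAt hp
  have h2 := mfderiv_comp_apply p (mdifferentiableAt_fst (I := 𝓡∂ 2) (I' := 𝓡 (2 * n))) h1 v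
  rw [mfderiv_fst] at h2
  refine h2.symm.trans ?_
  congr 1
  refine Filter.EventuallyEq.mfderiv_eq ?_
  filter_upwards [(F.triv b).open_source.mem_nhds hp] with p' hp'
  exact triv_fst hp'

variable {D : Type} [TopologicalSpace D] [ChartedSpace (EuclideanHalfSpace 2) D] {f : D → F.B}
  {hf : ContMDiff (𝓡∂ 2) (𝓡∂ 2) ∞ f} [IsManifold (𝓡∂ 2) ∞ D] [IsManifold (𝓡 (2 * n)) ∞ M]

namespace Pullback

theorem mfderiv_π_snd (q : Pullback hf) (v : TangentSpace (totalModel n) q) :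
    mfderiv (totalModel n) (𝓡∂ 2) F.π q.snd (mfderiv (totalModel n) (totalModel n) snd q v) =
      mfderiv (𝓡∂ 2) (𝓡∂ 2) f q.fst (mfderiv (totalModel n) (𝓡∂ 2) fst q v) := by
  have h1 := mfderiv_comp_apply q (F.π_smooth.mdifferentiableAt (x := q.snd) (by simp))
    ((contMDiff_snd (hf := hf)).mdifferentiableAt (by simp)) v
  have h2 := mfderiv_comp_apply q (hf.mdifferentiableAt (x := q.fst) (by simp))
    ((contMDiff_fst (hf := hf)).mdifferentiableAt (by simp)) v
  have h3 : F.π ∘ snd (hf := hf) = f ∘ fst := funext π_snd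
  rw [h3] at h1
  exact h1.symm.trans h2

theorem mdifferentiable_triv (q : Pullback hf) :
    (triv q).MDifferentiable (totalModel n) (totalModel n) :=
  ⟨(contMDiffOn_triv q).mdifferentiableOn (by simp),
    (contMDiffOn_triv_symm q).mdifferentiableOn (by simp)⟩

theorem tangent_eq_zero {q : Pullback hf} {v : TangentSpace (totalModel n) q}
    (h1 : mfderiv (totalModel n) (𝓡∂ 2) fst q v = 0)
    (h2 : mfderiv (totalModel n) (totalModel n) snd q v = 0) : v = 0 := by
  have hs := mem_triv_source_self q
  have d1 : MDifferentiableAt (totalModel n) (𝓡∂ 2) (fst (hf := hf)) q :=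
    contMDiff_fst.mdifferentiableAt (by simp)
  have d2 : MDifferentiableAt (totalModel n) (totalModel n) (snd (hf := hf)) q :=
    contMDiff_snd.mdifferentiableAt (by simp)
  have d3 := (FibrationData.mdifferentiable_triv (f q.fst)).mdifferentiableAt hs
  have d4 : MDifferentiableAt (totalModel n) (𝓡 (2 * n)) (fun p => (F.triv (f q.fst) p).2) q.snd :=
    (mdifferentiableAt_snd (I := 𝓡∂ 2) (I' := 𝓡 (2 * n))).comp q.snd d3
  have d5 : mfderiv (totalModel n) (totalModel n) (triv q) q v =
      ((mfderiv (totalModel n) (𝓡∂ 2) fst q v, mfderiv (totalModel n) (𝓡 (2 * n))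
        ((fun p => (F.triv (f q.fst) p).2) ∘ snd) q v) :
        EuclideanSpace ℝ (Fin 2) × EuclideanSpace ℝ (Fin (2 * n))) := by
    have := mfderiv_prodMk d1 (d4.comp q d2)
    exact congrArg (fun L => L v) this
  rw [mfderiv_comp_apply q d4 d2, h1, h2, map_zero] at d5
  exact (mdifferentiable_triv q).mfderiv_injective hs (d5.trans (map_zero _).symm)

theorem exists_tangent_aux {q₀ : Pullback hf} {y : D × M} (hy : y ∈ (triv q₀).target)
    (e : TangentSpace (𝓡∂ 2) ((triv q₀).symm y).fst)
    (u : TangentSpace (totalModel n) ((triv q₀).symm y).snd)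
    (h : mfderiv (totalModel n) (𝓡∂ 2) F.π ((triv q₀).symm y).snd u =
      mfderiv (𝓡∂ 2) (𝓡∂ 2) f ((triv q₀).symm y).fst e) :
    ∃ v : TangentSpace (totalModel n) ((triv q₀).symm y),
      mfderiv (totalModel n) (𝓡∂ 2) fst ((triv q₀).symm y) v = e ∧
      mfderiv (totalModel n) (totalModel n) snd ((triv q₀).symm y) v = u := by
  have hsrc : (triv q₀).symm y ∈ (triv q₀).source := (triv q₀).map_target hy
  have hsrc' : ((triv q₀).symm y).snd ∈ (F.triv (f q₀.fst)).source := hsrc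
  have hd := (mdifferentiable_triv q₀).mdifferentiableAt_symm hy
  set u' : EuclideanSpace ℝ (Fin 2) × EuclideanSpace ℝ (Fin (2 * n)) :=
    mfderiv (totalModel n) (totalModel n) (F.triv (f q₀.fst)) ((triv q₀).symm y).snd u with hu'
  have hu1 : u'.1 = mfderiv (totalModel n) (𝓡∂ 2) F.π ((triv q₀).symm y).snd u := mfderiv_triv_fst hsrc' u
  set w : TangentSpace (totalModel n) y := ((e, u'.2) : EuclideanSpace ℝ (Fin 2) ×
    EuclideanSpace ℝ (Fin (2 * n))) with hw
  have d1 : MDifferentiableAt (totalModel n) (𝓡∂ 2) (fst (hf := hf)) ((triv q₀).symm y) :=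
    contMDiff_fst.mdifferentiableAt (by simp)
  have d2 : MDifferentiableAt (totalModel n) (totalModel n) (snd (hf := hf)) ((triv q₀).symm y) :=
    contMDiff_snd.mdifferentiableAt (by simp)
  have d3 := (FibrationData.mdifferentiable_triv (f q₀.fst)).mdifferentiableAt hsrc'
  refine ⟨mfderiv (totalModel n) (totalModel n) (triv q₀).symm y w, ?_, ?_⟩
  · rw [← mfderiv_comp_apply y d1 hd]
    have h1 : fst ∘ (triv q₀).symm =ᶠ[𝓝 y] Prod.fst := by
      filter_upwards [(triv q₀).open_target.mem_nhds hy] with y' hy'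
      exact fst_triv_symm q₀ hy'
    rw [h1.mfderiv_eq, mfderiv_fst]
    rfl
  · refine (FibrationData.mdifferentiable_triv (f q₀.fst)).mfderiv_injective hsrc' ?_
    have e1 := mfderiv_comp_apply y d2 hd w
    have e2 := mfderiv_comp_apply y (g := F.triv (f q₀.fst)) (f := snd ∘ (triv q₀).symm) d3
      (d2.comp y hd) w
    have h1 : (F.triv (f q₀.fst)) ∘ (snd ∘ (triv q₀).symm) =ᶠ[𝓝 y] fun y => (f y.1, y.2) := by
      filter_upwards [(triv q₀).open_target.mem_nhds hy] with y' hy'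
      simp only [Function.comp_apply, snd_triv_symm q₀ hy']
      exact (F.triv (f q₀.fst)).right_inv hy'
    rw [h1.mfderiv_eq] at e2
    have d4 : MDifferentiableAt (totalModel n) (𝓡∂ 2) (fun y : D × M => f y.1) y :=
      (hf.mdifferentiableAt (by simp)).comp y mdifferentiableAt_fst
    have e3 : mfderiv (totalModel n) (totalModel n) (fun y : D × M => (f y.1, y.2)) y w =
        ((mfderiv (totalModel n) (𝓡∂ 2) (fun y : D × M => f y.1) y w,
          mfderiv (totalModel n) (𝓡 (2 * n)) (Prod.snd : D × M → M) y w) :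
          EuclideanSpace ℝ (Fin 2) × EuclideanSpace ℝ (Fin (2 * n))) :=
      congrArg (fun L => L w) (mfderiv_prodMk d4 mdifferentiableAt_snd)
    have e4 : mfderiv (totalModel n) (𝓡∂ 2) (fun y : D × M => f y.1) y w = u'.1 := by
      have := mfderiv_comp_apply y (g := f) (f := (Prod.fst : D × M → D))
        (hf.mdifferentiableAt (by simp)) (mdifferentiableAt_fst (I := 𝓡∂ 2) (I' := 𝓡 (2 * n))) w
      refine this.trans ?_
      rw [hu1, h, mfderiv_fst]
      have hfst : ((triv q₀).symm y).fst = y.1 := fst_triv_symm q₀ hy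
      rw [← hfst]
      rfl
    rw [e4, mfderiv_snd] at e3
    rw [← e1]
    exact e2.symm.trans e3

/-- The tangent spaces of the pullback are the fibre products of tangent spaces. -/
theorem exists_tangent (q : Pullback hf) (e : TangentSpace (𝓡∂ 2) q.fst)
    (u : TangentSpace (totalModel n) q.snd)
    (h : mfderiv (totalModel n) (𝓡∂ 2) F.π q.snd u = mfderiv (𝓡∂ 2) (𝓡∂ 2) f q.fst e) :
    ∃ v : TangentSpace (totalModel n) q, mfderiv (totalModel n) (𝓡∂ 2) fst q v = e ∧
      mfderiv (totalModel n) (totalModel n) snd q v = u := by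
  have hs := mem_triv_source_self q
  have key := fun e u h => exists_tangent_aux (q₀ := q) ((triv q).map_source hs) e u h
  rw [(triv q).left_inv hs] at key
  exact key e u h

theorem locally_trivial (d : D) : ∃ U : Set D, d ∈ U ∧
    ∃ e : OpenPartialHomeomorph (Pullback hf) (D × M),
      e.source = fst ⁻¹' U ∧ e.target = U ×ˢ univ ∧ (∀ q ∈ e.source, (e q).1 = fst q) ∧
      ContMDiffOn (totalModel n) (totalModel n) ∞ e e.source ∧
      ContMDiffOn (totalModel n) (totalModel n) ∞ e.symm e.target := by
  by_cases h : ∃ q : Pullback hf, q.fst = d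
  · obtain ⟨q, rfl⟩ := h
    refine ⟨f ⁻¹' F.trivSet (f q.fst), F.mem_trivSet _, triv q, ?_, ?_, fun _ _ => rfl,
      contMDiffOn_triv q, contMDiffOn_triv_symm q⟩
    · ext q'
      change q'.snd ∈ (F.triv (f q.fst)).source ↔ f q'.fst ∈ F.trivSet (f q.fst)
      rw [mem_triv_source, π_snd]
    · ext y
      change (f y.1, y.2) ∈ (F.triv (f q.fst)).target ↔ _
      rw [mem_triv_target]
      simp
  · -- a bundle with an empty fibre over `d` has empty fibres near `d`
    have hM : IsEmpty M := by
      refine ⟨fun m => h ?_⟩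
      have hm : (f d, m) ∈ (F.triv (f d)).target := mem_triv_target.2 (F.mem_trivSet _)
      exact ⟨mk d ((F.triv (f d)).symm (f d, m)) (π_triv_symm hm), rfl⟩
    have hP : IsEmpty (Pullback hf) :=
      ⟨fun q => hM.elim (F.triv (f q.fst) q.snd).2⟩
    have hPM : IsEmpty (D × M) := ⟨fun y => hM.elim y.2⟩
    exact ⟨univ, mem_univ _, Homeomorph.empty.toOpenPartialHomeomorph, by simp, by simp,
      fun q => hP.elim q, fun q => hP.elim q, fun y => hPM.elim y⟩

end Pullback

end TangentPullback

section Compact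

variable {n : ℕ} {M : Type u} [TopologicalSpace M]
  [ChartedSpace (EuclideanSpace ℝ (Fin (2 * n))) M]
  {S : ModelSurface} (F : FibrationData (n := n) M S)

/-- The total space of a fibre bundle with compact base and fibre is compact. -/
theorem compactSpace_total [CompactSpace M] : CompactSpace F.P := by
  rcases isEmpty_or_nonempty M with hM | ⟨⟨m⟩⟩
  · have : IsEmpty F.P := ⟨fun p => hM.elim (F.triv (F.π p) p).2⟩
    infer_instance
  have hopen : ∀ b, IsOpen (F.trivSet b) := by
    intro b
    have : F.trivSet b = (fun b' => (b', m)) ⁻¹' (F.triv b).target := by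
      ext b'; rw [mem_preimage, mem_triv_target]
    rw [this]
    exact (F.triv b).open_target.preimage (by fun_prop)
  have hK : ∀ b, ∃ K, IsCompact K ∧ b ∈ interior K ∧ K ⊆ F.trivSet b := fun b =>
    exists_compact_subset (hopen b) (F.mem_trivSet b)
  choose K hK1 hK2 hK3 using hK
  have hc : ∀ b, IsCompact (F.π ⁻¹' K b) := by
    intro b
    have h1 : F.π ⁻¹' K b = (F.triv b).symm '' (K b ×ˢ univ) := by
      ext p
      constructor
      · intro hp
        have hs : p ∈ (F.triv b).source := mem_triv_source.2 (hK3 b hp)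
        refine ⟨F.triv b p, ⟨?_, mem_univ _⟩, (F.triv b).left_inv hs⟩
        rw [triv_fst hs]; exact hp
      · rintro ⟨y, hy, rfl⟩
        rw [mem_preimage, π_triv_symm (mem_triv_target.2 (hK3 b hy.1))]
        exact hy.1
    rw [h1]
    exact ((hK1 b).prod isCompact_univ).image_of_continuousOn
      ((F.triv b).continuousOn_symm.mono fun y hy => mem_triv_target.2 (hK3 b hy.1))
  obtain ⟨t, ht⟩ := isCompact_univ.elim_finite_subcover (fun b => interior (K b))
    (fun b => isOpen_interior) fun b _ => mem_iUnion.2 ⟨b, hK2 b⟩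
  refine ⟨(t.isCompact_biUnion fun b _ => hc b).of_isClosed_subset isClosed_univ fun p _ => ?_⟩
  obtain ⟨b, hb, hp⟩ := mem_iUnion₂.1 (ht (mem_univ (F.π p)))
  exact mem_iUnion₂.2 ⟨b, hb, (interior_subset hp : F.π p ∈ K b)⟩

end Compact
end FibrationData
end HamGeometry

namespace HamGeometry

/-! ### Alternating 2-forms -/

section FormAlgebra

variable {E : Type*} [NormedAddCommGroup E] [NormedSpace ℝ E]
  {E' : Type*} [NormedAddCommGroup E'] [NormedSpace ℝ E']

theorem form_add_left (η : E [⋀^Fin 2]→L[ℝ] ℝ) (v v' w : E) :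
    η ![v + v', w] = η ![v, w] + η ![v', w] := η.vecCons_add ![w] v v'

theorem form_smul_left (η : E [⋀^Fin 2]→L[ℝ] ℝ) (c : ℝ) (v w : E) :
    η ![c • v, w] = c * η ![v, w] := η.vecCons_smul ![w] c v

theorem form_swap (η : E [⋀^Fin 2]→L[ℝ] ℝ) (v w : E) : η ![v, w] = -η ![w, v] := by
  have := η.toAlternatingMap.map_swap ![w, v] (i := 0) (j := 1) (by simp)
  have e : (![w, v] ∘ Equiv.swap 0 1 : Fin 2 → E) = ![v, w] := by
    ext i; fin_cases i <;> simp
  rw [e] at this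
  exact this

theorem form_self (η : E [⋀^Fin 2]→L[ℝ] ℝ) (v : E) : η ![v, v] = 0 := by
  have := form_swap η v v
  linarith

/-- An alternating 2-form as a bilinear form. -/
def formBilin (η : E [⋀^Fin 2]→L[ℝ] ℝ) : LinearMap.BilinForm ℝ E :=
  LinearMap.mk₂ ℝ (fun v w => η ![v, w]) (form_add_left η) (form_smul_left η)
    (fun v w w' => by
      simp only [form_swap η v, form_add_left]; ring)
    (fun c v w => by simp only [form_swap η v, form_smul_left, smul_eq_mul]; ring)

@[simp] theorem formBilin_apply (η : E [⋀^Fin 2]→L[ℝ] ℝ) (v w : E) :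
    formBilin η v w = η ![v, w] := rfl

theorem form_add_right (η : E [⋀^Fin 2]→L[ℝ] ℝ) (v w w' : E) :
    η ![v, w + w'] = η ![v, w] + η ![v, w'] := (formBilin η v).map_add w w'

theorem form_smul_right (η : E [⋀^Fin 2]→L[ℝ] ℝ) (c : ℝ) (v w : E) :
    η ![v, c • w] = c * η ![v, w] := (formBilin η v).map_smul c w

theorem form_ext {η η' : E [⋀^Fin 2]→L[ℝ] ℝ} (h : ∀ v w, η ![v, w] = η' ![v, w]) : η = η' := by
  ext v
  have : v = ![v 0, v 1] := by ext i; fin_cases i <;> rfl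
  rw [this]; exact h _ _

theorem form_comp_apply (η : E [⋀^Fin 2]→L[ℝ] ℝ) (A : E' →L[ℝ] E) (v w : E') :
    η.compContinuousLinearMap A ![v, w] = η ![A v, A w] := by
  rw [ContinuousAlternatingMap.compContinuousLinearMap_apply]
  congr 1
  ext i; fin_cases i <;> rfl

theorem form_eq_sum (η : E [⋀^Fin 2]→L[ℝ] ℝ) {ι : Type*} [Fintype ι] (b : Module.Basis ι ℝ E)
    (v w : E) : η ![v, w] = ∑ i, ∑ j, b.repr v i * b.repr w j * η ![b i, b j] := by
  conv_lhs => rw [← formBilin_apply, ← b.sum_repr v, ← b.sum_repr w]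
  simp only [map_sum, LinearMap.sum_apply, map_smul, LinearMap.smul_apply, formBilin_apply,
    smul_eq_mul, Finset.mul_sum]
  rw [Finset.sum_comm]
  exact Finset.sum_congr rfl fun i _ => Finset.sum_congr rfl fun j _ => by ring

variable [FiniteDimensional ℝ E] {m : WithTop ℕ∞} {s : Set E'}

theorem contDiffOn_form {f : E' → E [⋀^Fin 2]→L[ℝ] ℝ}
    (h : ∀ v w, ContDiffOn ℝ m (fun x => f x ![v, w]) s) : ContDiffOn ℝ m f s := by
  let b := Module.finBasis ℝ E
  let L : (E [⋀^Fin 2]→L[ℝ] ℝ) →ₗ[ℝ] (Fin (Module.finrank ℝ E) × Fin (Module.finrank ℝ E) → ℝ) :=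
    { toFun := fun η p => η ![b p.1, b p.2]
      map_add' := fun _ _ => rfl
      map_smul' := fun _ _ => rfl }
  have hL : Function.Injective L := by
    intro η η' hη
    refine form_ext fun v w => ?_
    rw [form_eq_sum η b, form_eq_sum η' b]
    refine Finset.sum_congr rfl fun i _ => Finset.sum_congr rfl fun j _ => ?_
    have : η ![b i, b j] = η' ![b i, b j] := congrFun hη (i, j)
    rw [this]
  obtain ⟨K, hK⟩ := LinearMap.exists_leftInverse_of_injective L (LinearMap.ker_eq_bot.2 hL)
  have h1 : ContDiffOn ℝ m (fun x => L (f x)) s := contDiffOn_pi.2 fun p => h _ _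
  have h2 : ContDiffOn ℝ m (fun x => K.toContinuousLinearMap (L (f x))) s :=
    K.toContinuousLinearMap.contDiff.comp_contDiffOn h1
  refine h2.congr fun x _ => ?_
  exact (congrArg (fun g : (E [⋀^Fin 2]→L[ℝ] ℝ) →ₗ[ℝ] _ => g (f x)) hK).symm

omit [FiniteDimensional ℝ E] in
theorem ContDiffOn.form_const {f : E' → E [⋀^Fin 2]→L[ℝ] ℝ} (hf : ContDiffOn ℝ m f s) (v w : E) :
    ContDiffOn ℝ m (fun x => f x ![v, w]) s :=
  (ContinuousAlternatingMap.apply ℝ E ℝ ![v, w]).contDiff.comp_contDiffOn hf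

theorem ContDiffOn.form_apply {f : E' → E [⋀^Fin 2]→L[ℝ] ℝ} {v w : E' → E}
    (hf : ContDiffOn ℝ m f s) (hv : ContDiffOn ℝ m v s) (hw : ContDiffOn ℝ m w s) :
    ContDiffOn ℝ m (fun x => f x ![v x, w x]) s := by
  let b := Module.finBasis ℝ E
  have hc : ∀ i, ∀ u : E' → E, ContDiffOn ℝ m u s → ContDiffOn ℝ m (fun x => b.repr (u x) i) s :=
    fun i u hu => (b.coord i).toContinuousLinearMap.contDiff.comp_contDiffOn hu
  refine ContDiffOn.congr (f := fun x => ∑ i, ∑ j, b.repr (v x) i * b.repr (w x) j * f x ![b i, b j])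
    ?_ fun x _ => form_eq_sum _ b _ _
  exact ContDiffOn.sum fun i _ => ContDiffOn.sum fun j _ =>
    ((hc i v hv).mul (hc j w hw)).mul (ContDiffOn.form_const hf _ _)

end FormAlgebra

/-! ### The pullback of a 2-form -/

section FormPullback

variable {E : Type*} [NormedAddCommGroup E] [NormedSpace ℝ E]
  {H : Type*} [TopologicalSpace H] {I : ModelWithCorners ℝ E H}
  {N : Type*} [TopologicalSpace N] [ChartedSpace H N] [IsManifold I ∞ N]
  {E' : Type*} [NormedAddCommGroup E'] [NormedSpace ℝ E']
  {H' : Type*} [TopologicalSpace H'] {J : ModelWithCorners ℝ E' H'}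
  {X : Type*} [TopologicalSpace X] [ChartedSpace H' X] [IsManifold J ∞ X]

/-- The pullback of a 2-form. -/
noncomputable def TwoForm.pullback (J : ModelWithCorners ℝ E' H') (g : X → N) (σ : TwoForm I N) :
    TwoForm J X :=
  fun x => (σ (g x)).compContinuousLinearMap (mfderiv J I g x)

omit [IsManifold I ∞ N] [IsManifold J ∞ X] in
theorem TwoForm.pullback_apply (g : X → N) (σ : TwoForm I N) (x : X) (v w : TangentSpace J x) :
    σ.pullback J g x ![v, w] = σ (g x) ![mfderiv J I g x v, mfderiv J I g x w] :=
  form_comp_apply (E := E) (E' := E') (σ (g x)) (mfderiv J I g x) v w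

omit [IsManifold I ∞ N] [IsManifold J ∞ X] in
theorem TwoForm.inChart_apply (σ : TwoForm I N) (p : N) (y : E) (v w : E) :
    σ.inChart p y ![v, w] = σ ((extChartAt I p).symm y)
      ![mfderivWithin 𝓘(ℝ, E) I (extChartAt I p).symm (range I) y v,
        mfderivWithin 𝓘(ℝ, E) I (extChartAt I p).symm (range I) y w] :=
  form_comp_apply (E := E) (E' := E) (σ ((extChartAt I p).symm y))
    (mfderivWithin 𝓘(ℝ, E) I (extChartAt I p).symm (range I) y) v w

omit [IsManifold I ∞ N] in
theorem TwoForm.apply_congr (σ : TwoForm I N) {p p' : N} (h : p = p') {v w v' w' : E} (hv : v = v')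
    (hw : w = w') : (σ p : E [⋀^Fin 2]→L[ℝ] ℝ) ![v, w] = (σ p' : E [⋀^Fin 2]→L[ℝ] ℝ) ![v', w'] := by
  subst h hv hw; rfl

variable {g : X → N}

theorem fderivWithin_writtenInExtChart {x₀ : X} {q : N} {y : E'}
    (hy : y ∈ (extChartAt J x₀).target)
    (hg : MDifferentiableAt J I g ((extChartAt J x₀).symm y))
    (hq : g ((extChartAt J x₀).symm y) ∈ (extChartAt I q).source) (v : E') :
    fderivWithin ℝ (fun y => extChartAt I q (g ((extChartAt J x₀).symm y))) (range J) y v =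
      mfderiv I 𝓘(ℝ, E) (extChartAt I q) (g ((extChartAt J x₀).symm y))
        (mfderiv J I g ((extChartAt J x₀).symm y)
          (mfderivWithin 𝓘(ℝ, E') J (extChartAt J x₀).symm (range J) y v)) := by
  have hs := mdifferentiableWithinAt_extChartAt_symm (I := J) hy
  have hu : UniqueMDiffWithinAt 𝓘(ℝ, E') (range J) y :=
    (J.uniqueDiffOn y (extChartAt_target_subset_range x₀ hy)).uniqueMDiffWithinAt
  have hc := mdifferentiableAt_extChartAt (I := I) (x := q) (by rwa [extChartAt_source] at hq)
  have h1 := mfderiv_comp_mfderivWithin y hg hs hu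
  have h2 := mfderiv_comp_mfderivWithin y (g := extChartAt I q)
    (f := g ∘ (extChartAt J x₀).symm) hc (hg.comp_mdifferentiableWithinAt y hs) hu
  rw [h1] at h2
  rw [← mfderivWithin_eq_fderivWithin]
  exact congrArg (fun L => L v) h2

/-- The pullback of a form, read in charts, is the pullback by the map read in these charts. -/
theorem TwoForm.inChart_pullback (σ : TwoForm I N) {x₀ : X} {q : N} {y : E'}
    (hy : y ∈ (extChartAt J x₀).target)
    (hg : MDifferentiableAt J I g ((extChartAt J x₀).symm y))
    (hq : g ((extChartAt J x₀).symm y) ∈ (extChartAt I q).source) :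
    (σ.pullback J g).inChart x₀ y =
      (σ.inChart q (extChartAt I q (g ((extChartAt J x₀).symm y)))).compContinuousLinearMap
        (fderivWithin ℝ (fun y => extChartAt I q (g ((extChartAt J x₀).symm y))) (range J) y) := by
  refine form_ext fun v w => ?_
  rw [form_comp_apply, TwoForm.inChart_apply, TwoForm.inChart_apply, TwoForm.pullback_apply,
    fderivWithin_writtenInExtChart hy hg hq, fderivWithin_writtenInExtChart hy hg hq]
  have h1 := mfderivWithin_extChartAt_symm_comp_mfderiv_extChartAt' (I := I) hq
  refine TwoForm.apply_congr σ ((extChartAt I q).left_inv hq).symm ?_ ?_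
  · exact (congrArg (fun L : E →L[ℝ] E => L (mfderiv J I g ((extChartAt J x₀).symm y)
          (mfderivWithin 𝓘(ℝ, E') J (extChartAt J x₀).symm (range J) y v))) h1).symm
  · exact (congrArg (fun L : E →L[ℝ] E => L (mfderiv J I g ((extChartAt J x₀).symm y)
          (mfderivWithin 𝓘(ℝ, E') J (extChartAt J x₀).symm (range J) y w))) h1).symm

omit [IsManifold J ∞ X] in
theorem mem_closure_interior_of_isOpen_preimage {x₀ : X} {O : Set X} (hO : IsOpen O) {y : E'}
    (hy : y ∈ (extChartAt J x₀).target ∩ (extChartAt J x₀).symm ⁻¹' O) :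
    y ∈ closure (interior ((extChartAt J x₀).target ∩ (extChartAt J x₀).symm ⁻¹' O)) := by
  obtain ⟨u, hu, he⟩ := (continuousOn_iff'.1 (continuousOn_extChartAt_symm (I := J) x₀)) O hO
  rw [inter_comm, he, inter_comm] at hy ⊢
  rw [interior_inter, hu.interior_eq, inter_comm]
  exact hu.inter_closure ⟨hy.2, extChartAt_target_subset_closure_interior hy.1⟩

variable [FiniteDimensional ℝ E] [FiniteDimensional ℝ E']

/-- Locally, the pullback of a smooth closed 2-form by a smooth map is smooth and closed. -/
theorem TwoForm.pullback_local (σ : TwoForm I N)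
    (h1 : ∀ p : N, ContDiffOn ℝ ∞ (σ.inChart p) (extChartAt I p).target)
    {O : Set X} (hO : IsOpen O) (hg : ContMDiffOn J I ∞ g O) {x₀ : X} {y : E'}
    (hy : y ∈ (extChartAt J x₀).target) (hyO : (extChartAt J x₀).symm y ∈ O) :
    ContDiffWithinAt ℝ ∞ ((σ.pullback J g).inChart x₀) (extChartAt J x₀).target y ∧
      ((∀ p : N, ∀ y ∈ (extChartAt I p).target,
        extDerivWithin (σ.inChart p) (extChartAt I p).target y = 0) →
        extDerivWithin ((σ.pullback J g).inChart x₀) (extChartAt J x₀).target y = 0) := by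
  set q := g ((extChartAt J x₀).symm y) with hq
  set O' := O ∩ g ⁻¹' (extChartAt I q).source with hO'
  have hO'o : IsOpen O' := hg.continuousOn.isOpen_inter_preimage hO (isOpen_extChartAt_source q)
  set T := (extChartAt J x₀).target ∩ (extChartAt J x₀).symm ⁻¹' O' with hT
  have hyT : y ∈ T := ⟨hy, hyO, mem_extChartAt_source q⟩
  have hTu : UniqueDiffOn ℝ T := uniqueDiffOn_extChartAt_target_inter_preimage x₀ hO'o
  have hTn : ∀ z ∈ T, T ∈ 𝓝[range J] z := by
    intro z hz
    obtain ⟨u, hu, he⟩ := (continuousOn_iff'.1 (continuousOn_extChartAt_symm (I := J) x₀)) O' hO'o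
    have hTe : T = (extChartAt J x₀).target ∩ u := by rw [hT, inter_comm, he, inter_comm]
    rw [hTe] at hz ⊢
    exact Filter.inter_mem (extChartAt_target_mem_nhdsWithin_of_mem hz.1)
      (mem_nhdsWithin_of_mem_nhds (hu.mem_nhds hz.2))
  set G : E' → E := fun y => extChartAt I q (g ((extChartAt J x₀).symm y)) with hG
  have hGs : ContDiffOn ℝ ∞ G T := by
    have h2 : ContMDiffOn J 𝓘(ℝ, E) ∞ (fun x => extChartAt I q (g x)) O' :=
      contMDiffOn_extChartAt.comp (hg.mono inter_subset_left)
        fun x hx => by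
          have := hx.2
          rwa [mem_preimage, extChartAt_source] at this
    exact (h2.comp ((contMDiffOn_extChartAt_symm x₀).mono inter_subset_left)
      fun z hz => hz.2).contDiffOn
  have hGT : MapsTo G T (extChartAt I q).target := fun z hz => (extChartAt I q).map_source hz.2.2
  have hform : ∀ z ∈ T, (σ.pullback J g).inChart x₀ z =
      (σ.inChart q (G z)).compContinuousLinearMap (fderivWithin ℝ G T z) := by
    intro z hz
    have hd : MDifferentiableAt J I g ((extChartAt J x₀).symm z) :=
      (hg.contMDiffAt (hO.mem_nhds hz.2.1)).mdifferentiableAt (by simp)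
    rw [TwoForm.inChart_pullback σ hz.1 hd hz.2.2]
    congr 1
    exact fderivWithin_of_mem_nhdsWithin (hTn z hz)
      (J.uniqueDiffOn _ (extChartAt_target_subset_range x₀ hz.1))
      (hGs.differentiableOn (by simp) z hz)
  have hTt : T ∈ 𝓝[(extChartAt J x₀).target] y :=
    nhdsWithin_mono _ (extChartAt_target_subset_range x₀) (hTn y hyT)
  constructor
  · have h3 : ContDiffOn ℝ ∞ (fun z => (σ.inChart q (G z)).compContinuousLinearMap
        (fderivWithin ℝ G T z)) T := by
      refine contDiffOn_form fun v w => ?_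
      simp only [form_comp_apply]
      have h4 : ContDiffOn ℝ ∞ (fderivWithin ℝ G T) T := hGs.fderivWithin hTu (by simp)
      exact ContDiffOn.form_apply ((h1 q).comp hGs hGT) (h4.clm_apply contDiffOn_const)
        (h4.clm_apply contDiffOn_const)
    exact ((h3.congr hform) y hyT).mono_of_mem_nhdsWithin hTt
  · intro h2
    have h3 : extDerivWithin ((σ.pullback J g).inChart x₀) (extChartAt J x₀).target y =
        extDerivWithin ((σ.pullback J g).inChart x₀) T y := by
      have h5 : (extChartAt J x₀).target =ᶠ[𝓝 y] T := by
        have := mem_nhdsWithin.1 hTt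
        obtain ⟨u, hu, hyu, hsub⟩ := this
        filter_upwards [hu.mem_nhds hyu] with z hz
        exact propext ⟨fun h => hsub ⟨hz, h⟩, fun h => h.1⟩
      simp only [extDerivWithin, fderivWithin_congr_set h5]
    rw [h3, extDerivWithin_congr' hform hyT]
    rw [extDerivWithin_pullback (r := ∞) (t := (extChartAt I q).target)
      ((h1 q).differentiableOn (by simp) _ (hGT hyT)) (hGs y hyT) (by simp; exact natCast_le_infty 2) hTu
      (mem_closure_interior_of_isOpen_preimage hO'o hyT) hyT hGT, h2 q _ (hGT hyT)]
    ext; simp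

end FormPullback
end HamGeometry

namespace HamGeometry

/-! ### Gram determinants -/

section Determinants

variable {E : Type*} [AddCommGroup E] [Module ℝ E] {ι ι' : Type*} [Fintype ι] [DecidableEq ι]
  [Fintype ι'] [DecidableEq ι']

/-- The determinant of the Gram matrix of a bilinear form with respect to a family. -/
def gramDet (B : LinearMap.BilinForm ℝ E) (b : ι → E) : ℝ := (Matrix.of fun i j => B (b i) (b j)).det

theorem gramDet_basis_change (B : LinearMap.BilinForm ℝ E) (b c : Module.Basis ι ℝ E) :
    gramDet B c = (b.toMatrix c).det ^ 2 * gramDet B b := by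
  have h := LinearMap.BilinForm.toMatrix_mul_basis_toMatrix b c B
  have e : ∀ d : Module.Basis ι ℝ E, gramDet B d = (LinearMap.BilinForm.toMatrix d B).det := by
    intro d
    unfold gramDet
    congr 1
    ext i j
    simp [LinearMap.BilinForm.toMatrix_apply]
  rw [e, e, ← h, Matrix.det_mul, Matrix.det_mul, Matrix.det_transpose]
  ring

theorem gramDet_comp (B : LinearMap.BilinForm ℝ E) (A : E →ₗ[ℝ] E) (b : Module.Basis ι ℝ E) :
    gramDet B (A ∘ b) = (LinearMap.det A) ^ 2 * gramDet B b := by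
  have h := LinearMap.BilinForm.toMatrix_comp b b B A A
  have e : ∀ C : LinearMap.BilinForm ℝ E,
      gramDet C b = (LinearMap.BilinForm.toMatrix b C).det := by
    intro C
    unfold gramDet
    congr 1
    ext i j
    simp [LinearMap.BilinForm.toMatrix_apply]
  have e2 : gramDet B (A ∘ b) = gramDet (B.comp A A) b := rfl
  rw [e2, e, e, h, Matrix.det_mul, Matrix.det_mul, Matrix.det_transpose, LinearMap.det_toMatrix]
  ring

theorem gramDet_equiv (B : LinearMap.BilinForm ℝ E) (b : ι → E) (e : ι' ≃ ι) :
    gramDet B (b ∘ e) = gramDet B b := by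
  unfold gramDet
  rw [← Matrix.det_submatrix_equiv_self e]
  rfl

theorem gramDet_ne_zero (B : LinearMap.BilinForm ℝ E) (hB : ∀ v, (∀ w, B v w = 0) → v = 0)
    (b : Module.Basis ι ℝ E) : gramDet B b ≠ 0 := by
  intro h0
  obtain ⟨v, hv, hv0⟩ := Matrix.exists_vecMul_eq_zero_iff.2 h0
  apply hv
  have h1 : (∑ i, v i • b i) = 0 := by
    apply hB
    intro w
    rw [← b.sum_repr w]
    simp only [map_sum, map_smul, LinearMap.sum_apply, LinearMap.smul_apply, smul_eq_mul]
    refine Finset.sum_eq_zero fun j _ => ?_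
    have := congrFun hv0 j
    simp only [Matrix.vecMul, dotProduct, Matrix.of_apply, Pi.zero_apply] at this
    rw [this, mul_zero]
  funext i
  exact Fintype.linearIndependent_iff.1 b.linearIndependent v h1 i

variable [FiniteDimensional ℝ E] in
/-- Let `B` be alternating, nondegenerate on the kernel `V` of `ρ : E → ℂ`, and nonnegative on
the lifts of `(z, i z)` to the `B`-complement of `V`. In a basis adapted to the decomposition
`E = V ⊕ V^⊥`, the Gram matrix of `B + ε ρ^* β`, for the area form `β` of `ℂ`, is block diagonal
with the first block independent of `ε`, and the root of its determinant is affine in `ε`. -/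
theorem sqrt_gramDet_add_le (B β : LinearMap.BilinForm ℝ E) (ρ : E →ₗ[ℝ] ℂ)
    (hB : ∀ v w, B v w = -B w v) (hρ : Function.Surjective ρ)
    (hβ : ∀ v w, β v w = (starRingEnd ℂ (ρ v) * ρ w).im)
    (hV : ∀ v, ρ v = 0 → (∀ w, ρ w = 0 → B v w = 0) → v = 0)
    (hpos : ∀ h h', (∀ v, ρ v = 0 → B h v = 0) → (∀ v, ρ v = 0 → B h' v = 0) →
      ρ h' = Complex.I * ρ h → 0 ≤ B h h')
    (b : Module.Basis ι ℝ E) {ε : ℝ} (hε : 0 ≤ ε) :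
    √|gramDet (B + ε • β) b| ≤ √|gramDet B b| + ε * √|gramDet (B + β) b| := by
  have hrefl : B.IsRefl := fun v w h => by rw [hB, h, neg_zero]
  set V := LinearMap.ker ρ with hVdef
  have hnd : (B.restrict V).Nondegenerate := by
    refine ⟨fun v h => ?_, fun v h => ?_⟩
    · exact Subtype.ext (hV v v.2 fun w hw => h ⟨w, hw⟩)
    · refine Subtype.ext (hV v v.2 fun w hw => ?_)
      have : B w v = 0 := h ⟨w, hw⟩
      rw [hB, this, neg_zero]
  have hc : IsCompl V (B.orthogonal V) :=
    LinearMap.BilinForm.isCompl_orthogonal_of_restrict_nondegenerate hrefl hnd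
  have horth : ∀ h ∈ B.orthogonal V, ∀ v, ρ v = 0 → B h v = 0 := by
    intro h hh v hv
    have := (LinearMap.BilinForm.mem_orthogonal_iff.1 hh) v hv
    rw [hB, this, neg_zero]
  -- the complement is mapped isomorphically to `ℂ`
  let r : B.orthogonal V ≃ₗ[ℝ] ℂ := LinearEquiv.ofBijective (ρ.domRestrict _) (by
    constructor
    · rw [← LinearMap.ker_eq_bot, LinearMap.ker_eq_bot']
      intro h hh
      have : (h : E) ∈ V ⊓ B.orthogonal V := ⟨hh, h.2⟩
      rw [hc.inf_eq_bot] at this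
      exact Subtype.ext this
    · intro z
      obtain ⟨e, he⟩ := hρ z
      have : e ∈ V ⊔ B.orthogonal V := by rw [hc.sup_eq_top]; trivial
      obtain ⟨v, hv, h, hh, rfl⟩ := Submodule.mem_sup.1 this
      refine ⟨⟨h, hh⟩, ?_⟩
      have : ρ v = 0 := hv
      simpa [this] using he)
  have hr : ∀ z, ρ (r.symm z) = z := fun z => r.apply_symm_apply z
  let bV := Module.finBasis ℝ V
  let b' := (bV.prod (Complex.basisOneI.map r.symm)).map (Submodule.prodEquivOfIsCompl _ _ hc)
  let f := b'.indexEquiv b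
  let c := b'.reindex f
  obtain ⟨h₁, hh₁⟩ : ∃ h : E, h = (r.symm 1 : B.orthogonal V) := ⟨_, rfl⟩
  obtain ⟨h₂, hh₂⟩ : ∃ h : E, h = (r.symm Complex.I : B.orthogonal V) := ⟨_, rfl⟩
  have h1o : ∀ v, ρ v = 0 → B h₁ v = 0 := hh₁ ▸ horth _ (r.symm 1).2
  have h2o : ∀ v, ρ v = 0 → B h₂ v = 0 := hh₂ ▸ horth _ (r.symm Complex.I).2
  have hr1 : ρ h₁ = 1 := hh₁ ▸ hr 1
  have hr2 : ρ h₂ = Complex.I := hh₂ ▸ hr Complex.I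
  have hself : ∀ v, B v v = 0 := fun v => by have := hB v v; linarith
  set a := B h₁ h₂ with ha
  have ha0 : 0 ≤ a := hpos h₁ h₂ h1o h2o (by rw [hr1, hr2, mul_one])
  set G := (Matrix.of fun i j => B (bV i) (bV j)).det with hG
  have hb'l : ∀ i, b' (Sum.inl i) = bV i := fun i => by simp [b']
  have hb'r : ∀ i, b' (Sum.inr i) = ![h₁, h₂] i := fun i => by
    fin_cases i <;> simp [b', hh₁, hh₂]
  -- In the adapted basis the second block of the Gram matrix is that of `(a + t)` times the area
  -- form.
  have key : ∀ t : ℝ, gramDet (B + t • β) c = G * (a + t) ^ 2 := by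
    intro t
    have e1 : (c : _ → E) = b' ∘ f.symm := by funext i; simp [c]
    rw [e1, gramDet_equiv]
    have e2 : (Matrix.of fun i j => (B + t • β) (b' i) (b' j)) =
        Matrix.fromBlocks (Matrix.of fun i j => B (bV i) (bV j)) 0 0
          !![0, a + t; -(a + t), 0] := by
      ext i j
      have hk : ∀ i, ρ (bV i) = 0 := fun i => (bV i).2
      have hk1 : ∀ i, B (bV i) h₁ = 0 := fun i => by rw [hB, h1o _ (hk i), neg_zero]
      have hk2 : ∀ i, B (bV i) h₂ = 0 := fun i => by rw [hB, h2o _ (hk i), neg_zero]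
      have h21 : B h₂ h₁ = - a := hB _ _
      rcases i with i | i <;> rcases j with j | j
      · simp [hb'l, hβ, hk]
      · fin_cases j <;> simp [hb'l, hb'r, hβ, hk, hk1, hk2]
      · fin_cases i <;> simp [hb'l, hb'r, hβ, hk, h1o, h2o]
      · fin_cases i <;> fin_cases j <;>
          simp [hb'r, hβ, hr1, hr2, hself, h21, ← ha] <;> ring
    unfold gramDet
    rw [e2, Matrix.det_fromBlocks_zero₂₁, Matrix.det_fin_two_of]
    ring
  have key2 : ∀ t : ℝ, 0 ≤ t → √|gramDet (B + t • β) b| =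
      |(c.toMatrix b).det| * √|G| * (a + t) := by
    intro t ht
    rw [gramDet_basis_change _ c b, key, abs_mul, abs_mul, abs_of_nonneg (sq_nonneg (a + t)),
      abs_of_nonneg (sq_nonneg (c.toMatrix b).det), Real.sqrt_mul (sq_nonneg _),
      Real.sqrt_mul (abs_nonneg _), Real.sqrt_sq_eq_abs, Real.sqrt_sq (by positivity), mul_assoc]
  have k0 := key2 0 le_rfl
  have k1 := key2 1 zero_le_one
  rw [zero_smul, add_zero] at k0
  rw [one_smul] at k1
  rw [key2 ε hε, k0, k1]
  have := mul_nonneg (mul_nonneg (abs_nonneg (c.toMatrix b).det) (Real.sqrt_nonneg |G|)) ha0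
  nlinarith [mul_nonneg hε this]

end Determinants
end HamGeometry

namespace HamGeometry
open Filter

/-! ### The volume density -/

section DensityLemmas

variable {E : Type*} [NormedAddCommGroup E] [NormedSpace ℝ E] [FiniteDimensional ℝ E]
  {H : Type*} [TopologicalSpace H] {I : ModelWithCorners ℝ E H}
  {N : Type*} [TopologicalSpace N] [ChartedSpace H N]

theorem TwoForm.volumeDensity_eq (σ : TwoForm I N) (p : N) (y : E) :
    σ.volumeDensity p y = ((Module.finrank ℝ E / 2).factorial : ℝ) *
      √|gramDet (formBilin (σ.inChart p y)) (Module.finBasis ℝ E)| := rfl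

theorem TwoForm.volumeDensity_nonneg (σ : TwoForm I N) (p : N) (y : E) :
    0 ≤ σ.volumeDensity p y := by
  unfold TwoForm.volumeDensity; positivity

theorem TwoForm.continuousOn_volumeDensity (σ : TwoForm I N) {p : N} {s : Set E}
    (h : ContinuousOn (σ.inChart p) s) : ContinuousOn (σ.volumeDensity p) s := by
  refine continuousOn_const.mul (ContinuousOn.sqrt (ContinuousOn.abs ?_))
  refine ContinuousOn.comp (g := Matrix.det) (Continuous.matrix_det continuous_id).continuousOn (t := univ)
    ?_ (mapsTo_univ _ _)
  refine continuousOn_pi.2 fun i => continuousOn_pi.2 fun j => ?_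
  exact (ContinuousAlternatingMap.apply ℝ E ℝ
    ![Module.finBasis ℝ E i, Module.finBasis ℝ E j]).continuous.comp_continuousOn h

end DensityLemmas

/-! ### Measurable sets in charts -/

section ChartMeasure

variable {E : Type*} [NormedAddCommGroup E] [NormedSpace ℝ E]
  [MeasurableSpace E] [BorelSpace E]
  {H : Type*} [TopologicalSpace H] {I : ModelWithCorners ℝ E H}
  {N : Type*} [TopologicalSpace N] [ChartedSpace H N]

theorem measurableSet_extChartAt_target (p : N) : MeasurableSet (extChartAt I p).target := by
  rw [extChartAt_target]
  exact ((chartAt H p).open_target.preimage I.continuous_symm).measurableSet.inter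
    I.isClosed_range.measurableSet

omit [MeasurableSpace E] [BorelSpace E] in
theorem extChartAt_image_eq {p : N} {A : Set N} (hA : A ⊆ (chartAt H p).source) :
    extChartAt I p '' A = (extChartAt I p).target ∩ (extChartAt I p).symm ⁻¹' A := by
  rw [← extChartAt_source I] at hA
  exact (extChartAt I p).image_eq_target_inter_inv_preimage hA

theorem measurableSet_extChartAt_target_inter_preimage (p : N) {A : Set N}
    (hA : MeasurableSet[borel N] A) :
    MeasurableSet ((extChartAt I p).target ∩ (extChartAt I p).symm ⁻¹' A) := by
  let _ : MeasurableSpace N := borel N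
  have _ : BorelSpace N := ⟨rfl⟩
  have hc : Continuous ((extChartAt I p).target.domRestrict (extChartAt I p).symm) :=
    continuousOn_iff_continuous_domRestrict.1 (continuousOn_extChartAt_symm p)
  have h := (measurableSet_extChartAt_target (I := I) p).subtype_image (hc.measurable hA)
  convert h using 1
  ext y
  simp only [mem_image, mem_preimage, Set.domRestrict_apply, Subtype.exists, exists_and_left,
    exists_prop, mem_inter_iff, exists_eq_right_right]
  exact and_comm

theorem measurableSet_extChartAt_image {p : N} {A : Set N} (hA : MeasurableSet[borel N] A)
    (hA' : A ⊆ (chartAt H p).source) : MeasurableSet (extChartAt I p '' A) := by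
  rw [extChartAt_image_eq hA']
  exact measurableSet_extChartAt_target_inter_preimage p hA

/-- A finite cover by open sets can be refined to a finite Borel partition. -/
theorem exists_borel_partition [CompactSpace N] (U : N → Set N) (hU : ∀ p, U p ∈ 𝓝 p) :
    ∃ (t : Finset N) (Q : N → Set N), (∀ j ∈ t, MeasurableSet[borel N] (Q j) ∧ Q j ⊆ U j) ∧
      (t : Set N).PairwiseDisjoint Q ∧ ⋃ j ∈ t, Q j = univ := by
  let _ : MeasurableSpace N := borel N
  have _ : BorelSpace N := ⟨rfl⟩
  obtain ⟨t, ht⟩ := CompactSpace.elim_nhds_subcover (fun p => interior (U p))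
    fun p => interior_mem_nhds.2 (hU p)
  suffices ∀ t : Finset N, ∃ Q : N → Set N, (∀ j ∈ t, MeasurableSet (Q j) ∧ Q j ⊆ U j) ∧
      (t : Set N).PairwiseDisjoint Q ∧ ⋃ j ∈ t, Q j = ⋃ j ∈ t, interior (U j) by
    obtain ⟨Q, h1, h2, h3⟩ := this t
    exact ⟨t, Q, h1, h2, h3.trans ht⟩
  intro t
  classical
  induction t using Finset.induction_on with
  | empty => exact ⟨fun _ => ∅, by simp, by simp, by simp⟩
  | insert a t ha ih =>
    obtain ⟨Q, h1, h2, h3⟩ := ih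
    have hm : MeasurableSet (⋃ j ∈ t, interior (U j)) :=
      t.measurableSet_biUnion fun j _ => isOpen_interior.measurableSet
    refine ⟨Function.update Q a (interior (U a) \ ⋃ j ∈ t, interior (U j)), ?_, ?_, ?_⟩
    · intro j hj
      rcases Finset.mem_insert.1 hj with hj' | hj'
      · rw [hj', Function.update_self]
        exact ⟨isOpen_interior.measurableSet.diff hm, sdiff_subset.trans interior_subset⟩
      · rw [Function.update_of_ne (by rintro rfl; exact ha hj')]
        exact h1 j hj'
    · have hQ : ∀ j ∈ t, Function.update Q a
          (interior (U a) \ ⋃ j ∈ t, interior (U j)) j = Q j := fun j hj =>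
        Function.update_of_ne (by rintro rfl; exact ha hj) _ _
      rw [Finset.coe_insert]
      refine PairwiseDisjoint.insert_of_notMem ?_ (by simpa using ha) ?_
      · intro i hi j hj hij
        rw [Function.onFun, hQ i hi, hQ j hj]
        exact h2 hi hj hij
      · intro j hj
        rw [Function.update_self, hQ j hj]
        refine disjoint_sdiff_left.mono_right ?_
        rw [← h3]
        exact subset_biUnion_of_mem (u := Q) hj
    · rw [Finset.set_biUnion_insert, Finset.set_biUnion_insert, Function.update_self]
      have : ⋃ j ∈ t, Function.update Q a (interior (U a) \ ⋃ j ∈ t, interior (U j)) j =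
          ⋃ j ∈ t, interior (U j) := by
        rw [← h3]
        exact iUnion₂_congr fun j hj => Function.update_of_ne (by rintro rfl; exact ha hj) _ _
      rw [this, sdiff_union_self]

end ChartMeasure

/-! ### Volume and pullback -/

section VolumePullback

variable {E : Type*} [NormedAddCommGroup E] [NormedSpace ℝ E] [FiniteDimensional ℝ E]
  [MeasurableSpace E] [BorelSpace E]
  {H : Type*} [TopologicalSpace H] {I : ModelWithCorners ℝ E H}
  {N : Type*} [TopologicalSpace N] [ChartedSpace H N] [IsManifold I ∞ N]
  {X : Type*} [TopologicalSpace X] [ChartedSpace H X] [IsManifold I ∞ X]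

omit [FiniteDimensional ℝ E] [MeasurableSpace E] [BorelSpace E] in
theorem gramDet_formBilin_comp (η : E [⋀^Fin 2]→L[ℝ] ℝ) (A : E →L[ℝ] E) {ι : Type*} [Fintype ι]
    [DecidableEq ι] (b : Module.Basis ι ℝ E) :
    gramDet (formBilin (η.compContinuousLinearMap A)) b = A.det ^ 2 * gramDet (formBilin η) b := by
  have h := gramDet_comp (formBilin η) (A : E →ₗ[ℝ] E) b
  rw [← ContinuousLinearMap.det] at h
  rw [← h]
  unfold gramDet
  congr 1
  ext i j
  simp only [Matrix.of_apply, formBilin_apply, form_comp_apply]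
  rfl

variable {g : X → N}

omit [MeasurableSpace E] [BorelSpace E] in
/-- The density of a pullback, on the part of a chart of the source that is mapped to a chart of the
target. -/
theorem TwoForm.volumeDensity_pullback (σ : TwoForm I N) {x₀ : X} {q : N} {y : E}
    (hy : y ∈ (extChartAt I x₀).target)
    (hg : MDifferentiableAt I I g ((extChartAt I x₀).symm y))
    (hq : g ((extChartAt I x₀).symm y) ∈ (extChartAt I q).source) :
    (σ.pullback I g).volumeDensity x₀ y =
      |(fderivWithin ℝ (fun y => extChartAt I q (g ((extChartAt I x₀).symm y))) (range I) y).det| *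
        σ.volumeDensity q (extChartAt I q (g ((extChartAt I x₀).symm y))) := by
  rw [TwoForm.volumeDensity_eq, TwoForm.inChart_pullback σ hy hg hq, gramDet_formBilin_comp,
    TwoForm.volumeDensity_eq, abs_mul, abs_of_nonneg (sq_nonneg _), Real.sqrt_mul (sq_nonneg _),
    Real.sqrt_sq_eq_abs]
  ring

/-- The change of variables in one pair of charts, for a map that is injective on its
immersion points: the immersed part of a piece of the source has a measurable image with the same
integral, and the rest contributes nothing. -/
theorem TwoForm.exists_image_lintegral_pullback (σ : TwoForm I N) (hg : ContMDiff I I ∞ g)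
    (hinj : ∀ x x', Function.Injective (mfderiv I I g x) → Function.Injective (mfderiv I I g x') →
      g x = g x' → x = x')
    {p : X} {q : N} {A : Set X} {Q : Set N} (hA : MeasurableSet[borel X] A)
    (hAp : A ⊆ (chartAt H p).source) (hQ : MeasurableSet[borel N] Q)
    (hQq : Q ⊆ (chartAt H q).source) :
    ∃ Z ⊆ A ∩ g ⁻¹' Q, (∀ x ∈ Z, Function.Injective (mfderiv I I g x)) ∧
      MeasurableSet (extChartAt I q '' (g '' Z)) ∧
      ∫⁻ y in extChartAt I p '' (A ∩ g ⁻¹' Q),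
        ENNReal.ofReal ((σ.pullback I g).volumeDensity p y) ∂(Module.finBasis ℝ E).addHaar =
      ∫⁻ y in extChartAt I q '' (g '' Z),
        ENNReal.ofReal (σ.volumeDensity q y) ∂(Module.finBasis ℝ E).addHaar := by
  set ep := extChartAt I p with hep
  set eq := extChartAt I q with heq
  set G : E → E := fun y => eq (g (ep.symm y)) with hG
  set O' : Set X := g ⁻¹' eq.source with hO'
  have hO'o : IsOpen O' := (isOpen_extChartAt_source q).preimage hg.continuous
  set T := ep.target ∩ ep.symm ⁻¹' O' with hT
  have hTu : UniqueDiffOn ℝ T := uniqueDiffOn_extChartAt_target_inter_preimage p hO'o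
  have hTr : ∀ z ∈ T, T ∈ 𝓝[range I] z := by
    intro z hz
    obtain ⟨u, hu, he⟩ := (continuousOn_iff'.1 (continuousOn_extChartAt_symm (I := I) p)) O' hO'o
    have hTe : T = ep.target ∩ u := by rw [hT, inter_comm, he, inter_comm]
    rw [hTe] at hz ⊢
    exact Filter.inter_mem (extChartAt_target_mem_nhdsWithin_of_mem hz.1)
      (mem_nhdsWithin_of_mem_nhds (hu.mem_nhds hz.2))
  have hGs : ContDiffOn ℝ ∞ G T := by
    have h2 : ContMDiffOn I 𝓘(ℝ, E) ∞ (fun x => eq (g x)) O' :=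
      contMDiffOn_extChartAt.comp hg.contMDiffOn fun x hx => by
        have := hx
        rwa [hO', mem_preimage, heq, extChartAt_source] at this
    exact (h2.comp ((contMDiffOn_extChartAt_symm p).mono inter_subset_left)
      fun z hz => hz.2).contDiffOn
  have hfd : ∀ z ∈ T, fderivWithin ℝ G (range I) z = fderivWithin ℝ G T z := fun z hz =>
    fderivWithin_of_mem_nhdsWithin (hTr z hz)
      (I.uniqueDiffOn _ (extChartAt_target_subset_range p hz.1))
      (hGs.differentiableOn (by simp) z hz)
  have hcont : ContinuousOn (fun z => (fderivWithin ℝ G T z).det) T :=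
    ContinuousLinearMap.continuous_det.comp_continuousOn (hGs.continuousOn_fderivWithin hTu (by simp))
  obtain ⟨u, hu, hue⟩ := (continuousOn_iff'.1 hcont) {0}ᶜ isOpen_compl_singleton
  have hgQ : MeasurableSet[borel X] (g ⁻¹' Q) := by
    let _ : MeasurableSpace N := borel N
    let _ : MeasurableSpace X := borel X
    have _ : BorelSpace N := ⟨rfl⟩
    have _ : BorelSpace X := ⟨rfl⟩
    exact hg.continuous.measurable hQ
  have hAQ : MeasurableSet[borel X] (A ∩ g ⁻¹' Q) := @MeasurableSet.inter _ (borel X) _ _ hA hgQ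
  set S := ep '' (A ∩ g ⁻¹' Q) with hS
  have hSm : MeasurableSet S := measurableSet_extChartAt_image hAQ (inter_subset_left.trans hAp)
  have hST : S ⊆ T := by
    rintro _ ⟨x, hx, rfl⟩
    have hxs : x ∈ ep.source := by rw [hep, extChartAt_source]; exact hAp hx.1
    refine ⟨ep.map_source hxs, ?_⟩
    rw [mem_preimage, ep.left_inv hxs, hO', mem_preimage, heq, extChartAt_source]
    exact hQq hx.2
  -- The part of the piece on which the map is an immersion.
  set S' := S ∩ u with hS'
  have hS'm : MeasurableSet S' := hSm.inter hu.measurableSet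
  have hS'T : S' ⊆ T := inter_subset_left.trans hST
  have hdet : ∀ y ∈ S, y ∈ u ↔ (fderivWithin ℝ G T y).det ≠ 0 := by
    intro y hy
    have := Set.ext_iff.1 hue y
    simp only [mem_inter_iff, mem_preimage, mem_compl_iff, mem_singleton_iff, hST hy, and_true] at this
    exact this.symm
  have hmd : ∀ x, MDifferentiableAt I I g x := fun x => hg.mdifferentiableAt (by simp)
  have himm : ∀ y ∈ S', Function.Injective (mfderiv I I g (ep.symm y)) := by
    intro y hy
    rw [injective_iff_map_eq_zero]
    intro v hv
    have hyT := hS'T hy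
    have h1 := mfderivWithin_extChartAt_symm_comp_mfderiv_extChartAt' (I := I)
      (ep.map_target hyT.1)
    rw [← hep, ep.right_inv hyT.1] at h1
    have h2 := fun w => fderivWithin_writtenInExtChart (g := g) hyT.1 (hmd _) hyT.2 w
    have h3 : fderivWithin ℝ G T y (mfderiv I 𝓘(ℝ, E) ep (ep.symm y) v) = 0 := by
      rw [← hfd y hyT]
      refine (h2 _).trans ?_
      have h4 : mfderivWithin 𝓘(ℝ, E) I ep.symm (range I) y (mfderiv I 𝓘(ℝ, E) ep (ep.symm y) v) = v :=
        congrArg (fun L : E →L[ℝ] E => L v) h1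
      refine (congrArg (mfderiv I 𝓘(ℝ, E) eq (g (ep.symm y)))
        ((congrArg (mfderiv I I g (ep.symm y)) h4).trans hv)).trans (map_zero _)
    have h5 : mfderiv I 𝓘(ℝ, E) ep (ep.symm y) v = (0 : E) := by
      have hne := (hdet y hy.1).1 hy.2
      have : LinearMap.ker (fderivWithin ℝ G T y : E →ₗ[ℝ] E) = ⊥ := by
        by_contra hk
        exact hne (LinearMap.det_eq_zero_iff_ker_ne_bot.2 hk)
      exact (LinearMap.ker_eq_bot'.1 this) _ h3
    have h6 := congrArg (fun L : E →L[ℝ] E => L v) h1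
    refine h6.symm.trans ((congrArg (mfderivWithin 𝓘(ℝ, E) I ep.symm (range I) y) h5).trans (map_zero _))
  have hGinj : InjOn G S' := by
    intro y hy y' hy' h
    have e1 : g (ep.symm y) = g (ep.symm y') := eq.injOn (hS'T hy).2 (hS'T hy').2 h
    exact ep.symm.injOn (hS'T hy).1 (hS'T hy').1 (hinj _ _ (himm y hy) (himm y' hy') e1)
  have hder : ∀ y ∈ S', HasFDerivWithinAt G (fderivWithin ℝ G T y) S' y := fun y hy =>
    ((hGs.differentiableOn (by simp) y (hS'T hy)).hasFDerivWithinAt).mono hS'T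
  have himg : G '' S' = eq '' (g '' (ep.symm '' S')) := by
    rw [image_image, image_image]
  refine ⟨ep.symm '' S', ?_, ?_, ?_, ?_⟩
  · rintro _ ⟨y, hy, rfl⟩
    obtain ⟨x, hx, rfl⟩ := hy.1
    rw [ep.left_inv (by rw [hep, extChartAt_source]; exact hAp hx.1)]
    exact hx
  · rintro _ ⟨y, hy, rfl⟩
    exact himm y hy
  · rw [← himg]
    exact measurable_image_of_fderivWithin hS'm hder hGinj
  · rw [← himg, lintegral_image_eq_lintegral_abs_det_fderiv_mul _ hS'm hder hGinj]
    have hval : ∀ y ∈ S, ENNReal.ofReal ((σ.pullback I g).volumeDensity p y) =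
        ENNReal.ofReal |(fderivWithin ℝ G T y).det| * ENNReal.ofReal (σ.volumeDensity q (G y)) := by
      intro y hy
      rw [TwoForm.volumeDensity_pullback σ (hST hy).1 (hmd _) (hST hy).2,
        ENNReal.ofReal_mul (abs_nonneg _), ← hfd y (hST hy)]
    rw [setLIntegral_congr_fun hSm hval, ← lintegral_inter_add_sdiff _ S hu.measurableSet]
    -- On the complement the Jacobian determinant, and with it the density of the pullback,
    -- vanishes.
    have : ∫⁻ y in S \ u, ENNReal.ofReal |(fderivWithin ℝ G T y).det| *
        ENNReal.ofReal (σ.volumeDensity q (G y)) ∂(Module.finBasis ℝ E).addHaar = 0 := by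
      rw [setLIntegral_congr_fun (g := fun _ => 0) (hSm.diff hu.measurableSet)]
      · simp
      · intro y hy
        have : (fderivWithin ℝ G T y).det = 0 := by
          by_contra h
          exact hy.2 ((hdet y hy.1).2 h)
        simp [this]
    rw [this, add_zero]

/-- The volume of the pullback by a map that is injective on its immersion points is at most the
integral over any partition of the target into pieces of charts. -/
theorem TwoForm.volume_pullback_le_sum (σ : TwoForm I N) (hg : ContMDiff I I ∞ g)
    (hinj : ∀ x x', Function.Injective (mfderiv I I g x) → Function.Injective (mfderiv I I g x') →
      g x = g x' → x = x')
    {t : Finset N} {Q : N → Set N}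
    (hQ : ∀ j ∈ t, MeasurableSet[borel N] (Q j) ∧ Q j ⊆ (chartAt H j).source)
    (hd : (t : Set N).PairwiseDisjoint Q) (hcov : ⋃ j ∈ t, Q j = univ) :
    (σ.pullback I g).volume ≤ ∑ j ∈ t, ∫⁻ y in extChartAt I j '' Q j,
      ENNReal.ofReal (σ.volumeDensity j y) ∂(Module.finBasis ℝ E).addHaar := by
  refine iSup_le fun s => iSup_le fun A => iSup_le fun ⟨hA, hAd⟩ => ?_
  have hgQ : ∀ j ∈ t, MeasurableSet[borel X] (g ⁻¹' Q j) := by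
    intro j hj
    let _ : MeasurableSpace N := borel N
    let _ : MeasurableSpace X := borel X
    have _ : BorelSpace N := ⟨rfl⟩
    have _ : BorelSpace X := ⟨rfl⟩
    exact hg.continuous.measurable (hQ j hj).1
  have hsplit : ∀ p ∈ s, ∫⁻ y in extChartAt I p '' A p,
      ENNReal.ofReal ((σ.pullback I g).volumeDensity p y) ∂(Module.finBasis ℝ E).addHaar =
      ∑ j ∈ t, ∫⁻ y in extChartAt I p '' (A p ∩ g ⁻¹' Q j),
      ENNReal.ofReal ((σ.pullback I g).volumeDensity p y) ∂(Module.finBasis ℝ E).addHaar := by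
    intro p hp
    have e1 : extChartAt I p '' A p = ⋃ j ∈ t, extChartAt I p '' (A p ∩ g ⁻¹' Q j) := by
      rw [← image_iUnion₂, ← inter_iUnion₂, ← preimage_iUnion₂, hcov, preimage_univ, inter_univ]
    rw [e1, lintegral_biUnion_finset]
    · intro i hi j hj hij
      refine disjoint_image_image fun x hx y hy he => ?_
      have hs : ∀ z ∈ A p, z ∈ (extChartAt I p).source := fun z hz => by
        rw [extChartAt_source]; exact (hA p hp).2 hz
      have := (extChartAt I p).injOn (hs x hx.1) (hs y hy.1) he
      subst this
      exact (hd hi hj hij).le_bot ⟨hx.2, hy.2⟩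
    · intro j hj
      exact measurableSet_extChartAt_image
        (@MeasurableSet.inter _ (borel X) _ _ (hA p hp).1 (hgQ j hj))
        (inter_subset_left.trans (hA p hp).2)
  rw [Finset.sum_congr rfl hsplit, Finset.sum_comm]
  refine Finset.sum_le_sum fun j hj => ?_
  have hZ : ∀ p ∈ s, _ := fun p hp => σ.exists_image_lintegral_pullback hg hinj (hA p hp).1
    (hA p hp).2 (hQ j hj).1 (hQ j hj).2
  choose! Z hZs hZi hZm hZe using hZ
  -- The images of the immersed parts of the different pieces are disjoint, by the injectivity.
  rw [Finset.sum_congr rfl hZe, ← lintegral_biUnion_finset]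
  · refine lintegral_mono_set (iUnion₂_subset fun p hp => ?_)
    refine image_mono ?_
    rintro _ ⟨x, hx, rfl⟩
    exact (hZs p hp hx).2
  · intro p hp p' hp' hne
    refine disjoint_image_image ?_
    rintro _ ⟨x, hx, rfl⟩ _ ⟨x', hx', rfl⟩ he
    have hs : ∀ p ∈ s, ∀ z ∈ Z p, g z ∈ (extChartAt I j).source := fun p hp z hz => by
      rw [extChartAt_source]; exact (hQ j hj).2 (hZs p hp hz).2
    have e1 := (extChartAt I j).injOn (hs p hp x hx) (hs p' hp' x' hx') he
    have e2 := hinj _ _ (hZi p hp x hx) (hZi p' hp' x' hx') e1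
    subst e2
    exact (hAd hp hp' hne).le_bot ⟨(hZs p hp hx).1, (hZs p' hp' hx').1⟩
  · exact fun p hp => hZm p hp

/-- The volume does not increase under pullback by a map that is injective on its immersion
points. -/
theorem TwoForm.volume_pullback_le [CompactSpace N] (σ : TwoForm I N) (hg : ContMDiff I I ∞ g)
    (hinj : ∀ x x', Function.Injective (mfderiv I I g x) → Function.Injective (mfderiv I I g x') →
      g x = g x' → x = x') :
    (σ.pullback I g).volume ≤ σ.volume := by
  obtain ⟨t, Q, h1, h2, h3⟩ := exists_borel_partition (fun p : N => (chartAt H p).source)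
    fun p => chart_source_mem_nhds H p
  refine (σ.volume_pullback_le_sum hg hinj h1 h2 h3).trans ?_
  exact le_iSup_of_le t (le_iSup_of_le Q (le_iSup_of_le ⟨h1, h2⟩ le_rfl))

/-- A form is its own pullback by the identity, so its volume is at most the integral over a
partition into pieces that are contained in compact parts of charts. -/
theorem TwoForm.volume_lt_top [CompactSpace N] [T2Space N] (σ : TwoForm I N)
    (hs : ∀ p : N, ContinuousOn (σ.inChart p) (extChartAt I p).target) : σ.volume < ⊤ := by
  have hK : ∀ p : N, ∃ K ∈ 𝓝 p, IsCompact K ∧ K ⊆ (chartAt H p).source := by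
    intro p
    obtain ⟨K, hK, hKs, hKc⟩ := local_compact_nhds (chart_source_mem_nhds H p)
    exact ⟨K, hK, hKc, hKs⟩
  choose K hKn hKc hKs using hK
  obtain ⟨t, Q, h1, h2, h3⟩ := exists_borel_partition K hKn
  have hid : σ.pullback I (id : N → N) = σ := by
    funext x
    refine form_ext (E := E) fun v w => (TwoForm.pullback_apply (I := I) (J := I) id σ x v w).trans ?_
    rw [mfderiv_id]
    rfl
  rw [← hid]
  refine (σ.volume_pullback_le_sum contMDiff_id (fun x x' _ _ h => h)
    (fun j hj => ⟨(h1 j hj).1, (h1 j hj).2.trans (hKs j)⟩) h2 h3).trans_lt ?_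
  refine ENNReal.sum_lt_top.2 fun j hj => ?_
  have hKt : extChartAt I j '' K j ⊆ (extChartAt I j).target := by
    rintro _ ⟨x, hx, rfl⟩
    exact (extChartAt I j).map_source (by rw [extChartAt_source]; exact hKs j hx)
  have hKcomp : IsCompact (extChartAt I j '' K j) :=
    (hKc j).image_of_continuousOn ((continuousOn_extChartAt j).mono (by
      rw [extChartAt_source]; exact hKs j))
  have hc := (σ.continuousOn_volumeDensity (hs j)).mono hKt
  refine (lintegral_mono_set (image_mono (h1 j hj).2)).trans_lt ?_
  obtain ⟨C, hC⟩ := hKcomp.bddAbove_image hc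
  refine setLIntegral_lt_top_of_le_nnreal hKcomp.measure_lt_top.ne ⟨C.toNNReal, fun x hx => ?_⟩
  exact ENNReal.ofReal_le_ofReal (hC (mem_image_of_mem _ hx))

theorem TwoForm.volume_ne_zero [I.Boundaryless] [Nonempty N] {σ : TwoForm I N}
    (hσ : σ.IsSymplectic) : σ.volume ≠ 0 := by
  obtain ⟨p⟩ := ‹Nonempty N›
  set μ := (Module.finBasis ℝ E).addHaar with hμ
  have hsrc : extChartAt I p '' (chartAt H p).source = (extChartAt I p).target := by
    rw [← extChartAt_source I, (extChartAt I p).image_source_eq_target]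
  have hle : ∫⁻ y in (extChartAt I p).target, ENNReal.ofReal (σ.volumeDensity p y) ∂μ ≤ σ.volume := by
    refine le_iSup_of_le {p} (le_iSup_of_le (fun _ => (chartAt H p).source) (le_iSup_of_le ?_ ?_))
    · refine ⟨fun q hq => ?_, by simp⟩
      rw [Finset.mem_singleton.1 hq]
      exact ⟨MeasurableSpace.measurableSet_generateFrom (chartAt H p).open_source, subset_rfl⟩
    · rw [Finset.sum_singleton, hsrc]
  intro h0
  rw [h0, nonpos_iff_eq_zero] at hle
  have htm := measurableSet_extChartAt_target (I := I) p
  have hm : AEMeasurable (fun y => ENNReal.ofReal (σ.volumeDensity p y))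
      (μ.restrict (extChartAt I p).target) :=
    ((σ.continuousOn_volumeDensity (hσ.smooth p).continuousOn).aemeasurable htm).ennreal_ofReal
  -- The density of a nondegenerate form is positive on the target of a chart, which is open as
  -- there is no boundary.
  have hpos : ∀ y ∈ (extChartAt I p).target, 0 < σ.volumeDensity p y := by
    intro y hy
    refine mul_pos (by positivity) (Real.sqrt_pos.2 (abs_pos.2 ?_))
    refine gramDet_ne_zero (formBilin (σ.inChart p y)) (fun v hv => ?_) _
    have h2 := mfderivWithin_extChartAt_symm_comp_mfderiv_extChartAt (I := I) hy
    have h1 := mfderiv_extChartAt_comp_mfderivWithin_extChartAt_symm (I := I) hy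
    have e0 : mfderivWithin 𝓘(ℝ, E) I (extChartAt I p).symm (range I) y v = 0 := by
      refine hσ.nondegenerate _ _ fun w => ?_
      have h3 := hv (mfderiv I 𝓘(ℝ, E) (extChartAt I p) ((extChartAt I p).symm y) w)
      replace h3 := (TwoForm.inChart_apply σ p y v _).symm.trans h3
      have h4 := congrArg (fun L : E →L[ℝ] E => L w) h2
      exact (congrArg (fun z : E => (σ ((extChartAt I p).symm y) : E [⋀^Fin 2]→L[ℝ] ℝ) ![_, z])
        h4).symm.trans h3
    have h5 := congrArg (fun L : E →L[ℝ] E => L v) h1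
    refine h5.symm.trans ((congrArg (mfderiv I 𝓘(ℝ, E) (extChartAt I p)
      ((extChartAt I p).symm y)) e0).trans (map_zero _))
  rw [lintegral_eq_zero_iff' hm] at hle
  have hno : ∀ᵐ y ∂μ.restrict (extChartAt I p).target, False := by
    filter_upwards [hle, ae_restrict_mem htm] with y hy hyt
    have := ENNReal.ofReal_eq_zero.1 hy
    exact absurd (hpos y hyt) (not_lt.2 this)
  have hz : μ (extChartAt I p).target = 0 := by
    rw [← Measure.restrict_apply_univ]
    simpa [ae_iff] using hno
  exact ((isOpen_extChartAt_target p).measure_pos μ ⟨_, mem_extChartAt_target p⟩).ne' hz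

omit [IsManifold I ∞ N] in
theorem TwoForm.volume_le_add {τ₀ τ₁ τ : TwoForm I N} {ε : ℝ} (hε : 0 ≤ ε)
    (hs : ∀ p : N, ContinuousOn (τ₁.inChart p) (extChartAt I p).target)
    (h : ∀ p : N, ∀ y ∈ (extChartAt I p).target,
      τ.volumeDensity p y ≤ τ₀.volumeDensity p y + ε * τ₁.volumeDensity p y) :
    τ.volume ≤ τ₀.volume + ENNReal.ofReal ε * τ₁.volume := by
  refine iSup_le fun s => iSup_le fun A => iSup_le fun hA => ?_
  have hle : ∀ σ : TwoForm I N, ∑ p ∈ s, ∫⁻ y in extChartAt I p '' A p,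
      ENNReal.ofReal (σ.volumeDensity p y) ∂(Module.finBasis ℝ E).addHaar ≤ σ.volume :=
    fun σ => le_iSup_of_le s (le_iSup_of_le A (le_iSup_of_le hA le_rfl))
  refine le_trans ?_ (add_le_add (hle τ₀) (mul_le_mul_right (hle τ₁) _))
  rw [Finset.mul_sum, ← Finset.sum_add_distrib]
  refine Finset.sum_le_sum fun p hp => ?_
  have hAm : MeasurableSet (extChartAt I p '' A p) :=
    measurableSet_extChartAt_image (hA.1 p hp).1 (hA.1 p hp).2
  have hAt : extChartAt I p '' A p ⊆ (extChartAt I p).target := by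
    rintro _ ⟨x, hx, rfl⟩
    exact (extChartAt I p).map_source (by rw [extChartAt_source]; exact (hA.1 p hp).2 hx)
  have hm : AEMeasurable (fun y => ENNReal.ofReal (τ₁.volumeDensity p y))
      ((Module.finBasis ℝ E).addHaar.restrict (extChartAt I p '' A p)) :=
    (((τ₁.continuousOn_volumeDensity (hs p)).mono hAt).aemeasurable hAm).ennreal_ofReal
  rw [← lintegral_const_mul'' _ hm, ← lintegral_add_right' _ (hm.const_mul _)]
  refine setLIntegral_mono' hAm fun y hy => ?_
  rw [← ENNReal.ofReal_mul hε, ← ENNReal.ofReal_add (τ₀.volumeDensity_nonneg p y)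
    (mul_nonneg hε (τ₁.volumeDensity_nonneg p y))]
  exact ENNReal.ofReal_le_ofReal (h p y (hAt hy))

end VolumePullback
end HamGeometry

namespace HamGeometry
open Filter
open scoped NNReal

/-! ### Forms nondegenerate along a factor -/

section FibreBound

variable {V W : Type*} [NormedAddCommGroup V] [NormedSpace ℝ V] [NormedAddCommGroup W]
  [NormedSpace ℝ W]

theorem abs_form_le (η : V [⋀^Fin 2]→L[ℝ] ℝ) (v w : V) : |η ![v, w]| ≤ ‖η‖ * ‖v‖ * ‖w‖ := by
  have := η.le_opNorm ![v, w]
  rw [Fin.prod_univ_two] at this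
  simpa [mul_assoc] using this

variable [FiniteDimensional ℝ W]

/-- The nondegeneracy of `η₀` on the second factor persists, with a uniform bound, for the forms
close to `η₀`. -/
theorem exists_fibre_bound (η₀ : (V × W) [⋀^Fin 2]→L[ℝ] ℝ)
    (h : ∀ x : W, (∀ w : W, η₀ ![((0 : V), x), ((0 : V), w)] = 0) → x = 0) :
    ∃ C : ℝ, 0 < C ∧ ∃ δ > 0, ∀ η : (V × W) [⋀^Fin 2]→L[ℝ] ℝ, ‖η - η₀‖ ≤ δ → ∀ (x : W) (R : ℝ),
      0 ≤ R → (∀ w : W, |η ![((0 : V), x), ((0 : V), w)]| ≤ R * ‖w‖) → ‖x‖ ≤ C * R := by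
  let T : W →ₗ[ℝ] (W →L[ℝ] ℝ) :=
    { toFun := fun x => LinearMap.toContinuousLinearMap
        ((formBilin η₀ ((0 : V), x)).comp (LinearMap.inr ℝ V W))
      map_add' := fun x y => by
        ext w
        have := form_add_left η₀ ((0 : V), x) ((0 : V), y) ((0 : V), w)
        simpa using this
      map_smul' := fun c x => by
        ext w
        have := form_smul_left η₀ c ((0 : V), x) ((0 : V), w)
        simpa using this }
  have hTa : ∀ x w, T x w = η₀ ![((0 : V), x), ((0 : V), w)] := fun x w => rfl
  have hT : Function.Injective T := by
    rw [injective_iff_map_eq_zero]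
    intro x hx
    refine h x fun w => ?_
    rw [← hTa, hx]; rfl
  obtain ⟨K, hK0, hK⟩ := T.toContinuousLinearMap.injective_iff_antilipschitz.1 hT
  have hK' : ∀ x, ‖x‖ ≤ K * ‖T x‖ := fun x => hK.le_mul_norm (map_zero _) x
  have hK0' : (0 : ℝ) < K := hK0
  refine ⟨2 * K, by positivity, 1 / (2 * K), by positivity, fun η hη x R hR hx => ?_⟩
  -- The error term is absorbed in the left hand side of `‖x‖ ≤ K ‖T x‖`, which explains `δ = 1 / (2
  -- K)`.
  have h1 : ‖T x‖ ≤ R + 1 / (2 * K) * ‖x‖ := by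
    refine ContinuousLinearMap.opNorm_le_bound _ (by positivity) fun w => ?_
    rw [hTa, Real.norm_eq_abs]
    have e : η₀ ![((0 : V), x), ((0 : V), w)] =
        η ![((0 : V), x), ((0 : V), w)] - (η - η₀) ![((0 : V), x), ((0 : V), w)] := by
      simp
    have h2 := abs_form_le (η - η₀) ((0 : V), x) ((0 : V), w)
    have n1 : ∀ z : W, ‖((0 : V), z)‖ = ‖z‖ := fun z => by simp [Prod.norm_def]
    rw [n1, n1] at h2
    rw [e]
    refine (abs_sub _ _).trans ?_
    have h3 : ‖η - η₀‖ * ‖x‖ * ‖w‖ ≤ 1 / (2 * K) * ‖x‖ * ‖w‖ := by gcongr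
    have := hx w
    linarith
  have h4 := hK' x
  have h5 : (K : ℝ) * ‖T x‖ ≤ K * (R + 1 / (2 * K) * ‖x‖) := by gcongr
  have h6 : (K : ℝ) * (R + 1 / (2 * K) * ‖x‖) = K * R + ‖x‖ / 2 := by field_simp
  linarith

end FibreBound

universe u

namespace FibrationData

/-! ### Coordinates adapted to a fibration -/

section AdaptedChart

variable {n : ℕ} {M : Type u} [TopologicalSpace M]
  [ChartedSpace (EuclideanSpace ℝ (Fin (2 * n))) M] [IsManifold (𝓡 (2 * n)) ∞ M]
  {S : ModelSurface} (F : FibrationData (n := n) M S)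

/-- The model vector space of the total space. -/
abbrev TotalSpace (n : ℕ) := EuclideanSpace ℝ (Fin 2) × EuclideanSpace ℝ (Fin (2 * n))

/-- The coordinates of the total space around `p₀` given by a local trivialisation and charts of
the base and of the fibre. -/
noncomputable def adapted (p₀ : F.P) (p : F.P) : TotalSpace n :=
  extChartAt (totalModel n) (F.triv (F.π p₀) p₀) (F.triv (F.π p₀) p)

/-- The domain of the coordinates `adapted`. -/
def adaptedSource (p₀ : F.P) : Set F.P :=
  (F.triv (F.π p₀)).source ∩ F.triv (F.π p₀) ⁻¹'
    (extChartAt (totalModel n) (F.triv (F.π p₀) p₀)).source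

/-- The form of the fibration in the coordinates `adapted`. -/
noncomputable def adaptedForm (p₀ : F.P) : TotalSpace n → TotalSpace n [⋀^Fin 2]→L[ℝ] ℝ :=
  (F.Ω.pullback (totalModel n) (F.triv (F.π p₀)).symm).inChart (F.triv (F.π p₀) p₀)

variable {F} {p₀ : F.P}

omit [IsManifold (𝓡 (2 * n)) ∞ M] in
theorem mem_triv_source_self : p₀ ∈ (F.triv (F.π p₀)).source := mem_triv_source.2 (F.mem_trivSet _)

omit [IsManifold (𝓡 (2 * n)) ∞ M] in
theorem isOpen_adaptedSource : IsOpen (F.adaptedSource p₀) :=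
  (F.triv (F.π p₀)).isOpen_inter_preimage (isOpen_extChartAt_source _)

omit [IsManifold (𝓡 (2 * n)) ∞ M] in
theorem mem_adaptedSource : p₀ ∈ F.adaptedSource p₀ :=
  ⟨mem_triv_source_self, mem_extChartAt_source _⟩

omit [IsManifold (𝓡 (2 * n)) ∞ M] in
theorem adapted_injOn : InjOn (F.adapted p₀) (F.adaptedSource p₀) := fun _ hp _ hq h =>
  (F.triv (F.π p₀)).injOn hp.1 hq.1 ((extChartAt _ _).injOn hp.2 hq.2 h)

theorem mdifferentiableAt_adapted {p : F.P} (hp : p ∈ F.adaptedSource p₀) :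
    MDifferentiableAt (totalModel n) 𝓘(ℝ, TotalSpace n) (F.adapted p₀) p := by
  have h1 := (mdifferentiable_triv (F.π p₀)).mdifferentiableAt hp.1
  have h2 := mdifferentiableAt_extChartAt (I := totalModel n) (x := F.triv (F.π p₀) p₀)
    (y := F.triv (F.π p₀) p) (by have := hp.2; rwa [mem_preimage, extChartAt_source] at this)
  exact h2.comp p h1

omit [IsManifold (𝓡 (2 * n)) ∞ M] in
theorem adapted_fst {p : F.P} (hp : p ∈ F.adaptedSource p₀) :
    (F.adapted p₀ p).1 = extChartAt (𝓡∂ 2) (F.π p₀) (F.π p) := by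
  unfold adapted
  rw [extChartAt_prod]
  show extChartAt (𝓡∂ 2) (F.triv (F.π p₀) p₀).1 (F.triv (F.π p₀) p).1 = _
  rw [triv_fst hp.1, triv_fst mem_triv_source_self]

omit [IsManifold (𝓡 (2 * n)) ∞ M] in
theorem π_mem_source {p : F.P} (hp : p ∈ F.adaptedSource p₀) :
    F.π p ∈ (extChartAt (𝓡∂ 2) (F.π p₀)).source := by
  have := hp.2
  rw [mem_preimage, extChartAt_prod] at this
  have h2 : (F.triv (F.π p₀) p).1 ∈ (extChartAt (𝓡∂ 2) (F.triv (F.π p₀) p₀).1).source := this.1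
  rwa [triv_fst hp.1, triv_fst mem_triv_source_self] at h2

theorem mfderiv_adapted_fst {p : F.P} (hp : p ∈ F.adaptedSource p₀)
    (v : TangentSpace (totalModel n) p) :
    (mfderiv (totalModel n) 𝓘(ℝ, TotalSpace n) (F.adapted p₀) p v : TotalSpace n).1 =
      mfderiv (𝓡∂ 2) 𝓘(ℝ, EuclideanSpace ℝ (Fin 2)) (extChartAt (𝓡∂ 2) (F.π p₀)) (F.π p)
        (mfderiv (totalModel n) (𝓡∂ 2) F.π p v) := by
  have hs := π_mem_source hp
  rw [extChartAt_source] at hs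
  have h1 := mfderiv_comp_apply p (mdifferentiableAt_extChartAt (I := 𝓡∂ 2) hs)
    (F.π_smooth.mdifferentiableAt (x := p) (by simp)) v
  have h3 : MDifferentiableAt 𝓘(ℝ, TotalSpace n) 𝓘(ℝ, EuclideanSpace ℝ (Fin 2))
      (Prod.fst : TotalSpace n → _) (F.adapted p₀ p) :=
    differentiableAt_fst.mdifferentiableAt
  have h2 := mfderiv_comp_apply p h3 (mdifferentiableAt_adapted hp) v
  have h4 : mfderiv (totalModel n) 𝓘(ℝ, EuclideanSpace ℝ (Fin 2))
      ((Prod.fst : TotalSpace n → _) ∘ F.adapted p₀) p =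
      mfderiv (totalModel n) 𝓘(ℝ, EuclideanSpace ℝ (Fin 2))
      (extChartAt (𝓡∂ 2) (F.π p₀) ∘ F.π) p := by
    refine Filter.EventuallyEq.mfderiv_eq ?_
    filter_upwards [isOpen_adaptedSource.mem_nhds hp] with p' hp' using adapted_fst hp'
  have h5 := (congrArg (fun L : TotalSpace n →L[ℝ] EuclideanSpace ℝ (Fin 2) => L v) h4).symm
  refine Eq.trans ?_ (h5.symm.trans h1)
  refine Eq.trans ?_ h2.symm
  rw [mfderiv_eq_fderiv]
  exact (congrArg (fun L : TotalSpace n →L[ℝ] EuclideanSpace ℝ (Fin 2) =>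
    L (mfderiv (totalModel n) 𝓘(ℝ, TotalSpace n) (F.adapted p₀) p v)) fderiv_fst).symm

theorem mfderiv_adapted {p : F.P} (hp : p ∈ F.adaptedSource p₀)
    (v : TangentSpace (totalModel n) p) :
    mfderiv (totalModel n) 𝓘(ℝ, TotalSpace n) (F.adapted p₀) p v =
      mfderiv (totalModel n) 𝓘(ℝ, TotalSpace n)
        (extChartAt (totalModel n) (F.triv (F.π p₀) p₀)) (F.triv (F.π p₀) p)
        (mfderiv (totalModel n) (totalModel n) (F.triv (F.π p₀)) p v) := by
  have h1 := (mdifferentiable_triv (F.π p₀)).mdifferentiableAt hp.1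
  have h2 := mdifferentiableAt_extChartAt (I := totalModel n) (x := F.triv (F.π p₀) p₀)
    (y := F.triv (F.π p₀) p) (by have := hp.2; rwa [mem_preimage, extChartAt_source] at this)
  exact mfderiv_comp_apply p h2 h1 v

theorem adaptedForm_apply {p : F.P} (hp : p ∈ F.adaptedSource p₀)
    (u v : TangentSpace (totalModel n) p) :
    F.adaptedForm p₀ (F.adapted p₀ p)
      ![(mfderiv (totalModel n) 𝓘(ℝ, TotalSpace n) (F.adapted p₀) p u : TotalSpace n),
        mfderiv (totalModel n) 𝓘(ℝ, TotalSpace n) (F.adapted p₀) p v] = F.Ω p ![u, v] := by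
  set e := F.triv (F.π p₀) with he
  have hX : ∀ z : TotalSpace n, mfderivWithin 𝓘(ℝ, TotalSpace n) (totalModel n)
      (extChartAt (totalModel n) (e p₀)).symm (range (totalModel n)) (F.adapted p₀ p)
      (mfderiv (totalModel n) 𝓘(ℝ, TotalSpace n) (extChartAt (totalModel n) (e p₀)) (e p) z) = z :=
    fun z => congrArg (fun L : TotalSpace n →L[ℝ] TotalSpace n => L z)
      (mfderivWithin_extChartAt_symm_comp_mfderiv_extChartAt' (I := totalModel n) hp.2)
  have hA : ∀ z : TotalSpace n, mfderiv (totalModel n) (totalModel n) e.symm (e p)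
      (mfderiv (totalModel n) (totalModel n) e p z) = z :=
    fun z => congrArg (fun L : TotalSpace n →L[ℝ] TotalSpace n => L z)
      ((mdifferentiable_triv (F.π p₀)).symm_comp_deriv hp.1)
  have e1 : ∀ z : TangentSpace (totalModel n) p, mfderivWithin 𝓘(ℝ, TotalSpace n) (totalModel n)
      (extChartAt (totalModel n) (e p₀)).symm (range (totalModel n)) (F.adapted p₀ p)
      (mfderiv (totalModel n) 𝓘(ℝ, TotalSpace n) (F.adapted p₀) p z) =
      mfderiv (totalModel n) (totalModel n) e p z := fun z =>
    (congrArg (mfderivWithin 𝓘(ℝ, TotalSpace n) (totalModel n)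
      (extChartAt (totalModel n) (e p₀)).symm (range (totalModel n)) (F.adapted p₀ p))
      (mfderiv_adapted hp z)).trans (hX _)
  refine (TwoForm.inChart_apply (I := totalModel n) (F.Ω.pullback (totalModel n) e.symm) (e p₀)
    (F.adapted p₀ p) _ _).trans ?_
  refine (TwoForm.apply_congr (I := totalModel n) (F.Ω.pullback (totalModel n) e.symm)
    ((extChartAt (totalModel n) (e p₀)).left_inv hp.2) (e1 u) (e1 v)).trans ?_
  refine (TwoForm.pullback_apply (I := totalModel n) (J := totalModel n) e.symm F.Ω (e p) _ _).trans ?_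
  exact TwoForm.apply_congr (I := totalModel n) F.Ω (e.left_inv hp.1) (hA u) (hA v)

theorem exists_adapted_tangent {p : F.P} (hp : p ∈ F.adaptedSource p₀) (w : TotalSpace n) :
    ∃ v : TangentSpace (totalModel n) p,
      mfderiv (totalModel n) 𝓘(ℝ, TotalSpace n) (F.adapted p₀) p v = w := by
  set e := F.triv (F.π p₀) with he
  set z : TotalSpace n := mfderivWithin 𝓘(ℝ, TotalSpace n) (totalModel n)
      (extChartAt (totalModel n) (e p₀)).symm (range (totalModel n)) (F.adapted p₀ p) w with hz
  have h1 : mfderiv (totalModel n) 𝓘(ℝ, TotalSpace n) (extChartAt (totalModel n) (e p₀)) (e p) z =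
      w := congrArg (fun L : TotalSpace n →L[ℝ] TotalSpace n => L w)
      (mfderiv_extChartAt_comp_mfderivWithin_extChartAt_symm' (I := totalModel n) hp.2)
  have h0 := (mdifferentiable_triv (F.π p₀)).comp_symm_deriv (e.map_source hp.1)
  rw [e.left_inv hp.1] at h0
  have h2 : mfderiv (totalModel n) (totalModel n) e p
      (mfderiv (totalModel n) (totalModel n) e.symm (e p) z) = z :=
    congrArg (fun L : TotalSpace n →L[ℝ] TotalSpace n => L z) h0
  refine ⟨mfderiv (totalModel n) (totalModel n) e.symm (e p) z, ?_⟩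
  exact (mfderiv_adapted hp _).trans ((congrArg (mfderiv (totalModel n) 𝓘(ℝ, TotalSpace n)
    (extChartAt (totalModel n) (e p₀)) (e p)) h2).trans h1)

theorem adapted_vertical {p : F.P} (hp : p ∈ F.adaptedSource p₀)
    (v : TangentSpace (totalModel n) p) : F.IsVertical v ↔
    (mfderiv (totalModel n) 𝓘(ℝ, TotalSpace n) (F.adapted p₀) p v : TotalSpace n).1 = 0 := by
  rw [mfderiv_adapted_fst hp]
  unfold IsVertical
  constructor
  · intro h
    rw [h]; exact map_zero _
  · intro h
    have h1 := congrArg (fun L : EuclideanSpace ℝ (Fin 2) →L[ℝ] EuclideanSpace ℝ (Fin 2) =>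
      L (mfderiv (totalModel n) (𝓡∂ 2) F.π p v))
      (mfderivWithin_extChartAt_symm_comp_mfderiv_extChartAt' (I := 𝓡∂ 2) (π_mem_source hp))
    exact h1.symm.trans ((congrArg (mfderivWithin 𝓘(ℝ, EuclideanSpace ℝ (Fin 2)) (𝓡∂ 2)
      (extChartAt (𝓡∂ 2) (F.π p₀)).symm (range (𝓡∂ 2)) _) h).trans (map_zero _))

/-- In the adapted coordinates, the form is Lipschitz and uniformly nondegenerate along the fibres
near `p₀`. -/
theorem exists_adapted_bounds
    (hΩ : ∀ p : F.P, ContDiffOn ℝ ∞ (F.Ω.inChart p) (extChartAt (totalModel n) p).target)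
    (hfib : ∀ (p : F.P) (v : TangentSpace (totalModel n) p), F.IsVertical v →
      (∀ w : TangentSpace (totalModel n) p, F.IsVertical w → F.Ω p ![v, w] = 0) → v = 0)
    (p₀ : F.P) :
    ∃ U : Set F.P, IsOpen U ∧ p₀ ∈ U ∧ U ⊆ F.adaptedSource p₀ ∧ ∃ C L A : ℝ, 0 < C ∧ 0 ≤ L ∧ 0 ≤ A ∧
      (∀ p ∈ U, ‖F.adaptedForm p₀ (F.adapted p₀ p)‖ ≤ A) ∧
      (∀ p ∈ U, ∀ q ∈ U, ‖F.adaptedForm p₀ (F.adapted p₀ p) - F.adaptedForm p₀ (F.adapted p₀ q)‖ ≤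
        L * ‖F.adapted p₀ p - F.adapted p₀ q‖) ∧
      ∀ p ∈ U, ∀ (x : EuclideanSpace ℝ (Fin (2 * n))) (R : ℝ), 0 ≤ R →
        (∀ w : EuclideanSpace ℝ (Fin (2 * n)), |F.adaptedForm p₀ (F.adapted p₀ p) ![(0, x), (0, w)]| ≤
          R * ‖w‖) → ‖x‖ ≤ C * R := by
  set e := F.triv (F.π p₀) with he
  set η := F.adaptedForm p₀ with hη
  set y₀ := F.adapted p₀ p₀ with hy₀
  have hy₀t : y₀ ∈ (extChartAt (totalModel n) (e p₀)).target := mem_extChartAt_target _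
  have hsm : ContDiffWithinAt ℝ ∞ η (extChartAt (totalModel n) (e p₀)).target y₀ := by
    refine (TwoForm.pullback_local F.Ω hΩ e.open_target (F.contMDiffOn_triv_symm (F.π p₀))
      hy₀t ?_).1
    rw [hy₀, adapted, (extChartAt (totalModel n) (e p₀)).left_inv (mem_extChartAt_source _)]
    exact e.map_source mem_triv_source_self
  have hsm' : ContDiffWithinAt ℝ 1 η (range (totalModel n)) y₀ :=
    (hsm.mono_of_mem_nhdsWithin (extChartAt_target_mem_nhdsWithin_of_mem hy₀t)).of_le (by simp)
  obtain ⟨K, t, ht, hK⟩ := hsm'.exists_lipschitzOnWith (totalModel n).convex_range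
  obtain ⟨C, hC, δ, hδ, hCδ⟩ := exists_fibre_bound (η y₀) (by
    intro x hx
    obtain ⟨v, hv⟩ := exists_adapted_tangent (F := F) (p₀ := p₀) mem_adaptedSource ((0, x) : TotalSpace n)
    have hv0 : v = 0 := by
      refine hfib p₀ v ((adapted_vertical mem_adaptedSource v).2 (by rw [hv])) fun w hw => ?_
      rw [← adaptedForm_apply mem_adaptedSource, hv]
      have hw' := (adapted_vertical mem_adaptedSource w).1 hw
      have hz : (mfderiv (totalModel n) 𝓘(ℝ, TotalSpace n) (F.adapted p₀) p₀ w : TotalSpace n) =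
          (0, (mfderiv (totalModel n) 𝓘(ℝ, TotalSpace n) (F.adapted p₀) p₀ w : TotalSpace n).2) :=
        Prod.ext hw' rfl
      exact (congrArg (fun z : TotalSpace n => η y₀ ![(0, x), z]) hz).trans (hx _)
    have := hv.symm.trans ((congrArg _ hv0).trans (map_zero _))
    exact congrArg Prod.snd this)
  have hcont : ContinuousAt (F.adapted p₀) p₀ :=
    (mdifferentiableAt_adapted mem_adaptedSource).continuousAt
  have hmem : ∀ p ∈ F.adaptedSource p₀, F.adapted p₀ p ∈ range (totalModel n) := fun p hp =>
    extChartAt_target_subset_range _ ((extChartAt (totalModel n) (e p₀)).map_source hp.2)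
  have hnear : ∀ᶠ p in 𝓝 p₀, p ∈ F.adaptedSource p₀ ∧ F.adapted p₀ p ∈ t ∧
      ‖F.adapted p₀ p - y₀‖ ≤ δ / (K + 1) := by
    have h1 : ∀ᶠ p in 𝓝 p₀, p ∈ F.adaptedSource p₀ := isOpen_adaptedSource.mem_nhds mem_adaptedSource
    have h2 : Tendsto (F.adapted p₀) (𝓝 p₀) (𝓝[range (totalModel n)] y₀) :=
      tendsto_nhdsWithin_iff.2 ⟨hcont, h1.mono hmem⟩
    have h3 : ∀ᶠ p in 𝓝 p₀, ‖F.adapted p₀ p - y₀‖ < δ / (K + 1) := by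
      have : Tendsto (fun p => ‖F.adapted p₀ p - y₀‖) (𝓝 p₀) (𝓝 0) := by
        have := (hcont.tendsto.sub_const y₀).norm
        rw [← hy₀, sub_self, norm_zero] at this
        exact this
      exact this.eventually_lt_const (by positivity)
    filter_upwards [h1, h2 ht, h3] with p a b c using ⟨a, b, c.le⟩
  obtain ⟨U, hU, hUo, hU0⟩ := eventually_nhds_iff.1 hnear
  have hy0t : y₀ ∈ t := (hU p₀ hU0).2.1
  have hclose : ∀ p ∈ U, ‖η (F.adapted p₀ p) - η y₀‖ ≤ δ := by
    intro p hp
    have h1 := hK.dist_le_mul _ (hU p hp).2.1 _ hy0t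
    rw [dist_eq_norm, dist_eq_norm] at h1
    have h2 := (hU p hp).2.2
    have h3 : (K : ℝ) * ‖F.adapted p₀ p - y₀‖ ≤ (K + 1) * (δ / (K + 1)) := by gcongr; simp
    have h4 : ((K : ℝ) + 1) * (δ / (K + 1)) = δ := by field_simp
    linarith
  refine ⟨U, hUo, hU0, fun p hp => (hU p hp).1, C, K, ‖η y₀‖ + δ, hC, K.2, by positivity, ?_, ?_, ?_⟩
  · intro p hp
    have h1 := norm_add_le (η (F.adapted p₀ p) - η y₀) (η y₀)
    rw [sub_add_cancel] at h1
    linarith [hclose p hp]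
  · intro p hp q hq
    have h1 := hK.dist_le_mul _ (hU p hp).2.1 _ (hU q hq).2.1
    rwa [dist_eq_norm, dist_eq_norm] at h1
  · intro p hp x R hR h
    exact hCδ _ (hclose p hp) x R hR h

end AdaptedChart
end FibrationData
end HamGeometry

namespace HamGeometry
open Filter
open scoped NNReal

universe u

namespace FibrationData

/-! ### Uniqueness of horizontal lifts -/

section Lifts

variable {n : ℕ} {M : Type u} [TopologicalSpace M]
  [ChartedSpace (EuclideanSpace ℝ (Fin (2 * n))) M]
  {S : ModelSurface} (F : FibrationData (n := n) M S)

/-- The path `c : [a, b] → P` is a horizontal lift of the path `γ : [a, b] → B`. -/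
def IsLiftOn (γ : ℝ → F.B) (c : ℝ → F.P) (a b : ℝ) : Prop :=
  ∀ t ∈ Icc a b, F.π (c t) = γ t ∧ ∃ u : TangentSpace (totalModel n) (c t),
    HasMFDerivWithinAt 𝓘(ℝ, ℝ) (totalModel n) c (Icc a b) t ((1 : ℝ →L[ℝ] ℝ).smulRight u) ∧
    F.IsHorizontal u

variable {F} {γ : ℝ → F.B} {c c' : ℝ → F.P} {a b : ℝ}

theorem isHorizontal_smul {p : F.P} {u : TangentSpace (totalModel n) p} (h : F.IsHorizontal u)
    (k : ℝ) : F.IsHorizontal (k • u) := fun v hv => by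
  have h1 := form_smul_left (E := TotalSpace n) (F.Ω p) k u v
  exact h1.trans ((congrArg (k * ·) (h v hv)).trans (mul_zero k))

theorem IsLiftOn.mono (h : F.IsLiftOn γ c a b) {a' b' : ℝ} (ha : a ≤ a') (hb : b' ≤ b) :
    F.IsLiftOn γ c a' b' := by
  intro t ht
  have hs : Icc a' b' ⊆ Icc a b := Icc_subset_Icc ha hb
  obtain ⟨h1, u, h2, h3⟩ := h t (hs ht)
  exact ⟨h1, u, h2.mono hs, h3⟩

theorem IsLiftOn.comp (h : F.IsLiftOn γ c a b) {ρ : ℝ → ℝ} {a' b' : ℝ}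
    (hρ : DifferentiableOn ℝ ρ (Icc a' b')) (hm : MapsTo ρ (Icc a' b') (Icc a b)) :
    F.IsLiftOn (γ ∘ ρ) (c ∘ ρ) a' b' := by
  intro t ht
  obtain ⟨h1, u, h2, h3⟩ := h (ρ t) (hm ht)
  refine ⟨h1, derivWithin ρ (Icc a' b') t • u, ?_, isHorizontal_smul h3 _⟩
  have hd : HasMFDerivWithinAt 𝓘(ℝ, ℝ) 𝓘(ℝ, ℝ) ρ (Icc a' b') t
      ((1 : ℝ →L[ℝ] ℝ).smulRight (derivWithin ρ (Icc a' b') t)) :=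
    ((hρ t ht).hasDerivWithinAt).hasFDerivWithinAt.hasMFDerivWithinAt
  have := h2.comp t hd hm
  refine this.congr_mfderiv (ContinuousLinearMap.ext_ring ?_)
  show ((1 : ℝ) • derivWithin ρ (Icc a' b') t) • u = (1 : ℝ) • derivWithin ρ (Icc a' b') t • u
  rw [one_smul, one_smul]

theorem IsLiftOn.continuousOn (h : F.IsLiftOn γ c a b) : ContinuousOn c (Icc a b) := fun t ht =>
  let ⟨_, _, h2, _⟩ := h t ht
  h2.1

theorem isLiftOn_const {x : F.B} {p : F.P} (hp : F.π p = x) :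
    F.IsLiftOn (fun _ => x) (fun _ => p) a b := fun t _ =>
  ⟨hp, 0, by
    have := hasMFDerivWithinAt_const (I := 𝓘(ℝ, ℝ)) (I' := totalModel n) p (Icc a b) t
    exact this.congr_mfderiv (ContinuousLinearMap.ext_ring (smul_zero (1 : ℝ)).symm), fun v _ => by
    exact (formBilin (E := TotalSpace n) (F.Ω p)).map_zero₂ v⟩

variable [IsManifold (𝓡 (2 * n)) ∞ M]

theorem hasDerivWithinAt_adapted {p₀ : F.P} {s : Set ℝ} {t : ℝ} {u : TangentSpace (totalModel n) (c t)}
    (hu : HasMFDerivWithinAt 𝓘(ℝ, ℝ) (totalModel n) c s t ((1 : ℝ →L[ℝ] ℝ).smulRight u))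
    (hp : c t ∈ F.adaptedSource p₀) :
    HasDerivWithinAt (fun t => F.adapted p₀ (c t))
      (mfderiv (totalModel n) 𝓘(ℝ, TotalSpace n) (F.adapted p₀) (c t) u : TotalSpace n) s t := by
  have key : ∀ (f : ℝ → TotalSpace n) (L : ℝ →L[ℝ] TotalSpace n), HasFDerivWithinAt f L s t →
      HasDerivWithinAt f (L 1) s t := fun _ _ h => h.hasDerivWithinAt
  refine (key _ _ ((mdifferentiableAt_adapted hp).hasMFDerivAt.comp_hasMFDerivWithinAt t
    hu).hasFDerivWithinAt).congr_deriv ?_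
  exact congrArg (mfderiv (totalModel n) 𝓘(ℝ, TotalSpace n) (F.adapted p₀) (c t)) (one_smul ℝ u)

/-- Horizontal lifts with the same starting point agree for a short time. In adapted coordinates,
horizontality is a linear equation for the velocity along the fibre whose coefficients are
Lipschitz, so the difference of the two lifts is controlled by Gronwall's inequality. -/
theorem IsLiftOn.eq_near
    (hΩ : ∀ p : F.P, ContDiffOn ℝ ∞ (F.Ω.inChart p) (extChartAt (totalModel n) p).target)
    (hfib : ∀ (p : F.P) (v : TangentSpace (totalModel n) p), F.IsVertical v →
      (∀ w : TangentSpace (totalModel n) p, F.IsVertical w → F.Ω p ![v, w] = 0) → v = 0)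
    (hγ : ContMDiffOn 𝓘(ℝ, ℝ) (𝓡∂ 2) ∞ γ (Icc a b)) (hab : a < b)
    (hc : F.IsLiftOn γ c a b) (hc' : F.IsLiftOn γ c' a b) (h : c a = c' a) :
    ∃ d, a < d ∧ d ≤ b ∧ ∀ t ∈ Icc a d, c t = c' t := by
  set p₀ := c a with hp₀
  obtain ⟨U, hUo, hU0, hUs, C, L, A, hC, hL, hA, hbd, hlip, hnd⟩ := exists_adapted_bounds hΩ hfib p₀
  have ha : a ∈ Icc a b := ⟨le_rfl, hab.le⟩
  -- a time interval on which both lifts stay in the domain of the coordinates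
  obtain ⟨d, had, hdb, hd⟩ : ∃ d, a < d ∧ d ≤ b ∧ ∀ t ∈ Icc a d, c t ∈ U ∧ c' t ∈ U := by
    have h1 : ∀ᶠ t in 𝓝[Icc a b] a, c t ∈ U := (hc.continuousOn a ha) (hUo.mem_nhds hU0)
    have h2 : ∀ᶠ t in 𝓝[Icc a b] a, c' t ∈ U :=
      (hc'.continuousOn a ha) (hUo.mem_nhds (by rw [← h]; exact hU0))
    obtain ⟨ε, hε, hs⟩ := Metric.mem_nhdsWithin_iff.1 (h1.and h2)
    refine ⟨min b (a + ε / 2), lt_min hab (by linarith), min_le_left _ _, fun t ht => hs ⟨?_, ?_⟩⟩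
    · rw [Metric.mem_ball, Real.dist_eq, abs_of_nonneg (by linarith [ht.1])]
      linarith [ht.2.trans (min_le_right _ _)]
    · exact ⟨ht.1, ht.2.trans (min_le_left _ _)⟩
  have hsub : Icc a d ⊆ Icc a b := Icc_subset_Icc le_rfl hdb
  -- the coordinate expression of the base path has bounded velocity
  set z : ℝ → EuclideanSpace ℝ (Fin 2) := fun t => extChartAt (𝓡∂ 2) (F.π p₀) (γ t) with hz
  have hzs : ContDiffOn ℝ ∞ z (Icc a d) := by
    refine ContMDiffOn.contDiffOn ?_
    refine (contMDiffOn_extChartAt (n := ∞)).comp (hγ.mono hsub) fun t ht => ?_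
    have := π_mem_source (hUs (hd t ht).1)
    rw [extChartAt_source] at this
    rw [mem_preimage, ← (hc t (hsub ht)).1]
    exact this
  obtain ⟨V, hV⟩ := isCompact_Icc.bddAbove_image
    (hzs.continuousOn_derivWithin (uniqueDiffOn_Icc had) (by simp)).norm
  have hV' : ∀ t ∈ Icc a d, ‖derivWithin z (Icc a d) t‖ ≤ V := fun t ht => hV (mem_image_of_mem _ ht)
  have hV0 : 0 ≤ V := (norm_nonneg _).trans (hV' a ⟨le_rfl, had.le⟩)
  have hη : ∀ p (x y : TotalSpace n), F.adaptedForm p₀ p ![x, y] = formBilin (F.adaptedForm p₀ p) x y :=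
    fun _ _ _ => rfl
  -- the velocity of a lift in adapted coordinates
  have key : ∀ e : ℝ → F.P, F.IsLiftOn γ e a b → (∀ t ∈ Icc a d, e t ∈ U) → ∀ t ∈ Icc a d,
      ∃ x : EuclideanSpace ℝ (Fin (2 * n)),
        HasDerivWithinAt (fun t => F.adapted p₀ (e t)) (derivWithin z (Icc a d) t, x) (Icc a d) t ∧
        (∀ w : EuclideanSpace ℝ (Fin (2 * n)), F.adaptedForm p₀ (F.adapted p₀ (e t))
          ![(derivWithin z (Icc a d) t, x), (0, w)] = 0) ∧ ‖x‖ ≤ C * (A * V) := by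
    intro e he heU t ht
    obtain ⟨h1, u, h2, h3⟩ := he t (hsub ht)
    have hp := hUs (heU t ht)
    have hder := hasDerivWithinAt_adapted (h2.mono hsub) hp
    set y : TotalSpace n := mfderiv (totalModel n) 𝓘(ℝ, TotalSpace n) (F.adapted p₀) (e t) u with hy
    have hfst : HasDerivWithinAt z y.1 (Icc a d) t := by
      have h4 : HasDerivWithinAt (fun t => (F.adapted p₀ (e t)).1) y.1 (Icc a d) t :=
        hder.hasFDerivWithinAt.fst.hasDerivWithinAt.congr_deriv (by simp)
      refine h4.congr_of_mem (fun s hs => ?_) ht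
      rw [adapted_fst (hUs (heU s hs)), (he s (hsub hs)).1]
    have hy1 : derivWithin z (Icc a d) t = y.1 := hfst.derivWithin (uniqueDiffOn_Icc had t ht)
    have hhor : ∀ w : EuclideanSpace ℝ (Fin (2 * n)), F.adaptedForm p₀ (F.adapted p₀ (e t))
        ![(y.1, y.2), (0, w)] = 0 := by
      intro w
      obtain ⟨v, hv⟩ := exists_adapted_tangent hp ((0, w) : TotalSpace n)
      have h5 := h3 v ((adapted_vertical hp v).2 (by rw [hv]))
      rw [← adaptedForm_apply hp] at h5
      exact (congrArg (fun z : TotalSpace n => F.adaptedForm p₀ (F.adapted p₀ (e t)) ![y, z])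
        hv).symm.trans h5
    refine ⟨y.2, by rw [hy1]; exact hder, by rw [hy1]; exact hhor, ?_⟩
    refine hnd (e t) (heU t ht) y.2 (A * V) (by positivity) fun w => ?_
    have h6 := hhor w
    have e1 : ((y.1, y.2) : TotalSpace n) = (y.1, 0) + (0, y.2) := by simp
    rw [e1, form_add_left] at h6
    rw [eq_neg_of_add_eq_zero_right h6, abs_neg]
    refine (abs_form_le _ _ _).trans ?_
    have n1 : ‖((0, w) : TotalSpace n)‖ = ‖w‖ := by simp [Prod.norm_def]
    have n2 : ‖((y.1, 0) : TotalSpace n)‖ = ‖y.1‖ := by simp [Prod.norm_def]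
    rw [n1, n2]
    have := hbd _ (heU t ht)
    have h7 := hV' t ht
    rw [hy1] at h7
    gcongr
  have hk := key c hc fun t ht => (hd t ht).1
  have hk' := key c' hc' fun t ht => (hd t ht).2
  choose! x hx1 hx2 hx3 using hk
  choose! x' hx1' hx2' hx3' using hk'
  -- The Gronwall estimate for the difference of the coordinates of the lifts, which is vertical.
  have hzero := eq_zero_of_abs_deriv_le_mul_abs_self_of_eq_zero_right
    (f := fun t => F.adapted p₀ (c t) - F.adapted p₀ (c' t))
    (f' := fun t => (0, x t - x' t)) (a := a) (b := d) (K := C * (L * (V + C * (A * V)))) ?_ ?_ ?_ ?_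
  · exact ⟨d, had, hdb, fun t ht => adapted_injOn (hUs (hd t ht).1) (hUs (hd t ht).2)
      (sub_eq_zero.1 (hzero t ht))⟩
  · exact fun t ht => ((hx1 t ht).continuousWithinAt).sub (hx1' t ht).continuousWithinAt
  · intro t ht
    have ht' := Ico_subset_Icc_self ht
    have h1 := (hx1 t ht').sub (hx1' t ht')
    have h2 : ((derivWithin z (Icc a d) t, x t) : TotalSpace n) - (derivWithin z (Icc a d) t, x' t) =
        (0, x t - x' t) := by simp
    rw [h2] at h1
    exact h1.mono_of_mem_nhdsWithin (Icc_mem_nhdsGE_of_mem ht)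
  · show F.adapted p₀ (c a) - F.adapted p₀ (c' a) = 0
    rw [← h, hp₀, sub_self]
  · intro t ht
    have ht' := Ico_subset_Icc_self ht
    have n1 : ‖((0, x t - x' t) : TotalSpace n)‖ = ‖x t - x' t‖ := by simp [Prod.norm_def]
    rw [n1]
    have := hnd (c t) (hd t ht').1 (x t - x' t)
      (L * (V + C * (A * V)) * ‖F.adapted p₀ (c t) - F.adapted p₀ (c' t)‖) (by positivity) fun w => ?_
    · refine this.trans (le_of_eq (by ring))
    set v := derivWithin z (Icc a d) t with hv
    set η := F.adaptedForm p₀ (F.adapted p₀ (c t)) with hη1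
    set η' := F.adaptedForm p₀ (F.adapted p₀ (c' t)) with hη2
    have e1 : ((0, x t - x' t) : TotalSpace n) = (v, x t) + (-1 : ℝ) • (v, x' t) := by
      simp [sub_eq_add_neg]
    have e2 : η ![(0, x t - x' t), (0, w)] = -((η - η') ![(v, x' t), (0, w)]) := by
      rw [e1, form_add_left, form_smul_left, hx2 t ht' w, ContinuousAlternatingMap.sub_apply,
        hx2' t ht' w]
      ring
    rw [e2, abs_neg]
    refine (abs_form_le _ _ _).trans ?_
    have n2 : ‖((0, w) : TotalSpace n)‖ = ‖w‖ := by simp [Prod.norm_def]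
    have n3 : ‖((v, x' t) : TotalSpace n)‖ ≤ V + C * (A * V) := by
      rw [Prod.norm_def]
      refine max_le ?_ ?_
      · have := hV' t ht'; have : 0 ≤ C * (A * V) := by positivity
        simp only; linarith
      · have := hx3' t ht'; simp only; linarith
    rw [n2]
    have h8 := hlip _ (hd t ht').1 _ (hd t ht').2
    calc ‖η - η'‖ * ‖((v, x' t) : TotalSpace n)‖ * ‖w‖
        ≤ (L * ‖F.adapted p₀ (c t) - F.adapted p₀ (c' t)‖) * (V + C * (A * V)) * ‖w‖ := by gcongr
      _ = _ := by ring

/-- Uniqueness of horizontal lifts. -/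
theorem IsLiftOn.eqOn
    (hΩ : ∀ p : F.P, ContDiffOn ℝ ∞ (F.Ω.inChart p) (extChartAt (totalModel n) p).target)
    (hfib : ∀ (p : F.P) (v : TangentSpace (totalModel n) p), F.IsVertical v →
      (∀ w : TangentSpace (totalModel n) p, F.IsVertical w → F.Ω p ![v, w] = 0) → v = 0)
    (hγ : ContMDiffOn 𝓘(ℝ, ℝ) (𝓡∂ 2) ∞ γ (Icc a b))
    (hc : F.IsLiftOn γ c a b) (hc' : F.IsLiftOn γ c' a b) (h : c a = c' a) :
    EqOn c c' (Icc a b) := by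
  refine IsClosed.Icc_subset_of_forall_exists_gt (s := {t | c t = c' t}) ?_ h ?_
  · have h1 : IsClosed {q : F.P × F.P | q.1 = q.2} := isClosed_diagonal
    have h2 := (hc.continuousOn.prodMk hc'.continuousOn).preimage_isClosed_of_isClosed isClosed_Icc h1
    rw [inter_comm] at h2
    exact h2
  · rintro t ⟨ht, htI⟩ y hy
    obtain ⟨d, h1, h2, h3⟩ := IsLiftOn.eq_near hΩ hfib (hγ.mono (Icc_subset_Icc htI.1 le_rfl)) htI.2
      (hc.mono htI.1 le_rfl) (hc'.mono htI.1 le_rfl) ht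
    exact ⟨min d y, h3 _ ⟨le_min h1.le (le_of_lt hy), min_le_left _ _⟩,
      lt_min h1 hy, min_le_right _ _⟩

end Lifts
end FibrationData
end HamGeometry

namespace HamGeometry

universe u

/-! ### A word in a group -/

section Words

variable {n : ℕ} {M : Type u} [TopologicalSpace M]
  [ChartedSpace (EuclideanSpace ℝ (Fin (2 * n))) M]

/-- `a₁⁻¹ a₃⁻¹ ⋯ a_{2m-1}⁻¹`. -/
def oddInv {G : Type*} [Group G] (a : ℕ → G) : ℕ → G
  | 0 => 1
  | m + 1 => oddInv a m * (a (2 * m + 1))⁻¹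

/-- `a₂⁻¹ a₄⁻¹ ⋯ a_{2m}⁻¹`. -/
def evenInv {G : Type*} [Group G] (a : ℕ → G) : ℕ → G
  | 0 => 1
  | m + 1 => evenInv a m * (a (2 * m + 2))⁻¹

/-- `a_m ⋯ a₂ a₁`. -/
def descProd {G : Type*} [Group G] (a : ℕ → G) : ℕ → G
  | 0 => 1
  | m + 1 => a (m + 1) * descProd a m

/-- The word read off from the cut system is a product of `m` commutators: adding two letters
conjugates the word and multiplies it by one commutator. -/
theorem word_mem_commutatorProducts {σ : TwoForm (𝓡 (2 * n)) M} {Γ : Subgroup (Equiv.Perm M)}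
    (hΓ : (Γ : Set (Equiv.Perm M)) ⊆ Ham σ) {a : ℕ → Equiv.Perm M} (ha : ∀ k, a k ∈ Γ) (m : ℕ) :
    oddInv a m * descProd a (2 * m) * evenInv a m ∈ commutatorProducts σ m := by
  have hodd : ∀ m, oddInv a m ∈ Γ := by
    intro m
    induction m with
    | zero => exact Γ.one_mem
    | succ m ih => exact Γ.mul_mem ih (Γ.inv_mem (ha _))
  suffices ∃ l : List (Equiv.Perm M), l.length ≤ m ∧
      (∀ c ∈ l, ∃ x ∈ Γ, ∃ y ∈ Γ, c = x * y * x⁻¹ * y⁻¹) ∧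
      l.prod = oddInv a m * descProd a (2 * m) * evenInv a m by
    obtain ⟨l, h1, h2, h3⟩ := this
    refine ⟨l, h1, fun c hc => ?_, h3⟩
    obtain ⟨x, hx, y, hy, rfl⟩ := h2 c hc
    exact ⟨x, hΓ hx, y, hΓ hy, rfl⟩
  induction m with
  | zero => exact ⟨[], by simp, by simp, by simp [oddInv, evenInv, descProd]⟩
  | succ m ih =>
    obtain ⟨l, h1, h2, h3⟩ := ih
    set b := a (2 * m + 2) with hb
    set x := oddInv a m * (a (2 * m + 1))⁻¹ with hx
    -- The new commutator, and the old ones conjugated by the new letter.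
    refine ⟨(x * b * x⁻¹ * b⁻¹) :: l.map (MulAut.conj b), by simpa using h1, ?_, ?_⟩
    · intro c hc
      rcases List.mem_cons.1 hc with rfl | hc
      · exact ⟨x, Γ.mul_mem (hodd m) (Γ.inv_mem (ha _)), b, ha _, rfl⟩
      · obtain ⟨d, hd, rfl⟩ := List.mem_map.1 hc
        obtain ⟨y, hy, z, hz, rfl⟩ := h2 d hd
        have hc : ∀ w ∈ Γ, MulAut.conj b w ∈ Γ := fun w hw =>
          Γ.mul_mem (Γ.mul_mem (ha _) hw) (Γ.inv_mem (ha _))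
        exact ⟨_, hc y hy, _, hc z hz, by simp only [map_mul, map_inv]⟩
    · rw [List.prod_cons, ← map_list_prod, h3, MulAut.conj_apply]
      rw [show 2 * (m + 1) = 2 * m + 1 + 1 by ring]
      simp only [oddInv, evenInv, descProd, ← hx]
      rw [show 2 * m + 1 + 1 = 2 * m + 2 by ring, ← hb]
      have : x⁻¹ = a (2 * m + 1) * (oddInv a m)⁻¹ := by rw [hx]; group
      rw [this]
      group

end Words

/-- Two smooth maps on the line that agree near a point can be glued there. -/
theorem contMDiff_ite_le {E H B : Type*} [NormedAddCommGroup E] [NormedSpace ℝ E]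
    [TopologicalSpace H] {I : ModelWithCorners ℝ E H} [TopologicalSpace B] [ChartedSpace H B]
    {f₁ f₂ : ℝ → B} (h1 : ContMDiff 𝓘(ℝ, ℝ) I ∞ f₁) (h2 : ContMDiff 𝓘(ℝ, ℝ) I ∞ f₂) {s r : ℝ}
    (hr : 0 < r) (h : ∀ t, |t - s| < r → f₁ t = f₂ t) :
    ContMDiff 𝓘(ℝ, ℝ) I ∞ (fun t => if t ≤ s then f₁ t else f₂ t) := by
  intro t
  rcases lt_or_ge t (s + r) with ht | ht
  · refine (h1 t).congr_of_eventuallyEq ?_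
    filter_upwards [Iio_mem_nhds ht] with u hu
    split_ifs with hus
    · rfl
    · refine (h u ?_).symm
      rw [abs_lt]
      constructor <;> [linarith [not_le.1 hus]; linarith [mem_Iio.1 hu]]
  · refine (h2 t).congr_of_eventuallyEq ?_
    filter_upwards [Ioi_mem_nhds (show s < t by linarith)] with u hu
    exact if_neg (not_le.2 hu)

namespace FibrationData

/-! ### The monodromies of loops -/

section Loops

variable {n : ℕ} {M : Type u} [TopologicalSpace M]
  [ChartedSpace (EuclideanSpace ℝ (Fin (2 * n))) M]
  {S : ModelSurface} (F : FibrationData (n := n) M S)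

/-- Parallel transport along `γ : [0, 1] → B` takes `p` to `q`. -/
def Transports (γ : ℝ → F.B) (p q : F.P) : Prop :=
  ∃ c, F.IsLiftOn γ c 0 1 ∧ c 0 = p ∧ c 1 = q

/-- A smooth loop at the base-point that is constant near its ends. -/
def IsFlatLoop (γ : ℝ → F.B) : Prop :=
  ContMDiff 𝓘(ℝ, ℝ) (𝓡∂ 2) ∞ γ ∧ ∃ r > 0, ∀ t, (t ≤ r ∨ 1 - r ≤ t) → γ t = F.bdry 0

variable {F} {γ γ' : ℝ → F.B} {c c' : ℝ → F.P} {a b : ℝ}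

theorem IsLiftOn.congr_base (h : F.IsLiftOn γ c a b) (hγ : ∀ t ∈ Icc a b, γ' t = γ t) :
    F.IsLiftOn γ' c a b := fun t ht => ⟨(h t ht).1.trans (hγ t ht).symm, (h t ht).2⟩

/-- A lift, run through from time `p` to time `q`, is parallel transport. -/
theorem IsLiftOn.transports (h : F.IsLiftOn γ c a b) {p q : ℝ} (hp : p ∈ Icc a b) (hq : q ∈ Icc a b)
    (hγ : ∀ t ∈ Icc (0 : ℝ) 1, γ' t = γ (p + (q - p) * t)) : F.Transports γ' (c p) (c q) := by
  have h1 : F.IsLiftOn (γ ∘ fun t => p + (q - p) * t) (c ∘ fun t => p + (q - p) * t) 0 1 := by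
    refine h.comp (by fun_prop) fun t ht => ?_
    have h2 := (convex_Icc a b) hp hq (sub_nonneg.2 ht.2) ht.1 (sub_add_cancel _ _)
    convert h2 using 1
    simp only [smul_eq_mul]; ring
  exact ⟨_, h1.congr_base hγ, by simp, by simp⟩

theorem Transports.symm {p q : F.P} (h : F.Transports γ p q) :
    F.Transports (fun t => γ (1 - t)) q p := by
  obtain ⟨c, h1, rfl, rfl⟩ := h
  refine h1.transports ⟨zero_le_one, le_rfl⟩ ⟨le_rfl, zero_le_one⟩ fun t _ => ?_
  congr 1; ring

variable [IsManifold (𝓡 (2 * n)) ∞ M] {σ : TwoForm (𝓡 (2 * n)) M} (hF : F.IsHamiltonian σ)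

include hF

theorem IsHamiltonian.lift_eqOn (hγ : ContMDiffOn 𝓘(ℝ, ℝ) (𝓡∂ 2) ∞ γ (Icc a b))
    (hc : F.IsLiftOn γ c a b) (hc' : F.IsLiftOn γ c' a b) (h : c a = c' a) : EqOn c c' (Icc a b) :=
  IsLiftOn.eqOn hF.symplectic.smooth hF.fibre_nondegenerate hγ hc hc' h

/-- Parallel transport is single-valued, as horizontal lifts are unique. -/
theorem IsHamiltonian.transports_unique {p q q' : F.P}
    (hγ : ContMDiffOn 𝓘(ℝ, ℝ) (𝓡∂ 2) ∞ γ (Icc 0 1))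
    (h : F.Transports γ p q) (h' : F.Transports γ p q') : q = q' := by
  obtain ⟨c, h1, h2, rfl⟩ := h
  obtain ⟨c', h1', h2', rfl⟩ := h'
  exact hF.lift_eqOn hγ h1 h1' (h2.trans h2'.symm) ⟨zero_le_one, le_rfl⟩

theorem IsHamiltonian.transports_left_unique {p p' q : F.P}
    (hγ : ContMDiffOn 𝓘(ℝ, ℝ) (𝓡∂ 2) ∞ γ (Icc 0 1))
    (h : F.Transports γ p q) (h' : F.Transports γ p' q) : p = p' := by
  refine hF.transports_unique ?_ h.symm h'.symm
  refine hγ.comp (t := Icc 0 1) (f := fun t : ℝ => 1 - t)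
    (contDiff_const.sub contDiff_id).contMDiff.contMDiffOn fun t ht => ?_
  exact ⟨by linarith [ht.2], by linarith [ht.1]⟩

omit [IsManifold (𝓡 (2 * n)) ∞ M] in
/-- The lifts of a smooth loop at the base-point, parametrised by any interval. -/
theorem IsHamiltonian.exists_lift (hγ : ContMDiffOn 𝓘(ℝ, ℝ) (𝓡∂ 2) ∞ γ (Icc a b)) (hab : a < b)
    (ha : γ a = F.bdry 0) (hb : γ b = F.bdry 0) :
    ∃ h ∈ Ham σ, F.HasMonodromy (fun t => γ (a + (b - a) * t)) h ∧
      ∀ x, ∃ c, F.IsLiftOn γ c a b ∧ c a = F.ι x ∧ c b = F.ι (h x) := by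
  have hba : 0 < b - a := sub_pos.2 hab
  obtain ⟨h, hh, hm⟩ := hF.monodromy_mem_Ham (fun t => γ (a + (b - a) * t)) (by
    refine hγ.comp (f := fun t : ℝ => a + (b - a) * t)
      (contDiff_const.add (contDiff_const.mul contDiff_id)).contMDiff.contMDiffOn fun t ht => ?_
    exact ⟨by nlinarith [ht.1], by nlinarith [ht.2]⟩) (by simpa using ha) (by simpa using hb)
  refine ⟨h, hh, hm, fun x => ?_⟩
  obtain ⟨c, h1, h2, h3⟩ := hm x
  have h4 : F.IsLiftOn ((fun t => γ (a + (b - a) * t)) ∘ fun s => (s - a) / (b - a))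
      (c ∘ fun s => (s - a) / (b - a)) a b := by
    refine IsLiftOn.comp h1 (by fun_prop) fun s hs => ⟨div_nonneg (by linarith [hs.1]) hba.le, ?_⟩
    rw [div_le_one hba]; linarith [hs.2]
  refine ⟨_, h4.congr_base fun t _ => ?_, by simp [h2], ?_⟩
  · simp only [Function.comp]
    congr 1
    field_simp
    ring
  · simp [h3, div_self hba.ne']

variable (F)

/-- The monodromies around smooth loops at the base-point. -/
def IsHamiltonian.loopGroup : Subgroup (Equiv.Perm M) where
  carrier := {a | ∃ γ, F.IsFlatLoop γ ∧ F.HasMonodromy γ a}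
  one_mem' := ⟨fun _ => F.bdry 0, ⟨contMDiff_const, 1, one_pos, fun _ _ => rfl⟩, fun x =>
    ⟨fun _ => F.ι x, isLiftOn_const (hF.ι_range.subset ⟨x, rfl⟩), rfl, rfl⟩⟩
  mul_mem' := by
    rintro a₂ a₁ ⟨γ₂, ⟨hs₂, r₂, hr₂, h₂⟩, hm₂⟩ ⟨γ₁, ⟨hs₁, r₁, hr₁, h₁⟩, hm₁⟩
    set γ : ℝ → F.B := fun t => if t ≤ 1 / 2 then γ₁ (2 * t) else γ₂ (2 * t - 1) with hγ
    have hsm : ContMDiff 𝓘(ℝ, ℝ) (𝓡∂ 2) ∞ γ := by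
      refine contMDiff_ite_le (f₁ := fun t => γ₁ (2 * t)) (f₂ := fun t => γ₂ (2 * t - 1))
        (hs₁.comp (by fun_prop : ContDiff ℝ ∞ fun t : ℝ => 2 * t).contMDiff)
        (hs₂.comp (by fun_prop : ContDiff ℝ ∞ fun t : ℝ => 2 * t - 1).contMDiff)
        (r := min r₁ r₂ / 2) (by positivity) fun t ht => ?_
      rw [abs_lt] at ht
      have := min_le_left r₁ r₂
      have := min_le_right r₁ r₂
      rw [h₁ _ (Or.inr (by linarith)), h₂ _ (Or.inl (by linarith))]
    have hflat : ∃ r > 0, ∀ t, (t ≤ r ∨ 1 - r ≤ t) → γ t = F.bdry 0 := by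
      refine ⟨min (1 / 4) (min r₁ r₂ / 2), by positivity, fun t ht => ?_⟩
      have e1 := min_le_left r₁ r₂
      have e2 := min_le_right r₁ r₂
      have e3 := min_le_left (1 / 4) (min r₁ r₂ / 2)
      have e4 := min_le_right (1 / 4) (min r₁ r₂ / 2)
      rcases ht with ht | ht
      · rw [hγ]; simp only
        rw [if_pos (by linarith), h₁ _ (Or.inl (by linarith))]
      · rw [hγ]; simp only
        rw [if_neg (by linarith), h₂ _ (Or.inr (by linarith))]
    obtain ⟨r, hr, hb⟩ := hflat
    have hloop : F.IsFlatLoop γ := ⟨hsm, r, hr, hb⟩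
    obtain ⟨h, -, hm, -⟩ := hF.exists_lift (a := 0) (b := 1) hsm.contMDiffOn zero_lt_one
      (hb 0 (Or.inl hr.le)) (hb 1 (Or.inr (by linarith)))
    simp only [sub_zero, one_mul, zero_add] at hm
    have : h = a₂ * a₁ := by
      ext x
      obtain ⟨c, k1, k2, k3⟩ := hm x
      have t1 : F.Transports γ₁ (c 0) (c (1 / 2)) := by
        refine IsLiftOn.transports k1 (by simp) (by norm_num) fun t ht => ?_
        rw [hγ]; simp only
        rw [if_pos (by linarith [ht.2])]
        congr 1; ring
      have t2 : F.Transports γ₂ (c (1 / 2)) (c 1) := by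
        refine IsLiftOn.transports k1 (by norm_num) (by simp) fun t ht => ?_
        rw [hγ]; simp only
        split_ifs with hle
        · have : t = 0 := by linarith [ht.1]
          subst this
          rw [h₁ _ (Or.inr (by linarith)), h₂ _ (Or.inl hr₂.le)]
        · congr 1; ring
      rw [k2] at t1
      have e1 := hF.transports_unique hs₁.contMDiffOn t1 (hm₁ x)
      rw [e1] at t2
      have e2 := hF.transports_unique hs₂.contMDiffOn t2 (hm₂ (a₁ x))
      exact hF.ι_injective (k3.symm.trans e2)
    exact ⟨γ, hloop, this ▸ hm⟩
  inv_mem' := by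
    rintro a ⟨γ, ⟨hs, r, hr, h⟩, hm⟩
    refine ⟨fun t => γ (1 - t), ⟨hs.comp (contDiff_const.sub contDiff_id).contMDiff, r, hr,
      fun t ht => h _ ?_⟩, fun x => ?_⟩
    · rcases ht with ht | ht
      · right; linarith
      · left; linarith
    · have := hm (a⁻¹ x)
      rw [show a (a⁻¹ x) = x from a.apply_symm_apply x] at this
      exact Transports.symm this

variable {F}

/-- The monodromy around a loop is Hamiltonian by the definition of a Hamiltonian fibration, and it
is determined by the loop. -/
theorem IsHamiltonian.loopGroup_subset : (hF.loopGroup F : Set (Equiv.Perm M)) ⊆ Ham σ := by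
  rintro a ⟨γ, ⟨hs, r, hr, h⟩, hm⟩
  obtain ⟨b, hb, hm'⟩ := hF.monodromy_mem_Ham γ hs.contMDiffOn (h 0 (Or.inl hr.le))
    (h 1 (Or.inr (by linarith)))
  have : a = b := by
    ext x
    exact hF.ι_injective (hF.transports_unique hs.contMDiffOn (hm x) (hm' x))
  exact this ▸ hb

theorem IsHamiltonian.exists_lift_mem_loopGroup (hγ : ContMDiff 𝓘(ℝ, ℝ) (𝓡∂ 2) ∞ γ) (hab : a < b)
    {r : ℝ} (hr : 0 < r) (h : ∀ t, (t ≤ a + r ∨ b - r ≤ t) → γ t = F.bdry 0) :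
    ∃ k ∈ hF.loopGroup F, ∀ x, ∃ c, F.IsLiftOn γ c a b ∧ c a = F.ι x ∧ c b = F.ι (k x) := by
  obtain ⟨k, -, h1, h2⟩ := hF.exists_lift hγ.contMDiffOn hab (h a (Or.inl (by linarith)))
    (h b (Or.inr (by linarith)))
  have hba : 0 < b - a := sub_pos.2 hab
  refine ⟨k, ⟨_, ⟨hγ.comp (contDiff_const.add (contDiff_const.mul contDiff_id)).contMDiff,
    r / (b - a), by positivity, fun t ht => h _ ?_⟩, h1⟩, h2⟩
  have e : (b - a) * (r / (b - a)) = r := by field_simp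
  rcases ht with ht | ht
  · left
    have := mul_le_mul_of_nonneg_left ht hba.le
    show a + (b - a) * t ≤ a + r
    linarith
  · right
    have := mul_le_mul_of_nonneg_left ht hba.le
    show b - r ≤ a + (b - a) * t
    linarith

end Loops
end FibrationData
end HamGeometry

namespace HamGeometry

universe u

namespace FibrationData

/-! ### Parallel transport along the cut path -/

section CutSystem

variable {n : ℕ} {M : Type u} [TopologicalSpace M]
  [ChartedSpace (EuclideanSpace ℝ (Fin (2 * n))) M]
  {S : ModelSurface} {F : FibrationData (n := n) M S}

/-- The combinatorics of the cut system of the surface of genus `g`, for a path in the base of the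
fibration: the edges `c (k + ·)` and `c (2 (2 g + 1) + k + ·)`, `k ≤ 2 g`, both join the `k`-th to
the `(k + 1)`-st vertex, the second edge with `k = 0` excepted, and `c` runs through each of these
edges once in each direction. -/
structure IsCutPath (F : FibrationData (n := n) M S) (g : ℕ) (c : ℝ → F.B) : Prop where
  smooth : ContMDiff 𝓘(ℝ, ℝ) (𝓡∂ 2) ∞ c
  of_le : ∀ u : ℝ, u ≤ 1 / 3 → c u = F.bdry 0
  of_ge : ∀ u : ℝ, 4 * (2 * g + 1) - 1 / 3 ≤ u → c u = F.bdry 0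
  near_node : ∀ k : ℕ, k ≤ 4 * (2 * g + 1) → ∀ u : ℝ, |u - k| ≤ 1 / 3 → c u = c k
  node : ∀ k : ℕ, 1 ≤ k → k ≤ 2 * g + 1 → c (2 * (2 * g + 1) + k) = c k
  two_mul_sub : ∀ k : ℕ, k ≤ 2 * g → ∀ s : ℝ, k ≤ s → s ≤ k + 1 →
    c (2 * (2 * g + 1) - s) = if Even k then c (2 * (2 * g + 1) + s) else c s
  four_mul_sub : ∀ k : ℕ, k ≤ 2 * g → ∀ s : ℝ, k ≤ s → s ≤ k + 1 →
    c (4 * (2 * g + 1) - s) = if Even k then c s else c (2 * (2 * g + 1) + s)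

variable {g : ℕ} {c : ℝ → F.B} [IsManifold (𝓡 (2 * n)) ∞ M] {σ : TwoForm (𝓡 (2 * n)) M}

/-- The loop along the cut path to the `k`-th vertex, along the second edge to the next vertex, and
back along the cut path. -/
theorem IsCutPath.exists_edge_monodromy (hF : F.IsHamiltonian σ) (hc : F.IsCutPath g c) {k : ℕ}
    (hk1 : 1 ≤ k) (hk : k ≤ 2 * g) {C : M → ℝ → F.P} {A B : ℝ} (hA : A ≤ 0) (hB : 4 * (2 * g + 1) ≤ B)
    (hC : ∀ x, F.IsLiftOn c (C x) A B) (hC0 : ∀ x, C x 0 = F.ι x) :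
    ∃ a ∈ hF.loopGroup F, ∀ x, F.Transports (fun t => c (2 * (2 * g + 1) + k + t)) (C x k)
      (C (a x) (k + 1)) := by
  have hkR : (k : ℝ) ≤ 2 * g := by exact_mod_cast hk
  have hk1R : (1 : ℝ) ≤ k := by exact_mod_cast hk1
  have hg0 : (0 : ℝ) ≤ g := Nat.cast_nonneg g
  have n1 : ∀ u : ℝ, |u - k| ≤ 1 / 3 → c u = c k ∧ c (2 * (2 * g + 1) + u) = c k := by
    intro u hu
    refine ⟨hc.near_node k (by omega) u hu, ?_⟩
    rw [← hc.node k hk1 (by omega)]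
    have := hc.near_node (2 * (2 * g + 1) + k) (by omega) (2 * (2 * g + 1) + u) (by
      push_cast; convert hu using 2; ring)
    rw [this]; push_cast; rfl
  have n2 : ∀ u : ℝ, |u - (k + 1)| ≤ 1 / 3 → c u = c (k + 1) ∧ c (2 * (2 * g + 1) + u) = c (k + 1) := by
    intro u hu
    have e0 := hc.near_node (k + 1) (by omega) u (by push_cast; exact hu)
    have e1 := hc.node (k + 1) (by omega) (by omega)
    have e2 := hc.near_node (2 * (2 * g + 1) + (k + 1)) (by omega) (2 * (2 * g + 1) + u) (by
      push_cast; convert hu using 2; ring)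
    push_cast at e0 e1 e2
    exact ⟨e0, by rw [e2, e1]⟩
  -- The loop is smooth, since the cut path is constant near the vertices.
  set ℓ : ℝ → F.B := fun u => if u ≤ k then c u else
    (if u ≤ k + 1 then c (2 * (2 * g + 1) + u) else c (2 * k + 2 - u)) with hℓ
  have hsm : ContMDiff 𝓘(ℝ, ℝ) (𝓡∂ 2) ∞ ℓ := by
    have h1 : ContMDiff 𝓘(ℝ, ℝ) (𝓡∂ 2) ∞ fun u =>
        (if u ≤ (k + 1 : ℝ) then c (2 * (2 * g + 1) + u) else c (2 * k + 2 - u)) := by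
      refine contMDiff_ite_le (r := 1 / 3) (f₁ := fun u => c (2 * (2 * g + 1) + u))
        (f₂ := fun u => c (2 * k + 2 - u))
        (hc.smooth.comp (by fun_prop : ContDiff ℝ ∞ fun u : ℝ => 2 * (2 * g + 1) + u).contMDiff)
        (hc.smooth.comp (by fun_prop : ContDiff ℝ ∞ fun u : ℝ => 2 * k + 2 - u).contMDiff)
        (by norm_num) fun t ht => ?_
      have ht' := abs_lt.1 ht
      rw [(n2 t ht.le).2, (n2 (2 * k + 2 - t) (abs_le.2 ⟨by linarith, by linarith⟩)).1]
    refine contMDiff_ite_le (r := 1 / 3) hc.smooth h1 (by norm_num) fun t ht => ?_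
    rw [(n1 t ht.le).1]
    rw [abs_lt] at ht
    rw [if_pos (by linarith), (n1 t (abs_le.2 ⟨by linarith, by linarith⟩)).2]
  obtain ⟨a, ha, hlift⟩ := hF.exists_lift_mem_loopGroup (γ := ℓ) (a := 0) (b := 2 * k + 2) (r := 1 / 3)
    hsm (by linarith) (by norm_num) (by
      rintro t (ht | ht)
      · rw [hℓ]; simp only
        rw [if_pos (by linarith), hc.of_le t (by linarith)]
      · rw [hℓ]; simp only
        rw [if_neg (by linarith), if_neg (by linarith), hc.of_le _ (by linarith)])
  refine ⟨a, ha, fun x => ?_⟩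
  obtain ⟨l, h1, h2, h3⟩ := hlift x
  have e1 : l k = C x k := by
    have m1 : F.IsLiftOn c l 0 k := (h1.mono le_rfl (by linarith)).congr_base fun t ht => by
      rw [hℓ]; simp only; rw [if_pos ht.2]
    exact hF.lift_eqOn hc.smooth.contMDiffOn m1 ((hC x).mono hA (by linarith))
      (h2.trans (hC0 x).symm) ⟨by linarith, le_rfl⟩
  have e2 : l (k + 1) = C (a x) (k + 1) := by
    have m1 : F.IsLiftOn (ℓ ∘ fun s => 2 * k + 2 - s) (l ∘ fun s => 2 * k + 2 - s) 0 (k + 1) :=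
      h1.comp (by fun_prop) fun s hs => ⟨by linarith [hs.2], by linarith [hs.1]⟩
    have m2 : F.IsLiftOn c (l ∘ fun s => 2 * k + 2 - s) 0 (k + 1) := m1.congr_base fun s hs => by
      rw [hℓ]; simp only [Function.comp]
      rw [if_neg (by linarith [hs.2])]
      split_ifs with h
      · have : s = k + 1 := by linarith [hs.2]
        rw [this, (n2 _ (by norm_num [show (2 * k + 2 - (k + 1) - (k + 1) : ℝ) = 0 by ring])).2]
      · congr 1; ring
    have m3 := hF.lift_eqOn hc.smooth.contMDiffOn m2 ((hC (a x)).mono hA (by linarith)) (by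
      simp only [Function.comp, sub_zero]; rw [h3, hC0]) ⟨by linarith, le_rfl⟩
    simp only [Function.comp] at m3
    rw [← m3]; congr 1; ring
  rw [← e1, ← e2]
  refine h1.transports ⟨by linarith, by linarith⟩ ⟨by linarith, by linarith⟩ fun t ht => ?_
  rw [hℓ]; simp only [add_sub_cancel_left, one_mul]
  split_ifs with h h'
  · have : t = 0 := by linarith [ht.1]
    rw [this, add_zero, add_zero]
    exact hc.node k hk1 (by omega)
  · congr 1; ring
  · exact absurd (by linarith [ht.2]) h'

/-- Parallel transport along the cut path is a product of `g` commutators of Hamiltonian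
diffeomorphisms. -/
theorem IsCutPath.exists_monodromy (hF : F.IsHamiltonian σ) (hc : F.IsCutPath g c) {A B : ℝ}
    (hA : A ≤ 0) (hB : 4 * (2 * g + 1) ≤ B) :
    ∃ ψ ∈ commutatorProducts σ g, ∀ x, ∃ C : ℝ → F.P, F.IsLiftOn c C A B ∧
      C A = F.ι x ∧ C B = F.ι (ψ x) := by
  have hg0 : (0 : ℝ) ≤ g := Nat.cast_nonneg g
  obtain ⟨ψ, -, -, hψ⟩ := hF.exists_lift (γ := c) (a := A) (b := B) hc.smooth.contMDiffOn
    (by linarith) (hc.of_le _ (by linarith)) (hc.of_ge _ (by linarith))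
  choose C hC hCA hCB using hψ
  have hπι : ∀ x, F.π (F.ι x) = F.bdry 0 := fun x => hF.ι_range.subset ⟨x, rfl⟩
  have hC0 : ∀ x, C x 0 = F.ι x := fun x => by
    have h1 : F.IsLiftOn c (fun _ => F.ι x) A 0 := (isLiftOn_const (hπι x)).congr_base fun t ht =>
      hc.of_le t (by linarith [ht.2])
    exact hF.lift_eqOn hc.smooth.contMDiffOn ((hC x).mono le_rfl (by linarith)) h1 (hCA x)
      ⟨hA, le_rfl⟩
  have hC4 : ∀ x, C x (4 * (2 * g + 1)) = F.ι (ψ x) := fun x => by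
    have hb : F.π (C x (4 * (2 * g + 1))) = F.bdry 0 :=
      ((hC x _ ⟨by linarith, hB⟩).1).trans (hc.of_ge _ (by linarith))
    have h1 : F.IsLiftOn c (fun _ => C x (4 * (2 * g + 1))) (4 * (2 * g + 1)) B :=
      (isLiftOn_const hb).congr_base fun t ht => hc.of_ge t (by linarith [ht.1])
    have := hF.lift_eqOn hc.smooth.contMDiffOn ((hC x).mono (by linarith) le_rfl) h1 rfl
      ⟨hB, le_rfl⟩
    rw [← hCB x, this]
  have hedge : ∀ k : ℕ, ∃ a ∈ hF.loopGroup F, 1 ≤ k → k ≤ 2 * g → ∀ x,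
      F.Transports (fun t => c (2 * (2 * g + 1) + k + t)) (C x k) (C (a x) (k + 1)) := by
    intro k
    by_cases h : 1 ≤ k ∧ k ≤ 2 * g
    · obtain ⟨a, h1, h2⟩ := hc.exists_edge_monodromy hF h.1 h.2 hA hB hC hC0
      exact ⟨a, h1, fun _ _ => h2⟩
    · exact ⟨1, (hF.loopGroup F).one_mem, fun h1 h2 => absurd ⟨h1, h2⟩ h⟩
  -- The letter `a k` measures the difference between the two edges from the `k`-th vertex to the
  -- next.
  choose a ha hN using hedge
  have hsm : ∀ (f : ℝ → ℝ), ContDiff ℝ ∞ f → ContMDiffOn 𝓘(ℝ, ℝ) (𝓡∂ 2) ∞ (fun t => c (f t)) (Icc 0 1) :=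
    fun f hf => (hc.smooth.comp hf.contMDiff).contMDiffOn
  have hPs : ∀ k : ℝ, ContMDiffOn 𝓘(ℝ, ℝ) (𝓡∂ 2) ∞ (fun t => c (k + t)) (Icc 0 1) := fun k =>
    hsm (fun t => k + t) (by fun_prop)
  -- the edges run through by the four quarters of the cut path
  have q1 : ∀ k : ℕ, k ≤ 2 * g → ∀ x, F.Transports (fun t => c (k + t)) (C x k) (C x (k + 1)) := by
    intro k hk x
    have hkR : (k : ℝ) ≤ 2 * g := by exact_mod_cast hk
    have hk0 : (0 : ℝ) ≤ k := Nat.cast_nonneg k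
    exact (hC x).transports ⟨by linarith, by linarith⟩ ⟨by linarith, by linarith⟩ fun t _ => by
      congr 1; ring
  have q2 : ∀ k : ℕ, k ≤ 2 * g → ∀ x, F.Transports
      (fun t => if Even k then c (2 * (2 * g + 1) + k + t) else c (k + t))
      (C x (2 * (2 * g + 1) - k)) (C x (2 * (2 * g + 1) - (k + 1))) := by
    intro k hk x
    have hkR : (k : ℝ) ≤ 2 * g := by exact_mod_cast hk
    have hk0 : (0 : ℝ) ≤ k := Nat.cast_nonneg k
    refine (hC x).transports ⟨by linarith, by linarith⟩ ⟨by linarith, by linarith⟩ fun t ht => ?_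
    have := hc.two_mul_sub k hk (k + t) (by linarith [ht.1]) (by linarith [ht.2])
    rw [show (2 * (2 * g + 1) - k + (2 * (2 * g + 1) - (k + 1) - (2 * (2 * g + 1) - k)) * t : ℝ) =
      2 * (2 * g + 1) - (k + t) by ring, this, add_assoc]
  have q3 : ∀ k : ℕ, k ≤ 2 * g → ∀ x, F.Transports (fun t => c (2 * (2 * g + 1) + k + t))
      (C x (2 * (2 * g + 1) + k)) (C x (2 * (2 * g + 1) + (k + 1))) := by
    intro k hk x
    have hkR : (k : ℝ) ≤ 2 * g := by exact_mod_cast hk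
    have hk0 : (0 : ℝ) ≤ k := Nat.cast_nonneg k
    exact (hC x).transports ⟨by linarith, by linarith⟩ ⟨by linarith, by linarith⟩ fun t _ => by
      congr 1; ring
  have q4 : ∀ k : ℕ, k ≤ 2 * g → ∀ x, F.Transports
      (fun t => if Even k then c (k + t) else c (2 * (2 * g + 1) + k + t))
      (C x (4 * (2 * g + 1) - k)) (C x (4 * (2 * g + 1) - (k + 1))) := by
    intro k hk x
    have hkR : (k : ℝ) ≤ 2 * g := by exact_mod_cast hk
    have hk0 : (0 : ℝ) ≤ k := Nat.cast_nonneg k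
    refine (hC x).transports ⟨by linarith, by linarith⟩ ⟨by linarith, by linarith⟩ fun t ht => ?_
    have := hc.four_mul_sub k hk (k + t) (by linarith [ht.1]) (by linarith [ht.2])
    rw [show (4 * (2 * g + 1) - k + (4 * (2 * g + 1) - (k + 1) - (4 * (2 * g + 1) - k)) * t : ℝ) =
      4 * (2 * g + 1) - (k + t) by ring, this, add_assoc]
  have hinv : ∀ k x, (a k) ((a k)⁻¹ x) = x := fun k x => (a k).apply_symm_apply x
  -- In the second quarter the edges with even `k` are second edges, run through backwards; each
  -- of them contributes the inverse of a letter with an even index.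
  have s2 : ∀ x, ∀ d m, m + d = g → C x (2 * (2 * g + 1) - (2 * m + 1)) =
      C (((evenInv a m)⁻¹ * evenInv a g) x) (2 * m + 1) := by
    intro x d
    induction d with
    | zero =>
      intro m hm
      obtain rfl : m = g := by omega
      rw [inv_mul_cancel]
      show C x _ = C x _
      congr 1; ring
    | succ d ih =>
      intro m hm
      have h1 := ih (m + 1) (by omega)
      set y := ((evenInv a (m + 1))⁻¹ * evenInv a g) x with hy
      have hyy : ((evenInv a m)⁻¹ * evenInv a g) x = (a (2 * m + 2))⁻¹ y := by
        rw [hy, ← Equiv.Perm.mul_apply]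
        congr 1
        simp only [evenInv]; group
      have h2 := q2 (2 * m + 2) (by omega) x
      have h3 := q2 (2 * m + 1) (by omega) x
      have h4 := hN (2 * m + 2) (by omega) (by omega) ((a (2 * m + 2))⁻¹ y)
      rw [hinv] at h4
      simp only [show Even (2 * m + 2) from ⟨m + 1, by ring⟩, if_true] at h2
      simp only [show ¬ Even (2 * m + 1) by simp, if_false] at h3
      push_cast at h1 h2 h3 h4
      rw [show (2 * (m + 1) + 1 : ℝ) = 2 * m + 2 + 1 by ring] at h1
      rw [h1] at h2
      have h5 := hF.transports_left_unique (hPs _) h2 h4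
      have h6 := q1 (2 * m + 1) (by omega) ((a (2 * m + 2))⁻¹ y)
      push_cast at h6
      rw [show (2 * m + 1 + 1 : ℝ) = 2 * m + 2 by ring] at h3 h6
      rw [h5] at h3
      rw [hyy]
      exact hF.transports_left_unique (hPs _) h3 h6
  -- The third quarter runs through all second edges, and contributes the letters `a 1`, …,
  -- `a (2 g)`.
  have s3 : ∀ x, ∀ m ≤ 2 * g, C x (2 * (2 * g + 1) + (m + 1)) =
      C ((descProd a m * evenInv a g) x) (m + 1) := by
    intro x m
    induction m with
    | zero =>
      intro _
      have h1 := q2 0 (by omega) x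
      have h2 := q3 0 (by omega) x
      have h3 := s2 x g 0 (by omega)
      simp only [Even.zero, if_true] at h1
      push_cast at h1 h2 h3 ⊢
      simp only [sub_zero, add_zero, zero_add, mul_zero] at h1 h2 h3 ⊢
      -- the first edge of this quarter runs back along the last one of the second quarter
      have h4 : C x (2 * (2 * g + 1) + 1) = C x (2 * (2 * g + 1) - 1) :=
        hF.transports_unique (hPs _) h2 h1
      rw [h4, h3]
      simp [evenInv, descProd]
    | succ m ih =>
      intro hm
      have h1 := ih (by omega)
      have h2 := q3 (m + 1) hm x
      have h3 := hN (m + 1) (by omega) hm ((descProd a m * evenInv a g) x)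
      push_cast at h2 h3 ⊢
      rw [h1] at h2
      rw [hF.transports_unique (hPs _) h2 h3]
      rfl
  -- The fourth quarter runs back over the second edges with odd `k`, and contributes the inverses
  -- of the letters with odd indices.
  have s4 : ∀ x, ∀ d m, m + d = g → C x (4 * (2 * g + 1) - (2 * m + 1)) =
      C (((oddInv a m)⁻¹ * (oddInv a g * descProd a (2 * g) * evenInv a g)) x) (2 * m + 1) := by
    intro x d
    induction d with
    | zero =>
      intro m hm
      obtain rfl : m = g := by omega
      have h1 := s3 x (2 * m) (by omega)
      rw [mul_assoc, inv_mul_cancel_left]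
      push_cast at h1 ⊢
      rw [← h1]
      congr 1; ring
    | succ d ih =>
      intro m hm
      have h1 := ih (m + 1) (by omega)
      set w := oddInv a g * descProd a (2 * g) * evenInv a g with hw
      set y := ((oddInv a (m + 1))⁻¹ * w) x with hy
      have hyy : ((oddInv a m)⁻¹ * w) x = (a (2 * m + 1))⁻¹ y := by
        rw [hy, ← Equiv.Perm.mul_apply]
        congr 1
        simp only [oddInv]; group
      have h2 := q4 (2 * m + 2) (by omega) x
      have h3 := q4 (2 * m + 1) (by omega) x
      have h4 := hN (2 * m + 1) (by omega) (by omega) ((a (2 * m + 1))⁻¹ y)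
      rw [hinv] at h4
      simp only [show Even (2 * m + 2) from ⟨m + 1, by ring⟩, if_true] at h2
      simp only [show ¬ Even (2 * m + 1) by simp, if_false] at h3
      have h6 := q1 (2 * m + 2) (by omega) y
      push_cast at h1 h2 h3 h4 h6
      rw [show (2 * (m + 1) + 1 : ℝ) = 2 * m + 2 + 1 by ring] at h1
      rw [h1] at h2
      have h5 := hF.transports_left_unique (hPs _) h2 h6
      rw [show (2 * m + 1 + 1 : ℝ) = 2 * m + 2 by ring] at h3 h4
      rw [h5] at h3
      rw [hyy]
      exact hF.transports_left_unique (hPs _) h3 h4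
  have s5 : ψ = oddInv a g * descProd a (2 * g) * evenInv a g := by
    ext x
    refine hF.ι_injective ?_
    rw [← hC4, ← hC0]
    have h1 := s4 x g 0 (by omega)
    have h2 := q4 0 (by omega) x
    have h3 := q1 0 (by omega) ((oddInv a g * descProd a (2 * g) * evenInv a g) x)
    simp only [Even.zero, if_true] at h2
    simp only [oddInv, inv_one, one_mul] at h1
    push_cast at h1 h2 h3
    simp only [sub_zero, zero_add, mul_zero] at h1 h2 h3
    rw [h1] at h2
    exact hF.transports_left_unique (by simpa using hPs 0) h2 h3
  refine ⟨ψ, ?_, fun x => ⟨C x, hC x, hCA x, hCB x⟩⟩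
  rw [s5]
  exact word_mem_commutatorProducts hF.loopGroup_subset ha g

end CutSystem
end FibrationData
end HamGeometry

namespace HamGeometry

open Filter Complex

/-! ### Smoothness of the cut path -/

section CutPathSmooth

variable (g : ℕ)

/-- On the upper part of the plane `cutMap` depends on the real part only. -/
theorem cutMap_of_half_le {z : ℂ} (h0 : 1 / 2 ≤ z.im) :
    cutMap g z = cutPath g (4 * (2 * g + 1) * z.re + 2 * (2 * g + 1)) := by
  have hg : (0 : ℝ) ≤ g := Nat.cast_nonneg g
  have hl : ∀ l : ℝ, halfMap g l z = hyper g (realPoint g (4 * (2 * g + 1) * z.re + l)) := by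
    intro l
    unfold halfMap stripPoint realPoint
    rw [stripHeight_of_ge h0]
    simp
  have hc : (0 : ℝ) < 4 * (2 * g + 1) := by positivity
  unfold cutMap
  split_ifs with h
  · rw [cutPath_of_le g (by nlinarith), hl]
  · rw [cutPath_of_ge g (by nlinarith), hl]
    ring_nf

/-- Above the height `1 / 2` the map `cutMap` depends on the real part only, so that it recovers the
cut path on a horizontal line. The smoothness of the path follows from this. -/
theorem cutPath_eq_cutMap (u : ℝ) :
    cutPath g u = cutMap g (((u - 2 * (2 * g + 1)) / (4 * (2 * g + 1)) : ℝ) + I) := by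
  rw [cutMap_of_half_le g (by rw [add_im, ofReal_im, I_im]; norm_num)]
  congr 1
  simp only [add_re, ofReal_re, I_re, add_zero]
  field_simp
  ring

theorem contDiff_cutPath : ContDiff ℝ ∞ (cutPath g) := by
  have h : cutPath g = cutMap g ∘ fun u : ℝ => (((u - 2 * (2 * g + 1)) / (4 * (2 * g + 1)) : ℝ) + I : ℂ) :=
    funext (cutPath_eq_cutMap g)
  rw [h]
  refine (contDiff_cutMap g).comp (ContDiff.add ?_ contDiff_const)
  exact ofRealCLM.contDiff.comp ((contDiff_id.sub contDiff_const).div_const _)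

theorem cutPath_mem (u : ℝ) : cutPath g u ∈ (genusSurface g).carrier := by
  rw [cutPath_eq_cutMap]; exact cutMap_mem g _

theorem realPoint_near_node {k : ℕ} (hk : k ≤ 2 * (2 * g + 1)) {u : ℝ} (hu : |u - k| ≤ 1 / 3) :
    realPoint g u = realPoint g k := by
  have hu' := abs_le.1 hu
  rcases hk.lt_or_eq with hk | rfl
  · have h : ∀ s : ℝ, |s - k| ≤ 1 / 3 → stepAngle g s = node g k := by
      intro s hs
      have hs' := abs_le.1 hs
      unfold stepAngle
      rw [steps_eq hk (by linarith) (by linarith), unitStep_of_le (by linarith), mul_zero, add_zero]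
    unfold realPoint
    rw [h u hu, h k (by simp)]
  · push_cast at hu' ⊢
    rw [realPoint_of_ge g (by linarith), realPoint_of_ge g (by linarith)]

theorem cutPath_near_node {k : ℕ} (hk : k ≤ 4 * (2 * g + 1)) {u : ℝ} (hu : |u - k| ≤ 1 / 3) :
    cutPath g u = cutPath g k := by
  have hu' := abs_le.1 hu
  rcases lt_trichotomy k (2 * (2 * g + 1)) with h | h | h
  · have hR : (k : ℝ) + 1 ≤ 2 * (2 * g + 1) := by exact_mod_cast h
    rw [cutPath_of_le g (by linarith), cutPath_of_le g (by linarith), realPoint_near_node g h.le hu]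
  · have hR : (k : ℝ) = 2 * (2 * g + 1) := by rw [h]; push_cast; ring
    rw [hR] at hu' ⊢
    rcases le_total u (2 * (2 * g + 1)) with hle | hle
    · rw [cutPath_of_le g hle, cutPath_of_le g le_rfl, realPoint_of_ge g (by linarith),
        realPoint_of_ge g (by linarith)]
    · rw [cutPath_of_ge g hle, cutPath_of_ge g le_rfl, realPoint_of_le g (by linarith),
        realPoint_of_le g (by linarith)]
  · obtain ⟨j, rfl⟩ := Nat.exists_eq_add_of_le h.le
    have hR : (1 : ℝ) ≤ j := by
      have : 1 ≤ j := by omega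
      exact_mod_cast this
    push_cast at hu' hu ⊢
    rw [cutPath_of_ge g (by linarith), cutPath_of_ge g (by linarith), add_sub_cancel_left,
      realPoint_near_node g (k := j) (by omega) (abs_le.2 ⟨by linarith, by linarith⟩)]

end CutPathSmooth

universe u

namespace FibrationData

/-! ### Lifting maps to the base -/

section LiftToBase

variable {n : ℕ} {M : Type u} [TopologicalSpace M]
  [ChartedSpace (EuclideanSpace ℝ (Fin (2 * n))) M] {S : ModelSurface}

theorem exists_emb_eq (F : FibrationData (n := n) M S) {q : ℂ × ℂ} (h : q ∈ S.carrier) :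
    ∃ b, F.emb b = q := by
  rw [← F.emb_range] at h; exact h

/-- A map to the model surface that is smooth as a map to `ℂ²` lifts to a smooth map to the base. -/
theorem exists_lift_to_base (F : FibrationData (n := n) M S)
    {E' H' X : Type*} [NormedAddCommGroup E'] [NormedSpace ℝ E']
    [TopologicalSpace H'] {J : ModelWithCorners ℝ E' H'} [TopologicalSpace X] [ChartedSpace H' X]
    [IsManifold J ∞ X] {h : X → ℂ × ℂ} (hs : ContMDiff J 𝓘(ℝ, ℂ × ℂ) ∞ h) (hm : ∀ x, h x ∈ S.carrier) :
    ∃ f : X → F.B, ContMDiff J (𝓡∂ 2) ∞ f ∧ ∀ x, F.emb (f x) = h x := by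
  choose f hf using fun x => F.exists_emb_eq (hm x)
  refine ⟨f, contMDiff_of_comp_immersion F.emb_smooth F.emb_injective F.emb_immersion ?_, hf⟩
  rw [show (fun x => F.emb (f x)) = h from funext hf]; exact hs

variable {g : ℕ}

theorem isCutPath (F : FibrationData (n := n) M (genusSurface g)) {c : ℝ → F.B}
    (hs : ContMDiff 𝓘(ℝ, ℝ) (𝓡∂ 2) ∞ c) (hc : ∀ u, F.emb (c u) = cutPath g u) : F.IsCutPath g c where
  smooth := hs
  of_le u hu := F.emb_injective (by rw [hc, cutPath_of_nonpos g hu, F.emb_bdry])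
  of_ge u hu := F.emb_injective (by rw [hc, cutPath_of_ge_four g hu, F.emb_bdry])
  near_node k hk u hu := F.emb_injective (by rw [hc, hc, cutPath_near_node g hk hu])
  node k h1 hk := F.emb_injective (by
    have : (k : ℝ) ≤ 2 * g + 1 := by exact_mod_cast hk
    have h0 : (0 : ℝ) ≤ g := Nat.cast_nonneg g
    rw [hc, hc, cutPath_add g (Nat.cast_nonneg k) (by linarith), flip_cutPath_node g h1 hk])
  two_mul_sub k hk s h1 h2 := F.emb_injective (by
    have : (k : ℝ) ≤ 2 * g := by exact_mod_cast hk
    have h0 : (0 : ℝ) ≤ k := Nat.cast_nonneg k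
    rw [hc, cutPath_two_mul_sub g hk h1 h2]
    split_ifs
    · rw [hc, cutPath_add g (by linarith) (by linarith)]
    · rw [hc])
  four_mul_sub k hk s h1 h2 := F.emb_injective (by
    have : (k : ℝ) ≤ 2 * g := by exact_mod_cast hk
    have h0 : (0 : ℝ) ≤ k := Nat.cast_nonneg k
    rw [hc, cutPath_four_mul_sub g hk h1 h2]
    split_ifs
    · rw [hc]
    · rw [hc, cutPath_add g (by linarith) (by linarith)])

end LiftToBase
end FibrationData
end HamGeometry

namespace HamGeometry

open Complex

/-! ### Semipositive forms -/

section Semipositive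

/-- The standard area form of the plane. -/
noncomputable def planeAreaForm : ℂ [⋀^Fin 2]→L[ℝ] ℝ :=
  haveI := Complex.finrank_real_complex_fact
  Complex.orientation.volumeForm.mkContinuous 1 fun v => by
    rw [one_mul]; exact Complex.orientation.abs_volumeForm_apply_le v

theorem planeAreaForm_apply (v w : ℂ) : planeAreaForm ![v, w] = (starRingEnd ℂ v * w).im := by
  have := Complex.finrank_real_complex_fact
  rw [← Complex.areaForm, Orientation.areaForm_to_volumeForm]
  rfl

theorem planeAreaForm_mul_I (z : ℂ) : planeAreaForm ![z, I * z] = ‖z‖ ^ 2 := by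
  rw [planeAreaForm_apply, ← normSq_eq_norm_sq, normSq_apply]
  simp

variable {E : Type*} [NormedAddCommGroup E] [NormedSpace ℝ E]
  {E' : Type*} [NormedAddCommGroup E'] [NormedSpace ℝ E']

/-- The linear algebra of a form that is nondegenerate along the fibres of `ρ` and nonnegative on
the positively oriented planes orthogonal to the fibres. -/
structure IsSemipositive (η : E [⋀^Fin 2]→L[ℝ] ℝ) (ρ : E →L[ℝ] ℂ) : Prop where
  surjective : Function.Surjective ρ
  nondegenerate : ∀ v, ρ v = 0 → (∀ w, ρ w = 0 → η ![v, w] = 0) → v = 0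
  nonneg : ∀ h h', (∀ v, ρ v = 0 → η ![h, v] = 0) → (∀ v, ρ v = 0 → η ![h', v] = 0) →
    ρ h' = I * ρ h → 0 ≤ η ![h, h']

theorem add_smul_form_apply (η β : E [⋀^Fin 2]→L[ℝ] ℝ) (ε : ℝ) (v w : E) :
    (η + ε • β) ![v, w] = η ![v, w] + ε * β ![v, w] := rfl

namespace IsSemipositive

variable {η : E [⋀^Fin 2]→L[ℝ] ℝ} {ρ : E →L[ℝ] ℂ}

theorem comp (h : IsSemipositive η ρ) {A : E' →L[ℝ] E} (hA : Function.Bijective A) :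
    IsSemipositive (η.compContinuousLinearMap A) (ρ.comp A) where
  surjective := h.surjective.comp hA.2
  nondegenerate v hv hw := hA.1 <| by
    rw [map_zero]
    refine h.nondegenerate _ hv fun w hw' => ?_
    obtain ⟨w, rfl⟩ := hA.2 w
    rw [← form_comp_apply]; exact hw w hw'
  nonneg u u' hu hu' huu' := by
    rw [form_comp_apply]
    refine h.nonneg _ _ (fun v hv => ?_) (fun v hv => ?_) huu'
    · obtain ⟨v, rfl⟩ := hA.2 v
      rw [← form_comp_apply]; exact hu v hv
    · obtain ⟨v, rfl⟩ := hA.2 v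
      rw [← form_comp_apply]; exact hu' v hv

/-- Since the form is nondegenerate on the fibres, every vector of the base has a lift that is
orthogonal to the fibre. -/
theorem exists_orthogonal [FiniteDimensional ℝ E] (h : IsSemipositive η ρ) (z : ℂ) :
    ∃ u, ρ u = z ∧ ∀ v, ρ v = 0 → η ![u, v] = 0 := by
  obtain ⟨e, rfl⟩ := h.surjective z
  -- the fibre part of `e` is found by duality on the kernel of `ρ`
  let V := LinearMap.ker (ρ : E →ₗ[ℝ] ℂ)
  let T : V →ₗ[ℝ] Module.Dual ℝ V :=
    ((formBilin η).domRestrict V).compr₂ LinearMap.id |>.compl₂ V.subtype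
  have hT : Function.Injective T := by
    rw [← LinearMap.ker_eq_bot, LinearMap.ker_eq_bot']
    intro v hv
    refine Subtype.ext (h.nondegenerate v v.2 fun w hw => ?_)
    exact congrArg (fun L : Module.Dual ℝ V => L ⟨w, hw⟩) hv
  have hT' : Function.Surjective T :=
    (LinearMap.injective_iff_surjective_of_finrank_eq_finrank Subspace.dual_finrank_eq.symm).1 hT
  obtain ⟨v, hv⟩ := hT' ((formBilin η e).comp V.subtype)
  have hv0 : ρ v = 0 := v.2
  refine ⟨e + (-1 : ℝ) • (v : E), by rw [map_add, map_smul, hv0, smul_zero, add_zero], fun w hw => ?_⟩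
  have h1 : η ![(v : E), w] = η ![e, w] := congrArg (fun L : Module.Dual ℝ V => L ⟨w, hw⟩) hv
  rw [form_add_left, form_smul_left, h1]; ring

/-- Orthogonality to the fibres is not affected by a form pulled back from the base. -/
theorem add_apply_of_vertical (ε : ℝ) (u : E) {v : E} (hv : ρ v = 0) :
    (η + ε • planeAreaForm.compContinuousLinearMap ρ) ![u, v] = η ![u, v] := by
  rw [add_smul_form_apply, form_comp_apply, planeAreaForm_apply, hv]
  simp

theorem add_pos (h : IsSemipositive η ρ) {ε : ℝ} (hε : 0 < ε) {u u' : E} (hu0 : u ≠ 0)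
    (hu : ∀ v, ρ v = 0 → η ![u, v] = 0) (hu' : ∀ v, ρ v = 0 → η ![u', v] = 0)
    (huu' : ρ u' = I * ρ u) : 0 < (η + ε • planeAreaForm.compContinuousLinearMap ρ) ![u, u'] := by
  rw [add_smul_form_apply, form_comp_apply, huu', planeAreaForm_mul_I]
  have h1 : ρ u ≠ 0 := fun h0 => hu0 (h.nondegenerate u h0 hu)
  have h2 := h.nonneg u u' hu hu' huu'
  have h3 : 0 < ‖ρ u‖ := norm_pos_iff.2 h1
  positivity

/-- A vector in the kernel of the sum is orthogonal to the fibres, and pairs positively with the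
orthogonal lift of `i ρ v` unless it vanishes. -/
theorem add_nondegenerate [FiniteDimensional ℝ E] (h : IsSemipositive η ρ) {ε : ℝ} (hε : 0 < ε) {v : E}
    (hv : ∀ w, (η + ε • planeAreaForm.compContinuousLinearMap ρ) ![v, w] = 0) : v = 0 := by
  by_contra h0
  have h1 : ∀ w, ρ w = 0 → η ![v, w] = 0 := fun w hw => by
    rw [← add_apply_of_vertical ε v hw]; exact hv w
  obtain ⟨u, hu, hu'⟩ := h.exists_orthogonal (I * ρ v)
  exact (h.add_pos hε h0 h1 hu' hu).ne' (hv u)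

theorem sqrt_gramDet_le [FiniteDimensional ℝ E] {ι : Type*} [Fintype ι] [DecidableEq ι]
    (h : IsSemipositive η ρ) (b : Module.Basis ι ℝ E) {ε : ℝ} (hε : 0 ≤ ε) :
    √|gramDet (formBilin (η + ε • planeAreaForm.compContinuousLinearMap ρ)) b| ≤
      √|gramDet (formBilin η) b| +
        ε * √|gramDet (formBilin (η + (1 : ℝ) • planeAreaForm.compContinuousLinearMap ρ)) b| := by
  have e : ∀ t : ℝ, formBilin (η + t • planeAreaForm.compContinuousLinearMap ρ) =
      formBilin η + t • formBilin (planeAreaForm.compContinuousLinearMap ρ) := fun t => rfl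
  rw [e, e, one_smul]
  refine sqrt_gramDet_add_le (formBilin η) _ (ρ : E →ₗ[ℝ] ℂ) (fun v w => form_swap η v w)
    h.surjective (fun v w => ?_) h.nondegenerate h.nonneg b hε
  rw [formBilin_apply, form_comp_apply, planeAreaForm_apply]
  rfl

end IsSemipositive

/-- The area form of the plane as a form on the manifold `ℂ`. -/
noncomputable def planeArea : TwoForm 𝓘(ℝ, ℂ) ℂ := fun _ => planeAreaForm

theorem planeArea_inChart (p y : ℂ) : planeArea.inChart p y = planeAreaForm := by
  refine form_ext fun v w => ?_
  refine (TwoForm.inChart_apply planeArea p y v w).trans ?_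
  have h : ∀ v : ℂ, mfderivWithin 𝓘(ℝ, ℂ) 𝓘(ℝ, ℂ) (extChartAt 𝓘(ℝ, ℂ) p).symm (range 𝓘(ℝ, ℂ)) y v = v := by
    intro v
    simp only [mfld_simps, mfderivWithin_univ]
    exact congrArg (fun L : ℂ →L[ℝ] ℂ => L v) (mfderiv_id (I := 𝓘(ℝ, ℂ)) (x := y))
  exact TwoForm.apply_congr planeArea (p := (extChartAt 𝓘(ℝ, ℂ) p).symm y) (p' := y)
    (by rw [extChartAt_model_space_eq_id]; rfl) (h v) (h w)

theorem planeArea_smooth (p : ℂ) :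
    ContDiffOn ℝ ∞ (planeArea.inChart p) (extChartAt 𝓘(ℝ, ℂ) p).target :=
  contDiffOn_const.congr fun y _ => planeArea_inChart p y

theorem planeArea_closed (p y : ℂ) :
    extDerivWithin (planeArea.inChart p) (extChartAt 𝓘(ℝ, ℂ) p).target y = 0 := by
  rw [show planeArea.inChart p = fun _ => planeAreaForm from funext (planeArea_inChart p)]
  rw [extDerivWithin, fderivWithin_const_apply]
  exact map_zero (ContinuousAlternatingMap.alternatizeUncurryFinCLM ℝ ℂ ℝ)

end Semipositive
end HamGeometry

namespace HamGeometry

open Complex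

universe u

/-! ### Positivity of the pulled back form -/

/-- A form that is positive on the positively oriented planes orthogonal to the kernel of `L` is
nonnegative on the pairs of orthogonal vectors whose images span a degenerate or a positively
oriented plane. -/
theorem nonneg_of_sense {E : Type*} [NormedAddCommGroup E] [NormedSpace ℝ E]
    {η : E [⋀^Fin 2]→L[ℝ] ℝ} {L : E →L[ℝ] ℂ × ℂ}
    (hnd : ∀ v, L v = 0 → (∀ w, L w = 0 → η ![v, w] = 0) → v = 0)
    (hpos : ∀ v w, v ≠ 0 → (∀ x, L x = 0 → η ![v, x] = 0) → (∀ x, L x = 0 → η ![w, x] = 0) →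
      L w = I • L v → 0 < η ![v, w])
    {u u' : E} (hu : ∀ x, L x = 0 → η ![u, x] = 0) (hu' : ∀ x, L x = 0 → η ![u', x] = 0)
    (h : L u = 0 ∨ ∃ c₁ c₂ : ℝ, 0 ≤ c₂ ∧ L u' = c₁ • L u + c₂ • (I • L u)) : 0 ≤ η ![u, u'] := by
  have h0 : ∀ w, η ![(0 : E), w] = 0 := fun w => by
    simpa using form_smul_left η 0 (0 : E) w
  rcases h with h | ⟨c₁, c₂, hc, h⟩
  · rw [hnd u h hu, h0]
  have hd : ∀ x, L x = 0 → η ![u' + (-c₁) • u, x] = 0 := fun x hx => by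
    rw [form_add_left, form_smul_left, hu x hx, hu' x hx]; ring
  have hL : L (u' + (-c₁) • u) = c₂ • (I • L u) := by
    rw [map_add, map_smul, h]; module
  rcases hc.eq_or_lt with rfl | hc
  · have := hnd _ (by rw [hL, zero_smul]) hd
    have e : u' = c₁ • u := by
      rw [neg_smul, ← sub_eq_add_neg, sub_eq_zero] at this; exact this
    rw [e, form_smul_right, form_self, mul_zero]
  -- The vector `(u' - c₁ u) / c₂` is an orthogonal lift of `i` times the image of `u`.
  · by_cases hu0 : u = 0
    · rw [hu0, h0]
    have h1 := hpos u (c₂⁻¹ • (u' + (-c₁) • u)) hu0 hu (fun x hx => by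
      rw [form_smul_left, hd x hx, mul_zero]) (by rw [map_smul, hL, inv_smul_smul₀ hc.ne'])
    rw [form_smul_right, form_add_right, form_smul_right, form_self, mul_zero, add_zero] at h1
    exact (pos_of_mul_pos_right h1 (inv_nonneg.2 hc.le)).le

namespace FibrationData

variable {n : ℕ} {M : Type u} [TopologicalSpace M]
  [ChartedSpace (EuclideanSpace ℝ (Fin (2 * n))) M] [IsManifold (𝓡 (2 * n)) ∞ M]
  {S : ModelSurface} {F : FibrationData (n := n) M S}

/-- The differential of the projection of a fibre bundle is surjective. -/
theorem exists_mfderiv_π_eq (p : F.P) (e : TangentSpace (𝓡∂ 2) (F.π p)) :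
    ∃ u : TangentSpace (totalModel n) p, mfderiv (totalModel n) (𝓡∂ 2) F.π p u = e := by
  have hp := F.mem_adaptedSource (p₀ := p)
  obtain ⟨u, hu⟩ := exists_adapted_tangent hp
    ((mfderiv (𝓡∂ 2) 𝓘(ℝ, EuclideanSpace ℝ (Fin 2)) (extChartAt (𝓡∂ 2) (F.π p)) (F.π p) e, 0) :
      TotalSpace n)
  refine ⟨u, ?_⟩
  have h1 := mfderiv_adapted_fst hp u
  rw [hu] at h1
  exact ((isInvertible_mfderiv_extChartAt (I := 𝓡∂ 2) (mem_extChartAt_source (F.π p))).injective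
    h1).symm

omit [IsManifold (𝓡 (2 * n)) ∞ M] in
theorem baseVector_eq_zero {p : F.P} {u : TangentSpace (totalModel n) p} :
    F.baseVector u = 0 ↔ F.IsVertical u := by
  unfold baseVector IsVertical
  refine ⟨fun h => F.emb_immersion _ (h.trans (map_zero _).symm), fun h => ?_⟩
  rw [h]; exact map_zero _

/-- The differential of `P → B → ℂ²` as a linear map. -/
noncomputable def baseMap (p : F.P) : TotalSpace n →L[ℝ] ℂ × ℂ :=
  (mfderiv (𝓡∂ 2) 𝓘(ℝ, ℂ × ℂ) F.emb (F.π p) : EuclideanSpace ℝ (Fin 2) →L[ℝ] ℂ × ℂ).comp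
    (mfderiv (totalModel n) (𝓡∂ 2) F.π p : TotalSpace n →L[ℝ] EuclideanSpace ℝ (Fin 2))

omit [IsManifold (𝓡 (2 * n)) ∞ M] in
theorem IsHamiltonian.nonneg_of_baseVector {σ : TwoForm (𝓡 (2 * n)) M} (hF : F.IsHamiltonian σ)
    {p : F.P} {u u' : TangentSpace (totalModel n) p} (hu : F.IsHorizontal u)
    (hu' : F.IsHorizontal u') (h : F.baseVector u = 0 ∨ ∃ c₁ c₂ : ℝ, 0 ≤ c₂ ∧
      F.baseVector u' = c₁ • F.baseVector u + c₂ • (I • F.baseVector u)) : 0 ≤ F.Ω p ![u, u'] :=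
  nonneg_of_sense (E := TotalSpace n) (η := F.Ω p) (L := F.baseMap p)
    (fun v h1 h2 => hF.fibre_nondegenerate p v (baseVector_eq_zero.1 h1) fun w hw =>
      h2 w (baseVector_eq_zero.2 hw))
    (fun v w h0 h1 h2 h3 => hF.positive p v w h0 (fun x hx => h1 x (baseVector_eq_zero.2 hx))
      (fun x hx => h2 x (baseVector_eq_zero.2 hx)) h3)
    (fun v hv => hu v (baseVector_eq_zero.1 hv)) (fun v hv => hu' v (baseVector_eq_zero.1 hv)) h

end FibrationData

theorem UnitDisc.mfderiv_val_surjective (z : UnitDisc) :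
    Function.Surjective (mfderiv (𝓡∂ 2) 𝓘(ℝ, ℂ) UnitDisc.val z) := by
  let L : EuclideanSpace ℝ (Fin 2) →L[ℝ] ℂ := mfderiv (𝓡∂ 2) 𝓘(ℝ, ℂ) UnitDisc.val z
  have h : Function.Injective (L : EuclideanSpace ℝ (Fin 2) →ₗ[ℝ] ℂ) :=
    UnitDisc.mfderiv_val_injective z
  have h' : Function.Surjective (L : EuclideanSpace ℝ (Fin 2) →ₗ[ℝ] ℂ) :=
    (LinearMap.injective_iff_surjective_of_finrank_eq_finrank (by simp)).1 h
  exact h'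

namespace FibrationData

variable {n : ℕ} {M : Type u} [TopologicalSpace M]
  [ChartedSpace (EuclideanSpace ℝ (Fin (2 * n))) M] [IsManifold (𝓡 (2 * n)) ∞ M]
  {S : ModelSurface} {F : FibrationData (n := n) M S} {f : UnitDisc → F.B}
  {hf : ContMDiff (𝓡∂ 2) (𝓡∂ 2) ∞ f}

namespace Pullback

/-- The projection of the pullback to the disc, as a map to the plane. -/
noncomputable def toPlane (q : Pullback hf) : ℂ := q.fst.val

theorem contMDiff_toPlane : ContMDiff (totalModel n) 𝓘(ℝ, ℂ) ∞ (toPlane (hf := hf)) :=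
  UnitDisc.contMDiff_val.comp contMDiff_fst

theorem mfderiv_toPlane (q : Pullback hf) (v : TangentSpace (totalModel n) q) :
    mfderiv (totalModel n) 𝓘(ℝ, ℂ) toPlane q v =
      mfderiv (𝓡∂ 2) 𝓘(ℝ, ℂ) UnitDisc.val q.fst (mfderiv (totalModel n) (𝓡∂ 2) fst q v) :=
  mfderiv_comp_apply q (g := UnitDisc.val) (f := fst)
    (UnitDisc.contMDiff_val.mdifferentiableAt (by simp))
    (contMDiff_fst.mdifferentiableAt (by simp)) v

theorem mfderiv_toPlane_eq_zero {q : Pullback hf} {v : TangentSpace (totalModel n) q} :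
    mfderiv (totalModel n) 𝓘(ℝ, ℂ) toPlane q v = 0 ↔ mfderiv (totalModel n) (𝓡∂ 2) fst q v = 0 := by
  rw [mfderiv_toPlane]
  refine ⟨fun h => UnitDisc.mfderiv_val_injective q.fst (h.trans (map_zero _).symm), fun h => ?_⟩
  rw [h]; exact map_zero _

theorem mfderiv_toPlane_surjective (q : Pullback hf) :
    Function.Surjective (mfderiv (totalModel n) 𝓘(ℝ, ℂ) toPlane q) := by
  intro z
  obtain ⟨e, he⟩ := q.fst.mfderiv_val_surjective z
  obtain ⟨u, hu⟩ := F.exists_mfderiv_π_eq q.snd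
    (mfderiv (𝓡∂ 2) (𝓡∂ 2) f q.fst e : EuclideanSpace ℝ (Fin 2))
  obtain ⟨v, hv, -⟩ := exists_tangent q e u hu
  refine ⟨v, ?_⟩
  rw [mfderiv_toPlane, hv]; exact he

variable {h : ℂ → ℂ × ℂ}

omit [IsManifold (𝓡 (2 * n)) ∞ M] in
theorem mfderiv_emb_comp (hf : ContMDiff (𝓡∂ 2) (𝓡∂ 2) ∞ f) (hh : Differentiable ℝ h) (hfh : ∀ d, F.emb (f d) = h d.val) (d : UnitDisc)
    (e : TangentSpace (𝓡∂ 2) d) :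
    mfderiv (𝓡∂ 2) 𝓘(ℝ, ℂ × ℂ) F.emb (f d) (mfderiv (𝓡∂ 2) (𝓡∂ 2) f d e) =
      fderiv ℝ h d.val (mfderiv (𝓡∂ 2) 𝓘(ℝ, ℂ) UnitDisc.val d e) := by
  have h1 := mfderiv_comp_apply d (F.emb_smooth.mdifferentiableAt (x := f d) (by simp))
    (hf.mdifferentiableAt (by simp)) e
  have h2 := mfderiv_comp_apply d (g := h) (f := UnitDisc.val) (hh _).mdifferentiableAt
    (UnitDisc.contMDiff_val.mdifferentiableAt (by simp)) e
  rw [show F.emb ∘ f = h ∘ UnitDisc.val from funext hfh] at h1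
  rw [mfderiv_eq_fderiv] at h2
  exact h1.symm.trans h2

theorem baseVector_mfderiv_snd (hh : Differentiable ℝ h) (hfh : ∀ d, F.emb (f d) = h d.val)
    (q : Pullback hf) (v : TangentSpace (totalModel n) q) :
    F.baseVector (mfderiv (totalModel n) (totalModel n) snd q v) =
      fderiv ℝ h q.toPlane (mfderiv (totalModel n) 𝓘(ℝ, ℂ) toPlane q v) := by
  rw [mfderiv_toPlane]
  refine Eq.trans ?_ (mfderiv_emb_comp hf hh hfh q.fst _)
  unfold baseVector
  rw [mfderiv_π_snd]
  have : ∀ (b b' : F.B) (e : EuclideanSpace ℝ (Fin 2)), b = b' →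
      (mfderiv (𝓡∂ 2) 𝓘(ℝ, ℂ × ℂ) F.emb b : EuclideanSpace ℝ (Fin 2) →L[ℝ] ℂ × ℂ) e =
      (mfderiv (𝓡∂ 2) 𝓘(ℝ, ℂ × ℂ) F.emb b' : EuclideanSpace ℝ (Fin 2) →L[ℝ] ℂ × ℂ) e := by
    rintro b _ e rfl; rfl
  exact this _ _ _ q.π_snd

theorem isVertical_mfderiv_snd {q : Pullback hf} {v : TangentSpace (totalModel n) q}
    (hv : mfderiv (totalModel n) (𝓡∂ 2) fst q v = 0) :
    F.IsVertical (mfderiv (totalModel n) (totalModel n) snd q v) := by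
  unfold IsVertical
  rw [mfderiv_π_snd, hv]
  exact map_zero _

theorem exists_vertical_lift (q : Pullback hf) {w : TangentSpace (totalModel n) q.snd}
    (hw : F.IsVertical w) : ∃ v : TangentSpace (totalModel n) q,
      mfderiv (totalModel n) (𝓡∂ 2) fst q v = 0 ∧
      mfderiv (totalModel n) (totalModel n) snd q v = w :=
  exists_tangent q 0 w (hw.trans (map_zero _).symm)

/-- The pullback of the form of a fibration, before the area form of the disc is added. -/
noncomputable def form (hf : ContMDiff (𝓡∂ 2) (𝓡∂ 2) ∞ f) : TwoForm (totalModel n) (Pullback hf) :=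
  F.Ω.pullback (totalModel n) snd

omit [IsManifold (𝓡 (2 * n)) ∞ M] in
theorem form_apply (q : Pullback hf) (v w : TangentSpace (totalModel n) q) :
    form hf q ![v, w] = F.Ω q.snd ![mfderiv (totalModel n) (totalModel n) snd q v,
      mfderiv (totalModel n) (totalModel n) snd q w] := TwoForm.pullback_apply _ _ _ _ _

theorem isHorizontal_mfderiv_snd {q : Pullback hf} {v : TangentSpace (totalModel n) q}
    (hv : ∀ w : TangentSpace (totalModel n) q, mfderiv (totalModel n) (𝓡∂ 2) fst q w = 0 →
      form hf q ![v, w] = 0) :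
    F.IsHorizontal (mfderiv (totalModel n) (totalModel n) snd q v) := by
  intro w hw
  obtain ⟨w, hw1, rfl⟩ := exists_vertical_lift q hw
  rw [← form_apply]
  exact hv w hw1

variable {σ : TwoForm (𝓡 (2 * n)) M}

/-- The bundle map of the pullback is an isomorphism on the fibres and maps horizontal vectors to
horizontal vectors, over a base map that preserves the orientation or degenerates. -/
theorem isSemipositive_form (hF : F.IsHamiltonian σ) (hh : Differentiable ℝ h)
    (hs : SensePreserving h) (hfh : ∀ d, F.emb (f d) = h d.val) (q : Pullback hf) :
    IsSemipositive (E := TotalSpace n) (form hf q) (mfderiv (totalModel n) 𝓘(ℝ, ℂ) toPlane q) where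
  surjective := mfderiv_toPlane_surjective q
  nondegenerate v hv hw := by
    have hv' := mfderiv_toPlane_eq_zero.1 hv
    refine tangent_eq_zero hv' ?_
    exact hF.fibre_nondegenerate _ _ (isVertical_mfderiv_snd hv')
      (isHorizontal_mfderiv_snd fun w hw' => hw w (mfderiv_toPlane_eq_zero.2 hw'))
  nonneg u u' hu hu' huu' := by
    have h1 : F.IsHorizontal (mfderiv (totalModel n) (totalModel n) snd q u) :=
      isHorizontal_mfderiv_snd fun w hw => hu w (mfderiv_toPlane_eq_zero.2 hw)
    have h2 : F.IsHorizontal (mfderiv (totalModel n) (totalModel n) snd q u') :=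
      isHorizontal_mfderiv_snd fun w hw => hu' w (mfderiv_toPlane_eq_zero.2 hw)
    have b1 := baseVector_mfderiv_snd hh hfh q u
    have b2 := baseVector_mfderiv_snd hh hfh q u'
    refine le_of_le_of_eq ?_ (form_apply q u u').symm
    have b3 : F.baseVector (mfderiv (totalModel n) (totalModel n) snd q u') = fderiv ℝ h q.toPlane
        (I * (show ℂ from mfderiv (totalModel n) 𝓘(ℝ, ℂ) toPlane q u)) :=
      b2.trans (congrArg (fderiv ℝ h q.toPlane) huu')
    refine hF.nonneg_of_baseVector h1 h2 ?_
    rw [b1, b3]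
    exact hs _ _

end Pullback

end FibrationData
end HamGeometry

namespace HamGeometry

open Complex

/-! ### The sum of two forms -/

section SumForm

variable {E : Type*} [NormedAddCommGroup E] [NormedSpace ℝ E]
  {H : Type*} [TopologicalSpace H] {I : ModelWithCorners ℝ E H}
  {N : Type*} [TopologicalSpace N] [ChartedSpace H N]

/-- The form `σ + ε τ`. -/
noncomputable def TwoForm.addSmul (σ : TwoForm I N) (ε : ℝ) (τ : TwoForm I N) : TwoForm I N :=
  fun p => σ p + ε • τ p

variable {σ τ : TwoForm I N}

theorem TwoForm.addSmul_inChart (ε : ℝ) (p : N) :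
    (σ.addSmul ε τ).inChart p = fun y => σ.inChart p y + ε • τ.inChart p y := rfl

theorem TwoForm.addSmul_smooth (hσ : ∀ p, ContDiffOn ℝ ∞ (σ.inChart p) (extChartAt I p).target)
    (hτ : ∀ p, ContDiffOn ℝ ∞ (τ.inChart p) (extChartAt I p).target) (ε : ℝ) (p : N) :
    ContDiffOn ℝ ∞ ((σ.addSmul ε τ).inChart p) (extChartAt I p).target :=
  (hσ p).add (ContDiffOn.const_smul ε (hτ p))

theorem TwoForm.addSmul_closed (hσ : ∀ p, ContDiffOn ℝ ∞ (σ.inChart p) (extChartAt I p).target)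
    (hτ : ∀ p, ContDiffOn ℝ ∞ (τ.inChart p) (extChartAt I p).target)
    (hσc : ∀ p : N, ∀ y ∈ (extChartAt I p).target,
      extDerivWithin (σ.inChart p) (extChartAt I p).target y = 0)
    (hτc : ∀ p : N, ∀ y ∈ (extChartAt I p).target,
      extDerivWithin (τ.inChart p) (extChartAt I p).target y = 0) (ε : ℝ) (p : N) (y : E)
    (hy : y ∈ (extChartAt I p).target) :
    extDerivWithin ((σ.addSmul ε τ).inChart p) (extChartAt I p).target y = 0 := by
  have hu := uniqueDiffOn_extChartAt_target (I := I) p y hy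
  have h1 := (hσ p).differentiableOn (by simp) y hy
  have h2 := (hτ p).differentiableOn (by simp) y hy
  rw [addSmul_inChart, extDerivWithin_fun_add (ω₂ := fun y => ε • τ.inChart p y) hu h1 (h2.const_smul ε),
    extDerivWithin_fun_smul _ _ hu,
    hσc p y hy, hτc p y hy, smul_zero, add_zero]

end SumForm

universe u

namespace FibrationData

variable {n : ℕ} {M : Type u} [TopologicalSpace M]
  [ChartedSpace (EuclideanSpace ℝ (Fin (2 * n))) M] [IsManifold (𝓡 (2 * n)) ∞ M]
  {S : ModelSurface} {F : FibrationData (n := n) M S} {f : UnitDisc → F.B}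
  {hf : ContMDiff (𝓡∂ 2) (𝓡∂ 2) ∞ f}

/-! ### The disc fibration -/

/-- The boundary loop of the unit disc. -/
noncomputable def discLoop (t : ℝ) : UnitDisc :=
  ⟨exp (2 * Real.pi * I * t), mem_closedBall_zero_iff.2 (by
    rw [show (2 * Real.pi * I * t : ℂ) = ((2 * Real.pi * t : ℝ) : ℂ) * I by push_cast; ring,
      norm_exp_ofReal_mul_I])⟩

theorem discLoop_val (t : ℝ) : (discLoop t).val = exp (2 * Real.pi * I * t) := rfl

namespace Pullback

/-- The form on the pullback of a fibration to the disc: the pullback of the form of the fibration,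
made nondegenerate by a multiple of the area form of the disc. -/
noncomputable def discForm (hf : ContMDiff (𝓡∂ 2) (𝓡∂ 2) ∞ f) (ε : ℝ) :
    TwoForm (totalModel n) (Pullback hf) :=
  (form hf).addSmul ε (planeArea.pullback (totalModel n) toPlane)

variable {σ : TwoForm (𝓡 (2 * n)) M}

theorem discForm_smooth (hF : F.IsHamiltonian σ) (ε : ℝ) (p : Pullback hf) :
    ContDiffOn ℝ ∞ ((discForm hf ε).inChart p) (extChartAt (totalModel n) p).target :=
  TwoForm.addSmul_smooth
    (fun _ _ hy => (TwoForm.pullback_local F.Ω hF.symplectic.smooth isOpen_univ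
      contMDiff_snd.contMDiffOn hy (mem_univ _)).1)
    (fun _ _ hy => (TwoForm.pullback_local planeArea planeArea_smooth isOpen_univ
      contMDiff_toPlane.contMDiffOn hy (mem_univ _)).1) ε p

theorem discForm_closed (hF : F.IsHamiltonian σ) (ε : ℝ) (p : Pullback hf) (y : TotalSpace n)
    (hy : y ∈ (extChartAt (totalModel n) p).target) :
    extDerivWithin ((discForm hf ε).inChart p) (extChartAt (totalModel n) p).target y = 0 :=
  TwoForm.addSmul_closed
    (fun _ _ hy => (TwoForm.pullback_local F.Ω hF.symplectic.smooth isOpen_univ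
      contMDiff_snd.contMDiffOn hy (mem_univ _)).1)
    (fun _ _ hy => (TwoForm.pullback_local planeArea planeArea_smooth isOpen_univ
      contMDiff_toPlane.contMDiffOn hy (mem_univ _)).1)
    (fun _ _ hy => (TwoForm.pullback_local F.Ω hF.symplectic.smooth isOpen_univ
      contMDiff_snd.contMDiffOn hy (mem_univ _)).2 hF.symplectic.closed)
    (fun _ _ hy => (TwoForm.pullback_local planeArea planeArea_smooth isOpen_univ
      contMDiff_toPlane.contMDiffOn hy (mem_univ _)).2 fun p y _ => planeArea_closed p y) ε p y hy

theorem discForm_apply_of_vertical (ε : ℝ) {q : Pullback hf} (u : TangentSpace (totalModel n) q)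
    {v : TangentSpace (totalModel n) q} (hv : mfderiv (totalModel n) (𝓡∂ 2) fst q v = 0) :
    discForm hf ε q ![u, v] = form hf q ![u, v] :=
  IsSemipositive.add_apply_of_vertical (E := TotalSpace n) (η := form hf q)
    (ρ := mfderiv (totalModel n) 𝓘(ℝ, ℂ) toPlane q) ε u (mfderiv_toPlane_eq_zero.2 hv)

end Pullback

theorem contMDiff_disc_emb : ContMDiff (𝓡∂ 2) 𝓘(ℝ, ℂ × ℂ) ∞ fun z : UnitDisc => (z.val, (0 : ℂ)) :=
  UnitDisc.contMDiff_val.prodMk_space contMDiff_const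

theorem mfderiv_disc_emb (z : UnitDisc) (v : TangentSpace (𝓡∂ 2) z) :
    mfderiv (𝓡∂ 2) 𝓘(ℝ, ℂ × ℂ) (fun z : UnitDisc => (z.val, (0 : ℂ))) z v =
      ((mfderiv (𝓡∂ 2) 𝓘(ℝ, ℂ) UnitDisc.val z v, (0 : ℂ)) : ℂ × ℂ) := by
  have h := mfderiv_comp_apply z (g := ContinuousLinearMap.inl ℝ ℂ ℂ) (f := UnitDisc.val)
    (ContinuousLinearMap.mdifferentiableAt _) (UnitDisc.contMDiff_val.mdifferentiableAt (by simp)) v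
  rw [ContinuousLinearMap.mfderiv_eq] at h
  exact h

/-- The pullback of a fibration to the disc by a smooth map `f`, with the form `discForm`. -/
noncomputable def discFibration (hf : ContMDiff (𝓡∂ 2) (𝓡∂ 2) ∞ f) (ε : ℝ)
    (hι : ∀ x, F.π (F.ι x) = f (discLoop 0)) : FibrationData (n := n) M disc where
  B := UnitDisc
  emb z := (z.val, 0)
  emb_smooth := contMDiff_disc_emb
  emb_injective _ _ h := UnitDisc.val_injective (congrArg Prod.fst h)
  emb_immersion z v w h := UnitDisc.mfderiv_val_injective z (by
    rw [mfderiv_disc_emb, mfderiv_disc_emb] at h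
    exact congrArg Prod.fst h)
  emb_range := by
    ext q
    refine ⟨?_, fun hq => ⟨⟨q.1, mem_closedBall_zero_iff.2 hq.1⟩, Prod.ext rfl hq.2.symm⟩⟩
    rintro ⟨z, rfl⟩
    exact ⟨z.norm_val_le, rfl⟩
  P := Pullback hf
  π := Pullback.fst
  π_smooth := Pullback.contMDiff_fst
  locally_trivial := Pullback.locally_trivial
  Ω := Pullback.discForm hf ε
  bdry := discLoop
  emb_bdry _ := rfl
  ι x := Pullback.mk (discLoop 0) (F.ι x) (hι x)

variable {σ : TwoForm (𝓡 (2 * n)) M}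

section Lift

variable {ε : ℝ} {hι : ∀ x, F.π (F.ι x) = f (discLoop 0)}

theorem isHorizontal_discFibration {q : Pullback hf} {u : TangentSpace (totalModel n) q}
    (hu : F.IsHorizontal (mfderiv (totalModel n) (totalModel n) Pullback.snd q u)) :
    (discFibration hf ε hι).IsHorizontal (p := q) u := by
  intro v hv
  refine (Pullback.discForm_apply_of_vertical ε (q := q) u hv).trans ?_
  exact (Pullback.form_apply q u v).trans (hu _ (Pullback.isVertical_mfderiv_snd hv))

/-- A horizontal lift of a path through `f` lifts to the pullback. -/
theorem exists_lift_discFibration {γ : ℝ → UnitDisc}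
    (hγ : ContMDiffOn 𝓘(ℝ, ℝ) (𝓡∂ 2) ∞ γ (Icc 0 1)) {c : ℝ → F.P}
    (hc : F.IsHorizontalLift (f ∘ γ) c) : ∃ c' : ℝ → Pullback hf,
      (discFibration hf ε hι).IsHorizontalLift γ c' ∧
      ∀ t ∈ Icc (0 : ℝ) 1, (c' t).fst = γ t ∧ (c' t).snd = c t := by
  classical
  have h0 : F.π (c 0) = f (γ 0) := (hc 0 ⟨le_rfl, zero_le_one⟩).1
  -- The value outside the unit interval is arbitrary.
  let c' : ℝ → Pullback hf := fun t =>
    if h : F.π (c t) = f (γ t) then Pullback.mk (γ t) (c t) h else Pullback.mk (γ 0) (c 0) h0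
  have hc' : ∀ t ∈ Icc (0 : ℝ) 1, (c' t).fst = γ t ∧ (c' t).snd = c t := by
    intro t ht
    have h : F.π (c t) = f (γ t) := (hc t ht).1
    have : c' t = Pullback.mk (γ t) (c t) h := dif_pos h
    rw [this]
    exact ⟨rfl, rfl⟩
  refine ⟨c', fun t ht => ⟨(hc' t ht).1, ?_⟩, hc'⟩
  obtain ⟨-, u, hu, hu'⟩ := hc t ht
  have d1 : MDifferentiableWithinAt 𝓘(ℝ, ℝ) (𝓡∂ 2) (fun t => (c' t).fst) (Icc 0 1) t :=
    ((hγ t ht).mdifferentiableWithinAt (by simp)).congr (fun s hs => (hc' s hs).1) (hc' t ht).1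
  have hu2 : HasMFDerivWithinAt 𝓘(ℝ, ℝ) (totalModel n) (fun t => (c' t).snd) (Icc 0 1) t
      ((1 : ℝ →L[ℝ] ℝ).smulRight (u : TotalSpace n)) :=
    hu.congr_of_eventuallyEq (eventuallyEq_nhdsWithin_of_eqOn fun s hs => (hc' s hs).2) (hc' t ht).2
  have d3 := Pullback.mdifferentiableWithinAt d1 hu2.mdifferentiableWithinAt ht
  have hu3 := (Pullback.contMDiff_snd.mdifferentiableAt (x := c' t) (by simp)).hasMFDerivAt.comp_hasMFDerivWithinAt
    t d3.hasMFDerivWithinAt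
  have hU : UniqueMDiffWithinAt 𝓘(ℝ, ℝ) (Icc (0 : ℝ) 1) t :=
    (uniqueDiffOn_Icc zero_lt_one t ht).uniqueMDiffWithinAt
  have hcongr : ∀ (p p' : F.P) (u : TotalSpace n), p = p' → F.IsHorizontal (p := p) u →
      F.IsHorizontal (p := p') u := by
    rintro p _ u rfl h; exact h
  set L : ℝ →L[ℝ] TotalSpace n := mfderivWithin 𝓘(ℝ, ℝ) (totalModel n) c' (Icc 0 1) t with hL
  have hLu : (mfderiv (totalModel n) (totalModel n) Pullback.snd (c' t) :
      TotalSpace n →L[ℝ] TotalSpace n) (L 1) = (u : TotalSpace n) := by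
    have h1 := congrArg (fun A : ℝ →L[ℝ] TotalSpace n => A 1) (hU.eq hu3 hu2)
    exact h1.trans (one_smul ℝ (u : TotalSpace n))
  refine ⟨L 1, d3.hasMFDerivWithinAt.congr_mfderiv (ContinuousLinearMap.ext_ring ?_), ?_⟩
  · exact (one_smul ℝ (L 1)).symm
  · refine isHorizontal_discFibration (q := c' t) ?_
    exact hLu ▸ hcongr _ _ _ (hc' t ht).2.symm hu'

theorem hasMonodromy_discFibration {γ : ℝ → UnitDisc}
    (hγ : ContMDiffOn 𝓘(ℝ, ℝ) (𝓡∂ 2) ∞ γ (Icc 0 1)) (h0 : γ 0 = discLoop 0) (h1 : γ 1 = discLoop 0)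
    {a : Equiv.Perm M} (ha : F.HasMonodromy (f ∘ γ) a) : (discFibration hf ε hι).HasMonodromy γ a := by
  intro x
  obtain ⟨c, hc, hc0, hc1⟩ := ha x
  obtain ⟨c', h2, h3⟩ := exists_lift_discFibration (ε := ε) (hι := hι) hγ hc
  have e0 := h3 0 ⟨le_rfl, zero_le_one⟩
  have e1 := h3 1 ⟨zero_le_one, le_rfl⟩
  exact ⟨c', h2, Pullback.ext (e0.1.trans h0) (e0.2.trans hc0),
    Pullback.ext (e1.1.trans h1) (e1.2.trans hc1)⟩

theorem discFibration_isVertical {q : Pullback hf} {v : TangentSpace (totalModel n) q} :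
    (discFibration hf ε hι).IsVertical (p := q) v ↔
      mfderiv (totalModel n) 𝓘(ℝ, ℂ) Pullback.toPlane q v = 0 :=
  Pullback.mfderiv_toPlane_eq_zero.symm

theorem discFibration_baseVector {q : Pullback hf} (v : TangentSpace (totalModel n) q) :
    (discFibration hf ε hι).baseVector (p := q) v =
      ((mfderiv (totalModel n) 𝓘(ℝ, ℂ) Pullback.toPlane q v, (0 : ℂ)) : ℂ × ℂ) := by
  rw [Pullback.mfderiv_toPlane]
  exact mfderiv_disc_emb q.fst _

theorem contMDiff_mk_ι (hF : F.IsHamiltonian σ) : ContMDiff (𝓡 (2 * n)) (totalModel n) ∞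
    (fun x => Pullback.mk (hf := hf) (discLoop 0) (F.ι x) (hι x)) := fun x =>
  Pullback.contMDiffWithinAt contMDiffWithinAt_const (hF.ι_smooth x) (mem_univ x)

/-- Adding a positive multiple of the area form makes the semipositive form symplectic and positive
on the horizontal planes, without changing the fibres, the connection or the monodromies. -/
theorem isHamiltonian_discFibration (hF : F.IsHamiltonian σ) {h : ℂ → ℂ × ℂ}
    (hh : Differentiable ℝ h) (hs : SensePreserving h) (hfh : ∀ d, F.emb (f d) = h d.val)
    (hε : 0 < ε) (hf0 : f (discLoop 0) = F.bdry 0) :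
    (discFibration hf ε hι).IsHamiltonian σ := by
  have hsp := Pullback.isSemipositive_form (hf := hf) hF hh hs hfh
  have hor : ∀ {q : Pullback hf} {u : TangentSpace (totalModel n) q},
      (discFibration hf ε hι).IsHorizontal (p := q) u → ∀ v : TotalSpace n,
      (mfderiv (totalModel n) 𝓘(ℝ, ℂ) Pullback.toPlane q : TotalSpace n →L[ℝ] ℂ) v = 0 →
      (Pullback.form hf q : TotalSpace n [⋀^Fin 2]→L[ℝ] ℝ) ![u, v] = 0 := fun {q u} hu v hv =>
    (Pullback.discForm_apply_of_vertical ε (q := q) u (Pullback.mfderiv_toPlane_eq_zero.1 hv)).symm.trans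
      (hu v (discFibration_isVertical.2 hv))
  constructor
  · exact ⟨Pullback.discForm_smooth hF ε, Pullback.discForm_closed hF ε, fun q v hv =>
      (hsp q).add_nondegenerate hε hv⟩
  · intro q v hv hw
    refine (hsp q).nondegenerate v (discFibration_isVertical.1 hv) fun w hw' => ?_
    exact (Pullback.discForm_apply_of_vertical ε (q := q) v
      (Pullback.mfderiv_toPlane_eq_zero.1 hw')).symm.trans (hw w (discFibration_isVertical.2 hw'))
  · intro q u w hu0 hu hw hb
    refine (hsp q).add_pos hε hu0 (hor hu) (hor hw) ?_
    have b1 := discFibration_baseVector (ε := ε) (hι := hι) (q := q) u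
    have b2 := discFibration_baseVector (ε := ε) (hι := hι) (q := q) w
    exact congrArg Prod.fst (b2.symm.trans (hb.trans (congrArg (I • ·) b1)))
  · exact contMDiff_mk_ι (hι := hι) hF
  · intro x y hxy
    exact hF.ι_injective (congrArg (Pullback.snd (hf := hf)) hxy)
  · ext q
    constructor
    · rintro ⟨x, rfl⟩; rfl
    · intro hq
      have hq' : Pullback.fst (hf := hf) q = discLoop 0 := hq
      have h1 : F.π (Pullback.snd (hf := hf) q) = F.bdry 0 :=
        (Pullback.π_snd (hf := hf) q).trans ((congrArg f hq').trans hf0)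
      obtain ⟨x, hx⟩ := hF.ι_range.symm.subset h1
      exact ⟨x, Pullback.ext hq'.symm hx⟩
  · intro x v w
    set k : M → Pullback hf := fun x => Pullback.mk (hf := hf) (discLoop 0) (F.ι x) (hι x) with hk
    have hkd : MDifferentiableAt (𝓡 (2 * n)) (totalModel n) k x :=
      (contMDiff_mk_ι (hι := hι) hF).mdifferentiableAt (by simp)
    have h1 : ∀ v : TangentSpace (𝓡 (2 * n)) x, mfderiv (totalModel n) (𝓡∂ 2) Pullback.fst (k x)
        (mfderiv (𝓡 (2 * n)) (totalModel n) k x v) = 0 := fun v => by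
      have h2 := mfderiv_comp_apply x (g := Pullback.fst) (f := k)
        (Pullback.contMDiff_fst.mdifferentiableAt (by simp)) hkd v
      refine h2.symm.trans ?_
      rw [show Pullback.fst ∘ k = fun _ => discLoop 0 from rfl, mfderiv_const]
      rfl
    have h3 : ∀ v : TangentSpace (𝓡 (2 * n)) x, mfderiv (totalModel n) (totalModel n) Pullback.snd (k x)
        (mfderiv (𝓡 (2 * n)) (totalModel n) k x v) = mfderiv (𝓡 (2 * n)) (totalModel n) F.ι x v :=
      fun v => (mfderiv_comp_apply x (g := Pullback.snd) (f := k)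
        (Pullback.contMDiff_snd.mdifferentiableAt (by simp)) hkd v).symm
    refine (Pullback.discForm_apply_of_vertical ε (q := k x) _ (h1 w)).trans ?_
    refine (Pullback.form_apply (k x) _ _).trans ?_
    refine Eq.trans ?_ (hF.ι_symplectic x v w)
    exact TwoForm.apply_congr F.Ω rfl (h3 v) (h3 w)
  · intro γ hγ h0 h1
    obtain ⟨a, ha, hm⟩ := hF.monodromy_mem_Ham (f ∘ γ) (hf.comp_contMDiffOn hγ)
      ((congrArg f h0).trans hf0) ((congrArg f h1).trans hf0)
    exact ⟨a, ha, hasMonodromy_discFibration hγ h0 h1 hm⟩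

end Lift

end FibrationData
end HamGeometry

namespace HamGeometry

open Complex

universe u

namespace FibrationData

variable {n : ℕ} {M : Type u} [TopologicalSpace M]
  [ChartedSpace (EuclideanSpace ℝ (Fin (2 * n))) M] [IsManifold (𝓡 (2 * n)) ∞ M]
  {σ : TwoForm (𝓡 (2 * n)) M}

/-! ### The area of the disc fibration -/

section Volume

variable {S : ModelSurface} {F : FibrationData (n := n) M S} {f : UnitDisc → F.B}
  {hf : ContMDiff (𝓡∂ 2) (𝓡∂ 2) ∞ f} {h : ℂ → ℂ × ℂ}

namespace Pullback

theorem volumeDensity_discForm_le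
    (hsp : ∀ q : Pullback hf, IsSemipositive (E := TotalSpace n) (form hf q)
      (mfderiv (totalModel n) 𝓘(ℝ, ℂ) toPlane q)) {ε : ℝ} (hε : 0 ≤ ε) (p : Pullback hf)
    {y : TotalSpace n} (hy : y ∈ (extChartAt (totalModel n) p).target) :
    (discForm hf ε).volumeDensity p y ≤
      (form hf).volumeDensity p y + ε * (discForm hf 1).volumeDensity p y := by
  rw [TwoForm.volumeDensity_eq, TwoForm.volumeDensity_eq, TwoForm.volumeDensity_eq]
  set A : TotalSpace n →L[ℝ] TotalSpace n := mfderivWithin 𝓘(ℝ, TotalSpace n) (totalModel n)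
    (extChartAt (totalModel n) p).symm (range (totalModel n)) y with hA
  have hAb : Function.Bijective A :=
    (isInvertible_mfderivWithin_extChartAt_symm (I := totalModel n) hy).bijective
  have key := ((hsp ((extChartAt (totalModel n) p).symm y)).comp hAb).sqrt_gramDet_le
    (Module.finBasis ℝ (TotalSpace n)) hε
  have hk : (0 : ℝ) ≤ ((Module.finrank ℝ (TotalSpace n) / 2).factorial : ℝ) := by positivity
  refine (mul_le_mul_of_nonneg_left key hk).trans_eq ?_
  rw [mul_add, mul_left_comm]
  rfl

/-- The fibrewise linear algebra of `sqrt_gramDet_add_le`, integrated. The volume of the disc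
fibration exceeds that of the pulled back form by `O(ε)`. -/
theorem volume_discForm_le
    (hF : F.IsHamiltonian σ) (hh : Differentiable ℝ h)
    (hs : SensePreserving h) (hfh : ∀ d, F.emb (f d) = h d.val) {ε : ℝ} (hε : 0 ≤ ε) :
    (discForm hf ε).volume ≤ (form hf).volume + ENNReal.ofReal ε * (discForm hf 1).volume :=
  TwoForm.volume_le_add hε (fun p => (discForm_smooth hF 1 p).continuousOn) fun p _ hy =>
    volumeDensity_discForm_le (isSemipositive_form hF hh hs hfh) hε p hy

/-- The bundle map of the pullback is injective on its immersion points, since `f` is. -/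
theorem volume_form_le [CompactSpace F.P] (hh : Differentiable ℝ h) (hfh : ∀ d, F.emb (f d) = h d.val)
    (hinj : ∀ z z', h z = h z' → (∀ e, fderiv ℝ h z e = 0 → e = 0) →
      (∀ e, fderiv ℝ h z' e = 0 → e = 0) → z = z') : (form hf).volume ≤ F.Ω.volume := by
  refine TwoForm.volume_pullback_le F.Ω contMDiff_snd fun q q' hq hq' hqq' => ?_
  have key : ∀ q : Pullback hf, Function.Injective (mfderiv (totalModel n) (totalModel n) snd q) →
      ∀ e, fderiv ℝ h q.fst.val e = 0 → e = 0 := by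
    intro q hq e he
    obtain ⟨a, rfl⟩ := q.fst.mfderiv_val_surjective e
    have h1 := (mfderiv_emb_comp hf hh hfh q.fst a).trans he
    have h2 : mfderiv (𝓡∂ 2) (𝓡∂ 2) f q.fst a = 0 :=
      F.emb_immersion _ (h1.trans (map_zero _).symm)
    obtain ⟨v, hv, hv'⟩ := exists_tangent q a 0 ((map_zero _).trans h2.symm)
    have hv0 : v = 0 := hq (hv'.trans (map_zero _).symm)
    rw [← hv, hv0, map_zero]
    exact map_zero _
  have h3 : f q.fst = f q'.fst :=
    (π_snd q).symm.trans ((congrArg F.π hqq').trans (π_snd q'))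
  refine ext (UnitDisc.val_injective (hinj _ _ ?_ (key q hq) (key q' hq'))) hqq'
  rw [← hfh, ← hfh, h3]

theorem volume_discForm_lt_top [CompactSpace M] (hF : F.IsHamiltonian σ) (ε : ℝ)
    (hι : ∀ x, F.π (F.ι x) = f (discLoop 0)) : (discForm hf ε).volume < ⊤ := by
  have : CompactSpace (Pullback hf) := (discFibration hf ε hι).compactSpace_total
  exact TwoForm.volume_lt_top _ fun p => (discForm_smooth hF ε p).continuousOn

end Pullback

end Volume

/-! ### The boundary monodromy of the disc fibration -/

section Boundary

theorem discLoop_val_re (t : ℝ) : (discLoop t).val.re = Real.cos (2 * Real.pi * t) := by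
  rw [discLoop_val, show (2 * Real.pi * I * t : ℂ) = ((2 * Real.pi * t : ℝ) : ℂ) * I by push_cast; ring,
    exp_ofReal_mul_I_re]

theorem discLoop_val_im (t : ℝ) : (discLoop t).val.im = Real.sin (2 * Real.pi * t) := by
  rw [discLoop_val, show (2 * Real.pi * I * t : ℂ) = ((2 * Real.pi * t : ℝ) : ℂ) * I by push_cast; ring,
    exp_ofReal_mul_I_im]

theorem contMDiff_discLoop : ContMDiff 𝓘(ℝ, ℝ) (𝓡∂ 2) ∞ discLoop := by
  refine contMDiff_of_comp_immersion UnitDisc.contMDiff_val UnitDisc.val_injective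
    UnitDisc.mfderiv_val_injective (ContDiff.contMDiff ?_)
  show ContDiff ℝ ∞ fun t : ℝ => exp (2 * Real.pi * I * t)
  exact (contDiff_const.mul ofRealCLM.contDiff).cexp

theorem discLoop_one : discLoop 1 = discLoop 0 := UnitDisc.val_injective <| by
  rw [discLoop_val, discLoop_val]
  simp

variable {g : ℕ} {F : FibrationData (n := n) M (genusSurface g)} {f : UnitDisc → F.B}

omit [IsManifold (𝓡 (2 * n)) ∞ M] in
theorem emb_discLoop_of_le (hfh : ∀ d, F.emb (f d) = cutMap g d.val) {t : ℝ} (h0 : 0 ≤ t)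
    (h1 : t ≤ 1 / 2) : F.emb (f (discLoop t)) =
      cutPath g (4 * (2 * g + 1) * Real.cos (2 * Real.pi * t) + 2 * (2 * g + 1)) := by
  rw [hfh, cutMap_top, discLoop_val_re]
  · rw [discLoop_val_re, discLoop_val_im, Real.cos_sq_add_sin_sq]
  · rw [discLoop_val_im]
    have := Real.pi_pos
    exact Real.sin_nonneg_of_nonneg_of_le_pi (by positivity) (by nlinarith)

omit [IsManifold (𝓡 (2 * n)) ∞ M] in
theorem discLoop_of_ge (hfh : ∀ d, F.emb (f d) = cutMap g d.val) {t : ℝ} (h0 : 1 / 2 ≤ t)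
    (h1 : t ≤ 1) : f (discLoop t) = F.bdry (bottomParam g (Real.cos (2 * Real.pi * t))) := by
  refine F.emb_injective ?_
  rw [hfh, cutMap_bottom, discLoop_val_re, F.emb_bdry]
  · rw [discLoop_val_re, discLoop_val_im, Real.cos_sq_add_sin_sq]
  · rw [discLoop_val_im]
    have := Real.pi_pos
    have h2 : Real.sin (2 * Real.pi * t - 2 * Real.pi) ≤ 0 :=
      Real.sin_nonpos_of_nonpos_of_neg_pi_le (by nlinarith) (by nlinarith)
    rwa [Real.sin_sub_two_pi] at h2

omit [IsManifold (𝓡 (2 * n)) ∞ M] in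
theorem apply_discLoop_zero (hfh : ∀ d, F.emb (f d) = cutMap g d.val) :
    f (discLoop 0) = F.bdry 0 := by
  refine F.emb_injective ?_
  rw [emb_discLoop_of_le hfh le_rfl (by norm_num), mul_zero, Real.cos_zero, F.emb_bdry]
  have : (0 : ℝ) ≤ g := Nat.cast_nonneg g
  exact cutPath_of_ge_four g (by nlinarith)

/-- The boundary of the disc is mapped to the cut path, run through backwards, followed by the
boundary of the surface. -/
theorem exists_monodromy_discLoop (hF : F.IsHamiltonian σ) (hf : ContMDiff (𝓡∂ 2) (𝓡∂ 2) ∞ f)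
    (hfh : ∀ d, F.emb (f d) = cutMap g d.val) {φ : Equiv.Perm M} (hφ : F.HasMonodromy F.bdry φ) :
    ∃ ψ ∈ commutatorProducts σ g, F.HasMonodromy (f ∘ discLoop) (φ * ψ⁻¹) := by
  have hg : (0 : ℝ) ≤ g := Nat.cast_nonneg g
  obtain ⟨c, hc, hce⟩ := F.exists_lift_to_base (J := 𝓘(ℝ, ℝ)) (contDiff_cutPath g).contMDiff
    (cutPath_mem g)
  obtain ⟨ψ, hψ, hC⟩ := (F.isCutPath hc hce).exists_monodromy hF (A := -(2 * (2 * g + 1)))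
    (B := 6 * (2 * g + 1)) (by linarith) (by linarith)
  refine ⟨ψ, hψ, ?_⟩
  have hγ : ContMDiff 𝓘(ℝ, ℝ) (𝓡∂ 2) ∞ (f ∘ discLoop) := hf.comp contMDiff_discLoop
  have h0 := apply_discLoop_zero hfh
  obtain ⟨a, -, -, ha⟩ := hF.exists_lift (γ := f ∘ discLoop) (a := 0) (b := 1) hγ.contMDiffOn
    zero_lt_one h0 ((congrArg f discLoop_one).trans h0)
  have hcos : ∀ t : ℝ, DifferentiableAt ℝ (fun t => Real.cos (2 * Real.pi * t)) t := fun t => by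
    fun_prop
  have hcπ : Real.cos (2 * Real.pi * (1 / 2)) = -1 := by
    rw [show 2 * Real.pi * (1 / 2) = Real.pi by ring, Real.cos_pi]
  have key : ∀ x l, F.IsLiftOn (f ∘ discLoop) l 0 1 → l 0 = F.ι x → l 1 = F.ι (φ (ψ⁻¹ x)) := by
    intro x l hl hl0
    obtain ⟨C, hC1, hC2, hC3⟩ := hC (ψ⁻¹ x)
    obtain ⟨b, hb1, hb2, hb3⟩ := hφ (ψ⁻¹ x)
    set ρ : ℝ → ℝ := fun t => 4 * (2 * g + 1) * Real.cos (2 * Real.pi * t) + 2 * (2 * g + 1) with hρ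
    -- On the upper half circle the lift runs back along the lift of the cut path that ends at `x`,
    -- and on the lower one it is the lift of the boundary loop that starts where the former ends.
    have m1 : F.IsLiftOn (f ∘ discLoop) (C ∘ ρ) 0 (1 / 2) := by
      refine (hC1.comp (ρ := ρ) (fun t _ => ?_) fun t _ => ?_).congr_base fun t ht => ?_
      · exact (((hcos t).const_mul _).add_const _).differentiableWithinAt
      · have := Real.neg_one_le_cos (2 * Real.pi * t)
        have := Real.cos_le_one (2 * Real.pi * t)
        constructor <;> simp only [hρ] <;> nlinarith
      · refine F.emb_injective ?_
        exact (emb_discLoop_of_le hfh ht.1 ht.2).trans (hce _).symm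
    have m2 : F.IsLiftOn (f ∘ discLoop)
        (b ∘ fun t => bottomParam g (Real.cos (2 * Real.pi * t))) (1 / 2) 1 := by
      refine (IsLiftOn.comp (γ := F.bdry) (a := 0) (b := 1) hb1
        (ρ := fun t => bottomParam g (Real.cos (2 * Real.pi * t))) (fun t _ => ?_)
        fun t _ => bottomParam_mem g _).congr_base fun t ht => discLoop_of_ge hfh ht.1 ht.2
      exact (((contDiff_bottomParam g).differentiable (by simp) _).comp t
        (hcos t)).differentiableWithinAt
    have e1 : l (1 / 2) = F.ι (ψ⁻¹ x) := by
      have := hF.lift_eqOn hγ.contMDiffOn (hl.mono le_rfl (by norm_num)) m1 (by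
        rw [hl0, Function.comp_apply, hρ]
        simp only [mul_zero, Real.cos_zero, mul_one]
        rw [show 4 * (2 * (g : ℝ) + 1) + 2 * (2 * g + 1) = 6 * (2 * g + 1) by ring, hC3]
        exact congrArg F.ι (ψ.apply_symm_apply x).symm) (right_mem_Icc.2 (by norm_num))
      rw [this, Function.comp_apply, hρ]
      simp only [hcπ]
      rw [show 4 * (2 * (g : ℝ) + 1) * -1 + 2 * (2 * g + 1) = -(2 * (2 * g + 1)) by ring, hC2]
    have e2 := hF.lift_eqOn hγ.contMDiffOn (hl.mono (by norm_num) le_rfl) m2 (by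
      rw [e1, Function.comp_apply, hcπ, bottomParam_neg_one, hb2]) (right_mem_Icc.2 (by norm_num))
    rw [e2, Function.comp_apply, mul_one, Real.cos_two_pi, bottomParam_one, hb3]
  intro x
  obtain ⟨l, hl1, hl2, hl3⟩ := ha x
  exact ⟨l, hl1, hl2, key x l hl1 hl2⟩

end Boundary

end FibrationData
end HamGeometry

namespace HamGeometry

open Filter

/-! ### Conclusion -/

theorem TwoForm.volume_of_isEmpty {E : Type*} [NormedAddCommGroup E] [NormedSpace ℝ E]
    [FiniteDimensional ℝ E] [MeasurableSpace E] [BorelSpace E] {H : Type*} [TopologicalSpace H]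
    {I : ModelWithCorners ℝ E H} {N : Type*} [TopologicalSpace N] [ChartedSpace H N] [IsEmpty N]
    (σ : TwoForm I N) : σ.volume = 0 := by
  refine le_antisymm (iSup_le fun s => iSup_le fun A => iSup_le fun _ => ?_) zero_le
  rw [Finset.eq_empty_of_isEmpty s, Finset.sum_empty]

theorem le_of_forall_le_add_ofReal_mul {a b K : ℝ≥0∞} (hK : K ≠ ⊤)
    (h : ∀ ε : ℝ, 0 < ε → a ≤ b + ENNReal.ofReal ε * K) : a ≤ b := by
  have h1 : Tendsto (fun ε : ℝ => b + ENNReal.ofReal ε * K) (𝓝[>] 0)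
      (𝓝 (b + ENNReal.ofReal 0 * K)) :=
    tendsto_const_nhds.add (ENNReal.Tendsto.mul_const
      ((ENNReal.continuous_ofReal.tendsto 0).mono_left nhdsWithin_le_nhds) (Or.inr hK))
  rw [ENNReal.ofReal_zero, zero_mul, add_zero] at h1
  exact ge_of_tendsto h1 (eventually_nhdsWithin_of_forall h)

end HamGeometry

theorem mainTheorem2 {n : ℕ} {M : Type*} [TopologicalSpace M]
    [ChartedSpace (EuclideanSpace ℝ (Fin (2 * n))) M] [IsManifold (𝓡 (2 * n)) ∞ M]
    [T2Space M] [CompactSpace M]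
    (σ : HamGeometry.TwoForm (𝓡 (2 * n)) M) (hσ : σ.IsSymplectic)
    (g : ℕ) (φ : Equiv.Perm M) (hφ : φ ∈ HamGeometry.Ham σ) :
    HamGeometry.gArea σ g φ ≥
      (⨅ ψ ∈ HamGeometry.commutatorProducts σ g, HamGeometry.d₀ σ φ ψ) := by
  open HamGeometry FibrationData in
  refine le_iInf fun F => le_iInf fun hF => le_iInf fun hm => ?_
  -- The map that cuts the surface open, as a map to the base of the fibration.
  obtain ⟨f, hf, hfh⟩ := F.exists_lift_to_base (h := fun d : UnitDisc => cutMap g d.val)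
    ((contDiff_cutMap g).contMDiff.comp UnitDisc.contMDiff_val) fun d => cutMap_mem g _
  have hcut : Differentiable ℝ (cutMap g) := (contDiff_cutMap g).differentiable (by simp)
  have hf0 := apply_discLoop_zero hfh
  have hι : ∀ x, F.π (F.ι x) = f (discLoop 0) := fun x =>
    (hF.ι_range.subset ⟨x, rfl⟩ : F.π (F.ι x) = F.bdry 0).trans hf0.symm
  obtain ⟨ψ, hψ, hmon⟩ := exists_monodromy_discLoop hF hf hfh hm
  -- The disc fibrations with boundary monodromy `φ ψ⁻¹` compete in the definition of `d₀ σ φ ψ`.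
  have key : ∀ ε : ℝ, 0 < ε → (⨅ ψ ∈ commutatorProducts σ g, d₀ σ φ ψ) ≤
      (Pullback.discForm hf ε).volume / σ.volume := by
    intro ε hε
    refine iInf₂_le_of_le ψ hψ ?_
    have h1 := isHamiltonian_discFibration (hf := hf) (ε := ε) (hι := hι) hF hcut
      (sensePreserving_cutMap g) hfh hε hf0
    exact iInf_le_of_le (discFibration hf ε hι) (iInf_le_of_le h1 (iInf_le_of_le
      (hasMonodromy_discFibration contMDiff_discLoop.contMDiffOn rfl discLoop_one hmon) le_rfl))
  rcases isEmpty_or_nonempty M with hM | hM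
  -- If `M` is empty, so is the disc fibration, and its area is `0 / 0 = 0`.
  · have : IsEmpty (Pullback hf) := ⟨fun q => hM.elim (F.triv (f q.fst) q.snd).2⟩
    refine (key 1 one_pos).trans ?_
    rw [TwoForm.volume_of_isEmpty, ENNReal.zero_div]
    exact zero_le
  have : CompactSpace F.P := F.compactSpace_total
  have hV : (Pullback.discForm hf 1).volume / σ.volume ≠ ⊤ :=
    ENNReal.div_ne_top (Pullback.volume_discForm_lt_top hF 1 hι).ne (TwoForm.volume_ne_zero hσ)
  -- Pulling back does not increase the area, and the contribution of the disc vanishes as `ε → 0`.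
  refine le_of_forall_le_add_ofReal_mul hV fun ε hε => (key ε hε).trans ?_
  rw [area, ← mul_div_assoc, ← ENNReal.add_div]
  refine ENNReal.div_le_div_right ?_ _
  refine (Pullback.volume_discForm_le hF hcut (sensePreserving_cutMap g) hfh hε.le).trans ?_
  gcongr
  exact Pullback.volume_form_le hcut hfh fun z z' => cutMap_injective g
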